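/- **An almost paradoxist model (the silo extended by a hyperbolic region).** *Definitions.* An S-manifold is a collection of equilateral triangles of side 1 glued along their edges, every edge being shared by exactly two triangles and every vertex by five (elliptic vertex), six (Euclidean vertex) or seven (hyperbolic vertex) triangles, arranged in a cycle around the vertex. A line is the image of a complete unit-speed curve $\gamma:\mathbb R\to M$ that, away from the vertices, is straight in every triangle and in every pair of adjacent triangles laid flat in the plane, and that makes two equal angles ($150^\circ$, $180^\circ$ or $210^\circ$) at every vertex through which it passes. Two lines are parallel if they are disjoint. A point $P$ not on a line $l$ is, with respect to $l$: *elliptic* if no line through $P$ is parallel to $l$; *Euclidean* if exactly one is; *hyperbolic* if at least two are. A hyperbolic point is *finitely hyperbolic* if there are only finitely many parallels through it; *regularly hyperbolic* if there are infinitely many parallels and infinitely many non-parallels through it; *extremely hyperbolic* if there are infinitely many parallels and only finitely many, but at least one, non-parallels through it; *completely hyperbolic* if all the lines through it are parallel to $l$. An S-manifold is *almost paradoxist* if it has elliptic, Euclidean, regularly hyperbolic, extremely hyperbolic and completely hyperbolic points (each with respect to some line), i.e. all the kinds required of a paradoxist geometry with the possible exception of finitely hyperbolic points. *Theorem.* There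 is an S-manifold $M$ homeomorphic to the plane such that - $M$ has exactly six elliptic vertices, namely one vertex $o$ and the five vertices adjacent to $o$; - $M$ has exactly five Euclidean vertices, namely the vertices that are not elliptic but are adjacent to an elliptic vertex; - all the other vertices of $M$ are hyperbolic; and such that the following holds. Let the cylinder of $M$ be the union of the triangles that have a Euclidean vertex. There is a line of $M$ that is a circle (a simple closed geodesic) and is contained in the cylinder. For every such line $l$ there are points of $M$ that are, with respect to $l$, elliptic, Euclidean, regularly hyperbolic, extremely hyperbolic and completely hyperbolic, respectively. Hence $M$ is almost paradoxist. Moreover, there are two points of $M$ that do not lie on a common line. -/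

import Mathlib

noncomputable section

/-- `IsLink T v c`: the triangles of `T` at `v` are exactly the `n` triangles
`{v, c k, c (k+1)}`, arranged cyclically around `v`. -/
def IsLink {V : Type} [DecidableEq V] (T : Set (Finset V)) (v : V) {n : ℕ} (c : ZMod n → V) :
    Prop :=
  Function.Injective c ∧ ∀ τ : Finset V, (τ ∈ T ∧ v ∈ τ) ↔ ∃ k : ZMod n, τ = {v, c k, c (k + 1)}

/-- An S-manifold: a collection of equilateral triangles of side `1` glued along edges, with five,
six or seven triangles arranged in a cycle around every vertex. (In particular every edge lies in
exactly two triangles, because every edge at `v` lies in exactly two triangles of that cycle.) -/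
structure SManifold where
  V : Type
  [decEq : DecidableEq V]
  triangles : Set (Finset V)
  card_eq_three : ∀ τ ∈ triangles, τ.card = 3
  exists_link : ∀ v : V, ∃ n : ℕ, (n = 5 ∨ n = 6 ∨ n = 7) ∧
    ∃ c : ZMod n → V, IsLink triangles v c

attribute [instance] SManifold.decEq

namespace SManifold

/-! ### Vertices -/

/-- The number of triangles that share the vertex `v`. -/
def valence (M : SManifold) (v : M.V) : ℕ := {τ | τ ∈ M.triangles ∧ v ∈ τ}.ncard

def IsEllipticVertex (M : SManifold) (v : M.V) : Prop := M.valence v = 5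

def IsEuclideanVertex (M : SManifold) (v : M.V) : Prop := M.valence v = 6

def IsHyperbolicVertex (M : SManifold) (v : M.V) : Prop := M.valence v = 7

/-- `u` and `v` are the two ends of an edge. -/
def Adj (M : SManifold) (u v : M.V) : Prop := u ≠ v ∧ ∃ τ ∈ M.triangles, u ∈ τ ∧ v ∈ τ

/-! ### Points -/

/-- The points of the manifold, in barycentric coordinates: the points of the triangle `τ` are the
convex combinations of its vertices. -/
def Point (M : SManifold) : Type :=
  {p : M.V → ℝ // (∀ v, 0 ≤ p v) ∧
    ∃ τ ∈ M.triangles, (∀ v, v ∉ τ → p v = 0) ∧ ∑ v ∈ τ, p v = 1}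

instance (M : SManifold) : CoeFun M.Point (fun _ => M.V → ℝ) := ⟨fun p => p.1⟩

/-- The topology of convergence of all barycentric coordinates. As every vertex lies in only
finitely many triangles, it is the usual topology of the glued space. -/
instance (M : SManifold) : TopologicalSpace M.Point :=
  inferInstanceAs (TopologicalSpace {p : M.V → ℝ // (∀ v, 0 ≤ p v) ∧
    ∃ τ ∈ M.triangles, (∀ v, v ∉ τ → p v = 0) ∧ ∑ v ∈ τ, p v = 1})

/-- `p` lies in the closed triangle with vertex set `τ`. -/
def Point.MemTriangle {M : SManifold} (p : M.Point) (τ : Finset M.V) : Prop :=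
  ∀ v, v ∉ τ → p v = 0

/-! ### Lines -/

/-- `exp (i π / 3)`, so that `0`, `1`, `ω` are the vertices of an equilateral triangle of side
`1`. -/
def ω : ℂ := Complex.exp (Real.pi / 3 * Complex.I)

/-- Two adjacent triangles `{u, v, w}` and `{u, v, w'}` laid flat in the plane `ℂ`, with
`u ↦ 0`, `v ↦ 1`, `w ↦ ω` and `w' ↦ conj ω`. -/
def layFlat {M : SManifold} (v w w' : M.V) (p : M.Point) : ℂ :=
  (p v : ℂ) + (p w : ℂ) * ω + (p w' : ℂ) * (starRingEnd ℂ) ω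

/-- Near the time `t`, the curve `γ` stays in a pair of adjacent triangles, and it is a straight
line of unit speed when this pair is laid flat. -/
def IsStraightAt {M : SManifold} (γ : ℝ → M.Point) (t : ℝ) : Prop :=
  ∃ u v w w' : M.V, {u, v, w} ∈ M.triangles ∧ {u, v, w'} ∈ M.triangles ∧ w ≠ w' ∧
    ∃ z d : ℂ, ‖d‖ = 1 ∧ ∃ ε > 0, ∀ s ∈ Set.Icc (-ε) ε,
      ((γ (t + s)).MemTriangle {u, v, w} ∨ (γ (t + s)).MemTriangle {u, v, w'}) ∧
      layFlat v w w' (γ (t + s)) = z + s * d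

/-- The point `p` has polar coordinates `(r, θ)` around the vertex `v` with link `c`: the angle
`θ` runs once around `v` from `0` to `n π / 3`, the edge to `c k` being at the angle `k π / 3`; the
triangle `{v, c k, c (k+1)}` takes up the angles from `k π / 3` to `(k+1) π / 3`. -/
def HasPolarCoord {M : SManifold} (v : M.V) {n : ℕ} (c : ZMod n → M.V) (p : M.Point)
    (r θ : ℝ) : Prop :=
  ∃ k : ℤ, k * (Real.pi / 3) ≤ θ ∧ θ ≤ (k + 1) * (Real.pi / 3) ∧
    p.MemTriangle {v, c k, c (k + 1)} ∧
    (p (c k) : ℂ) + (p (c (k + 1)) : ℂ) * ω =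
      r * Complex.exp ((θ - k * (Real.pi / 3) : ℝ) * Complex.I)

/-- At the time `t` the curve `γ` passes through the vertex `v`: it arrives and leaves along straight
segments of unit speed, which make two equal angles at `v`, each of them half of the total angle
`n π / 3` (that is, 150, 180 or 210 degrees). -/
def BisectsVertexAt {M : SManifold} (γ : ℝ → M.Point) (t : ℝ) (v : M.V) : Prop :=
  ∃ (n : ℕ) (c : ZMod n → M.V), (n = 5 ∨ n = 6 ∨ n = 7) ∧ IsLink M.triangles v c ∧
    ∃ θ : ℝ, ∃ ε > 0, ∀ s ∈ Set.Icc 0 ε,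
      HasPolarCoord v c (γ (t - s)) s θ ∧
      HasPolarCoord v c (γ (t + s)) s (θ + n * (Real.pi / 6))

/-- A complete geodesic, parametrized by arc length. -/
def IsGeodesic {M : SManifold} (γ : ℝ → M.Point) : Prop :=
  ∀ t, (∀ v, γ t v = 1 → BisectsVertexAt γ t v) ∧ ((∀ v, γ t v ≠ 1) → IsStraightAt γ t)

/-- A line, as a set of points. -/
def IsLine {M : SManifold} (l : Set M.Point) : Prop :=
  ∃ γ : ℝ → M.Point, IsGeodesic γ ∧ Set.range γ = l

/-- A line that is a circle: a geodesic that closes up after some length `L` and does not meet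
itself before. -/
def IsCircularLine {M : SManifold} (l : Set M.Point) : Prop :=
  ∃ γ : ℝ → M.Point, IsGeodesic γ ∧ Set.range γ = l ∧
    ∃ L > 0, ∀ s t : ℝ, γ s = γ t ↔ ∃ k : ℤ, t = s + k * L

/-! ### Parallels -/

/-- The lines through `P` that are parallel to `l`. -/
def parallels {M : SManifold} (l : Set M.Point) (P : M.Point) : Set (Set M.Point) :=
  {m | IsLine m ∧ P ∈ m ∧ Disjoint m l}

/-- The lines through `P` that are not parallel to `l`. -/
def nonparallels {M : SManifold} (l : Set M.Point) (P : M.Point) : Set (Set M.Point) :=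
  {m | IsLine m ∧ P ∈ m ∧ ¬ Disjoint m l}

def IsEuclideanPoint {M : SManifold} (l : Set M.Point) (P : M.Point) : Prop :=
  P ∉ l ∧ ∃! m, m ∈ parallels l P

def IsEllipticPoint {M : SManifold} (l : Set M.Point) (P : M.Point) : Prop :=
  P ∉ l ∧ parallels l P = ∅

/-- At least two parallels. -/
def IsHyperbolicPoint {M : SManifold} (l : Set M.Point) (P : M.Point) : Prop :=
  P ∉ l ∧ (parallels l P).Nontrivial

def IsRegularlyHyperbolicPoint {M : SManifold} (l : Set M.Point) (P : M.Point) : Prop :=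
  IsHyperbolicPoint l P ∧ (parallels l P).Infinite ∧ (nonparallels l P).Infinite

/-- There has to be a non-parallel, so that no completely hyperbolic point is extremely
hyperbolic. -/
def IsExtremelyHyperbolicPoint {M : SManifold} (l : Set M.Point) (P : M.Point) : Prop :=
  IsHyperbolicPoint l P ∧ (parallels l P).Infinite ∧
    (nonparallels l P).Finite ∧ (nonparallels l P).Nonempty

def IsCompletelyHyperbolicPoint {M : SManifold} (l : Set M.Point) (P : M.Point) : Prop :=
  IsHyperbolicPoint l P ∧ nonparallels l P = ∅

/-- All the kinds of points that a paradoxist geometry has to have occur, with the possible exception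
of the finitely hyperbolic ones. -/
def IsAlmostParadoxist (M : SManifold) : Prop :=
  (∃ (l : Set M.Point) (P : M.Point), IsLine l ∧ IsEllipticPoint l P) ∧
  (∃ (l : Set M.Point) (P : M.Point), IsLine l ∧ IsEuclideanPoint l P) ∧
  (∃ (l : Set M.Point) (P : M.Point), IsLine l ∧ IsRegularlyHyperbolicPoint l P) ∧
  (∃ (l : Set M.Point) (P : M.Point), IsLine l ∧ IsExtremelyHyperbolicPoint l P) ∧
  (∃ (l : Set M.Point) (P : M.Point), IsLine l ∧ IsCompletelyHyperbolicPoint l P)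

/-! ### The model -/

/-- The silo extended by a hyperbolic region: a plane in which an elliptic vertex is surrounded by
five elliptic vertices, which are surrounded by five Euclidean vertices, and in which all the other
vertices are hyperbolic. -/
structure IsExtendedSilo (M : SManifold) : Prop where
  homeomorph_plane : Nonempty (M.Point ≃ₜ EuclideanSpace ℝ (Fin 2))
  elliptic_iff : ∃ o : M.V, ∀ v, M.IsEllipticVertex v ↔ v = o ∨ M.Adj o v
  ncard_elliptic : {v | M.IsEllipticVertex v}.ncard = 6
  euclidean_iff : ∀ v, M.IsEuclideanVertex v ↔
    ¬ M.IsEllipticVertex v ∧ ∃ u, M.IsEllipticVertex u ∧ M.Adj u v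
  ncard_euclidean : {v | M.IsEuclideanVertex v}.ncard = 5
  hyperbolic_iff : ∀ v, M.IsHyperbolicVertex v ↔
    ¬ M.IsEllipticVertex v ∧ ¬ M.IsEuclideanVertex v

/-- The cylinder of the silo: the triangles around the Euclidean vertices. -/
def cylinder (M : SManifold) : Set M.Point :=
  {p | ∃ τ ∈ M.triangles, p.MemTriangle τ ∧ ∃ v ∈ τ, M.IsEuclideanVertex v}

end SManifold

end

noncomputable section

namespace SManifold

open Set

/-! ### Links -/

section Links

variable {V : Type} [DecidableEq V] {T : Set (Finset V)}

/-! The model consists of concentric rings around the central vertex, of sizes 1, 5, 5, 5, 10, 25,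
65, …; valence seven forces each further size to be three times the last one minus the one before.
Everything is governed by the height `lin lvl`, the piecewise linear function whose value at a
vertex is the number of its ring.

The height is convex along geodesics. Across an edge its slope cannot decrease. At a vertex off ring
2 the ascending directions fill more than half of the total angle, so a geodesic that arrives
without descending leaves ascending (`slope_pos_of_vOpp`). Hence a geodesic never comes below a
height at which it did not descend (`height_le`). At heights strictly between 1 and 3 the surface is
a flat cylinder and the slope is preserved exactly (`slope_neg_of_opp`), so a geodesic with nonzero
slope there takes all the heights ahead of it in this range.

A closed geodesic therefore has constant height. A simple one fills its level, as the homeomorphism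
`toPlane` takes levels to round circles, and the heights 1 and 3 are excluded because a horizontal
geodesic through a vertex of ring 1 or 3 would turn upwards. So the circles in question are the
levels of height `y` with `1 < y < 3` (`circularLine_eq`), and to be parallel to one of them is to
miss the height `y`.

The special points are found by following geodesics. All lines through the centre meet the circle
(elliptic). At the midpoint of an edge of ring 3 only the line along the edge avoids the cylinder
(Euclidean). At a vertex of ring 3 whole intervals of directions go up on both sides, others go down
(regularly hyperbolic). Certain vertices further out (`IsChild`) are shielded: negative curvature
turns back every geodesic except perhaps the one along the edge to the single neighbour below. For
`vx 5 1` this line does reach the cylinder (extremely hyperbolic). For `vx 7 19` it is deflected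
along ring 4, so no line through this vertex comes below height 4 (completely hyperbolic), and none
contains the centre.

The local theory reduces geodesics to pairs of one-sided velocities (`GeodesicAt.germs`,
`geodesicAt_of_germs`), from which existence and uniqueness follow. Infinitely many lines come from
intervals of directions, since one line has only countably many directions (`infinite_of_angles`).
-/

theorem ne_of_card_eq_three {a b c : V} (h : ({a, b, c} : Finset V).card = 3) :
    a ≠ b ∧ a ≠ c ∧ b ≠ c := by
  refine ⟨?_, ?_, ?_⟩ <;> rintro rfl
  · have := Finset.card_le_two (a := a) (b := c)
    simp at h; omega
  · have := Finset.card_le_two (a := b) (b := a)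
    rw [Finset.insert_eq_of_mem (by simp)] at h; omega
  · have := Finset.card_le_two (a := a) (b := b)
    simp at h; omega

theorem card_eq_three_of_ne {a b c : V} (h₁ : a ≠ b) (h₂ : a ≠ c) (h₃ : b ≠ c) :
    ({a, b, c} : Finset V).card = 3 := Finset.card_eq_three.2 ⟨a, b, c, h₁, h₂, h₃, rfl⟩

theorem insert_rotate (a b c : V) : ({a, b, c} : Finset V) = {b, c, a} := by
  ext x; simp; tauto

theorem insert_swap (a b c : V) : ({a, b, c} : Finset V) = {a, c, b} := by
  ext x; simp; tauto

theorem insert_swap' (a b c : V) : ({a, b, c} : Finset V) = {b, a, c} := by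
  ext x; simp; tauto

variable {v : V} {n : ℕ} {c : ZMod n → V}

theorem two_ne_zero_zmod (hn : n = 5 ∨ n = 6 ∨ n = 7) : (2 : ZMod n) ≠ 0 := by
  rcases hn with rfl | rfl | rfl <;> decide

theorem one_ne_zero_zmod (hn : n = 5 ∨ n = 6 ∨ n = 7) : (1 : ZMod n) ≠ 0 := by
  rcases hn with rfl | rfl | rfl <;> decide

theorem _root_.IsLink.mem (h : IsLink T v c) (k : ZMod n) : {v, c k, c (k + 1)} ∈ T :=
  ((h.2 _).2 ⟨k, rfl⟩).1

theorem _root_.IsLink.ne (hT : ∀ τ ∈ T, τ.card = 3) (h : IsLink T v c) (k : ZMod n) : c k ≠ v :=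
  (ne_of_card_eq_three (hT _ (h.mem k))).1.symm

/-- The edge from `v` to `c k` lies in exactly two triangles of the cycle, the one after it and the
one before it. -/
theorem _root_.IsLink.third (hT : ∀ τ ∈ T, τ.card = 3) (h : IsLink T v c) {k : ZMod n} {x : V}
    (hx : {v, c k, x} ∈ T) : x = c (k + 1) ∨ x = c (k - 1) := by
  obtain ⟨j, hj⟩ := (h.2 _).1 ⟨hx, by simp⟩
  obtain ⟨h1, h2, h3⟩ := ne_of_card_eq_three (hT _ hx)
  have hk : c k ∈ ({v, c j, c (j + 1)} : Finset V) := by rw [← hj]; simp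
  have hx' : x ∈ ({v, c j, c (j + 1)} : Finset V) := by rw [← hj]; simp
  simp only [Finset.mem_insert, Finset.mem_singleton] at hk hx'
  rcases hk with hk | hk | hk
  · exact absurd hk.symm h1
  · have := h.1 hk
    subst this
    rcases hx' with e | e | e
    · exact absurd e.symm h2
    · exact absurd e.symm h3
    · exact Or.inl e
  · have := h.1 hk
    subst this
    rcases hx' with e | e | e
    · exact absurd e.symm h2
    · right; simpa using e
    · exact absurd e.symm h3

theorem _root_.IsLink.exists_index (hT : ∀ τ ∈ T, τ.card = 3) (h : IsLink T v c) {x y : V}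
    (hx : {v, x, y} ∈ T) : ∃ k, x = c k ∧ (y = c (k + 1) ∨ y = c (k - 1)) := by
  obtain ⟨j, hj⟩ := (h.2 _).1 ⟨hx, by simp⟩
  obtain ⟨h1, h2, h3⟩ := ne_of_card_eq_three (hT _ hx)
  have hx' : x ∈ ({v, c j, c (j + 1)} : Finset V) := by rw [← hj]; simp
  simp only [Finset.mem_insert, Finset.mem_singleton] at hx'
  rcases hx' with e | e | e
  · exact absurd e.symm h1
  · subst e; exact ⟨j, rfl, h.third hT hx⟩
  · subst e; exact ⟨j + 1, rfl, h.third hT hx⟩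

theorem _root_.IsLink.ncard_star (hn : n = 5 ∨ n = 6 ∨ n = 7) (hT : ∀ τ ∈ T, τ.card = 3)
    (h : IsLink T v c) : {τ | τ ∈ T ∧ v ∈ τ}.ncard = n := by
  have hne : NeZero n := ⟨by omega⟩
  have e : {τ | τ ∈ T ∧ v ∈ τ} = range (fun k : ZMod n => ({v, c k, c (k + 1)} : Finset V)) := by
    ext τ
    simp only [mem_ofPred_eq, mem_range, h.2 τ, eq_comm]
  have inj : Function.Injective (fun k : ZMod n => ({v, c k, c (k + 1)} : Finset V)) := by
    intro k j hkj
    simp only at hkj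
    have h1 : c k ∈ ({v, c j, c (j + 1)} : Finset V) := by rw [← hkj]; simp
    have h2 : c (k + 1) ∈ ({v, c j, c (j + 1)} : Finset V) := by rw [← hkj]; simp
    simp only [Finset.mem_insert, Finset.mem_singleton, h.ne hT, false_or, h.1.eq_iff] at h1 h2
    rcases h1 with h1 | h1
    · exact h1
    -- Equal triangles with `k = j + 1` would force `j + 2 = j`, impossible modulo 5, 6 or 7.
    · rcases h2 with h2 | h2
      · exfalso
        apply two_ne_zero_zmod hn
        have : j + 1 + 1 = j := by rw [← h1]; exact h2
        have h3 : j + 2 = j + 0 := by rw [← one_add_one_eq_two, ← add_assoc, this, add_zero]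
        exact add_left_cancel h3
      · exact add_right_cancel h2
  rw [e, ← Nat.card_coe_set_eq, Nat.card_range_of_injective inj, Nat.card_eq_fintype_card, ZMod.card]

theorem _root_.IsLink.card_unique (hT : ∀ τ ∈ T, τ.card = 3) (hn : n = 5 ∨ n = 6 ∨ n = 7) {n' : ℕ}
    (hn' : n' = 5 ∨ n' = 6 ∨ n' = 7) {c' : ZMod n' → V} (h : IsLink T v c) (h' : IsLink T v c') :
    n' = n := (h'.ncard_star hn' hT).symm.trans (h.ncard_star hn hT)

/-- Two cyclic enumerations of the same link differ by a dihedral symmetry. -/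
theorem _root_.IsLink.dihedral (hT : ∀ τ ∈ T, τ.card = 3) (hn : n = 5 ∨ n = 6 ∨ n = 7)
    {c' : ZMod n → V} (h : IsLink T v c) (h' : IsLink T v c') :
    ∃ a : ℤ, (∀ j, c' j = c (a + j)) ∨ (∀ j, c' j = c (a - j)) := by
  have hne : NeZero n := ⟨by omega⟩
  have h2 := two_ne_zero_zmod hn
  -- `σ k` is the position of `c' k` in the enumeration `c`. Consecutive positions differ by one,
  -- and injectivity forbids turning back, so the first step fixes the sense of all others.
  choose σ hσ using fun k => (h.exists_index hT (h'.mem k))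
  have inj : ∀ i j, σ i = σ j → i = j := fun i j e => h'.1 (by rw [(hσ i).1, (hσ j).1, e])
  have step : ∀ k, σ (k + 1) = σ k + 1 ∨ σ (k + 1) = σ k - 1 := by
    intro k
    have := (hσ k).2
    rw [(hσ (k + 1)).1, h.1.eq_iff, h.1.eq_iff] at this
    exact this
  have hnb : ∀ k : ZMod n, k + 1 + 1 ≠ k := by
    intro k e
    apply h2
    have : k + 2 = k + 0 := by rw [← one_add_one_eq_two, ← add_assoc, e, add_zero]
    exact add_left_cancel this
  have ha : ((σ 0 : ZMod n).val : ZMod n) = σ 0 := ZMod.natCast_zmod_val _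
  refine ⟨((σ 0).val : ℤ), ?_⟩
  have hall : ∀ j : ZMod n, ((j.val : ℕ) : ZMod n) = j := fun j => ZMod.natCast_zmod_val j
  rcases step 0 with s0 | s0
  · left
    have key : ∀ m : ℕ, σ m = σ 0 + m ∧ σ (m + 1) = σ 0 + m + 1 := by
      intro m
      induction m with
      | zero => simpa using s0
      | succ m ih =>
        refine ⟨by push_cast; rw [ih.2]; ring, ?_⟩
        push_cast
        rcases step (m + 1) with e | e
        · rw [e, ih.2]; ring
        · exfalso
          rw [ih.2, add_sub_cancel_right, ← ih.1] at e
          exact hnb _ (inj _ _ e)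
    intro j
    rw [(hσ j).1, ← hall j, (key j.val).1]
    push_cast
    rw [ha]
  · right
    have key : ∀ m : ℕ, σ m = σ 0 - m ∧ σ (m + 1) = σ 0 - m - 1 := by
      intro m
      induction m with
      | zero => simpa using s0
      | succ m ih =>
        refine ⟨by push_cast; rw [ih.2]; ring, ?_⟩
        push_cast
        rcases step (m + 1) with e | e
        · exfalso
          rw [ih.2, sub_add_cancel, ← ih.1] at e
          exact hnb _ (inj _ _ e)
        · rw [e, ih.2]; ring
    intro j
    rw [(hσ j).1, ← hall j, (key j.val).1]
    push_cast
    rw [ha]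

theorem third_unique (hT : ∀ τ ∈ T, τ.card = 3)
    (hL : ∀ v : V, ∃ n : ℕ, (n = 5 ∨ n = 6 ∨ n = 7) ∧ ∃ c : ZMod n → V, IsLink T v c)
    {u v w x y : V} (hw : {u, v, w} ∈ T) (hx : {u, v, x} ∈ T) (hy : {u, v, y} ∈ T)
    (hxw : x ≠ w) (hyw : y ≠ w) : x = y := by
  obtain ⟨n, hn, c, hc⟩ := hL u
  obtain ⟨k, rfl, h1⟩ := hc.exists_index hT hw
  have h2 := hc.third hT hx
  have h3 := hc.third hT hy
  rcases h1 with rfl | rfl <;> rcases h2 with rfl | rfl <;> rcases h3 with rfl | rfl <;> tauto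

theorem exists_other (hT : ∀ τ ∈ T, τ.card = 3)
    (hL : ∀ v : V, ∃ n : ℕ, (n = 5 ∨ n = 6 ∨ n = 7) ∧ ∃ c : ZMod n → V, IsLink T v c)
    {u v w : V} (hw : {u, v, w} ∈ T) : ∃ x, x ≠ w ∧ {u, v, x} ∈ T := by
  obtain ⟨n, hn, c, hc⟩ := hL u
  obtain ⟨k, rfl, h1⟩ := hc.exists_index hT hw
  have hne : c (k + 1) ≠ c (k - 1) := by
    intro e
    apply two_ne_zero_zmod hn
    have := hc.1 e
    have h3 : (k + 1) - (k - 1) = 0 := by rw [this, sub_self]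
    rw [← h3]; ring
  have m2 : {u, c k, c (k - 1)} ∈ T := by
    have := hc.mem (k - 1)
    rw [sub_add_cancel, insert_swap] at this
    exact this
  rcases h1 with rfl | rfl
  · exact ⟨_, hne.symm, m2⟩
  · exact ⟨_, hne, hc.mem k⟩

end Links

/-! ### Directions at a vertex -/

section Directions

variable {V : Type} [DecidableEq V]

/-- The unit vector from `v` to `a`, in barycentric coordinates. -/
def ev (v a x : V) : ℝ := (if x = a then 1 else 0) - (if x = v then 1 else 0)

/-- `polX φ` and `polY φ` are the coordinates of `exp (iφ)` in the real basis `1`, `ω`; see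
`polX_add_polY_mul_omega`. -/
def polX (φ : ℝ) : ℝ := Real.cos φ - Real.sin φ / √3

def polY (φ : ℝ) : ℝ := 2 * Real.sin φ / √3

theorem sqrt_three_pos : (0 : ℝ) < √3 := by positivity

theorem sqrt_three_sq : √3 * √3 = 3 := Real.mul_self_sqrt (by norm_num)

theorem polX_zero : polX 0 = 1 := by simp [polX]

theorem polY_zero : polY 0 = 0 := by simp [polY]

theorem polX_pi_div_three : polX (Real.pi / 3) = 0 := by
  have := sqrt_three_pos
  rw [polX, Real.cos_pi_div_three, Real.sin_pi_div_three]
  field_simp; norm_num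

theorem polY_pi_div_three : polY (Real.pi / 3) = 1 := by
  have := sqrt_three_pos
  rw [polY, Real.sin_pi_div_three]
  field_simp

/-- Reflection in the bisector of a sector exchanges its sides, so the bounds for `polX` follow from
those for `polY`. -/
theorem polX_eq_polY (φ : ℝ) : polX φ = polY (Real.pi / 3 - φ) := by
  have := sqrt_three_pos
  rw [polX, polY, Real.sin_sub, Real.sin_pi_div_three, Real.cos_pi_div_three]
  field_simp

theorem polY_pos {φ : ℝ} (h0 : 0 < φ) (h1 : φ ≤ Real.pi / 3) : 0 < polY φ := by
  have := sqrt_three_pos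
  have := Real.pi_pos
  have := Real.sin_pos_of_pos_of_lt_pi h0 (by linarith)
  rw [polY]; positivity

theorem polY_nonneg {φ : ℝ} (h0 : 0 ≤ φ) (h1 : φ ≤ Real.pi / 3) : 0 ≤ polY φ := by
  rcases h0.eq_or_lt with rfl | h
  · rw [polY_zero]
  · exact (polY_pos h h1).le

theorem polX_nonneg {φ : ℝ} (h0 : 0 ≤ φ) (h1 : φ ≤ Real.pi / 3) : 0 ≤ polX φ := by
  rw [polX_eq_polY]; exact polY_nonneg (by linarith) (by linarith)

theorem polX_pos {φ : ℝ} (h0 : 0 ≤ φ) (h1 : φ < Real.pi / 3) : 0 < polX φ := by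
  rw [polX_eq_polY]; exact polY_pos (by linarith) (by linarith)

/-- The squared length of `x + yω` is `x² + xy + y²`. -/
theorem polX_sq (φ : ℝ) : polX φ ^ 2 + polX φ * polY φ + polY φ ^ 2 = 1 := by
  have := sqrt_three_pos
  have h := Real.sin_sq_add_cos_sq φ
  have h3 : √3 ^ 2 = 3 := Real.sq_sqrt (by norm_num)
  rw [polX, polY]
  field_simp
  rw [h3]
  nlinarith

theorem omega_re : ω.re = 1 / 2 := by
  rw [ω, Complex.exp_re]; simp

theorem omega_im : ω.im = √3 / 2 := by
  rw [ω, Complex.exp_im]; simp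

theorem add_mul_omega_inj {a b a' b' : ℝ} :
    (a : ℂ) + b * ω = a' + b' * ω ↔ a = a' ∧ b = b' := by
  constructor
  · intro h
    have h1 := congrArg Complex.im h
    have h2 := congrArg Complex.re h
    simp [omega_re, omega_im] at h1 h2
    refine ⟨?_, h1⟩
    subst h1; linarith
  · rintro ⟨rfl, rfl⟩; rfl

theorem polX_add_polY_mul_omega (φ : ℝ) :
    (polX φ : ℂ) + polY φ * ω = Complex.exp (φ * Complex.I) := by
  have h3 := sqrt_three_pos
  apply Complex.ext
  · simp only [Complex.add_re, Complex.mul_re, Complex.ofReal_re, Complex.ofReal_im,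
      Complex.exp_ofReal_mul_I_re, omega_re, omega_im, polX, polY]
    field_simp; ring
  · simp only [Complex.add_im, Complex.mul_im, Complex.ofReal_re, Complex.ofReal_im,
      Complex.exp_ofReal_mul_I_im, omega_re, omega_im, polY]
    field_simp; ring

/-- The unit vector at the angle `θ` at `v`, in barycentric coordinates. -/
def pdir (v : V) {n : ℕ} (c : ZMod n → V) (θ : ℝ) (x : V) : ℝ :=
  polX (θ - ⌊θ / (Real.pi / 3)⌋ * (Real.pi / 3)) * ev v (c ⌊θ / (Real.pi / 3)⌋) x +
    polY (θ - ⌊θ / (Real.pi / 3)⌋ * (Real.pi / 3)) * ev v (c (⌊θ / (Real.pi / 3)⌋ + 1)) x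

variable (v : V) {n : ℕ} (c : ZMod n → V)

/-- On the ray shared by two sectors both formulas give the same vector. Sectors may thus be taken
closed at both ends, which frees later computations from the floor in the definition. -/
theorem pdir_eq {θ : ℝ} {k : ℤ} (h0 : k * (Real.pi / 3) ≤ θ) (h1 : θ ≤ (k + 1) * (Real.pi / 3))
    (x : V) : pdir v c θ x = polX (θ - k * (Real.pi / 3)) * ev v (c k) x +
      polY (θ - k * (Real.pi / 3)) * ev v (c (k + 1)) x := by
  have hp : 0 < Real.pi / 3 := by positivity
  rcases h1.lt_or_eq with h | h
  · have : ⌊θ / (Real.pi / 3)⌋ = k := by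
      rw [Int.floor_eq_iff, le_div_iff₀ hp, div_lt_iff₀ hp]; exact ⟨h0, h⟩
    rw [pdir, this]
  · have : ⌊θ / (Real.pi / 3)⌋ = k + 1 := by
      rw [h, mul_div_assoc, div_self hp.ne', mul_one]
      exact_mod_cast Int.floor_intCast (R := ℝ) (k + 1)
    rw [pdir, this, h]
    have e1 : (k + 1 : ℝ) * (Real.pi / 3) - k * (Real.pi / 3) = Real.pi / 3 := by ring
    have e2 : (k + 1 : ℝ) * (Real.pi / 3) - ((k + 1 : ℤ) : ℝ) * (Real.pi / 3) = 0 := by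
      push_cast; ring
    rw [e1, e2, polX_zero, polY_zero, polX_pi_div_three, polY_pi_div_three]
    push_cast; ring

theorem exists_sector (θ : ℝ) :
    ∃ k : ℤ, k * (Real.pi / 3) ≤ θ ∧ θ < (k + 1) * (Real.pi / 3) := by
  have hp : 0 < Real.pi / 3 := by positivity
  refine ⟨⌊θ / (Real.pi / 3)⌋, ?_, ?_⟩
  · rw [← le_div_iff₀ hp]; exact Int.floor_le _
  · rw [← div_lt_iff₀ hp]; exact Int.lt_floor_add_one _

theorem pdir_shift (a : ℤ) (θ : ℝ) :
    pdir v (fun j : ZMod n => c ((a : ZMod n) + j)) θ = pdir v c (θ + a * (Real.pi / 3)) := by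
  funext x
  obtain ⟨k, h0, h1⟩ := exists_sector θ
  rw [pdir_eq v _ h0 h1.le, pdir_eq v c (k := a + k) (by push_cast; linarith)
    (by push_cast; linarith)]
  push_cast
  rw [show θ + a * (Real.pi / 3) - (a + k) * (Real.pi / 3) = θ - k * (Real.pi / 3) by ring,
    add_assoc (a : ZMod n)]

theorem pdir_reflect (a : ℤ) (θ : ℝ) :
    pdir v (fun j : ZMod n => c ((a : ZMod n) - j)) θ = pdir v c (a * (Real.pi / 3) - θ) := by
  funext x
  obtain ⟨k, h0, h1⟩ := exists_sector θ
  rw [pdir_eq v _ h0 h1.le, pdir_eq v c (k := a - k - 1) (by push_cast; linarith)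
    (by push_cast; linarith)]
  push_cast
  rw [polX_eq_polY, polX_eq_polY (_ - _ - _)]
  rw [show a * (Real.pi / 3) - θ - (a - k - 1) * (Real.pi / 3)
    = Real.pi / 3 - (θ - k * (Real.pi / 3)) by ring, sub_sub_cancel, sub_add_cancel, sub_sub]
  ring

/-- Full turns shift the index by a multiple of `n`, which vanishes in `ZMod n`. -/
theorem pdir_add_period (m : ℤ) (θ : ℝ) :
    pdir v c (θ + m * (n * (Real.pi / 3))) = pdir v c θ := by
  have := pdir_shift v c (m * n) θ
  push_cast at this
  simp only [CharP.cast_eq_zero, mul_zero, zero_add] at this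
  rw [this]; congr 1; ring

variable {v c}

theorem ev_self {a : V} (h : a ≠ v) : ev v a a = 1 := by simp [ev, h]

theorem ev_of_ne {a x : V} (h : x ≠ a) (h' : x ≠ v) : ev v a x = 0 := by simp [ev, h, h']

theorem ev_base {a : V} (h : a ≠ v) : ev v a v = -1 := by simp [ev, h.symm]

end Directions

end SManifold

end


noncomputable section

namespace SManifold

open Set

variable {M : SManifold}

/-! ### Points in barycentric coordinates -/

theorem Point.ext {p q : M.Point} (h : ∀ x, p x = q x) : p = q := Subtype.ext (funext h)

theorem Point.nonneg (p : M.Point) (x : M.V) : 0 ≤ p x := p.2.1 x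

theorem sum_eq_of_support {V : Type} [DecidableEq V] {τ τ' : Finset V} {f : V → ℝ}
    (h : ∀ x, x ∉ τ → f x = 0) (h' : ∀ x, x ∉ τ' → f x = 0) : ∑ x ∈ τ, f x = ∑ x ∈ τ', f x := by
  rw [Finset.sum_subset (Finset.subset_union_left (s₂ := τ')) (fun x _ hx => h x hx),
    Finset.sum_subset (Finset.subset_union_right (s₁ := τ)) (fun x _ hx => h' x hx)]

theorem tri_ne {u v w : M.V} (h : {u, v, w} ∈ M.triangles) : u ≠ v ∧ u ≠ w ∧ v ≠ w :=
  ne_of_card_eq_three (M.card_eq_three _ h)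

theorem sum_tri {u v w : M.V} (h : {u, v, w} ∈ M.triangles) (f : M.V → ℝ) :
    ∑ x ∈ ({u, v, w} : Finset M.V), f x = f u + f v + f w := by
  obtain ⟨h1, h2, h3⟩ := tri_ne h
  rw [Finset.sum_insert (by simp [h1, h2]), Finset.sum_pair h3, add_assoc]

theorem Point.sum_eq_one {p : M.Point} {τ : Finset M.V} (h : p.MemTriangle τ) :
    ∑ x ∈ τ, p x = 1 := by
  obtain ⟨τ', _, h1, h2⟩ := p.2.2
  exact (sum_eq_of_support h h1).trans h2

theorem Point.exists_triangle (p : M.Point) : ∃ τ ∈ M.triangles, p.MemTriangle τ := by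
  obtain ⟨τ, h, h1, _⟩ := p.2.2
  exact ⟨τ, h, h1⟩

theorem exists_triple {τ : Finset M.V} (h : τ ∈ M.triangles) : ∃ u v w, τ = {u, v, w} := by
  obtain ⟨u, v, w, _, _, _, e⟩ := Finset.card_eq_three.1 (M.card_eq_three _ h)
  exact ⟨u, v, w, e⟩

theorem exists_triple_of_mem {τ : Finset M.V} (h : τ ∈ M.triangles) {u : M.V} (hu : u ∈ τ) :
    ∃ v w, τ = {u, v, w} := by
  obtain ⟨a, b, c, rfl⟩ := exists_triple h
  simp only [Finset.mem_insert, Finset.mem_singleton] at hu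
  rcases hu with rfl | rfl | rfl
  · exact ⟨_, _, rfl⟩
  · exact ⟨_, _, insert_swap' _ _ _⟩
  · exact ⟨_, _, by rw [insert_rotate, insert_rotate]⟩

theorem Point.le_one (p : M.Point) (x : M.V) : p x ≤ 1 := by
  obtain ⟨τ, hτ, h⟩ := p.exists_triangle
  by_cases hx : x ∈ τ
  · exact (Finset.single_le_sum (fun y _ => p.nonneg y) hx).trans_eq (Point.sum_eq_one h)
  · rw [h x hx]; norm_num

theorem Point.mem_of_pos {p : M.Point} {τ : Finset M.V} (h : p.MemTriangle τ) {x : M.V}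
    (hx : 0 < p x) : x ∈ τ := by
  by_contra hc
  exact hx.ne' (h x hc)

theorem Point.eq_zero_of_eq_one {p : M.Point} {v x : M.V} (h : p v = 1) (hx : x ≠ v) :
    p x = 0 := by
  obtain ⟨τ, hτ, ht⟩ := p.exists_triangle
  have hv : v ∈ τ := Point.mem_of_pos ht (by rw [h]; norm_num)
  obtain ⟨a, b, rfl⟩ := exists_triple_of_mem hτ hv
  have hs := Point.sum_eq_one ht
  rw [sum_tri hτ] at hs
  have ha := p.nonneg a
  have hb := p.nonneg b
  by_cases hxa : x = a
  · subst hxa; linarith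
  by_cases hxb : x = b
  · subst hxb; linarith
  exact ht x (by simp [hx, hxa, hxb])

theorem Point.sum_tri {p : M.Point} {u v w : M.V} (hT : {u, v, w} ∈ M.triangles)
    (h : p.MemTriangle {u, v, w}) : p u + p v + p w = 1 := by
  rw [← SManifold.sum_tri hT, Point.sum_eq_one h]

/-- The point with given barycentric coordinates. -/
def mkPoint {τ : Finset M.V} (hτ : τ ∈ M.triangles) (f : M.V → ℝ) (h0 : ∀ x, 0 ≤ f x)
    (h : ∀ x, x ∉ τ → f x = 0) (h1 : ∑ x ∈ τ, f x = 1) : M.Point :=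
  ⟨f, h0, τ, hτ, h, h1⟩

/-! ### Germs of curves -/

/-- On each side of `t` the curve is affine in barycentric coordinates. `RGerm` records the velocity
ahead, `LGerm` the velocity of the reversed curve, so that both vectors point away from `γ t`. -/
def RGerm (γ : ℝ → M.Point) (t : ℝ) (D : M.V → ℝ) : Prop :=
  ∃ ε > 0, ∀ s ∈ Icc 0 ε, ∀ x, γ (t + s) x = γ t x + s * D x

def LGerm (γ : ℝ → M.Point) (t : ℝ) (E : M.V → ℝ) : Prop :=
  ∃ ε > 0, ∀ s ∈ Icc 0 ε, ∀ x, γ (t - s) x = γ t x + s * E x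

/-- A unit tangent vector at `p`, in barycentric coordinates. -/
def IsDir (p : M.Point) (D : M.V → ℝ) : Prop :=
  ∃ τ ∈ M.triangles, p.MemTriangle τ ∧ (∀ x, x ∉ τ → D x = 0) ∧ ∑ x ∈ τ, D x = 0 ∧
    ∑ x ∈ τ, D x ^ 2 = 2 ∧ ∀ x, p x = 0 → 0 ≤ D x

/-- Incoming direction (reversed) `E` and outgoing direction `D` make equal angles at `v`. -/
def VOpp (v : M.V) (E D : M.V → ℝ) : Prop :=
  ∃ (n : ℕ) (c : ZMod n → M.V), (n = 5 ∨ n = 6 ∨ n = 7) ∧ IsLink M.triangles v c ∧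
    ∃ θ : ℝ, E = pdir v c θ ∧ D = pdir v c (θ + n * (Real.pi / 6))

/-- `E` and `D` are opposite at a point that is not a vertex. -/
def SOpp (p : M.Point) (E D : M.V → ℝ) : Prop :=
  (∀ x, D x = -E x) ∨ ∃ u v w w' : M.V, {u, v, w} ∈ M.triangles ∧ {u, v, w'} ∈ M.triangles ∧
    w ≠ w' ∧ p.MemTriangle {u, v, w} ∧ p w = 0 ∧ (∀ x, x ∉ ({u, v, w} : Finset M.V) → E x = 0) ∧
    0 < E w ∧ D u = -E u - E w ∧ D v = -E v - E w ∧ D w' = E w ∧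
    ∀ x, x ∉ ({u, v, w'} : Finset M.V) → D x = 0

def Opp (p : M.Point) (E D : M.V → ℝ) : Prop :=
  (∀ v, p v = 1 → VOpp v E D) ∧ ((∀ v, p v ≠ 1) → SOpp p E D)

def GeodesicAt (γ : ℝ → M.Point) (t : ℝ) : Prop :=
  (∀ v, γ t v = 1 → BisectsVertexAt γ t v) ∧ ((∀ v, γ t v ≠ 1) → IsStraightAt γ t)

theorem RGerm.nonneg {γ : ℝ → M.Point} {t : ℝ} {D : M.V → ℝ} (h : RGerm γ t D) {x : M.V}
    (hx : γ t x = 0) : 0 ≤ D x := by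
  obtain ⟨ε, hε, h⟩ := h
  have h1 := h ε ⟨hε.le, le_rfl⟩ x
  have h2 := (γ (t + ε)).nonneg x
  rw [h1, hx, zero_add] at h2
  exact nonneg_of_mul_nonneg_right h2 hε

theorem LGerm.nonneg {γ : ℝ → M.Point} {t : ℝ} {D : M.V → ℝ} (h : LGerm γ t D) {x : M.V}
    (hx : γ t x = 0) : 0 ≤ D x := by
  obtain ⟨ε, hε, h⟩ := h
  have h1 := h ε ⟨hε.le, le_rfl⟩ x
  have h2 := (γ (t - ε)).nonneg x
  rw [h1, hx, zero_add] at h2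
  exact nonneg_of_mul_nonneg_right h2 hε

theorem RGerm.unique {γ : ℝ → M.Point} {t : ℝ} {D D' : M.V → ℝ} (h : RGerm γ t D)
    (h' : RGerm γ t D') : D = D' := by
  obtain ⟨ε, hε, h⟩ := h
  obtain ⟨ε', hε', h'⟩ := h'
  funext x
  have hm : 0 < min ε ε' := lt_min hε hε'
  have h1 := h _ ⟨hm.le, min_le_left _ _⟩ x
  have h2 := h' _ ⟨hm.le, min_le_right _ _⟩ x
  rw [h1] at h2
  have := add_left_cancel h2
  exact mul_left_cancel₀ hm.ne' this

/-- The coordinates of a curve that is straight at `t`. -/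
def StraightCoords (γ : ℝ → M.Point) (t : ℝ) (u v w w' : M.V) (x0 x1 y0 y1 : ℝ) : Prop :=
  ∃ ε > 0, ∀ s ∈ Icc (-ε) ε, γ (t + s) w = max (y0 + s * y1) 0 ∧
    γ (t + s) w' = max (-(y0 + s * y1)) 0 ∧ γ (t + s) v = x0 + s * x1 - |y0 + s * y1| / 2 ∧
    γ (t + s) u = 1 - (x0 + s * x1) - |y0 + s * y1| / 2 ∧
    ∀ x, x ≠ u → x ≠ v → x ≠ w → x ≠ w' → γ (t + s) x = 0

theorem StraightCoords.swap {γ : ℝ → M.Point} {t : ℝ} {u v w w' : M.V} {x0 x1 y0 y1 : ℝ}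
    (h : StraightCoords γ t u v w w' x0 x1 y0 y1) :
    StraightCoords γ t u v w' w x0 x1 (-y0) (-y1) := by
  obtain ⟨ε, hε, h⟩ := h
  refine ⟨ε, hε, fun s hs => ?_⟩
  obtain ⟨a, b, c, d, e⟩ := h s hs
  have e1 : -y0 + s * -y1 = -(y0 + s * y1) := by ring
  rw [e1, neg_neg, abs_neg]
  exact ⟨b, a, c, d, fun x h1 h2 h3 h4 => e x h1 h2 h4 h3⟩

/-- The coordinate `y` is the weight of `w` minus that of `w'`, the signed height over the common
edge in units of `√3 / 2`. At every time one of these two weights is zero, which the maxima and the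
absolute value encode. -/
theorem IsStraightAt.coords {γ : ℝ → M.Point} {t : ℝ} (h : IsStraightAt γ t) :
    ∃ u v w w' : M.V, {u, v, w} ∈ M.triangles ∧ {u, v, w'} ∈ M.triangles ∧ w ≠ w' ∧
      ∃ x0 x1 y0 y1 : ℝ, x1 ^ 2 + 3 / 4 * y1 ^ 2 = 1 ∧
        StraightCoords γ t u v w w' x0 x1 y0 y1 := by
  obtain ⟨u, v, w, w', hw, hw', hne, z, d, hd, ε, hε, h⟩ := h
  have h3 := sqrt_three_pos
  have h33 := sqrt_three_sq
  have hd2 : d.re ^ 2 + d.im ^ 2 = 1 := by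
    have := Complex.sq_norm d
    rw [hd, Complex.normSq_apply] at this
    linarith
  refine ⟨u, v, w, w', hw, hw', hne, z.re, d.re, z.im * (2 / √3), d.im * (2 / √3), ?_, ε, hε,
    fun s hs => ?_⟩
  · rw [mul_pow, div_pow, Real.sq_sqrt (by norm_num)]; linarith
  · obtain ⟨hm, hl⟩ := h s hs
    obtain ⟨n1, n2, n3⟩ := tri_ne hw
    obtain ⟨n1', n2', n3'⟩ := tri_ne hw'
    have hre := congrArg Complex.re hl
    have him := congrArg Complex.im hl
    simp [layFlat, omega_re, omega_im] at hre him
    set q := γ (t + s)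
    have hy : z.im * (2 / √3) + s * (d.im * (2 / √3)) = q w - q w' := by
      have : z.im + s * d.im = (q w - q w') * (√3 / 2) := by rw [← him]; ring
      calc _ = (z.im + s * d.im) * (2 / √3) := by ring
        _ = _ := by rw [this]; field_simp
    rw [hy]
    have q1 := q.nonneg w
    have q2 := q.nonneg w'
    rcases hm with hm | hm
    · have hz : q w' = 0 := hm w' (by simp [n2'.symm, n3'.symm, hne.symm])
      have hs := Point.sum_tri hw hm
      rw [hz] at hre ⊢
      rw [sub_zero, max_eq_left q1, abs_of_nonneg q1, max_eq_right (by linarith)]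
      refine ⟨rfl, rfl, by linarith, by linarith, fun x h1 h2 h3 _ => hm x (by simp [h1, h2, h3])⟩
    · have hz : q w = 0 := hm w (by simp [n2.symm, n3.symm, hne])
      have hs := Point.sum_tri hw' hm
      rw [hz] at hre ⊢
      rw [zero_sub, neg_neg, max_eq_left q2, abs_neg, abs_of_nonneg q2,
        max_eq_right (by linarith)]
      refine ⟨rfl, rfl, by linarith, by linarith, fun x h1 h2 _ h3 => hm x (by simp [h1, h2, h3])⟩

/-- The vector with given coordinates on a triangle. -/
def triVec (u v w : M.V) (a b c : ℝ) (x : M.V) : ℝ :=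
  if x = u then a else if x = v then b else if x = w then c else 0

theorem triVec_apply {u v w : M.V} (h : {u, v, w} ∈ M.triangles) (a b c : ℝ) :
    triVec u v w a b c u = a ∧ triVec u v w a b c v = b ∧ triVec u v w a b c w = c := by
  obtain ⟨h1, h2, h3⟩ := tri_ne h
  simp [triVec, h1.symm, h2.symm, h3.symm]

theorem triVec_of_notMem {u v w : M.V} (a b c : ℝ) {x : M.V}
    (h : x ∉ ({u, v, w} : Finset M.V)) : triVec u v w a b c x = 0 := by
  simp only [Finset.mem_insert, Finset.mem_singleton, not_or] at h
  simp [triVec, h]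

theorem isDir_triVec {p : M.Point} {u v w : M.V} (h : {u, v, w} ∈ M.triangles)
    (hp : p.MemTriangle {u, v, w}) {a b c : ℝ} (h0 : a + b + c = 0)
    (h2 : a ^ 2 + b ^ 2 + c ^ 2 = 2) (hn : ∀ x, p x = 0 → 0 ≤ triVec u v w a b c x) :
    IsDir p (triVec u v w a b c) := by
  obtain ⟨e1, e2, e3⟩ := triVec_apply h a b c
  exact ⟨_, h, hp, fun x hx => triVec_of_notMem a b c hx, by rw [sum_tri h, e1, e2, e3, h0],
    by rw [sum_tri h, e1, e2, e3, h2], hn⟩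

/-- By `hy` the curve is in the first triangle just after `t`. Either it is there during a whole
neighbourhood of `t`, and the two directions are negatives of each other, or it crosses the edge at
`t`, and the backward direction is read off in the second triangle. -/
theorem StraightCoords.germs {γ : ℝ → M.Point} {t : ℝ} {u v w w' : M.V} {x0 x1 y0 y1 : ℝ}
    (hw : {u, v, w} ∈ M.triangles) (hw' : {u, v, w'} ∈ M.triangles) (hne : w ≠ w')
    (h : StraightCoords γ t u v w w' x0 x1 y0 y1) (hd : x1 ^ 2 + 3 / 4 * y1 ^ 2 = 1)
    (hy : 0 < y0 ∨ y0 = 0 ∧ 0 ≤ y1) :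
    ∃ D E, RGerm γ t D ∧ LGerm γ t E ∧ IsDir (γ t) D ∧ IsDir (γ t) E ∧ SOpp (γ t) E D := by
  obtain ⟨ε, hε, h⟩ := h
  obtain ⟨n1, n2, n3⟩ := tri_ne hw
  obtain ⟨n1', n2', n3'⟩ := tri_ne hw'
  have h0 := h 0 ⟨by linarith, hε.le⟩
  rw [add_zero, zero_mul, zero_mul, add_zero, add_zero] at h0
  obtain ⟨g1, g2, g3, g4, g5⟩ := h0
  have hy0 : 0 ≤ y0 := by rcases hy with h | h <;> linarith
  rw [max_eq_left hy0] at g1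
  rw [max_eq_right (by linarith)] at g2
  rw [abs_of_nonneg hy0] at g3 g4
  have mem : (γ t).MemTriangle {u, v, w} := by
    intro x hx
    simp only [Finset.mem_insert, Finset.mem_singleton, not_or] at hx
    by_cases hxw : x = w'
    · subst hxw; exact g2
    · exact g5 x hx.1 hx.2.1 hx.2.2 hxw
  -- the coordinates at a time when the curve is in the first triangle
  have key : ∀ s ∈ Icc (-ε) ε, 0 ≤ y0 + s * y1 → ∀ x,
      γ (t + s) x = γ t x + s * triVec u v w (-x1 - y1 / 2) (x1 - y1 / 2) y1 x := by
    intro s hs hpos x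
    obtain ⟨f1, f2, f3, f4, f5⟩ := h s hs
    obtain ⟨e1, e2, e3⟩ := triVec_apply hw (-x1 - y1 / 2) (x1 - y1 / 2) y1
    rw [max_eq_left hpos] at f1
    rw [max_eq_right (by linarith)] at f2
    rw [abs_of_nonneg hpos] at f3 f4
    by_cases hu : x = u
    · subst hu; rw [e1, f4, g4]; ring
    by_cases hv : x = v
    · subst hv; rw [e2, f3, g3]; ring
    by_cases hw0 : x = w
    · subst hw0; rw [e3, f1, g1]
    · rw [triVec_of_notMem _ _ _ (by simp [hu, hv, hw0])]
      by_cases hw1 : x = w'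
      · subst hw1; rw [f2, g2]; ring
      · rw [f5 x hu hv hw0 hw1, g5 x hu hv hw0 hw1]; ring
  by_cases hcase : 0 < y0 ∨ y1 = 0
  · -- a full neighbourhood lies in the first triangle
    obtain ⟨δ, hδ, hδε, hpos⟩ : ∃ δ > 0, δ ≤ ε ∧ ∀ s ∈ Icc (-δ) δ, 0 ≤ y0 + s * y1 := by
      rcases hcase with hc | hc
      -- This bound on `|s|` gives `|s * y1| ≤ y0`; the added 1 avoids a zero denominator.
      · refine ⟨min ε (y0 / (|y1| + 1)), lt_min hε (by positivity), min_le_left _ _, ?_⟩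
        intro s hs
        have hs' : |s| ≤ y0 / (|y1| + 1) := (abs_le.2 hs).trans (min_le_right _ _)
        have h1 : |s * y1| ≤ y0 := by
          rw [abs_mul]
          calc |s| * |y1| ≤ y0 / (|y1| + 1) * (|y1| + 1) := by gcongr; linarith
            _ = y0 := by field_simp
        linarith [(abs_le.1 h1).1]
      · exact ⟨ε, hε, le_rfl, fun s _ => by rw [hc]; linarith⟩
    have hR : RGerm γ t (triVec u v w (-x1 - y1 / 2) (x1 - y1 / 2) y1) :=
      ⟨δ, hδ, fun s hs x => key s ⟨by linarith [hs.1], by linarith [hs.2]⟩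
        (hpos s ⟨by linarith [hs.1], hs.2⟩) x⟩
    have hL : LGerm γ t (triVec u v w (-(-x1 - y1 / 2)) (-(x1 - y1 / 2)) (-y1)) := by
      refine ⟨δ, hδ, fun s hs x => ?_⟩
      rw [sub_eq_add_neg, key (-s) ⟨by linarith [hs.2], by linarith [hs.1]⟩
        (hpos (-s) ⟨by linarith [hs.2], by linarith [hs.1]⟩) x]
      simp only [triVec]; split_ifs <;> ring
    refine ⟨_, _, hR, hL, isDir_triVec hw mem (by ring) (by linear_combination 2 * hd)
      (fun x hx => hR.nonneg hx), isDir_triVec hw mem (by ring) (by linear_combination 2 * hd)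
      (fun x hx => hL.nonneg hx), Or.inl fun x => ?_⟩
    simp only [triVec]; split_ifs <;> ring
  · have hy00 : y0 = 0 := by
      rcases hy with h | h
      · exact absurd (Or.inl h) hcase
      · exact h.1
    have hy1 : 0 < y1 := by
      rcases hy with h | h
      · exact absurd (Or.inl h) hcase
      · exact lt_of_le_of_ne h.2 fun e => hcase (Or.inr e.symm)
    subst hy00
    have hR : RGerm γ t (triVec u v w (-x1 - y1 / 2) (x1 - y1 / 2) y1) :=
      ⟨ε, hε, fun s hs x => key s ⟨by linarith [hs.1], by linarith [hs.2]⟩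
        (by have := mul_nonneg hs.1 hy1.le; linarith) x⟩
    have mem' : (γ t).MemTriangle {u, v, w'} := by
      intro x hx
      simp only [Finset.mem_insert, Finset.mem_singleton, not_or] at hx
      by_cases hxw : x = w
      · subst hxw; exact g1
      · exact g5 x hx.1 hx.2.1 hxw hx.2.2
    obtain ⟨e1, e2, e3⟩ := triVec_apply hw' (x1 - y1 / 2) (-x1 - y1 / 2) y1
    have hL : LGerm γ t (triVec u v w' (x1 - y1 / 2) (-x1 - y1 / 2) y1) := by
      refine ⟨ε, hε, fun s hs x => ?_⟩
      obtain ⟨f1, f2, f3, f4, f5⟩ := h (-s) ⟨by linarith [hs.2], by linarith [hs.1]⟩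
      have hneg : 0 + -s * y1 ≤ 0 := by have := mul_nonneg hs.1 hy1.le; linarith
      rw [max_eq_right hneg] at f1
      rw [max_eq_left (by linarith)] at f2
      rw [abs_of_nonpos hneg] at f3 f4
      rw [sub_eq_add_neg]
      by_cases hu : x = u
      · subst hu; rw [e1, f4, g4]; ring
      by_cases hv : x = v
      · subst hv; rw [e2, f3, g3]; ring
      by_cases hw0 : x = w'
      · subst hw0; rw [e3, f2, g2]; ring
      · rw [triVec_of_notMem _ _ _ (by simp [hu, hv, hw0])]
        by_cases hw1 : x = w
        · subst hw1; rw [f1, g1]; ring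
        · rw [f5 x hu hv hw1 hw0, g5 x hu hv hw1 hw0]; ring
    obtain ⟨d1, d2, d3⟩ := triVec_apply hw (-x1 - y1 / 2) (x1 - y1 / 2) y1
    refine ⟨_, _, hR, hL, isDir_triVec hw mem (by ring) (by linear_combination 2 * hd)
      (fun x hx => hR.nonneg hx), isDir_triVec hw' mem' (by ring) (by linear_combination 2 * hd)
      (fun x hx => hL.nonneg hx), Or.inr ⟨u, v, w', w, hw', hw, hne.symm, mem', g2,
      fun x hx => triVec_of_notMem _ _ _ hx, by rw [e3]; exact hy1, by rw [d1, e1, e3]; ring,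
      by rw [d2, e2, e3]; ring, by rw [d3, e3], fun x hx => triVec_of_notMem _ _ _ hx⟩⟩

theorem IsStraightAt.germs {γ : ℝ → M.Point} {t : ℝ} (h : IsStraightAt γ t) :
    ∃ D E, RGerm γ t D ∧ LGerm γ t E ∧ IsDir (γ t) D ∧ IsDir (γ t) E ∧ SOpp (γ t) E D := by
  obtain ⟨u, v, w, w', hw, hw', hne, x0, x1, y0, y1, hd, h⟩ := h.coords
  rcases lt_trichotomy y0 0 with hy | hy | hy
  · exact h.swap.germs hw' hw hne.symm (by linarith) (Or.inl (by linarith))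
  · rcases le_total 0 y1 with hy1 | hy1
    · exact h.germs hw hw' hne hd (Or.inr ⟨hy, hy1⟩)
    · exact h.swap.germs hw' hw hne.symm (by linarith) (Or.inr ⟨by linarith, by linarith⟩)
  · exact h.germs hw hw' hne hd (Or.inl hy)

/-- Along a ray the barycentric coordinates are affine in `r`: the point is `v` plus `r` times the
unit vector at the angle `θ`. This turns the condition at a vertex into one on germs. -/
theorem hasPolarCoord_iff {v : M.V} {n : ℕ} {c : ZMod n → M.V} (hc : IsLink M.triangles v c)
    {p : M.Point} {r θ : ℝ} : HasPolarCoord v c p r θ ↔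
      ∀ x, p x = (if x = v then 1 else 0) + r * pdir v c θ x := by
  constructor
  · rintro ⟨k, h0, h1, hm, h⟩ x
    rw [← polX_add_polY_mul_omega, mul_add, ← mul_assoc, ← Complex.ofReal_mul,
      ← Complex.ofReal_mul, add_mul_omega_inj] at h
    rw [pdir_eq v c h0 h1]
    have hT := hc.mem k
    obtain ⟨n1, n2, n3⟩ := tri_ne hT
    have hs := Point.sum_tri hT hm
    by_cases hv : x = v
    · subst hv; simp only [ev, if_true, if_neg n1, if_neg n2]; linarith [h.1, h.2]
    by_cases hv1 : x = c k
    · subst hv1; simp only [ev, if_true, if_neg n1.symm, if_neg n3]; linarith [h.1, h.2]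
    by_cases hv2 : x = c (k + 1)
    · subst hv2; simp only [ev, if_true, if_neg n2.symm, if_neg n3.symm]; linarith [h.1, h.2]
    · rw [hm x (by simp [hv, hv1, hv2])]; simp [ev, hv, hv1, hv2]
  · intro h
    obtain ⟨k, h0, h1⟩ := exists_sector θ
    have hT := hc.mem k
    obtain ⟨n1, n2, n3⟩ := tri_ne hT
    refine ⟨k, h0, h1.le, fun x hx => ?_, ?_⟩
    · simp only [Finset.mem_insert, Finset.mem_singleton, not_or] at hx
      rw [h x, pdir_eq v c h0 h1.le]
      simp [ev, hx]
    · rw [← polX_add_polY_mul_omega, mul_add, ← mul_assoc, ← Complex.ofReal_mul,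
        ← Complex.ofReal_mul, add_mul_omega_inj, h, h, pdir_eq v c h0 h1.le, pdir_eq v c h0 h1.le]
      simp [ev, n1.symm, n2.symm, n3, n3.symm]

theorem isDir_pdir {v : M.V} {n : ℕ} {c : ZMod n → M.V} (hc : IsLink M.triangles v c)
    {p : M.Point} (hp : p v = 1) (θ : ℝ) : IsDir p (pdir v c θ) := by
  obtain ⟨k, h0, h1⟩ := exists_sector θ
  have hT := hc.mem k
  obtain ⟨n1, n2, n3⟩ := tri_ne hT
  have hX := polX_nonneg (sub_nonneg.2 h0) (by linarith)
  have hY := polY_nonneg (sub_nonneg.2 h0) (by linarith)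
  have hXY := polX_sq (θ - k * (Real.pi / 3))
  have e : ∀ x, pdir v c θ x = _ := fun x => pdir_eq v c h0 h1.le x
  have e1 := e v
  have e2 := e (c k)
  have e3 := e (c (k + 1))
  simp only [ev, if_true, if_neg n1, if_neg n2, if_neg n3, if_neg n1.symm, if_neg n2.symm,
    if_neg n3.symm] at e1 e2 e3
  refine ⟨_, hT, fun x hx => Point.eq_zero_of_eq_one hp ?_, fun x hx => ?_, ?_, ?_, ?_⟩
  · rintro rfl; simp at hx
  · simp only [Finset.mem_insert, Finset.mem_singleton, not_or] at hx
    rw [e]; simp [ev, hx]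
  · rw [sum_tri hT, e1, e2, e3]; ring
  · rw [sum_tri hT, e1, e2, e3]; linear_combination 2 * hXY
  · intro x hx
    have hxv : x ≠ v := by rintro rfl; rw [hp] at hx; norm_num at hx
    rw [e]
    simp only [ev, if_neg hxv, sub_zero]
    split_ifs <;> simp <;> linarith

theorem BisectsVertexAt.germs {γ : ℝ → M.Point} {t : ℝ} {v : M.V} (h : BisectsVertexAt γ t v)
    (hv : γ t v = 1) :
    ∃ D E, RGerm γ t D ∧ LGerm γ t E ∧ IsDir (γ t) D ∧ IsDir (γ t) E ∧ VOpp v E D := by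
  obtain ⟨n, c, hn, hc, θ, ε, hε, h⟩ := h
  have e : ∀ x, γ t x = if x = v then 1 else 0 := by
    intro x
    split_ifs with hx
    · rw [hx, hv]
    · exact Point.eq_zero_of_eq_one hv hx
  exact ⟨_, _, ⟨ε, hε, fun s hs x => by rw [e]; exact (hasPolarCoord_iff hc).1 (h s hs).2 x⟩,
    ⟨ε, hε, fun s hs x => by rw [e]; exact (hasPolarCoord_iff hc).1 (h s hs).1 x⟩,
    isDir_pdir hc hv _, isDir_pdir hc hv _, n, c, hn, hc, θ, rfl, rfl⟩

/-- Together with its converse `geodesicAt_of_germs` this makes being geodesic at `t` a condition on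
two velocities only. Gluing, reversal and uniqueness become algebra of the relation `Opp`. -/
theorem GeodesicAt.germs {γ : ℝ → M.Point} {t : ℝ} (h : GeodesicAt γ t) :
    ∃ D E, RGerm γ t D ∧ LGerm γ t E ∧ IsDir (γ t) D ∧ IsDir (γ t) E ∧ Opp (γ t) E D := by
  by_cases hv : ∃ v, γ t v = 1
  · obtain ⟨v, hv⟩ := hv
    obtain ⟨D, E, h1, h2, h3, h4, h5⟩ := (h.1 v hv).germs hv
    refine ⟨D, E, h1, h2, h3, h4, fun u hu => ?_, fun hc => absurd hv (hc v)⟩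
    have : u = v := by
      by_contra hne
      rw [Point.eq_zero_of_eq_one hv hne] at hu; norm_num at hu
    exact this ▸ h5
  · push Not at hv
    obtain ⟨D, E, h1, h2, h3, h4, h5⟩ := (h.2 hv).germs
    exact ⟨D, E, h1, h2, h3, h4, fun u hu => absurd hu (hv u), fun _ => h5⟩

end SManifold

end


noncomputable section

namespace SManifold

open Set

variable {M : SManifold}

/-! ### Opposite directions -/

theorem IsDir.sums {p : M.Point} {D : M.V → ℝ} (h : IsDir p D) {u v w : M.V}
    (hT : {u, v, w} ∈ M.triangles) (hD : ∀ x, x ∉ ({u, v, w} : Finset M.V) → D x = 0) :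
    D u + D v + D w = 0 ∧ D u ^ 2 + D v ^ 2 + D w ^ 2 = 2 := by
  obtain ⟨τ, _, _, h1, h2, h3, _⟩ := h
  constructor
  · rw [← sum_tri hT, ← h2]; exact sum_eq_of_support hD h1
  · rw [← sum_tri hT (fun x => D x ^ 2), ← h3]
    exact sum_eq_of_support (fun x hx => by rw [hD x hx]; norm_num)
      (fun x hx => by rw [h1 x hx]; norm_num)

theorem IsDir.triple {p : M.Point} {D : M.V → ℝ} (h : IsDir p D) :
    ∃ u v w, {u, v, w} ∈ M.triangles ∧ p.MemTriangle {u, v, w} ∧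
      (∀ x, x ∉ ({u, v, w} : Finset M.V) → D x = 0) ∧ D u + D v + D w = 0 ∧
      D u ^ 2 + D v ^ 2 + D w ^ 2 = 2 := by
  obtain ⟨τ, hT, h0, h1, h2, h3, _⟩ := h
  obtain ⟨u, v, w, rfl⟩ := exists_triple hT
  rw [sum_tri hT] at h2 h3
  exact ⟨u, v, w, hT, h0, h1, h2, h3⟩

theorem IsDir.nonneg {p : M.Point} {D : M.V → ℝ} (h : IsDir p D) {x : M.V} (hx : p x = 0) :
    0 ≤ D x := by
  obtain ⟨τ, _, _, _, _, _, h⟩ := h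
  exact h x hx

theorem norm_add_mul_omega {a b : ℝ} (h : a ^ 2 + a * b + b ^ 2 = 1) :
    ‖(a : ℂ) + b * ω‖ = 1 := by
  have h3 : √3 ^ 2 = 3 := Real.sq_sqrt (by norm_num)
  have : Complex.normSq ((a : ℂ) + b * ω) = 1 := by
    rw [Complex.normSq_apply]
    simp [omega_re, omega_im]
    linear_combination h + b ^ 2 / 4 * h3
  rw [← sq_eq_sq₀ (norm_nonneg _) zero_le_one, Complex.sq_norm, this, one_pow]

theorem conj_omega : (starRingEnd ℂ) ω = 1 - ω := by
  apply Complex.ext <;> simp [omega_re, omega_im]; norm_num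

theorem other_triangle {u v w : M.V} (h : {u, v, w} ∈ M.triangles) :
    ∃ x, x ≠ w ∧ {u, v, x} ∈ M.triangles := exists_other M.card_eq_three M.exists_link h

theorem third_eq {u v w x y : M.V} (hw : {u, v, w} ∈ M.triangles) (hx : {u, v, x} ∈ M.triangles)
    (hy : {u, v, y} ∈ M.triangles) (hxw : x ≠ w) (hyw : y ≠ w) : x = y :=
  third_unique M.card_eq_three M.exists_link hw hx hy hxw hyw

theorem geodesicAt_of_germs {γ : ℝ → M.Point} {t : ℝ} {D E : M.V → ℝ} (hR : RGerm γ t D)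
    (hL : LGerm γ t E) (hD : IsDir (γ t) D) (hO : Opp (γ t) E D) : GeodesicAt γ t := by
  obtain ⟨ε, hε, hR⟩ := hR
  obtain ⟨δ, hδ, hL⟩ := hL
  have hm : 0 < min ε δ := lt_min hε hδ
  refine ⟨fun v hv => ?_, fun hv => ?_⟩
  · obtain ⟨n, c, hn, hc, θ, rfl, rfl⟩ := hO.1 v hv
    have e : ∀ x, γ t x = if x = v then 1 else 0 := by
      intro x
      split_ifs with hx
      · rw [hx, hv]
      · exact Point.eq_zero_of_eq_one hv hx
    refine ⟨n, c, hn, hc, θ, min ε δ, hm, fun s hs => ⟨?_, ?_⟩⟩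
    · rw [hasPolarCoord_iff hc]; intro x
      rw [← e]; exact hL s ⟨hs.1, hs.2.trans (min_le_right _ _)⟩ x
    · rw [hasPolarCoord_iff hc]; intro x
      rw [← e]; exact hR s ⟨hs.1, hs.2.trans (min_le_left _ _)⟩ x
  · rcases hO.2 hv with h | ⟨u, v, w, w', hw, hw', hne, hp, hp0, hE, hE0, h1, h2, h3, hD0⟩
    · obtain ⟨u, v, w, hT, hp, hD0, hs, hq⟩ := hD.triple
      -- Any neighbouring triangle completes the flat pair: near `t` the curve stays in the first
      -- triangle.
      obtain ⟨w', hne, hw'⟩ := other_triangle hT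
      obtain ⟨n1, n2, n3⟩ := tri_ne hT
      obtain ⟨n1', n2', n3'⟩ := tri_ne hw'
      refine ⟨u, v, w, w', hT, hw', hne.symm, (γ t v : ℂ) + (γ t w : ℂ) * ω,
        (D v : ℂ) + (D w : ℂ) * ω, norm_add_mul_omega ?_, min ε δ, hm, ?_⟩
      · have : D u = -D v - D w := by linarith
        rw [this] at hq; linarith
      · have key : ∀ s ∈ Icc (-min ε δ) (min ε δ), ∀ x, γ (t + s) x = γ t x + s * D x := by
          intro s hs x
          rcases le_total 0 s with h0 | h0
          · exact hR s ⟨h0, hs.2.trans (min_le_left _ _)⟩ x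
          · have := hL (-s) ⟨by linarith, by linarith [hs.1, min_le_right ε δ]⟩ x
            rw [sub_neg_eq_add] at this
            rw [this, h]; ring
        intro s hs
        have hmem : (γ (t + s)).MemTriangle {u, v, w} := by
          intro x hx
          rw [key s hs, hp x hx, hD0 x hx]; ring
        refine ⟨Or.inl hmem, ?_⟩
        have : γ (t + s) w' = 0 := hmem w' (by simp [n2'.symm, n3'.symm, hne])
        rw [layFlat, this, key s hs, key s hs]
        push_cast; ring
    · obtain ⟨n1, n2, n3⟩ := tri_ne hw
      obtain ⟨n1', n2', n3'⟩ := tri_ne hw'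
      have hw'0 : γ t w' = 0 := hp w' (by simp [n2'.symm, n3'.symm, hne.symm])
      have hss := hD.sums hw' hD0
      refine ⟨u, v, w, w', hw, hw', hne, (γ t v : ℂ),
        (D v : ℂ) + (D w' : ℂ) * (1 - ω), ?_, min ε δ, hm, ?_⟩
      · have e : (D v : ℂ) + (D w' : ℂ) * (1 - ω) =
            ((D v + D w' : ℝ) : ℂ) + ((-D w' : ℝ) : ℂ) * ω := by push_cast; ring
        rw [e]
        apply norm_add_mul_omega
        have : D u = -D v - D w' := by linarith [hss.1]
        have h2 := hss.2
        rw [this] at h2; linarith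
      · intro s hs
        rcases le_total 0 s with h0 | h0
        · have key := hR s ⟨h0, hs.2.trans (min_le_left _ _)⟩
          refine ⟨Or.inr fun x hx => ?_, ?_⟩
          · have hx0 : γ t x = 0 := by
              by_cases hxw : x = w
              · rw [hxw, hp0]
              · apply hp; simp at hx ⊢; tauto
            rw [key, hx0, hD0 x hx]; ring
          · have hw0 : D w = 0 := hD0 w (by simp [n2.symm, n3.symm, hne])
            rw [layFlat, key, key, key, hp0, hw0, hw'0, conj_omega]
            push_cast; ring
        · have key := hL (-s) ⟨by linarith, by linarith [hs.1, min_le_right ε δ]⟩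
          rw [sub_neg_eq_add] at key
          refine ⟨Or.inl fun x hx => ?_, ?_⟩
          · rw [key, hp x hx, hE x hx]; ring
          · have hw0 : E w' = 0 := hE w' (by simp [n2'.symm, n3'.symm, hne.symm])
            rw [layFlat, key, key, key, hp0, hw0, hw'0, h2, h3, conj_omega]
            push_cast; ring

theorem VOpp.symm {v : M.V} {E D : M.V → ℝ} (h : VOpp v E D) : VOpp v D E := by
  obtain ⟨n, c, hn, hc, θ, rfl, rfl⟩ := h
  refine ⟨n, c, hn, hc, θ + n * (Real.pi / 6), rfl, ?_⟩
  rw [← pdir_add_period v c 1 θ]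
  congr 1; push_cast; ring

theorem SOpp.symm {p : M.Point} {E D : M.V → ℝ} (h : SOpp p E D) : SOpp p D E := by
  rcases h with h | ⟨u, v, w, w', hw, hw', hne, hp, hp0, hE, hE0, h1, h2, h3, hD0⟩
  · exact Or.inl fun x => by rw [h, neg_neg]
  · obtain ⟨n1, n2, n3⟩ := tri_ne hw
    obtain ⟨n1', n2', n3'⟩ := tri_ne hw'
    refine Or.inr ⟨u, v, w', w, hw', hw, hne.symm, fun x hx => ?_,
      hp w' (by simp [n2'.symm, n3'.symm, hne.symm]), hD0, by rw [h3]; exact hE0,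
      by rw [h1, h3]; ring, by rw [h2, h3]; ring, h3.symm, hE⟩
    by_cases hxw : x = w
    · rw [hxw, hp0]
    · apply hp; simp at hx ⊢; tauto

theorem Opp.symm {p : M.Point} {E D : M.V → ℝ} (h : Opp p E D) : Opp p D E :=
  ⟨fun v hv => (h.1 v hv).symm, fun hv => (h.2 hv).symm⟩

/-! ### Reversal and translation of geodesics. -/

theorem RGerm.reverse {γ : ℝ → M.Point} {t : ℝ} {D : M.V → ℝ} (h : RGerm γ t D) :
    LGerm (fun s => γ (-s)) (-t) D := by
  obtain ⟨ε, hε, h⟩ := h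
  refine ⟨ε, hε, fun s hs x => ?_⟩
  simpa [add_comm] using h s hs x

theorem LGerm.reverse {γ : ℝ → M.Point} {t : ℝ} {D : M.V → ℝ} (h : LGerm γ t D) :
    RGerm (fun s => γ (-s)) (-t) D := by
  obtain ⟨ε, hε, h⟩ := h
  refine ⟨ε, hε, fun s hs x => ?_⟩
  have := h s hs x
  simp only [neg_add, neg_neg]
  rwa [← sub_eq_add_neg]

theorem GeodesicAt.reverse {γ : ℝ → M.Point} {t : ℝ} (h : GeodesicAt γ t) :
    GeodesicAt (fun s => γ (-s)) (-t) := by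
  obtain ⟨D, E, h1, h2, h3, h4, h5⟩ := h.germs
  have h4' : IsDir ((fun s => γ (-s)) (-t)) E := by simpa using h4
  exact geodesicAt_of_germs h2.reverse h1.reverse h4' (by simpa using h5.symm)

theorem IsGeodesic.reverse {γ : ℝ → M.Point} (h : IsGeodesic γ) :
    IsGeodesic (fun s => γ (-s)) := by
  intro t
  have := GeodesicAt.reverse (γ := γ) (t := -t) (h (-t))
  rwa [neg_neg] at this

theorem RGerm.shift {γ : ℝ → M.Point} {t a : ℝ} {D : M.V → ℝ} (h : RGerm γ (t + a) D) :
    RGerm (fun s => γ (s + a)) t D := by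
  obtain ⟨ε, hε, h⟩ := h
  refine ⟨ε, hε, fun s hs x => ?_⟩
  simp only
  rw [add_right_comm]; exact h s hs x

theorem LGerm.shift {γ : ℝ → M.Point} {t a : ℝ} {D : M.V → ℝ} (h : LGerm γ (t + a) D) :
    LGerm (fun s => γ (s + a)) t D := by
  obtain ⟨ε, hε, h⟩ := h
  refine ⟨ε, hε, fun s hs x => ?_⟩
  simp only
  rw [sub_add_eq_add_sub]; exact h s hs x

theorem GeodesicAt.shift {γ : ℝ → M.Point} {t a : ℝ} (h : GeodesicAt γ (t + a)) :
    GeodesicAt (fun s => γ (s + a)) t := by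
  obtain ⟨D, E, h1, h2, h3, h4, h5⟩ := h.germs
  exact geodesicAt_of_germs h1.shift h2.shift h3 h5

theorem IsGeodesic.shift {γ : ℝ → M.Point} (h : IsGeodesic γ) (a : ℝ) :
    IsGeodesic (fun s => γ (s + a)) := fun t => GeodesicAt.shift (h (t + a))

/-! ### Uniqueness of opposite directions. -/

/-- In half-open sectors `polX` is positive, so the weight at `c k` betrays the sector: each of the
two indices equals the other or its successor modulo `n`. As 2 is not 0 modulo `n`, the indices
agree, and the cosine determines the angle within the sector. -/
theorem pdir_injective {v : M.V} {n : ℕ} {c : ZMod n → M.V} (hn : n = 5 ∨ n = 6 ∨ n = 7)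
    (hc : IsLink M.triangles v c) {θ θ' : ℝ} (h : pdir v c θ = pdir v c θ') :
    ∃ m : ℤ, θ' = θ + m * (n * (Real.pi / 3)) := by
  obtain ⟨k, h0, h1⟩ := exists_sector θ
  obtain ⟨k', h0', h1'⟩ := exists_sector θ'
  have e : ∀ x, pdir v c θ x = _ := fun x => pdir_eq v c h0 h1.le x
  have e' : ∀ x, pdir v c θ' x = _ := fun x => pdir_eq v c h0' h1'.le x
  have hX := polX_pos (sub_nonneg.2 h0) (by linarith : θ - k * (Real.pi / 3) < Real.pi / 3)
  have hX' := polX_pos (sub_nonneg.2 h0') (by linarith : θ' - k' * (Real.pi / 3) < Real.pi / 3)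
  have hne := hc.ne M.card_eq_three
  have h1n := one_ne_zero_zmod hn
  have h2n := two_ne_zero_zmod hn
  have hk : ∀ j : ZMod n, j + 1 ≠ j := fun j hj => h1n (by simpa using hj)
  have a1 : (k : ZMod n) = k' ∨ (k : ZMod n) = k' + 1 := by
    by_contra hcon
    push Not at hcon
    have := congrFun h (c k)
    rw [e, e'] at this
    simp [ev, hne, hc.1.eq_iff, hcon] at this
    rw [if_neg h1n] at this
    linarith
  have a2 : (k' : ZMod n) = k ∨ (k' : ZMod n) = k + 1 := by
    by_contra hcon
    push Not at hcon
    have := congrFun h (c k')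
    rw [e, e'] at this
    simp [ev, hne, hc.1.eq_iff, hcon] at this
    rw [if_neg h1n] at this
    linarith
  have hkk : (k : ZMod n) = k' := by
    rcases a1 with a1 | a1
    · exact a1
    rcases a2 with a2 | a2
    · exact a2.symm
    · exfalso
      rw [a2, add_assoc] at a1
      apply h2n
      rw [← one_add_one_eq_two]
      exact (left_eq_add.1 a1)
  have f1 := congrFun h (c k)
  have f2 := congrFun h (c (k + 1))
  rw [e, e', ← hkk] at f1 f2
  simp only [ev, if_neg (hne _), hc.1.eq_iff, if_neg (hk _), if_neg (hk _).symm] at f1 f2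
  simp only [if_true, sub_zero, mul_one, mul_zero, add_zero, zero_add] at f1 f2
  have h3 := sqrt_three_pos
  have hcos : Real.cos (θ - k * (Real.pi / 3)) = Real.cos (θ' - k' * (Real.pi / 3)) := by
    rw [polY, polY] at f2
    rw [polX, polX] at f1
    have : Real.sin (θ - k * (Real.pi / 3)) / √3 = Real.sin (θ' - k' * (Real.pi / 3)) / √3 := by
      have e3 : ∀ y : ℝ, 2 * y / √3 = 2 * (y / √3) := fun y => by ring
      rw [e3, e3] at f2; linarith
    linarith
  have hφ := Real.injOn_cos ⟨by linarith, by linarith [Real.pi_pos]⟩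
    ⟨by linarith, by linarith [Real.pi_pos]⟩ hcos
  obtain ⟨m, hm⟩ := (ZMod.intCast_eq_intCast_iff_dvd_sub _ _ _).1 hkk
  refine ⟨m, ?_⟩
  have hm' : (k' : ℝ) = k + n * m := by
    have : k' = k + n * m := by linarith
    exact_mod_cast this
  rw [hm'] at hφ
  linarith

/-- Half of the total angle is the same in either sense of rotation, so the condition may be
expressed in any cyclic enumeration of the link. -/
theorem VOpp.exists_angle {v : M.V} {E D : M.V → ℝ} (h : VOpp v E D) {n : ℕ} {c : ZMod n → M.V}
    (hn : n = 5 ∨ n = 6 ∨ n = 7) (hc : IsLink M.triangles v c) :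
    ∃ θ : ℝ, E = pdir v c θ ∧ D = pdir v c (θ + n * (Real.pi / 6)) := by
  obtain ⟨n', c', hn', hc', θ, rfl, rfl⟩ := h
  obtain rfl := hc.card_unique M.card_eq_three hn hn' hc'
  obtain ⟨a, ha | ha⟩ := hc.dihedral M.card_eq_three hn hc'
  · obtain rfl : c' = fun j => c ((a : ZMod n') + j) := funext ha
    refine ⟨θ + a * (Real.pi / 3), pdir_shift v c a θ, ?_⟩
    rw [pdir_shift]; congr 1; ring
  · obtain rfl : c' = fun j => c ((a : ZMod n') - j) := funext ha
    refine ⟨a * (Real.pi / 3) - θ, pdir_reflect v c a θ, ?_⟩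
    rw [pdir_reflect, ← pdir_add_period v c 1]
    congr 1; push_cast; ring

theorem VOpp.unique {v : M.V} {E D D' : M.V → ℝ} (h : VOpp v E D) (h' : VOpp v E D') :
    D = D' := by
  obtain ⟨n, c, hn, hc, θ, rfl, rfl⟩ := h
  obtain ⟨θ', h1, rfl⟩ := h'.exists_angle hn hc
  obtain ⟨m, rfl⟩ := pdir_injective hn hc h1
  rw [← pdir_add_period v c m]
  congr 1; ring

/-- When an edge is crossed, `E w > 0` at a vanishing weight, so `-E` is not an admissible
direction; this separates the two cases. Two crossings at a point that is not a vertex take place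
over the same edge, whose ends carry the positive weights. -/
theorem SOpp.unique {p : M.Point} {E D D' : M.V → ℝ} (h : SOpp p E D) (h' : SOpp p E D')
    (hD : IsDir p D) (hD' : IsDir p D') (hp1 : ∀ v, p v ≠ 1) : D = D' := by
  rcases h with h | ⟨u, v, w, w', hw, hw', hne, hp, hp0, hE, hE0, h1, h2, h3, hD0⟩
  · rcases h' with h' | ⟨u, v, w, w', hw, hw', hne, hp, hp0, hE, hE0, h1, h2, h3, hD0⟩
    · funext x; rw [h, h']
    · have := hD.nonneg hp0
      rw [h] at this; linarith
  · rcases h' with h' | ⟨a, b, c, c', hc, hc', hne', hq, hq0, hF, hF0, k1, k2, k3, hD0'⟩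
    · have := hD'.nonneg hp0
      rw [h'] at this; linarith
    · have s1 := Point.sum_tri hw hp
      have s2 := Point.sum_tri hc hq
      have pos : ∀ x, p x = 0 → x ≠ u ∧ x ≠ v := by
        intro x hx
        constructor <;> rintro rfl
        · exact hp1 v (by linarith)
        · exact hp1 u (by linarith)
      have pos' : p a ≠ 0 ∧ p b ≠ 0 :=
        ⟨fun hx => hp1 b (by linarith), fun hx => hp1 a (by linarith)⟩
      have hcw : c = w := by
        by_contra hcw
        obtain ⟨x1, x2⟩ := pos c hq0
        have := hE c (by simp [x1, x2, hcw])
        linarith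
      subst hcw
      have mem : ∀ x, p x ≠ 0 → x = u ∨ x = v := by
        intro x hx
        by_contra hcon
        push Not at hcon
        by_cases hxc : x = c
        · exact hx (hxc ▸ hq0)
        · exact hx (hp x (by simp [hcon, hxc]))
      obtain ⟨nab, _, _⟩ := tri_ne hc
      have hsame : (a = u ∧ b = v) ∨ (a = v ∧ b = u) := by
        rcases mem a pos'.1 with rfl | rfl <;> rcases mem b pos'.2 with rfl | rfl <;> tauto
      have hc'' : {u, v, c'} ∈ M.triangles := by
        rcases hsame with ⟨rfl, rfl⟩ | ⟨rfl, rfl⟩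
        · exact hc'
        · rw [insert_swap']; exact hc'
      obtain rfl := third_eq hw hw' hc'' hne.symm hne'.symm
      have hu : D u = D' u ∧ D v = D' v := by
        rcases hsame with ⟨rfl, rfl⟩ | ⟨rfl, rfl⟩
        · exact ⟨by rw [h1, k1], by rw [h2, k2]⟩
        · exact ⟨by rw [h1, k2], by rw [h2, k1]⟩
      funext x
      by_cases hxu : x = u
      · rw [hxu, hu.1]
      by_cases hxv : x = v
      · rw [hxv, hu.2]
      by_cases hxw : x = w'
      · rw [hxw, h3, k3]
      · rw [hD0 x (by simp [hxu, hxv, hxw]), hD0' x]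
        rcases hsame with ⟨rfl, rfl⟩ | ⟨rfl, rfl⟩ <;> simp [hxu, hxv, hxw]

theorem Opp.unique {p : M.Point} {E D D' : M.V → ℝ} (h : Opp p E D) (h' : Opp p E D')
    (hD : IsDir p D) (hD' : IsDir p D') : D = D' := by
  by_cases hv : ∃ v, p v = 1
  · obtain ⟨v, hv⟩ := hv
    exact (h.1 v hv).unique (h'.1 v hv)
  · push Not at hv
    exact (h.2 hv).unique (h'.2 hv) hD hD' hv

/-! ### Uniqueness of geodesics -/

theorem real_induction {P : ℝ → Prop} {a b : ℝ} (h0 : P a)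
    (hr : ∀ t ∈ Ico a b, (∀ s ∈ Icc a t, P s) → ∃ ε > 0, ∀ s ∈ Ioc t (t + ε), P s)
    (hl : ∀ t ∈ Ioc a b, (∀ s ∈ Ico a t, P s) → P t) : ∀ t ∈ Icc a b, P t := by
  intro t ht
  have hab : a ≤ b := ht.1.trans ht.2
  set S := {t | t ∈ Icc a b ∧ ∀ s ∈ Icc a t, P s} with hS
  have ha : a ∈ S := ⟨⟨le_rfl, hab⟩, fun s hs => by rw [le_antisymm hs.2 hs.1]; exact h0⟩
  have hb : BddAbove S := ⟨b, fun s hs => hs.1.2⟩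
  set c := sSup S with hc
  have hac : a ≤ c := le_csSup hb ha
  have hcb : c ≤ b := csSup_le ⟨a, ha⟩ fun s hs => hs.1.2
  have hlt : ∀ s ∈ Ico a c, P s := by
    intro s hs
    obtain ⟨r, hr, hsr⟩ := exists_lt_of_lt_csSup ⟨a, ha⟩ hs.2
    exact hr.2 s ⟨hs.1, hsr.le⟩
  have hPc : P c := by
    rcases hac.eq_or_lt with h | h
    · rw [← h]; exact h0
    · exact hl c ⟨h, hcb⟩ hlt
  have hle : ∀ s ∈ Icc a c, P s := by
    intro s hs
    rcases hs.2.eq_or_lt with h | h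
    · rw [h]; exact hPc
    · exact hlt s ⟨hs.1, h⟩
  rcases hcb.eq_or_lt with h | h
  · exact hle t ⟨ht.1, h ▸ ht.2⟩
  · exfalso
    obtain ⟨ε, hε, hr⟩ := hr c ⟨hac, h⟩ hle
    have hm : c < min (c + ε) b := lt_min (by linarith) h
    have : min (c + ε) b ∈ S := by
      refine ⟨⟨by linarith, min_le_right _ _⟩, fun s hs => ?_⟩
      rcases le_or_gt s c with h' | h'
      · exact hle s ⟨hs.1, h'⟩
      · exact hr s ⟨h', hs.2.trans (min_le_left _ _)⟩
    linarith [le_csSup hb this]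

/-- No continuity is assumed: the germ itself reaches up to `t`, and two sample times determine its
value and its slope. -/
theorem LGerm.apply_eq {γ : ℝ → M.Point} {t : ℝ} {E : M.V → ℝ} (h : LGerm γ t E) {a : ℝ}
    (ha : a < t) {x : M.V} {p d : ℝ} (hx : ∀ s ∈ Ico a t, γ s x = p + (s - t) * d) :
    γ t x = p ∧ E x = -d := by
  obtain ⟨ε, hε, h⟩ := h
  set δ := min ε (t - a) with hδ
  have hδ0 : 0 < δ := lt_min hε (by linarith)
  have hδ1 : δ ≤ t - a := min_le_right _ _
  have h1 := h δ ⟨hδ0.le, min_le_left _ _⟩ x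
  have h2 := h (δ / 2) ⟨by linarith, by linarith [min_le_left ε (t - a)]⟩ x
  rw [hx (t - δ) ⟨by linarith, by linarith⟩] at h1
  rw [hx (t - δ / 2) ⟨by linarith, by linarith⟩] at h2
  have e : γ t x = p := by linarith
  refine ⟨e, ?_⟩
  rw [e] at h1
  have : δ * (E x + d) = 0 := by linarith
  rcases mul_eq_zero.1 this with h | h <;> linarith

theorem LGerm.congr {γ η : ℝ → M.Point} {t a : ℝ} {E F : M.V → ℝ} (h : LGerm γ t E)
    (h' : LGerm η t F) (ha : a < t) (heq : ∀ s ∈ Ico a t, γ s = η s) : γ t = η t ∧ E = F := by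
  obtain ⟨ε, hε, h'⟩ := h'
  have hm : 0 < min ε (t - a) := lt_min hε (by linarith)
  have key : ∀ x, γ t x = η t x ∧ E x = - -F x := by
    intro x
    refine h.apply_eq (a := t - min ε (t - a)) (by linarith) fun s hs => ?_
    rw [heq s ⟨by linarith [hs.1, min_le_right ε (t - a)], hs.2⟩]
    have := h' (t - s) ⟨by linarith [hs.2], by linarith [hs.1, min_le_left ε (t - a)]⟩ x
    rw [sub_sub_cancel] at this
    rw [this]; ring
  exact ⟨Point.ext fun x => (key x).1, funext fun x => by rw [(key x).2, neg_neg]⟩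

/-- Real induction: agreement before `s` gives equal points and equal backward directions at `s`,
hence equal forward directions by `Opp.unique`, and agreement goes on beyond `s`. -/
theorem GeodesicAt.right_unique {γ η : ℝ → M.Point} {t T : ℝ} {D : M.V → ℝ}
    (hγ : ∀ s ∈ Ioc t T, GeodesicAt γ s) (hη : ∀ s ∈ Ioc t T, GeodesicAt η s) (h0 : γ t = η t)
    (hD : RGerm γ t D) (hD' : RGerm η t D) : ∀ s ∈ Icc t T, γ s = η s := by
  have ext : ∀ s D, γ s = η s → RGerm γ s D → RGerm η s D →
      ∃ ε > 0, ∀ r ∈ Ioc s (s + ε), γ r = η r := by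
    rintro s D h0 ⟨ε, hε, h⟩ ⟨ε', hε', h'⟩
    refine ⟨min ε ε', lt_min hε hε', fun r hr => Point.ext fun x => ?_⟩
    have h1 := h (r - s) ⟨by linarith [hr.1], by linarith [hr.2, min_le_left ε ε']⟩ x
    have h2 := h' (r - s) ⟨by linarith [hr.1], by linarith [hr.2, min_le_right ε ε']⟩ x
    rw [add_sub_cancel] at h1 h2
    rw [h1, h2, h0]
  refine real_induction h0 (fun s hs hP => ?_) (fun s hs hP => ?_)
  · rcases hs.1.eq_or_lt with rfl | hlt
    · exact ext t D h0 hD hD'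
    · obtain ⟨D1, E1, a1, a2, a3, a4, a5⟩ := (hγ s ⟨hlt, hs.2.le⟩).germs
      obtain ⟨D2, E2, b1, b2, b3, b4, b5⟩ := (hη s ⟨hlt, hs.2.le⟩).germs
      obtain ⟨e1, rfl⟩ := a2.congr b2 hlt fun r hr => hP r ⟨hr.1, hr.2.le⟩
      rw [← e1] at b3 b5
      obtain rfl := a5.unique b5 a3 b3
      exact ext s D1 e1 a1 b1
  · obtain ⟨D1, E1, a1, a2, a3, a4, a5⟩ := (hγ s hs).germs
    obtain ⟨D2, E2, b1, b2, b3, b4, b5⟩ := (hη s hs).germs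
    exact (a2.congr b2 hs.1 hP).1

theorem IsGeodesic.unique {γ η : ℝ → M.Point} (hγ : IsGeodesic γ) (hη : IsGeodesic η) {t : ℝ}
    {D : M.V → ℝ} (h0 : γ t = η t) (hD : RGerm γ t D) (hD' : RGerm η t D) : γ = η := by
  obtain ⟨D1, E1, a1, a2, a3, a4, a5⟩ := (show GeodesicAt γ t from hγ t).germs
  obtain ⟨D2, E2, b1, b2, b3, b4, b5⟩ := (show GeodesicAt η t from hη t).germs
  obtain rfl := hD.unique a1
  obtain rfl := hD'.unique b1
  rw [← h0] at b4 b5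
  obtain rfl := a5.symm.unique b5.symm a4 b4
  funext s
  rcases le_total t s with hs | hs
  · exact GeodesicAt.right_unique (fun s _ => hγ s) (fun s _ => hη s) h0 hD hD' s ⟨hs, le_rfl⟩
  · have := GeodesicAt.right_unique (γ := fun s => γ (-s)) (η := fun s => η (-s)) (t := -t)
      (T := -s) (fun s _ => hγ.reverse s) (fun s _ => hη.reverse s) (by simpa using h0)
      a2.reverse b2.reverse (-s) ⟨by linarith, le_rfl⟩
    simpa using this

/-! ### Following a geodesic through triangles -/

/-- A segment does not pass through a vertex in its interior. -/
theorem IsDir.add_ne_one {p : M.Point} {D : M.V → ℝ} (hdir : IsDir p D) {s S : ℝ}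
    (hpos : ∀ x, 0 ≤ p x + S * D x) (hs : 0 < s) (hsS : s < S) (y : M.V) :
    p y + s * D y ≠ 1 := by
  intro hy
  obtain ⟨u, v, w, hT, hp, hD0, hs0, hs2⟩ := hdir.triple
  have hy1 := p.le_one y
  have hyS : p y + S * D y ≤ 1 := by
    by_cases hym : y ∈ ({u, v, w} : Finset M.V)
    · have : ∑ x ∈ ({u, v, w} : Finset M.V), (p x + S * D x) = 1 := by
        rw [sum_tri hT]; linear_combination Point.sum_tri hT hp + S * hs0
      exact (Finset.single_le_sum (f := fun x => p x + S * D x)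
        (fun x _ => hpos x) hym).trans_eq this
    · rw [hp y hym, hD0 y hym]; norm_num
  have hDy : D y = 0 := by
    rcases lt_trichotomy (D y) 0 with h | h | h
    · have := mul_pos hs (neg_pos.2 h); linarith
    · exact h
    · have := mul_pos (sub_pos.2 hsS) h; linarith
  have hy0 : p y = 1 := by rw [hDy] at hy; linarith
  have hnn : ∀ x, 0 ≤ D x := by
    intro x
    by_cases hxy : x = y
    · rw [hxy, hDy]
    · exact hdir.nonneg (Point.eq_zero_of_eq_one hy0 hxy)
  have z1 : D u = 0 := by linarith [hnn u, hnn v, hnn w]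
  have z2 : D v = 0 := by linarith [hnn u, hnn v, hnn w]
  have z3 : D w = 0 := by linarith [hnn u, hnn v, hnn w]
  rw [z1, z2, z3] at hs2; norm_num at hs2

/-- As long as the affine motion has nonnegative weights, the geodesic follows it. To cross an edge
before the time `S`, some weight would have to vanish while decreasing, and it would be negative at
`S`. -/
theorem follow {γ : ℝ → M.Point} {t S : ℝ} {D : M.V → ℝ}
    (hg : ∀ s ∈ Ioc t (t + S), GeodesicAt γ s) (hD : RGerm γ t D) (hdir : IsDir (γ t) D)
    (hpos : ∀ x, 0 ≤ γ t x + S * D x) :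
    ∀ s ∈ Icc 0 S, ∀ x, γ (t + s) x = γ t x + s * D x := by
  suffices h : ∀ r ∈ Icc t (t + S), ∀ x, γ r x = γ t x + (r - t) * D x by
    intro s hs x
    rw [h (t + s) ⟨by linarith [hs.1], by linarith [hs.2]⟩, add_sub_cancel_left]
  have ext : ∀ s, (∀ x, γ s x = γ t x + (s - t) * D x) → RGerm γ s D →
      ∃ ε > 0, ∀ r ∈ Ioc s (s + ε), ∀ x, γ r x = γ t x + (r - t) * D x := by
    rintro s h0 ⟨ε, hε, h⟩
    refine ⟨ε, hε, fun r hr x => ?_⟩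
    have h1 := h (r - s) ⟨by linarith [hr.1], by linarith [hr.2]⟩ x
    rw [add_sub_cancel] at h1
    rw [h1, h0]; ring
  have left : ∀ s ∈ Ioc t (t + S), (∀ r ∈ Ico t s, ∀ x, γ r x = γ t x + (r - t) * D x) →
      ∀ E, LGerm γ s E → ∀ x, γ s x = γ t x + (s - t) * D x ∧ E x = -D x := by
    intro s hs hP E hE x
    exact hE.apply_eq hs.1 (x := x) (p := γ t x + (s - t) * D x) (d := D x)
      fun r hr => by rw [hP r hr]; ring
  refine real_induction (fun x => by rw [sub_self]; ring) (fun s hs hP => ?_) (fun s hs hP => ?_)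
  · rcases hs.1.eq_or_lt with rfl | hlt
    · exact ext t (hP t ⟨le_rfl, le_rfl⟩) hD
    · have hsI : s ∈ Ioc t (t + S) := ⟨hlt, hs.2.le⟩
      obtain ⟨D1, E1, a1, a2, a3, a4, a5⟩ := (hg s hsI).germs
      have hl := left s hsI (fun r hr => hP r ⟨hr.1, hr.2.le⟩) E1 a2
      have nv : ∀ v, γ s v ≠ 1 := fun y => by
        rw [(hl y).1]
        exact hdir.add_ne_one hpos (sub_pos.2 hlt) (by linarith [hs.2]) y
      rcases a5.2 nv with h | ⟨u, v, w, w', hw, hw', hne, hp, hp0, hE, hE0, h1, h2, h3, hD0⟩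
      · have : D1 = D := funext fun x => by rw [h, (hl x).2, neg_neg]
        exact ext s (fun x => (hl x).1) (this ▸ a1)
      · exfalso
        rw [(hl w).1] at hp0
        rw [(hl w).2] at hE0
        have := hpos w
        have h5 : (t + S - s) * D w < 0 := mul_neg_of_pos_of_neg (by linarith [hs.2]) (by linarith)
        linarith
  · intro x
    obtain ⟨D1, E1, a1, a2, a3, a4, a5⟩ := (hg s hs).germs
    exact (left s hs hP E1 a2 x).1

/-- At the time `t`, the curve is at `x u + y v + z w` and leaves with velocity
`a u + b v + c w`. -/
structure At (γ : ℝ → M.Point) (t : ℝ) (u v w : M.V) (x y z a b c : ℝ) : Prop where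
  tri : {u, v, w} ∈ M.triangles
  pos : ∀ q, γ t q = triVec u v w x y z q
  germ : RGerm γ t (triVec u v w a b c)
  sum : a + b + c = 0
  sq : a ^ 2 + b ^ 2 + c ^ 2 = 2

theorem At.rotate {γ : ℝ → M.Point} {t : ℝ} {u v w : M.V} {x y z a b c : ℝ}
    (h : At γ t u v w x y z a b c) : At γ t v w u y z x b c a := by
  obtain ⟨n1, n2, n3⟩ := tri_ne h.tri
  have e : ∀ x y z, triVec v w u y z x = triVec u v w x y z := by
    intro x y z; funext q; simp only [triVec]
    split_ifs <;> simp_all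
  exact ⟨by rw [← insert_rotate]; exact h.tri, by rw [e]; exact h.pos, by rw [e]; exact h.germ,
    by linarith [h.sum], by linarith [h.sq]⟩

theorem At.swap {γ : ℝ → M.Point} {t : ℝ} {u v w : M.V} {x y z a b c : ℝ}
    (h : At γ t u v w x y z a b c) : At γ t v u w y x z b a c := by
  obtain ⟨n1, n2, n3⟩ := tri_ne h.tri
  have e : ∀ x y z, triVec v u w y x z = triVec u v w x y z := by
    intro x y z; funext q; simp only [triVec]
    split_ifs <;> simp_all
  exact ⟨by rw [insert_swap']; exact h.tri, by rw [e]; exact h.pos, by rw [e]; exact h.germ,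
    by linarith [h.sum], by linarith [h.sq]⟩

theorem At.coords {γ : ℝ → M.Point} {t : ℝ} {u v w : M.V} {x y z a b c : ℝ}
    (h : At γ t u v w x y z a b c) : γ t u = x ∧ γ t v = y ∧ γ t w = z := by
  obtain ⟨e1, e2, e3⟩ := triVec_apply h.tri x y z
  exact ⟨by rw [h.pos, e1], by rw [h.pos, e2], by rw [h.pos, e3]⟩

theorem At.mem {γ : ℝ → M.Point} {t : ℝ} {u v w : M.V} {x y z a b c : ℝ}
    (h : At γ t u v w x y z a b c) : (γ t).MemTriangle {u, v, w} := fun q hq => by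
  rw [h.pos]; exact triVec_of_notMem _ _ _ hq

theorem At.sum_pos {γ : ℝ → M.Point} {t : ℝ} {u v w : M.V} {x y z a b c : ℝ}
    (h : At γ t u v w x y z a b c) : x + y + z = 1 := by
  have := Point.sum_tri h.tri h.mem
  obtain ⟨e1, e2, e3⟩ := h.coords
  rwa [e1, e2, e3] at this

theorem At.isDir {γ : ℝ → M.Point} {t : ℝ} {u v w : M.V} {x y z a b c : ℝ}
    (h : At γ t u v w x y z a b c) : IsDir (γ t) (triVec u v w a b c) :=
  isDir_triVec h.tri h.mem h.sum h.sq fun _ hq => h.germ.nonneg hq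

theorem At.follow {γ : ℝ → M.Point} (hg : IsGeodesic γ) {t S : ℝ} {u v w : M.V}
    {x y z a b c : ℝ} (h : At γ t u v w x y z a b c) (h1 : 0 ≤ x + S * a) (h2 : 0 ≤ y + S * b)
    (h3 : 0 ≤ z + S * c) : ∀ s ∈ Icc 0 S, ∀ q,
      γ (t + s) q = triVec u v w (x + s * a) (y + s * b) (z + s * c) q := by
  have e : ∀ s q, γ t q + s * triVec u v w a b c q =
      triVec u v w (x + s * a) (y + s * b) (z + s * c) q := by
    intro s q
    rw [h.pos q]
    simp only [triVec]; split_ifs <;> simp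
  intro s hs q
  rw [SManifold.follow (fun s _ => hg s) h.germ h.isDir (fun q => ?_) s hs q, e]
  rw [e]
  simp only [triVec]; split_ifs <;> first | assumption | exact le_rfl

theorem LGerm.of_affine {γ : ℝ → M.Point} {t S : ℝ} {p D : M.V → ℝ} (hS : 0 < S)
    (h : ∀ s ∈ Icc 0 S, ∀ x, γ (t + s) x = p x + s * D x) : LGerm γ (t + S) (fun x => -D x) := by
  refine ⟨S, hS, fun s hs x => ?_⟩
  have h1 := h S ⟨hS.le, le_rfl⟩ x
  have h2 := h (S - s) ⟨by linarith [hs.2], by linarith [hs.1]⟩ x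
  rw [show t + S - s = t + (S - s) by ring, h1, h2]; ring

theorem LGerm.unique {γ : ℝ → M.Point} {t : ℝ} {D D' : M.V → ℝ} (h : LGerm γ t D)
    (h' : LGerm γ t D') : D = D' := h.reverse.unique h'.reverse

/-- In the flat rhombus `w = u + v - w'`, so the velocity `a u + b v + c w` becomes `(a + c) u + (b
+ c) v - c w'`. -/
theorem At.cross {γ : ℝ → M.Point} (hg : IsGeodesic γ) {t S : ℝ} {u v w w' : M.V}
    {x y z a b c : ℝ} (h : At γ t u v w x y z a b c) (hS : 0 < S) (h1 : 0 < x + S * a)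
    (h2 : 0 < y + S * b) (h3 : z + S * c = 0) (hc : c < 0) (hw' : {u, v, w'} ∈ M.triangles)
    (hne : w' ≠ w) : At γ (t + S) u v w' (x + S * a) (y + S * b) 0 (a + c) (b + c) (-c) := by
  have hf := h.follow hg h1.le h2.le h3.ge
  have e : ∀ s q, triVec u v w (x + s * a) (y + s * b) (z + s * c) q =
      triVec u v w x y z q + s * triVec u v w a b c q := by
    intro s q
    simp only [triVec]; split_ifs <;> simp
  have hL : LGerm γ (t + S) (fun x => -triVec u v w a b c x) :=
    LGerm.of_affine (p := triVec u v w x y z) hS fun s hs q => by rw [hf s hs q, e]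
  obtain ⟨D, E, b1, b2, b3, b4, b5⟩ := (show GeodesicAt γ (t + S) from hg _).germs
  obtain rfl := b2.unique hL
  obtain ⟨d1, d2, d3⟩ := triVec_apply h.tri a b c
  have hq := hf S ⟨hS.le, le_rfl⟩
  rw [h3] at hq
  obtain ⟨n1, n2, n3⟩ := tri_ne h.tri
  obtain ⟨n1', n2', n3'⟩ := tri_ne hw'
  obtain ⟨p1, p2, p3⟩ := triVec_apply h.tri (x + S * a) (y + S * b) 0
  have hmem : (γ (t + S)).MemTriangle {u, v, w} := fun q hq' => by
    rw [hq]; exact triVec_of_notMem _ _ _ hq'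
  have hsum := Point.sum_tri h.tri hmem
  rw [hq, hq, hq, p1, p2, p3] at hsum
  have nv : ∀ q, γ (t + S) q ≠ 1 := by
    intro q h1'
    rw [hq] at h1'
    simp only [triVec] at h1'
    split_ifs at h1' <;> linarith
  have hmem' : ∀ q, triVec u v w (x + S * a) (y + S * b) 0 q =
      triVec u v w' (x + S * a) (y + S * b) 0 q := by
    intro q
    simp only [triVec]; split_ifs <;> rfl
  have hD : IsDir (γ (t + S)) (triVec u v w' (a + c) (b + c) (-c)) := by
    refine isDir_triVec hw' (fun q hq' => ?_) (by linarith [h.sum]) ?_ fun q hq0 => ?_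
    · rw [hq, hmem']; exact triVec_of_notMem _ _ _ hq'
    · have := h.sum
      have hc' : c = -a - b := by linarith
      have := h.sq
      rw [hc'] at this ⊢; linarith
    · rw [hq] at hq0
      by_cases hu : q = u
      · subst hu; rw [p1] at hq0; linarith
      by_cases hv : q = v
      · subst hv; rw [p2] at hq0; linarith
      by_cases hw : q = w'
      · subst hw; rw [(triVec_apply hw' _ _ _).2.2]; linarith
      · rw [triVec_of_notMem _ _ _ (by simp [hu, hv, hw])]
  have hO : SOpp (γ (t + S)) (fun x => -triVec u v w a b c x)
      (triVec u v w' (a + c) (b + c) (-c)) := by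
    obtain ⟨k1, k2, k3⟩ := triVec_apply hw' (a + c) (b + c) (-c)
    refine Or.inr ⟨u, v, w, w', h.tri, hw', hne.symm, hmem, by rw [hq, p3], fun q hq' => ?_, ?_, ?_,
      ?_, ?_, fun q hq' => triVec_of_notMem _ _ _ hq'⟩
    · simp only [triVec_of_notMem _ _ _ hq', neg_zero]
    · simp only [d3]; linarith
    · simp only [d1, d3, k1]; ring
    · simp only [d2, d3, k2]; ring
    · simp only [d3, k3]
  obtain rfl := (b5.2 nv).unique hO b3 hD nv
  refine ⟨hw', fun q => by rw [hq, hmem'], b1, by linarith [h.sum], ?_⟩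
  have hc' : c = -a - b := by linarith [h.sum]
  have := h.sq
  rw [hc'] at this ⊢; linarith

end SManifold

end


noncomputable section

namespace SManifold

open Set

variable {M : SManifold}

/-! ### Existence of geodesics -/

theorem RGerm.congr {γ η : ℝ → M.Point} {t δ : ℝ} {D : M.V → ℝ} (h : RGerm γ t D) (hδ : 0 < δ)
    (he : ∀ s ∈ Icc t (t + δ), γ s = η s) : RGerm η t D := by
  obtain ⟨ε, hε, h⟩ := h
  refine ⟨min ε δ, lt_min hε hδ, fun s hs x => ?_⟩
  rw [← he (t + s) ⟨by linarith [hs.1], by linarith [hs.2, min_le_right ε δ]⟩,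
    ← he t ⟨le_rfl, by linarith⟩]
  exact h s ⟨hs.1, hs.2.trans (min_le_left _ _)⟩ x

theorem LGerm.congr_left {γ η : ℝ → M.Point} {t δ : ℝ} {D : M.V → ℝ} (h : LGerm γ t D)
    (hδ : 0 < δ) (he : ∀ s ∈ Icc (t - δ) t, γ s = η s) : LGerm η t D := by
  obtain ⟨ε, hε, h⟩ := h
  refine ⟨min ε δ, lt_min hε hδ, fun s hs x => ?_⟩
  rw [← he (t - s) ⟨by linarith [hs.2, min_le_right ε δ], by linarith [hs.1]⟩,
    ← he t ⟨by linarith, le_rfl⟩]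
  exact h s ⟨hs.1, hs.2.trans (min_le_left _ _)⟩ x

theorem GeodesicAt.congr {γ η : ℝ → M.Point} {t δ : ℝ} (h : GeodesicAt γ t) (hδ : 0 < δ)
    (he : ∀ s ∈ Icc (t - δ) (t + δ), γ s = η s) : GeodesicAt η t := by
  obtain ⟨D, E, h1, h2, h3, h4, h5⟩ := h.germs
  rw [he t ⟨by linarith, by linarith⟩] at h3 h5
  exact geodesicAt_of_germs
    (h1.congr hδ fun s hs => he s ⟨by linarith [hs.1], hs.2⟩)
    (h2.congr_left hδ fun s hs => he s ⟨hs.1, by linarith [hs.2]⟩) h3 h5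

/-- A geodesic segment of length `T` with prescribed germs at both ends. -/
structure Ray (γ : ℝ → M.Point) (T : ℝ) (p : M.Point) (D : M.V → ℝ) (p' : M.Point)
    (E' : M.V → ℝ) : Prop where
  pos : 0 < T
  start : γ 0 = p
  germ : RGerm γ 0 D
  geod : ∀ t ∈ Ioo 0 T, GeodesicAt γ t
  finish : γ T = p'
  germ' : LGerm γ T E'

def Reach (T : ℝ) (p : M.Point) (D : M.V → ℝ) : Prop :=
  ∃ γ p' E', Ray γ T p D p' E' ∧ IsDir p' E'

theorem exists_segment {p : M.Point} {D : M.V → ℝ} (hd : IsDir p D) {S : ℝ} (hS : 0 < S)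
    (hpos : ∀ x, 0 ≤ p x + S * D x) : ∃ γ p', (∀ x, p' x = p x + S * D x) ∧
      Ray γ S p D p' (fun x => -D x) ∧ IsDir p' (fun x => -D x) := by
  obtain ⟨u, v, w, hT, hp, hD0, hs, hq⟩ := hd.triple
  have hnn : ∀ s ∈ Icc 0 S, ∀ x, 0 ≤ p x + s * D x := by
    intro s hs x
    have h1 := p.nonneg x
    have h2 := hpos x
    rcases le_total 0 (D x) with h | h
    · have := mul_nonneg hs.1 h; linarith
    · have := mul_le_mul_of_nonpos_right hs.2 h; linarith
  have hcl : ∀ s, max 0 (min s S) ∈ Icc 0 S := fun s =>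
    ⟨le_max_left _ _, max_le hS.le (min_le_right _ _)⟩
  -- Clamping the time to `[0, S]` makes the curve total. That it rests outside is harmless, since
  -- `Ray` only looks inside this interval.
  let γ : ℝ → M.Point := fun s => mkPoint hT (fun x => p x + max 0 (min s S) * D x)
    (hnn _ (hcl s)) (fun x hx => by rw [hp x hx, hD0 x hx]; ring)
    (by rw [sum_tri hT]; linear_combination Point.sum_tri hT hp + max 0 (min s S) * hs)
  have hγ : ∀ s ∈ Icc 0 S, ∀ x, γ s x = p x + s * D x := by
    intro s hs x
    have : max 0 (min s S) = s := by rw [min_eq_left hs.2, max_eq_right hs.1]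
    change p x + max 0 (min s S) * D x = _
    rw [this]
  have hR : ∀ s ∈ Ico 0 S, RGerm γ s D := by
    intro s hs
    refine ⟨S - s, by linarith [hs.2], fun r hr x => ?_⟩
    rw [hγ _ ⟨by linarith [hs.1, hr.1], by linarith [hr.2]⟩, hγ _ ⟨hs.1, hs.2.le⟩]; ring
  have hL : ∀ s ∈ Ioc 0 S, LGerm γ s (fun x => -D x) := by
    intro s hs
    refine ⟨s, hs.1, fun r hr x => ?_⟩
    rw [hγ _ ⟨by linarith [hr.2], by linarith [hs.2, hr.1]⟩, hγ _ ⟨hs.1.le, hs.2⟩]; ring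
  have hmem : ∀ s ∈ Icc 0 S, (γ s).MemTriangle {u, v, w} := fun s hs x hx => by
    rw [hγ s hs, hp x hx, hD0 x hx]; ring
  have sumT : ∀ f : M.V → ℝ, ∑ x ∈ ({u, v, w} : Finset M.V), f x = f u + f v + f w := sum_tri hT
  have hdR : ∀ s ∈ Ico 0 S, IsDir (γ s) D := fun s hs' =>
    ⟨_, hT, hmem s ⟨hs'.1, hs'.2.le⟩, hD0, by rw [sumT, hs], by rw [sumT, hq],
      fun x hx => (hR s hs').nonneg hx⟩
  have hS' : S ∈ Icc 0 S := ⟨hS.le, le_rfl⟩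
  refine ⟨γ, γ S, hγ S hS', ⟨hS, ?_, hR 0 ⟨le_rfl, hS⟩, ?_, rfl, hL S ⟨hS, le_rfl⟩⟩, ?_⟩
  · exact Point.ext fun x => by rw [hγ 0 ⟨le_rfl, hS.le⟩]; ring
  · intro t ht
    have nv : ∀ x, γ t x ≠ 1 := fun x => by
      rw [hγ t ⟨ht.1.le, ht.2.le⟩]
      exact hd.add_ne_one hpos ht.1 ht.2 x
    exact geodesicAt_of_germs (hR t ⟨ht.1.le, ht.2⟩) (hL t ⟨ht.1, ht.2.le⟩)
      (hdR t ⟨ht.1.le, ht.2⟩) ⟨fun x hx => absurd hx (nv x),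
      fun _ => Or.inl fun x => (neg_neg _).symm⟩
  · exact ⟨_, hT, hmem S hS', fun x hx => by simp only [hD0 x hx, neg_zero],
      by rw [sumT]; linarith, by rw [sumT]; simp only [neg_sq]; rw [hq],
      fun x hx => (hL S ⟨hS, le_rfl⟩).nonneg hx⟩

theorem Ray.concat {γ η : ℝ → M.Point} {T S : ℝ} {p p' p'' : M.Point} {D E' D' E'' : M.V → ℝ}
    (h : Ray γ T p D p' E') (hO : Opp p' E' D') (hd : IsDir p' D') (h' : Ray η S p' D' p'' E'') :
    ∃ ζ, Ray ζ (T + S) p D p'' E'' := by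
  have hT := h.pos
  have hS := h'.pos
  set ζ : ℝ → M.Point := fun t => if t ≤ T then γ t else η (t - T) with hζ
  have z1 : ∀ t ≤ T, γ t = ζ t := fun t ht => by simp [hζ, ht]
  have z2 : ∀ t, T ≤ t → η (t + -T) = ζ t := by
    intro t ht
    rcases ht.eq_or_lt with rfl | ht
    · rw [add_neg_cancel, ← z1 T le_rfl, h.finish, h'.start]
    · simp [hζ, not_le.2 ht, sub_eq_add_neg]
  refine ⟨ζ, by linarith, by rw [← z1 0 hT.le, h.start], h.germ.congr hT fun s hs => z1 s
    (by linarith [hs.2]), fun t ht => ?_, ?_, ?_⟩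
  · rcases lt_trichotomy t T with hlt | rfl | hlt
    · exact (h.geod t ⟨ht.1, hlt⟩).congr (sub_pos.2 hlt) fun s hs => z1 s (by linarith [hs.2])
    · have hz : ζ t = p' := by rw [← z1 t le_rfl, h.finish]
      have r1 : RGerm (fun s => η (s + -t)) t D' := by
        apply RGerm.shift; rw [add_neg_cancel]; exact h'.germ
      exact geodesicAt_of_germs (r1.congr hS fun s hs => z2 s hs.1)
        (h.germ'.congr_left hT fun s hs => z1 s hs.2) (hz ▸ hd) (hz ▸ hO)
    · have g1 : GeodesicAt (fun s => η (s + -T)) t :=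
        (h'.geod (t + -T) ⟨by linarith, by linarith [ht.2]⟩).shift
      exact g1.congr (sub_pos.2 hlt) fun s hs => z2 s (by linarith [hs.1])
  · rw [← z2 _ (by linarith)]; rw [← h'.finish]; congr 1; ring
  · have l1 : LGerm (fun s => η (s + -T)) (T + S) E'' := by
      apply LGerm.shift; rw [add_comm T, add_neg_cancel_right]; exact h'.germ'
    exact l1.congr_left hS fun s hs => z2 s (by linarith [hs.1])

theorem Reach.concat {γ : ℝ → M.Point} {T S : ℝ} {p p' : M.Point} {D E' D' : M.V → ℝ}
    (h : Ray γ T p D p' E') (hO : Opp p' E' D') (hd : IsDir p' D') (h' : Reach S p' D') :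
    Reach (T + S) p D := by
  obtain ⟨η, p'', E'', h', h''⟩ := h'
  obtain ⟨ζ, hζ⟩ := h.concat hO hd h'
  exact ⟨ζ, p'', E'', hζ, h''⟩

/-- In its sector the direction has weights `α, β ≥ 0` with `α² + αβ + β² = 1`. The arcsine yields
the angle from `β = 2 sin φ / √3`, and `α` is then determined as the nonnegative root. -/
theorem exists_angle_of_isDir {q : M.Point} {E : M.V → ℝ} (hE : IsDir q E) {v : M.V}
    (hv : q v = 1) {n : ℕ} {c : ZMod n → M.V} (hc : IsLink M.triangles v c) :
    ∃ θ, E = pdir v c θ := by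
  obtain ⟨τ, hT, hp, hD0, -⟩ := id hE
  have hvτ : v ∈ τ := Point.mem_of_pos hp (by rw [hv]; norm_num)
  obtain ⟨k, rfl⟩ := (hc.2 τ).1 ⟨hT, hvτ⟩
  obtain ⟨n1, n2, n3⟩ := tri_ne hT
  obtain ⟨s1, s2⟩ := hE.sums hT hD0
  have hα := hE.nonneg (Point.eq_zero_of_eq_one hv n1.symm)
  have hβ := hE.nonneg (Point.eq_zero_of_eq_one hv n2.symm)
  set α := E (c k)
  set β := E (c (k + 1))
  have hEv : E v = -α - β := by linarith
  rw [hEv] at s2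
  have hq : α ^ 2 + α * β + β ^ 2 = 1 := by linarith
  have h3 := sqrt_three_pos
  have hβ1 : β ≤ 1 := by nlinarith [mul_nonneg hα hβ]
  set φ := Real.arcsin (β * (√3 / 2)) with hφ
  have hπ := Real.pi_pos
  have hb0 : 0 ≤ β * (√3 / 2) := by positivity
  have hb1 : β * (√3 / 2) ≤ √3 / 2 := by nlinarith
  have hb2 : √3 / 2 ≤ 1 := by
    rw [div_le_one (by norm_num)]; exact Real.sqrt_le_iff.2 ⟨by norm_num, by norm_num⟩
  have hφ0 : 0 ≤ φ := Real.arcsin_nonneg.2 hb0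
  have hφ1 : φ ≤ Real.pi / 3 := by
    rw [hφ, Real.arcsin_le_iff_le_sin ⟨by linarith, by linarith⟩ ⟨by linarith, by linarith⟩,
      Real.sin_pi_div_three]
    exact hb1
  have hY : polY φ = β := by
    rw [polY, hφ, Real.sin_arcsin (by linarith) (by linarith)]; field_simp
  have hX : polX φ = α := by
    have hX0 := polX_nonneg hφ0 hφ1
    have hsq := polX_sq φ
    rw [hY] at hsq
    have h1 : (polX φ - α) * (polX φ + α + β) = 0 := by linarith
    rcases mul_eq_zero.1 h1 with h | h
    · linarith
    · have a0 : α = 0 := by linarith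
      have b0 : β = 0 := by linarith
      rw [a0, b0] at hq; norm_num at hq
  obtain ⟨k', hk'⟩ := ZMod.intCast_surjective k
  refine ⟨k' * (Real.pi / 3) + φ, funext fun x => ?_⟩
  rw [pdir_eq v c (k := k') (by linarith) (by linarith), add_sub_cancel_left, hX, hY, hk']
  by_cases hx : x = v
  · subst hx; rw [hEv]; simp [ev, n1, n2]; ring
  by_cases hx1 : x = c k
  · subst hx1; simp [ev, n1.symm, n3]; rfl
  by_cases hx2 : x = c (k + 1)
  · subst hx2; simp [ev, n2.symm, n3.symm]; rfl
  · rw [hD0 x (by simp [hx, hx1, hx2])]; simp [ev, hx, hx1, hx2]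

/-- At a vertex half of the total angle is added. Elsewhere `-E` serves unless it would make a
vanishing weight negative; in this case the edge opposite to that weight is crossed. -/
theorem exists_opp {q : M.Point} {E : M.V → ℝ} (hE : IsDir q E) : ∃ D, IsDir q D ∧ Opp q E D := by
  by_cases hv : ∃ v, q v = 1
  · obtain ⟨v, hv⟩ := hv
    obtain ⟨n, hn, c, hc⟩ := M.exists_link v
    obtain ⟨θ, rfl⟩ := exists_angle_of_isDir hE hv hc
    refine ⟨_, isDir_pdir hc hv (θ + n * (Real.pi / 6)), fun u hu => ?_, fun h => absurd hv (h v)⟩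
    have : u = v := by
      by_contra hne
      rw [Point.eq_zero_of_eq_one hv hne] at hu; norm_num at hu
    subst this
    exact ⟨n, c, hn, hc, θ, rfl, rfl⟩
  · push Not at hv
    suffices ∃ D, IsDir q D ∧ SOpp q E D by
      obtain ⟨D, h1, h2⟩ := this
      exact ⟨D, h1, fun v h => absurd h (hv v), fun _ => h2⟩
    obtain ⟨τ, hT, hp, hD0, -⟩ := id hE
    by_cases hw : ∃ w, q w = 0 ∧ 0 < E w
    · obtain ⟨w, hw0, hw1⟩ := hw
      have hwτ : w ∈ τ := by
        by_contra hcon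
        rw [hD0 w hcon] at hw1; exact lt_irrefl _ hw1
      obtain ⟨u, v, rfl⟩ := exists_triple_of_mem hT hwτ
      rw [insert_rotate] at hT hp hD0
      rename' u => a, v => b
      obtain ⟨w', hne, hw'⟩ := other_triangle hT
      obtain ⟨s1, s2⟩ := hE.sums hT hD0
      obtain ⟨n1, n2, n3⟩ := tri_ne hT
      obtain ⟨n1', n2', n3'⟩ := tri_ne hw'
      have hsum := Point.sum_tri hT hp
      have hmem : q.MemTriangle {a, b, w'} := by
        intro x hx
        by_cases hxw : x = w
        · rw [hxw, hw0]
        · apply hp; simp at hx ⊢; tauto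
      -- These are the coordinates of `-E` after the substitution `w = a + b - w'`, valid when the
      -- two triangles are laid flat.
      obtain ⟨d1, d2, d3⟩ := triVec_apply hw' (-E a - E w) (-E b - E w) (E w)
      refine ⟨triVec a b w' (-E a - E w) (-E b - E w) (E w),
        isDir_triVec hw' hmem (by linarith) ?_ ?_,
        Or.inr ⟨a, b, w, w', hT, hw', hne.symm, hp, hw0, hD0, hw1, d1, d2, d3,
          fun x hx => triVec_of_notMem _ _ _ hx⟩⟩
      · have : E w = -E a - E b := by linarith
        rw [this] at s2 ⊢; linarith
      · intro x hx
        by_cases hxa : x = a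
        · subst hxa; exact absurd (by linarith) (hv b)
        by_cases hxb : x = b
        · subst hxb; exact absurd (by linarith) (hv a)
        by_cases hxw : x = w'
        · subst hxw; rw [d3]; exact hw1.le
        · rw [triVec_of_notMem _ _ _ (by simp [hxa, hxb, hxw])]
    · push Not at hw
      obtain ⟨u, v, w, rfl⟩ := exists_triple hT
      obtain ⟨s1, s2⟩ := hE.sums hT hD0
      refine ⟨fun x => -E x, ⟨_, hT, hp, fun x hx => by simp only [hD0 x hx, neg_zero],
        by rw [sum_tri hT]; linarith, by rw [sum_tri hT]; simp only [neg_sq]; rw [s2],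
        fun x hx => by linarith [hw x hx]⟩, Or.inl fun x => rfl⟩

/-! ### Continuation of a segment within the star of a vertex. -/

section Star

variable {S : ℝ} {p : M.Point} {D : M.V → ℝ} {u v w : M.V}

/-- A crude bound for the speed of a barycentric coordinate; the sharp one is `2 / √3`. -/
theorem IsDir.abs_le (hd : IsDir p D) (x : M.V) : |D x| ≤ 3 / 2 := by
  obtain ⟨a, b, c, _, _, hD0, h1, h2⟩ := hd.triple
  rw [_root_.abs_le]
  by_cases hx : x ∈ ({a, b, c} : Finset M.V)
  · simp only [Finset.mem_insert, Finset.mem_singleton] at hx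
    rcases hx with hx | hx | hx <;> rw [hx] <;> constructor <;>
      nlinarith [sq_nonneg (D a), sq_nonneg (D b), sq_nonneg (D c)]
  · rw [hD0 x hx]; norm_num

/-- With weight at least `3 / 2 * S` at `u`, the weight of `u` stays nonnegative for the time `S`.
In all the lemmas of this section the curve hence remains in the star of `u`, and the only edges it
can cross are edges at `u`. -/
theorem reach_of_nonneg (hS : 0 < S) (hd : IsDir p D) (hu : 3 / 2 * S ≤ p u)
    (h : ∀ x, x ≠ u → 0 ≤ p x + S * D x) : Reach S p D := by
  obtain ⟨γ, p', _, h1, h2⟩ := exists_segment hd hS fun x => by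
    by_cases hx : x = u
    · subst hx
      have := (_root_.abs_le.1 (hd.abs_le x)).1
      nlinarith
    · exact h x hx
  exact ⟨γ, p', _, h1, h2⟩

theorem reach_of_nonneg' (hp : p.MemTriangle {u, v, w})
    (hD0 : ∀ x, x ∉ ({u, v, w} : Finset M.V) → D x = 0) (hS : 0 < S) (hd : IsDir p D)
    (hu : 3 / 2 * S ≤ p u) (hv : 0 ≤ p v + S * D v) (hw : 0 ≤ p w + S * D w) : Reach S p D := by
  refine reach_of_nonneg hS hd hu fun x hx => ?_
  by_cases hxv : x = v
  · rw [hxv]; exact hv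
  by_cases hxw : x = w
  · rw [hxw]; exact hw
  have hx' : x ∉ ({u, v, w} : Finset M.V) := by simp [hx, hxv, hxw]
  rw [hp x hx', hD0 x hx']; norm_num

theorem reach_of_apex (hT : {u, v, w} ∈ M.triangles) (hp : p.MemTriangle {u, v, w})
    (hD0 : ∀ x, x ∉ ({u, v, w} : Finset M.V) → D x = 0) (hd : IsDir p D)
    (hu : 3 / 2 * S ≤ p u) {r : ℝ} (hr : 0 < r) (hrS : r < S) (hv : p v + r * D v = 0)
    (hw : p w + r * D w = 0) : Reach S p D := by
  have hsum := Point.sum_tri hT hp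
  obtain ⟨s1, s2⟩ := hd.sums hT hD0
  have hpos : ∀ x, 0 ≤ p x + r * D x := by
    intro x
    by_cases hx : x ∈ ({u, v, w} : Finset M.V)
    · simp only [Finset.mem_insert, Finset.mem_singleton] at hx
      rcases hx with rfl | rfl | rfl
      · have : D x = -D v - D w := by linarith
        rw [this]; linarith
      · rw [hv]
      · rw [hw]
    · rw [hp x hx, hD0 x hx]; norm_num
  obtain ⟨γ, p', h1, h2, h3⟩ := exists_segment hd hr hpos
  obtain ⟨D', hD', hO⟩ := exists_opp h3
  have hp'u : p' u = 1 := by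
    have : D u = -D v - D w := by linarith
    rw [h1, this]; linarith
  have := Reach.concat h2 hO hD' (S := S - r) (reach_of_nonneg (u := u) (by linarith) hD'
    (by rw [hp'u]; nlinarith [p.le_one u]) fun x hx => by
      rw [Point.eq_zero_of_eq_one hp'u hx, zero_add]
      exact mul_nonneg (by linarith) (hD'.nonneg (Point.eq_zero_of_eq_one hp'u hx)))
  rwa [add_sub_cancel] at this

/-- When the edge `u w` is crossed, the weights of the outer vertices `w` and `w'` change with the
velocities `D v + D w` and `-D v`. The continuation from there is left to `H`. -/
theorem reach_of_cross (hT : {u, v, w} ∈ M.triangles) (hp : p.MemTriangle {u, v, w})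
    (hD0 : ∀ x, x ∉ ({u, v, w} : Finset M.V) → D x = 0) (hd : IsDir p D)
    (hu : 3 / 2 * S ≤ p u) {r : ℝ} (hr : 0 < r) (hrS : r < S) (hv : p v + r * D v = 0)
    (hDv : D v < 0) (hw : 0 < p w + r * D w)
    (H : ∀ w' p' D', {u, w, w'} ∈ M.triangles → p'.MemTriangle {u, w, w'} →
      (∀ x, x ∉ ({u, w, w'} : Finset M.V) → D' x = 0) → IsDir p' D' → 3 / 2 * (S - r) ≤ p' u →
      D' w = D v + D w → D' w' = -D v → Reach (S - r) p' D') : Reach S p D := by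
  have hsum := Point.sum_tri hT hp
  obtain ⟨s1, s2⟩ := hd.sums hT hD0
  have hbu := (_root_.abs_le.1 (hd.abs_le u)).1
  have hpu : 3 / 2 * (S - r) ≤ p u + r * D u := by nlinarith
  have hpos : ∀ x, 0 ≤ p x + r * D x := by
    intro x
    by_cases hx : x ∈ ({u, v, w} : Finset M.V)
    · simp only [Finset.mem_insert, Finset.mem_singleton] at hx
      rcases hx with rfl | rfl | rfl
      · linarith
      · rw [hv]
      · exact hw.le
    · rw [hp x hx, hD0 x hx]; norm_num
  obtain ⟨γ, p', h1, h2, h3⟩ := exists_segment hd hr hpos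
  have hT' : {u, w, v} ∈ M.triangles := by rw [insert_swap]; exact hT
  obtain ⟨w', hne, hw'⟩ := other_triangle hT'
  obtain ⟨n1, n2, n3⟩ := tri_ne hT'
  obtain ⟨n1', n2', n3'⟩ := tri_ne hw'
  have pv : p' v = 0 := by rw [h1, hv]
  have pu : 3 / 2 * (S - r) ≤ p' u := by rw [h1]; exact hpu
  have pw : 0 < p' w := by rw [h1]; exact hw
  have hm : p'.MemTriangle {u, w, v} := fun x hx => by
    rw [insert_swap] at hx
    rw [h1, hp x hx, hD0 x hx]; ring
  have hm' : p'.MemTriangle {u, w, w'} := by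
    intro x hx
    by_cases hxv : x = v
    · rw [hxv, pv]
    · apply hm; simp at hx ⊢; tauto
  have hsum' := Point.sum_tri hT' hm
  have hlt1 : p' u < 1 := by linarith
  obtain ⟨d1, d2, d3⟩ := triVec_apply hw' (D u + D v) (D v + D w) (-D v)
  have hd' : IsDir p' (triVec u w w' (D u + D v) (D v + D w) (-D v)) := by
    refine isDir_triVec hw' hm' (by linarith) ?_ fun x hx => ?_
    · have : D v = -D u - D w := by linarith
      rw [this] at s2 ⊢; linarith
    · by_cases hxa : x = u
      · subst hxa; linarith
      by_cases hxb : x = w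
      · subst hxb; linarith
      by_cases hxw : x = w'
      · subst hxw; rw [d3]; linarith
      · rw [triVec_of_notMem _ _ _ (by simp [hxa, hxb, hxw])]
  have nv : ∀ x, p' x ≠ 1 := by
    intro x hx
    by_cases hxa : x = u
    · subst hxa; linarith
    · have := Point.eq_zero_of_eq_one hx (Ne.symm hxa)
      linarith
  have hO : Opp p' (fun x => -D x) (triVec u w w' (D u + D v) (D v + D w) (-D v)) := by
    refine ⟨fun x hx => absurd hx (nv x), fun _ => Or.inr ⟨u, w, v, w', hT', hw', hne.symm, hm, pv,
      fun x hx => ?_, by linarith, by rw [d1]; ring, by rw [d2]; ring, d3,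
      fun x hx => triVec_of_notMem _ _ _ hx⟩⟩
    rw [insert_swap] at hx
    simp only [hD0 x hx, neg_zero]
  have := Reach.concat h2 hO hd' (H w' p' _ hw' hm' (fun x hx => triVec_of_notMem _ _ _ hx) hd' pu
    d2 d3)
  rwa [add_sub_cancel] at this

theorem crossing_time (hd : IsDir p D) (hDv : D v < 0) (hneg : ¬ 0 ≤ p v + S * D v) :
    ∃ r, 0 < r ∧ r < S ∧ p v + r * D v = 0 := by
  have hpv : 0 < p v := by
    refine lt_of_le_of_ne (p.nonneg v) fun h => ?_
    have := hd.nonneg h.symm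
    linarith
  refine ⟨p v / -D v, div_pos hpv (by linarith), ?_, ?_⟩
  · rw [div_lt_iff₀ (by linarith)]; push Not at hneg; linarith
  · field_simp [hDv.ne]; ring

/-- After the first crossing both outer weights have nonnegative velocities, so no further edge at
`u` is met. -/
theorem reach_one_crossing (hT : {u, v, w} ∈ M.triangles) (hp : p.MemTriangle {u, v, w})
    (hD0 : ∀ x, x ∉ ({u, v, w} : Finset M.V) → D x = 0) (hS : 0 < S) (hd : IsDir p D)
    (hu : 3 / 2 * S ≤ p u) (hDw : 0 ≤ D w) (hs : 0 ≤ D v + D w) : Reach S p D := by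
  have hpw := p.nonneg w
  by_cases hn : 0 ≤ p v + S * D v
  · exact reach_of_nonneg' hp hD0 hS hd hu hn (by nlinarith)
  have hDv : D v < 0 := by
    by_contra h
    have := p.nonneg v
    push Not at h
    exact hn (by nlinarith)
  obtain ⟨r, hr, hrS, hrv⟩ := crossing_time hd hDv hn
  refine reach_of_cross hT hp hD0 hd hu hr hrS hrv hDv (by nlinarith) ?_
  intro w' p' D' hT' hp' hD0' hd' hu' e1 e2
  exact reach_of_nonneg' hp' hD0' (by linarith) hd' hu'
    (add_nonneg (p'.nonneg _) (mul_nonneg (by linarith) (by linarith)))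
    (add_nonneg (p'.nonneg _) (mul_nonneg (by linarith) (by linarith)))

/-- After a crossing the velocities of the new outer weights are `D v + D w` and `-D v`; their sum
is `D w ≥ 0`, which is the situation of `reach_one_crossing`. -/
theorem reach_two_crossings (hT : {u, v, w} ∈ M.triangles) (hp : p.MemTriangle {u, v, w})
    (hD0 : ∀ x, x ∉ ({u, v, w} : Finset M.V) → D x = 0) (hS : 0 < S) (hd : IsDir p D)
    (hu : 3 / 2 * S ≤ p u) (hDw : 0 ≤ D w) : Reach S p D := by
  have hpw := p.nonneg w
  by_cases hs : 0 ≤ D v + D w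
  · exact reach_one_crossing hT hp hD0 hS hd hu hDw hs
  by_cases hn : 0 ≤ p v + S * D v
  · exact reach_of_nonneg' hp hD0 hS hd hu hn (by nlinarith)
  have hDv : D v < 0 := by linarith
  obtain ⟨r, hr, hrS, hrv⟩ := crossing_time hd hDv hn
  have h0 : 0 ≤ p w + r * D w := by nlinarith
  rcases h0.eq_or_lt with h0 | h0
  · exact reach_of_apex hT hp hD0 hd hu hr hrS hrv h0.symm
  refine reach_of_cross hT hp hD0 hd hu hr hrS hrv hDv h0 ?_
  intro w' p' D' hT' hp' hD0' hd' hu' e1 e2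
  exact reach_one_crossing hT' hp' hD0' (by linarith) hd' hu' (by linarith) (by linarith)

theorem reach_three_crossings (hT : {u, v, w} ∈ M.triangles) (hp : p.MemTriangle {u, v, w})
    (hD0 : ∀ x, x ∉ ({u, v, w} : Finset M.V) → D x = 0) (hd : IsDir p D)
    (hu : 3 / 2 * S ≤ p u) (hDv : D v < 0) {r : ℝ} (hr : 0 < r) (hrS : r < S)
    (hv : p v + r * D v = 0) (hw : 0 ≤ p w + r * D w) : Reach S p D := by
  rcases hw.eq_or_lt with h0 | h0
  · exact reach_of_apex hT hp hD0 hd hu hr hrS hv h0.symm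
  refine reach_of_cross hT hp hD0 hd hu hr hrS hv hDv h0 ?_
  intro w' p' D' hT' hp' hD0' hd' hu' e1 e2
  exact reach_two_crossings hT' hp' hD0' (by linarith) hd' hu' (by linarith)

/-- If both outer weights decrease, the edge opposite to the one that vanishes first is crossed, and
at most two crossings remain: a straight line meets at most four sectors of 60 degrees. -/
theorem reach_of_mem_star (hT : {u, v, w} ∈ M.triangles) (hp : p.MemTriangle {u, v, w})
    (hD0 : ∀ x, x ∉ ({u, v, w} : Finset M.V) → D x = 0) (hS : 0 < S) (hd : IsDir p D)
    (hu : 3 / 2 * S ≤ p u) : Reach S p D := by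
  have hT' : {u, w, v} ∈ M.triangles := by rw [insert_swap]; exact hT
  have hp' : p.MemTriangle {u, w, v} := by rw [insert_swap]; exact hp
  have hD0' : ∀ x, x ∉ ({u, w, v} : Finset M.V) → D x = 0 := by rw [insert_swap]; exact hD0
  by_cases hDw : 0 ≤ D w
  · exact reach_two_crossings hT hp hD0 hS hd hu hDw
  by_cases hDv : 0 ≤ D v
  · exact reach_two_crossings hT' hp' hD0' hS hd hu hDv
  push Not at hDw hDv
  by_cases hv : 0 ≤ p v + S * D v
  · by_cases hw : 0 ≤ p w + S * D w
    · exact reach_of_nonneg' hp hD0 hS hd hu hv hw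
    · obtain ⟨r, hr, hrS, hrw⟩ := crossing_time hd hDw hw
      exact reach_three_crossings hT' hp' hD0' hd hu hDw hr hrS hrw (by nlinarith)
  · obtain ⟨r, hr, hrS, hrv⟩ := crossing_time hd hDv hv
    rcases le_total 0 (p w + r * D w) with h | h
    · exact reach_three_crossings hT hp hD0 hd hu hDv hr hrS hrv h
    · obtain ⟨r', hr', hrS', hrw⟩ := crossing_time hd hDw (S := S) (by nlinarith)
      refine reach_three_crossings hT' hp' hD0' hd hu hDw hr' hrS' hrw ?_
      have : r' ≤ r := by
        by_contra hcon
        push Not at hcon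
        nlinarith
      nlinarith

end Star

/-- Some weight is at least `1 / 4 = 3 / 2 * (1 / 6)`. It matters that the length does not depend on
the point: segments near a vertex could otherwise become shorter and shorter, and the ray would not
be complete. -/
theorem reach_uniform {p : M.Point} {D : M.V → ℝ} (hd : IsDir p D) : Reach (1 / 6) p D := by
  obtain ⟨a, b, c, hT, hp, hD0, -, -⟩ := hd.triple
  have hsum := Point.sum_tri hT hp
  by_cases ha : 1 / 4 ≤ p a
  · exact reach_of_mem_star hT hp hD0 (by norm_num) hd (by linarith)
  by_cases hb : 1 / 4 ≤ p b
  · rw [insert_swap'] at hT hp hD0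
    exact reach_of_mem_star hT hp hD0 (by norm_num) hd (by linarith)
  · rw [insert_rotate, insert_rotate] at hT hp hD0
    exact reach_of_mem_star hT hp hD0 (by norm_num) hd (by linarith)

theorem exists_ray {p : M.Point} {D : M.V → ℝ} (hd : IsDir p D) :
    ∃ γ : ℝ → M.Point, γ 0 = p ∧ RGerm γ 0 D ∧ ∀ t > 0, GeodesicAt γ t := by
  have step : ∀ σ : {σ : M.Point × (M.V → ℝ) // IsDir σ.1 σ.2},
      ∃ σ' : {σ : M.Point × (M.V → ℝ) // IsDir σ.1 σ.2}, ∃ η E, Ray η (1 / 6) σ.1.1 σ.1.2 σ'.1.1 E ∧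
        Opp σ'.1.1 E σ'.1.2 := by
    rintro ⟨⟨p, D⟩, hd⟩
    obtain ⟨η, p', E', h1, h2⟩ := reach_uniform hd
    obtain ⟨D', h3, h4⟩ := exists_opp h2
    exact ⟨⟨⟨p', D'⟩, h3⟩, η, E', h1, h4⟩
  choose next η' E' hη using step
  let σ : ℕ → {σ : M.Point × (M.V → ℝ) // IsDir σ.1 σ.2} := fun n => next^[n] ⟨⟨p, D⟩, hd⟩
  have hσ : ∀ n, σ (n + 1) = next (σ n) := fun n => Function.iterate_succ_apply' _ _ _
  let η : ℕ → ℝ → M.Point := fun n => η' (σ n)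
  have hR : ∀ n, Ray (η n) (1 / 6) (σ n).1.1 (σ n).1.2 (σ (n + 1)).1.1 (E' (σ n)) := fun n => by
    rw [hσ]; exact (hη (σ n)).1
  have hO : ∀ n, Opp (σ (n + 1)).1.1 (E' (σ n)) (σ (n + 1)).1.2 := fun n => by
    rw [hσ]; exact (hη (σ n)).2
  -- The `n`-th segment is run through during `[n / 6, (n + 1) / 6]`.
  let γ : ℝ → M.Point := fun t => η ⌊6 * t⌋₊ (t - ⌊6 * t⌋₊ / 6)
  have key : ∀ n : ℕ, ∀ t ∈ Icc (n / 6 : ℝ) ((n + 1) / 6), η n (t + -(n / 6 : ℝ)) = γ t := by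
    intro n t ht
    rcases ht.2.eq_or_lt with h | h
    · have : ⌊6 * t⌋₊ = n + 1 := by
        rw [Nat.floor_eq_iff (by have := ht.1; have : (0:ℝ) ≤ n := n.cast_nonneg; linarith)]
        push_cast; constructor <;> linarith
      change _ = η ⌊6 * t⌋₊ (t - ⌊6 * t⌋₊ / 6)
      rw [this, h]
      push_cast
      rw [sub_self, (hR (n + 1)).start, ← (hR n).finish]
      congr 1; ring
    · have : ⌊6 * t⌋₊ = n := by
        rw [Nat.floor_eq_iff (by have := ht.1; have : (0:ℝ) ≤ n := n.cast_nonneg; linarith)]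
        constructor <;> linarith [ht.1]
      change _ = η ⌊6 * t⌋₊ (t - ⌊6 * t⌋₊ / 6)
      rw [this, sub_eq_add_neg]
  have rg : ∀ n : ℕ, RGerm γ (n / 6) (σ n).1.2 := by
    intro n
    have r1 : RGerm (fun s => η n (s + -(n / 6 : ℝ))) (n / 6) (σ n).1.2 := by
      apply RGerm.shift; rw [add_neg_cancel]; exact (hR n).germ
    exact r1.congr (δ := 1 / 6) (by norm_num) fun s hs => key n s ⟨hs.1, by linarith [hs.2]⟩
  have g0 : ∀ n : ℕ, γ (n / 6) = (σ n).1.1 := fun n => by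
    rw [← key n _ ⟨le_rfl, by linarith⟩, add_neg_cancel, (hR n).start]
  refine ⟨γ, by have := g0 0; rw [Nat.cast_zero, zero_div] at this; exact this,
    by have := rg 0; rw [Nat.cast_zero, zero_div] at this; exact this, fun t ht => ?_⟩
  set n := ⌊6 * t⌋₊ with hn
  have h1 : (n : ℝ) ≤ 6 * t := Nat.floor_le (by linarith)
  have h2 : 6 * t < n + 1 := Nat.lt_floor_add_one _
  rcases h1.eq_or_lt with h | h
  · have e : t = n / 6 := by linarith
    obtain ⟨m, hm⟩ : ∃ m, n = m + 1 := by
      refine Nat.exists_eq_succ_of_ne_zero fun h0 => ?_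
      rw [h0] at e; norm_num at e; linarith
    have l1 : LGerm (fun s => η m (s + -(m / 6 : ℝ))) (n / 6) (E' (σ m)) := by
      apply LGerm.shift
      have : (n / 6 : ℝ) + -(m / 6) = 1 / 6 := by rw [hm]; push_cast; ring
      rw [this]; exact (hR m).germ'
    have l2 : LGerm γ (n / 6) (E' (σ m)) := l1.congr_left (δ := 1 / 6) (by norm_num) fun s hs =>
      key m s ⟨by rw [hm] at hs; push_cast at hs; linarith [hs.1],
        by rw [hm] at hs; push_cast at hs; linarith [hs.2]⟩
    rw [e]
    refine geodesicAt_of_germs (rg n) l2 (by rw [g0]; exact (σ n).2) ?_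
    rw [g0, hm]; exact hO m
  · have g1 : GeodesicAt (fun s => η n (s + -(n / 6 : ℝ))) t :=
      ((hR n).geod (t + -(n / 6 : ℝ)) ⟨by linarith, by linarith⟩).shift
    have hpos : 0 < min (t - n / 6) ((n + 1) / 6 - t) := lt_min (by linarith) (by linarith)
    exact g1.congr hpos fun s hs => key n s
      ⟨by linarith [hs.1, min_le_left (t - n / 6) (((n : ℝ) + 1) / 6 - t)],
        by linarith [hs.2, min_le_right (t - n / 6) (((n : ℝ) + 1) / 6 - t)]⟩

theorem exists_geodesic {p : M.Point} {D : M.V → ℝ} (hd : IsDir p D) :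
    ∃ γ : ℝ → M.Point, IsGeodesic γ ∧ γ 0 = p ∧ RGerm γ 0 D := by
  obtain ⟨E, hE, hO⟩ := exists_opp hd
  obtain ⟨α, a0, a1, a2⟩ := exists_ray hd
  obtain ⟨β, b0, b1, b2⟩ := exists_ray hE
  let γ : ℝ → M.Point := fun t => if 0 ≤ t then α t else β (-t)
  have e1 : ∀ t, 0 ≤ t → α t = γ t := fun t ht => by simp [γ, ht]
  have e2 : ∀ t, t ≤ 0 → β (-t) = γ t := by
    intro t ht
    rcases ht.eq_or_lt with rfl | h
    · rw [← e1 0 le_rfl, neg_zero, a0, b0]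
    · simp [γ, not_le.2 h]
  have g0 : γ 0 = p := by rw [← e1 0 le_rfl, a0]
  have hR : RGerm γ 0 D := a1.congr one_pos fun s hs => e1 s hs.1
  have hL : LGerm γ 0 E := by
    have := b1.reverse
    rw [neg_zero] at this
    exact this.congr_left one_pos fun s hs => e2 s hs.2
  refine ⟨γ, fun t => ?_, g0, hR⟩
  change GeodesicAt γ t
  rcases lt_trichotomy t 0 with h | rfl | h
  · have := (b2 (-t) (by linarith)).reverse
    rw [neg_neg] at this
    exact this.congr (neg_pos.2 h) fun s hs => e2 s (by linarith [hs.2])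
  · exact geodesicAt_of_germs hR hL (g0 ▸ hd) (g0 ▸ hO.symm)
  · exact (a2 t h).congr h fun s hs => e1 s (by linarith [hs.1])

end SManifold

end


noncomputable section

namespace SManifold

open Set Topology

variable {M : SManifold}

/-! ### Every line has only countably many directions -/

theorem IsDir.eq_or_eq_neg {p q : M.Point} {D E : M.V → ℝ} (hD : IsDir p D) (hE : IsDir q E)
    {κ μ : ℝ} (hκ : κ ≠ 0) (h : ∀ x, κ * D x = μ * E x) :
    D = E ∨ D = fun x => -E x := by
  obtain ⟨u, v, w, hT, -, hD0, -, h2⟩ := hD.triple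
  have hμ : μ ≠ 0 := by
    rintro rfl
    have z : ∀ x, D x = 0 := fun x => by
      have := h x
      rw [zero_mul] at this
      exact (mul_eq_zero.1 this).resolve_left hκ
    rw [z, z, z] at h2; norm_num at h2
  have hE0 : ∀ x, x ∉ ({u, v, w} : Finset M.V) → E x = 0 := fun x hx => by
    have := h x
    rw [hD0 x hx, mul_zero] at this
    exact (mul_eq_zero.1 this.symm).resolve_left hμ
  have h2' := (hE.sums hT hE0).2
  have hsq : κ ^ 2 = μ ^ 2 := by
    have e : ∀ x, κ ^ 2 * D x ^ 2 = μ ^ 2 * E x ^ 2 := fun x => by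
      rw [← mul_pow, ← mul_pow, h]
    have e1 : κ ^ 2 * 2 = μ ^ 2 * 2 := by
      rw [← h2]; nth_rw 1 [h2, ← h2]; rw [mul_add, mul_add, e, e, e, h2, ← h2']; ring
    linarith
  rcases sq_eq_sq_iff_eq_or_eq_neg.1 hsq with rfl | rfl
  · exact Or.inl (funext fun x => mul_left_cancel₀ hκ (h x))
  · refine Or.inr (funext fun x => mul_left_cancel₀ hκ ?_)
    rw [h]; ring

/-- Countably many straight pieces cover `γ`. A segment contained in the line has uncountably many
points, so two of them lie on one piece, and their difference shows that the segment has the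
direction of this piece up to sign. -/
theorem exists_countable_directions {γ : ℝ → M.Point} (hγ : IsGeodesic γ) :
    ∃ C : Set (M.V → ℝ), C.Countable ∧ ∀ (η : ℝ → M.Point) (D : M.V → ℝ), IsDir (η 0) D →
      RGerm η 0 D → range η ⊆ range γ → D ∈ C := by
  have hg : ∀ t, ∃ D E ε, 0 < ε ∧ IsDir (γ t) D ∧ IsDir (γ t) E ∧
      (∀ s ∈ Icc 0 ε, ∀ x, γ (t + s) x = γ t x + s * D x) ∧
      (∀ s ∈ Icc 0 ε, ∀ x, γ (t - s) x = γ t x + s * E x) := by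
    intro t
    obtain ⟨D, E, ⟨ε, hε, h1⟩, ⟨δ, hδ, h2⟩, h3, h4, -⟩ := (show GeodesicAt γ t from hγ t).germs
    exact ⟨D, E, min ε δ, lt_min hε hδ, h3, h4,
      fun s hs => h1 s ⟨hs.1, hs.2.trans (min_le_left _ _)⟩,
      fun s hs => h2 s ⟨hs.1, hs.2.trans (min_le_right _ _)⟩⟩
  choose D E ε hε hD hE hR hL using hg
  obtain ⟨S, hS, hcov⟩ := TopologicalSpace.countable_cover_nhds
    (fun t => Ioo_mem_nhds (show t - ε t < t by linarith [hε t]) (show t < t + ε t by linarith [hε t]))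
  refine ⟨⋃ t ∈ S, {D t, fun x => -D t x, E t, fun x => -E t x},
    hS.biUnion fun t _ => (Set.toFinite _).countable, ?_⟩
  rintro η D₀ hD₀ ⟨ε₀, hε₀, h₀⟩ hsub
  have hpt : ∀ r : Ioc (0 : ℝ) ε₀, ∃ t : S, ∃ b : Bool, ∃ a : ℝ,
      (∀ x, η r x = γ t x + a * (if b then D t x else E t x)) := by
    rintro ⟨r, hr⟩
    obtain ⟨τ, hτ⟩ := hsub (mem_range_self r)
    have : τ ∈ ⋃ t ∈ S, Ioo (t - ε t) (t + ε t) := by rw [hcov]; trivial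
    simp only [mem_iUnion] at this
    obtain ⟨t, ht, h1, h2⟩ := this
    rcases le_total t τ with h | h
    · refine ⟨⟨t, ht⟩, true, τ - t, fun x => ?_⟩
      have := hR t (τ - t) ⟨by linarith, by linarith⟩ x
      rw [add_sub_cancel, hτ] at this
      simpa using this
    · refine ⟨⟨t, ht⟩, false, t - τ, fun x => ?_⟩
      have := hL t (t - τ) ⟨by linarith, by linarith⟩ x
      rw [sub_sub_cancel, hτ] at this
      simpa using this
  -- Each point of the initial segment of `η` is assigned a piece (`T`), a side of its centre (`b`)
  -- and a position on it (`a`). There are only countably many pairs of piece and side.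
  choose T b a ha using hpt
  have hni : ¬ Function.Injective fun r => (T r, b r) := by
    intro hinj
    have : Countable S := hS.to_subtype
    have h1 : Countable (Ioc (0 : ℝ) ε₀) := hinj.countable
    exact (Cardinal.Real.Ioc_countable_iff.not.2 (not_le.2 hε₀)) h1
  rw [Function.not_injective_iff] at hni
  obtain ⟨r₁, r₂, he, hne⟩ := hni
  obtain ⟨e1, e2⟩ := Prod.mk.inj he
  have hr : (r₁ - r₂ : ℝ) ≠ 0 := fun h => hne (Subtype.ext (by linarith))
  have hkey : ∀ x, (r₁ - r₂ : ℝ) * D₀ x =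
      (a r₁ - a r₂) * (if b r₂ then D (T r₂) x else E (T r₂) x) := by
    intro x
    have k1 := ha r₁ x
    have k2 := ha r₂ x
    have m1 := h₀ r₁ ⟨r₁.2.1.le, r₁.2.2⟩ x
    have m2 := h₀ r₂ ⟨r₂.2.1.le, r₂.2.2⟩ x
    rw [zero_add] at m1 m2
    rw [e1, e2, m1] at k1
    rw [m2] at k2
    linarith
  simp only [mem_iUnion]
  refine ⟨T r₂, (T r₂).2, ?_⟩
  cases hb : b r₂ with
  | true =>
    simp only [hb, if_true] at hkey
    rcases hD₀.eq_or_eq_neg (hD _) hr hkey with h | h <;> simp [h]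
  | false =>
    simp only [hb] at hkey
    rcases hD₀.eq_or_eq_neg (hE _) hr (fun x => by simpa using hkey x) with h | h <;> simp [h]

/-- Each line takes up only countably many angles, and an interval is uncountable. As `b - a ≤ π` is
less than a full turn around `v`, different angles are different directions. -/
theorem infinite_of_angles {v : M.V} {n : ℕ} {c : ZMod n → M.V} (hn : n = 5 ∨ n = 6 ∨ n = 7)
    (hc : IsLink M.triangles v c) {p : M.Point} (hp : p v = 1) {a b : ℝ} (hab : a < b)
    (hba : b - a ≤ Real.pi) {L : Set (Set M.Point)}
    (H : ∀ θ ∈ Ioo a b, ∀ γ, IsGeodesic γ → γ 0 = p → RGerm γ 0 (pdir v c θ) → range γ ∈ L) :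
    L.Infinite := by
  intro hfin
  have hex := fun θ => exists_geodesic (isDir_pdir hc hp θ)
  choose γ h1 h2 h3 using hex
  have hcount : ∀ m ∈ L, {θ | θ ∈ Ioo a b ∧ range (γ θ) = m}.Countable := by
    intro m _
    by_cases hem : {θ | θ ∈ Ioo a b ∧ range (γ θ) = m}.Nonempty
    · obtain ⟨θ₀, -, h0⟩ := hem
      obtain ⟨C, hC, hC'⟩ := exists_countable_directions (h1 θ₀)
      refine MapsTo.countable_of_injOn (f := pdir v c) (t := C) ?_ ?_ hC
      · rintro θ ⟨_, hθ⟩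
        refine hC' (γ θ) _ (by rw [h2]; exact isDir_pdir hc hp θ) (h3 θ) (by rw [hθ, h0])
      · rintro θ ⟨hθ, _⟩ θ' ⟨hθ', _⟩ he
        obtain ⟨m, hm⟩ := pdir_injective hn hc he
        have hπ := Real.pi_pos
        have hn5 : (5 : ℝ) ≤ n := by exact_mod_cast (by omega : 5 ≤ n)
        have hm0 : m = 0 := by
          by_contra hm0
          have hper : Real.pi < n * (Real.pi / 3) := by nlinarith
          have hd : |θ' - θ| < Real.pi := by
            rw [_root_.abs_lt]; constructor <;> linarith [hθ.1, hθ.2, hθ'.1, hθ'.2]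
          rw [hm, add_sub_cancel_left, abs_mul,
            abs_of_pos (show (0 : ℝ) < n * (Real.pi / 3) by linarith)] at hd
          have : (1 : ℝ) ≤ |(m : ℝ)| := by exact_mod_cast Int.one_le_abs hm0
          nlinarith
        rw [hm, hm0]; simp
    · rw [not_nonempty_iff_eq_empty.1 hem]; exact countable_empty
  have hsub : Ioo a b ⊆ ⋃ m ∈ L, {θ | θ ∈ Ioo a b ∧ range (γ θ) = m} := by
    intro θ hθ
    simp only [mem_iUnion]
    exact ⟨range (γ θ), H θ hθ (γ θ) (h1 θ) (h2 θ) (h3 θ), hθ, rfl⟩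
  have := (hfin.countable.biUnion hcount).mono hsub
  exact (Cardinal.Real.Ioo_countable_iff.not.2 (not_le.2 hab)) this

/-! ### Piecewise linear functions along geodesics -/

/-- The piecewise linear function with values `F` at the vertices. -/
def lin (F : M.V → ℝ) (g : M.V → ℝ) : ℝ := ∑ᶠ x, g x * F x

theorem lin_eq_sum (F : M.V → ℝ) {g : M.V → ℝ} {τ : Finset M.V} (h : ∀ x, x ∉ τ → g x = 0) :
    lin F g = ∑ x ∈ τ, g x * F x := by
  refine finsum_eq_sum_of_support_subset _ fun x hx => ?_
  by_contra hc
  rw [Function.mem_support, h x hc, zero_mul] at hx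
  exact hx rfl

theorem lin_tri (F : M.V → ℝ) {g : M.V → ℝ} {u v w : M.V} (hT : {u, v, w} ∈ M.triangles)
    (h : ∀ x, x ∉ ({u, v, w} : Finset M.V) → g x = 0) :
    lin F g = g u * F u + g v * F v + g w * F w := by
  rw [lin_eq_sum F h, sum_tri hT (fun x => g x * F x)]

theorem lin_add_mul (F : M.V → ℝ) {g h k : M.V → ℝ} {s : ℝ} {τ τ' : Finset M.V}
    (hg : ∀ x, x ∉ τ → g x = 0) (hh : ∀ x, x ∉ τ' → h x = 0) (hk : ∀ x, k x = g x + s * h x) :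
    lin F k = lin F g + s * lin F h := by
  have hg' : ∀ x, x ∉ τ ∪ τ' → g x = 0 := fun x hx => hg x fun h => hx (Finset.mem_union_left _ h)
  have hh' : ∀ x, x ∉ τ ∪ τ' → h x = 0 := fun x hx => hh x fun h => hx (Finset.mem_union_right _ h)
  rw [lin_eq_sum F hg', lin_eq_sum F hh', lin_eq_sum F (τ := τ ∪ τ') fun x hx => by
    rw [hk, hg' x hx, hh' x hx]; ring, Finset.mul_sum, ← Finset.sum_add_distrib]
  exact Finset.sum_congr rfl fun x _ => by rw [hk]; ring

theorem lin_neg_left (F : M.V → ℝ) (g : M.V → ℝ) : lin (fun x => -F x) g = -lin F g := by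
  simp only [lin, mul_neg, finsum_neg_distrib]

theorem lin_neg (F : M.V → ℝ) (g : M.V → ℝ) : lin F (fun x => -g x) = -lin F g := by
  simp only [lin, neg_mul, finsum_neg_distrib]

theorem lin_pdir (F : M.V → ℝ) {v : M.V} {n : ℕ} {c : ZMod n → M.V}
    (hc : IsLink M.triangles v c) {θ : ℝ} {k : ℤ} (h0 : k * (Real.pi / 3) ≤ θ)
    (h1 : θ ≤ (k + 1) * (Real.pi / 3)) : lin F (pdir v c θ) =
      polX (θ - k * (Real.pi / 3)) * (F (c k) - F v) +
        polY (θ - k * (Real.pi / 3)) * (F (c (k + 1)) - F v) := by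
  have hT := hc.mem k
  obtain ⟨n1, n2, n3⟩ := tri_ne hT
  rw [lin_tri F hT fun x hx => by
    simp only [Finset.mem_insert, Finset.mem_singleton, not_or] at hx
    rw [pdir_eq v c h0 h1]; simp [ev, hx], pdir_eq v c h0 h1, pdir_eq v c h0 h1,
    pdir_eq v c h0 h1]
  simp only [ev, if_true, if_neg n1, if_neg n2, if_neg n3, if_neg n1.symm, if_neg n2.symm,
    if_neg n3.symm]
  ring

theorem lin_vertex (F : M.V → ℝ) {p : M.Point} {v : M.V} (h : p v = 1) : lin F p = F v := by
  rw [lin_eq_sum F (τ := {v}) fun x hx =>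
    Point.eq_zero_of_eq_one h (by simpa using hx), Finset.sum_singleton, h, one_mul]

theorem IsDir.exists_support {p : M.Point} {D : M.V → ℝ} (h : IsDir p D) :
    ∃ τ : Finset M.V, ∀ x, x ∉ τ → D x = 0 := by
  obtain ⟨τ, _, _, h, _⟩ := h
  exact ⟨τ, h⟩

theorem lin_germ (F : M.V → ℝ) {p q : M.Point} {D : M.V → ℝ} (hD : IsDir p D) {s : ℝ}
    (h : ∀ x, q x = p x + s * D x) : lin F q = lin F p + s * lin F D := by
  obtain ⟨τ, _, hτ⟩ := p.exists_triangle
  obtain ⟨τ', hτ'⟩ := hD.exists_support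
  exact lin_add_mul F hτ hτ' h

/-- Propagation of a property `P` of the slope of a piecewise linear function along a geodesic. -/
theorem slope_propagate (F : M.V → ℝ) {γ : ℝ → M.Point} (hγ : IsGeodesic γ) {t₀ T σ : ℝ}
    {P : ℝ → Prop} (hP : ∀ s, P s → σ ≤ s) {D₀ : M.V → ℝ} (hD₀ : RGerm γ t₀ D₀)
    (h₀ : P (lin F D₀))
    (H : ∀ t ∈ Ioc t₀ T, ∀ E D, RGerm γ t D → LGerm γ t E → IsDir (γ t) D → IsDir (γ t) E →
      Opp (γ t) E D → lin F (γ t₀) + σ * (t - t₀) ≤ lin F (γ t) → P (-lin F E) → P (lin F D)) :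
    ∀ t ∈ Icc t₀ T, lin F (γ t₀) + σ * (t - t₀) ≤ lin F (γ t) ∧
      ∀ D, RGerm γ t D → P (lin F D) := by
  have hg : ∀ t, GeodesicAt γ t := hγ
  refine real_induction ⟨by simp, fun D hD => hD₀.unique hD ▸ h₀⟩ (fun t ht hQ => ?_)
    (fun t ht hQ => ?_)
  · obtain ⟨D, E, ⟨ε, hε, hR⟩, h2, h3, h4, h5⟩ := (hg t).germs
    obtain ⟨q1, q2⟩ := hQ t ⟨ht.1, le_rfl⟩
    have hPD := q2 D ⟨ε, hε, hR⟩
    refine ⟨ε / 2, by linarith, fun s hs => ⟨?_, fun D' hD' => ?_⟩⟩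
    · have := lin_germ F h3 (q := γ s) (s := s - t) fun x => by
        rw [← hR _ ⟨by linarith [hs.1], by linarith [hs.2]⟩, add_sub_cancel]
      have := hP _ hPD
      nlinarith [hs.1]
    · have : RGerm γ s D := by
        refine ⟨ε / 2, by linarith, fun r hr x => ?_⟩
        have e1 := hR (s - t + r) ⟨by linarith [hs.1, hr.1], by linarith [hs.2, hr.2]⟩ x
        have e2 := hR (s - t) ⟨by linarith [hs.1], by linarith [hs.2]⟩ x
        rw [← add_assoc, add_sub_cancel] at e1
        rw [add_sub_cancel] at e2
        rw [e1, e2]; ring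
      exact this.unique hD' ▸ hPD
  · obtain ⟨D, E, h1, ⟨ε, hε, hL⟩, h3, h4, h5⟩ := (hg t).germs
    set δ := min ε (t - t₀) with hδ
    have hδ0 : 0 < δ := lt_min hε (by linarith [ht.1])
    have hδ1 : δ ≤ ε := min_le_left _ _
    have hδ2 : δ ≤ t - t₀ := min_le_right _ _
    obtain ⟨q1, q2⟩ := hQ (t - δ) ⟨by linarith, by linarith⟩
    -- Just before `t` the curve runs in the direction `-E`, so the property already established at
    -- `t - δ` concerns the slope `-lin F E`.
    have hR : RGerm γ (t - δ) (fun x => -E x) := by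
      refine ⟨δ, hδ0, fun r hr x => ?_⟩
      have e1 := hL (δ - r) ⟨by linarith [hr.2], by linarith [hr.1]⟩ x
      have e2 := hL δ ⟨hδ0.le, hδ1⟩ x
      rw [show t - δ + r = t - (δ - r) by ring, e1, e2]; ring
    have hPE := q2 _ hR
    rw [lin_neg] at hPE
    have hf := lin_germ F h4 (q := γ (t - δ)) (s := δ) (hL δ ⟨hδ0.le, hδ1⟩)
    have hσ := hP _ hPE
    have hval : lin F (γ t₀) + σ * (t - t₀) ≤ lin F (γ t) := by nlinarith
    exact ⟨hval, fun D' hD' => h1.unique hD' ▸ H t ht E D h1 ⟨ε, hε, hL⟩ h3 h4 h5 hval hPE⟩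

/-- Opposite directions at a point that is not a vertex: either they are negatives of each other,
or an edge is crossed. -/
theorem SOpp.lin_add (F : M.V → ℝ) {p : M.Point} {E D : M.V → ℝ} (h : SOpp p E D) :
    lin F E + lin F D = 0 ∨ ∃ u v w w', {u, v, w} ∈ M.triangles ∧ {u, v, w'} ∈ M.triangles ∧
      w ≠ w' ∧ p.MemTriangle {u, v, w} ∧ p w = 0 ∧ 0 < E w ∧
      lin F E + lin F D = E w * (F w + F w' - F u - F v) := by
  rcases h with h | ⟨u, v, w, w', hw, hw', hne, hp, hp0, hE, hE0, h1, h2, h3, hD0⟩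
  · left
    rw [show D = fun x => -E x from funext h, lin_neg, add_neg_cancel]
  · refine Or.inr ⟨u, v, w, w', hw, hw', hne, hp, hp0, hE0, ?_⟩
    rw [lin_tri F hw hE, lin_tri F hw' hD0, h1, h2, h3]; ring

end SManifold

end


noncomputable section

namespace SManifold

open Set

/-! ### The rings of the model -/

/-- The number of vertices on the `k`-th ring. -/
def ringSize : ℕ → ℕ
  | 0 => 1
  | 1 => 5
  | 2 => 5
  | 3 => 5
  | k + 4 => 3 * ringSize (k + 3) - ringSize (k + 2)

theorem ringSize_aux (k : ℕ) : 5 ≤ ringSize (k + 2) ∧ ringSize (k + 2) ≤ ringSize (k + 3) := by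
  induction k with
  | zero => simp [ringSize]
  | succ k ih =>
    have : ringSize (k + 1 + 3) = 3 * ringSize (k + 3) - ringSize (k + 2) := by
      rw [show k + 1 + 3 = k + 4 from rfl, ringSize]
    rw [show k + 1 + 2 = k + 3 from rfl]
    omega

theorem five_le_ringSize {k : ℕ} (hk : 1 ≤ k) : 5 ≤ ringSize k := by
  match k, hk with
  | 1, _ => simp [ringSize]
  | k + 2, _ => exact (ringSize_aux k).1

theorem ringSize_pos (k : ℕ) : 0 < ringSize k := by
  match k with
  | 0 => simp [ringSize]
  | k + 1 => have := five_le_ringSize (k := k + 1) (by omega); omega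

theorem ringSize_le_succ (k : ℕ) : ringSize k ≤ ringSize (k + 1) := by
  match k with
  | 0 => simp [ringSize]
  | 1 => simp [ringSize]
  | k + 2 => exact (ringSize_aux k).2

/-- From the ring `k + 1`, `r_k + r_{k+1}` edges go inwards, `r_{k+1} + r_{k+2}` go outwards, and
every vertex has two neighbours on the ring. With average valence seven, `r_k + r_{k+2} = 3
r_{k+1}`. -/
theorem ringSize_rec {k : ℕ} (hk : 2 ≤ k) :
    (ringSize (k + 2) : ℤ) = 3 * ringSize (k + 1) - ringSize k := by
  obtain ⟨k, rfl⟩ := Nat.exists_eq_add_of_le' hk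
  have := (ringSize_aux k).2
  have e : ringSize (k + 2 + 2) = 3 * ringSize (k + 3) - ringSize (k + 2) := by
    rw [show k + 2 + 2 = k + 4 from rfl, ringSize]
  rw [show k + 2 + 1 = k + 3 from rfl]
  omega

theorem ringSize_pos' (k : ℕ) : 0 < (ringSize k : ℤ) := by exact_mod_cast ringSize_pos k

/-- The index of the apex on the ring `k + 1` of the triangle on the edge from `i - 1` to `i` of
the ring `k`. -/
def up (k : ℕ) (i : ℤ) : ℤ := ringSize (k + 1) * i / ringSize k

/-- The index of the apex on the ring `k` of the triangle on the edge from `j - 1` to `j` of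
the ring `k + 1`. -/
def dn (k : ℕ) (j : ℤ) : ℤ := (ringSize k * j - 1) / ringSize (k + 1)

/-- `up` is the floor of `i r_{k+1} / r_k` and `dn` is the ceiling of `j r_k / r_{k+1}` minus one.
The vertices of both rings are spread evenly around the circle, and this adjunction says how they
interleave. -/
theorem le_dn_iff (k : ℕ) (i j : ℤ) : i ≤ dn k j ↔ up k i < j := by
  rw [dn, up, Int.le_ediv_iff_mul_le (ringSize_pos' _), Int.ediv_lt_iff_lt_mul (ringSize_pos' _),
    Int.le_sub_one_iff, mul_comm i, mul_comm j]

theorem dn_eq_iff {k : ℕ} {i j : ℤ} : dn k j = i ↔ up k i < j ∧ j ≤ up k (i + 1) := by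
  rw [← le_dn_iff, ← not_lt (a := up k (i + 1)), ← le_dn_iff]; omega

theorem up_eq_iff {k : ℕ} {i j : ℤ} : up k j = i ↔ dn k i < j ∧ j ≤ dn k (i + 1) := by
  rw [← not_le (a := j), le_dn_iff, le_dn_iff]; omega

theorem up_add_mul (k : ℕ) (i m : ℤ) :
    up k (i + m * ringSize k) = up k i + m * ringSize (k + 1) := by
  rw [up, up, show (ringSize (k + 1) : ℤ) * (i + m * ringSize k)
    = ringSize (k + 1) * i + m * ringSize (k + 1) * ringSize k by ring,
    Int.add_mul_ediv_right _ _ (ringSize_pos' k).ne']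

theorem dn_add_mul (k : ℕ) (i m : ℤ) :
    dn k (i + m * ringSize (k + 1)) = dn k i + m * ringSize k := by
  rw [dn, dn, show (ringSize k : ℤ) * (i + m * ringSize (k + 1)) - 1
    = ringSize k * i - 1 + m * ringSize k * ringSize (k + 1) by ring,
    Int.add_mul_ediv_right _ _ (ringSize_pos' _).ne']

theorem up_lt_up (k : ℕ) (i : ℤ) : up k i < up k (i + 1) := by
  have h1 := ringSize_pos' k
  have h2 : (ringSize k : ℤ) ≤ ringSize (k + 1) := by exact_mod_cast ringSize_le_succ k
  rw [← le_dn_iff, dn, up, Int.le_ediv_iff_mul_le (ringSize_pos' _)]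
  have := Int.emod_lt_of_pos (ringSize (k + 1) * (i + 1)) h1
  have := Int.mul_ediv_add_emod (ringSize (k + 1) * (i + 1)) (ringSize k)
  nlinarith

theorem dn_succ (k : ℕ) (i : ℤ) : dn k (i + 1) = dn k i ∨ dn k (i + 1) = dn k i + 1 := by
  have h1 : dn k i ≤ dn k (i + 1) := by
    rw [le_dn_iff]
    have := (le_dn_iff k (dn k i) i).1 le_rfl
    omega
  have h2 : dn k (i + 1) < dn k i + 2 := by
    rw [← not_le, le_dn_iff, not_lt]
    have h3 := up_lt_up k (dn k i + 1)
    have h4 : ¬ (dn k i + 1 ≤ dn k i) := by omega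
    rw [le_dn_iff, not_lt] at h4
    rw [add_assoc] at h3
    have : (dn k i + (1 + 1)) = dn k i + 2 := by ring
    rw [this] at h3
    omega
  omega

/-- By the recursion `r_{k+2} i / r_{k+1} = 3 i - r_k i / r_{k+1}`, whose floor is `3 i` minus a
ceiling, and that ceiling is `dn k i + 1`. So a vertex with more neighbours inside has fewer
outside, seven in all. -/
theorem up_succ {k : ℕ} (hk : 2 ≤ k) (i : ℤ) : up (k + 1) i = 3 * i - dn k i - 1 := by
  have h := Int.mul_ediv_add_emod (ringSize k * i - 1) (ringSize (k + 1))
  have h1 := ringSize_pos' (k + 1)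
  have h2 := Int.emod_lt_of_pos (ringSize k * i - 1) h1
  have h3 := Int.emod_nonneg (ringSize k * i - 1) h1.ne'
  have hr := ringSize_rec hk
  apply Int.le_antisymm
  · rw [← Int.lt_add_one_iff, up, Int.ediv_lt_iff_lt_mul h1, show k + 1 + 1 = k + 2 from rfl, hr, dn]
    nlinarith
  · rw [up, Int.le_ediv_iff_mul_le h1, show k + 1 + 1 = k + 2 from rfl, hr, dn]
    nlinarith

theorem up_of_eq {k : ℕ} (h : ringSize (k + 1) = ringSize k) (i : ℤ) : up k i = i := by
  rw [up, h, mul_comm]; exact Int.mul_ediv_cancel _ (ringSize_pos' k).ne'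

theorem dn_of_eq {k : ℕ} (h : ringSize (k + 1) = ringSize k) (i : ℤ) : dn k i = i - 1 := by
  rw [dn_eq_iff, up_of_eq h, up_of_eq h]; omega

/-- The vertices of the model: the vertices of all rings. -/
abbrev SiloVertex : Type := Σ k : ℕ, ZMod (ringSize k)

/-- The `i`-th vertex of the ring `k`. -/
def vx (k : ℕ) (i : ℤ) : SiloVertex := ⟨k, (i : ZMod (ringSize k))⟩

@[simp] theorem vx_fst (k : ℕ) (i : ℤ) : (vx k i).1 = k := rfl

theorem vx_eq_iff {k : ℕ} {i j : ℤ} : vx k i = vx k j ↔ (ringSize k : ℤ) ∣ j - i := by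
  rw [vx, vx, Sigma.mk.injEq, heq_eq_eq, ZMod.intCast_eq_intCast_iff_dvd_sub]
  simp

theorem vx_add_mul (k : ℕ) (i m : ℤ) : vx k (i + m * ringSize k) = vx k i := by
  rw [vx_eq_iff]; exact ⟨-m, by ring⟩

theorem exists_eq_vx (v : SiloVertex) : ∃ i : ℤ, 0 ≤ i ∧ i < ringSize v.1 ∧ v = vx v.1 i := by
  obtain ⟨k, x⟩ := v
  have : NeZero (ringSize k) := ⟨(ringSize_pos k).ne'⟩
  refine ⟨x.val, by positivity, by exact_mod_cast ZMod.val_lt x, ?_⟩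
  simp [vx]

theorem vx_zero (i : ℤ) : vx 0 i = vx 0 0 := by rw [vx_eq_iff]; simp [ringSize]

theorem vx_ne_of_level {k l : ℕ} (h : k ≠ l) (i j : ℤ) : vx k i ≠ vx l j :=
  fun e => h (congrArg Sigma.fst e)

/-- Every ring but the central one has at least five vertices, so indices less than five apart are
not identified. -/
theorem vx_inj {k : ℕ} (hk : 1 ≤ k) {i j : ℤ} (h1 : i < j + 5) (h2 : j < i + 5)
    (h : vx k i = vx k j) : i = j := by
  rw [vx_eq_iff] at h
  have := five_le_ringSize hk
  have := Int.eq_zero_of_abs_lt_dvd h (by rw [_root_.abs_lt]; constructor <;> omega)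
  omega

theorem vx_ne {k : ℕ} (hk : 1 ≤ k) {i j : ℤ} (h : i ≠ j) (h1 : i < j + 5) (h2 : j < i + 5) :
    vx k i ≠ vx k j := fun e => h (vx_inj hk h1 h2 e)

/-! ### The triangles of the model -/

/-- The triangle outside of the edge from `i - 1` to `i` of the ring `k`. -/
def outer (k : ℕ) (i : ℤ) : Finset SiloVertex := {vx k (i - 1), vx k i, vx (k + 1) (up k i)}

/-- The triangle inside of the edge from `j - 1` to `j` of the ring `k + 1`. -/
def inner (k : ℕ) (j : ℤ) : Finset SiloVertex := {vx (k + 1) (j - 1), vx (k + 1) j, vx k (dn k j)}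

theorem outer_add_mul (k : ℕ) (i m : ℤ) : outer k (i + m * ringSize k) = outer k i := by
  rw [outer, up_add_mul, vx_add_mul, vx_add_mul, add_sub_right_comm, vx_add_mul, outer]

theorem inner_add_mul (k : ℕ) (i m : ℤ) : inner k (i + m * ringSize (k + 1)) = inner k i := by
  rw [inner, dn_add_mul, vx_add_mul, vx_add_mul, add_sub_right_comm, vx_add_mul, inner]

/-- All triangles of the model. -/
def siloTriangles : Set (Finset SiloVertex) :=
  {τ | (∃ k i, τ = inner k i) ∨ ∃ k i, 1 ≤ k ∧ τ = outer k i}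

theorem mem_outer {k l : ℕ} {i j : ℤ} : vx l j ∈ outer k i ↔
    l = k ∧ (vx k j = vx k (i - 1) ∨ vx k j = vx k i) ∨
      l = k + 1 ∧ vx (k + 1) j = vx (k + 1) (up k i) := by
  rw [outer]; simp only [Finset.mem_insert, Finset.mem_singleton]
  by_cases h : l = k
  · subst h; simp [vx_ne_of_level (show l ≠ l + 1 by omega)]
  · by_cases h' : l = k + 1
    · subst h'; simp [vx_ne_of_level (show k + 1 ≠ k by omega)]
    · simp [h, h', vx_ne_of_level h, vx_ne_of_level h']

theorem mem_inner {k l : ℕ} {i j : ℤ} : vx l j ∈ inner k i ↔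
    l = k + 1 ∧ (vx (k + 1) j = vx (k + 1) (i - 1) ∨ vx (k + 1) j = vx (k + 1) i) ∨
      l = k ∧ vx k j = vx k (dn k i) := by
  rw [inner]; simp only [Finset.mem_insert, Finset.mem_singleton]
  by_cases h : l = k
  · subst h; simp [vx_ne_of_level (show l ≠ l + 1 by omega)]
  · by_cases h' : l = k + 1
    · subst h'; simp [vx_ne_of_level (show k + 1 ≠ k by omega)]
    · simp [h, h', vx_ne_of_level h, vx_ne_of_level h']

theorem outer_of_vx_eq {k : ℕ} {i j : ℤ} (h : vx k i = vx k j) : outer k i = outer k j := by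
  obtain ⟨m, hm⟩ := vx_eq_iff.1 h
  rw [show j = i + m * ringSize k by linarith, outer_add_mul]

theorem inner_of_vx_eq {k : ℕ} {i j : ℤ} (h : vx (k + 1) i = vx (k + 1) j) :
    inner k i = inner k j := by
  obtain ⟨m, hm⟩ := vx_eq_iff.1 h
  rw [show j = i + m * ringSize (k + 1) by linarith, inner_add_mul]

theorem vx_add_of_eq {k : ℕ} {i j : ℤ} (h : vx k i = vx k (j - 1)) : vx k (i + 1) = vx k j := by
  rw [vx_eq_iff] at h ⊢
  rwa [show j - (i + 1) = j - 1 - i by ring]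

/-- The triangles at a vertex. -/
theorem mem_star_iff (k : ℕ) (i : ℤ) (τ : Finset SiloVertex) :
    (τ ∈ siloTriangles ∧ vx (k + 1) i ∈ τ) ↔
      τ = outer (k + 1) i ∨ τ = outer (k + 1) (i + 1) ∨ τ = inner k i ∨ τ = inner k (i + 1) ∨
      (∃ j, up (k + 1) i < j ∧ j ≤ up (k + 1) (i + 1) ∧ τ = inner (k + 1) j) ∨
      (1 ≤ k ∧ ∃ j, dn k i < j ∧ j ≤ dn k (i + 1) ∧ τ = outer k j) := by
  constructor
  · rintro ⟨⟨l, j, rfl⟩ | ⟨l, j, hl, rfl⟩, h⟩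
    · rcases mem_inner.1 h with ⟨e, h1 | h1⟩ | ⟨rfl, h1⟩
      · obtain rfl : k = l := by omega
        exact Or.inr (Or.inr (Or.inr (Or.inl (inner_of_vx_eq (vx_add_of_eq h1).symm))))
      · obtain rfl : k = l := by omega
        exact Or.inr (Or.inr (Or.inl (inner_of_vx_eq h1.symm)))
      -- The vertex is the apex only modulo full turns; `j` is shifted by as many turns of its own
      -- ring, so that `dn (k + 1) j` equals `i` as an integer.
      · obtain ⟨m, hm⟩ := vx_eq_iff.1 h1
        refine Or.inr (Or.inr (Or.inr (Or.inr (Or.inl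
          ⟨j + (-m) * ringSize (k + 1 + 1), ?_⟩))))
        rw [← and_assoc, ← dn_eq_iff, dn_add_mul]
        exact ⟨by linarith, (inner_add_mul _ _ _).symm⟩
    · rcases mem_outer.1 h with ⟨rfl, h1 | h1⟩ | ⟨e, h1⟩
      · exact Or.inr (Or.inl (outer_of_vx_eq (vx_add_of_eq h1).symm))
      · exact Or.inl (outer_of_vx_eq h1.symm)
      · obtain rfl : k = l := by omega
        obtain ⟨m, hm⟩ := vx_eq_iff.1 h1
        refine Or.inr (Or.inr (Or.inr (Or.inr (Or.inr ⟨hl, j + (-m) * ringSize k, ?_⟩))))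
        rw [← and_assoc, ← up_eq_iff, up_add_mul]
        exact ⟨by linarith, (outer_add_mul _ _ _).symm⟩
  · rintro (rfl | rfl | rfl | rfl | ⟨j, h1, h2, rfl⟩ | ⟨hk, j, h1, h2, rfl⟩)
    · exact ⟨Or.inr ⟨_, _, by omega, rfl⟩, by simp [outer]⟩
    · exact ⟨Or.inr ⟨_, _, by omega, rfl⟩, by simp [outer]⟩
    · exact ⟨Or.inl ⟨_, _, rfl⟩, by simp [inner]⟩
    · exact ⟨Or.inl ⟨_, _, rfl⟩, by simp [inner]⟩
    · exact ⟨Or.inl ⟨_, _, rfl⟩, by rw [inner, dn_eq_iff.2 ⟨h1, h2⟩]; simp⟩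
    · exact ⟨Or.inr ⟨_, _, hk, rfl⟩, by rw [outer, up_eq_iff.2 ⟨h1, h2⟩]; simp⟩

theorem mem_star_zero_iff (τ : Finset SiloVertex) :
    (τ ∈ siloTriangles ∧ vx 0 0 ∈ τ) ↔ ∃ j, τ = inner 0 j := by
  constructor
  · rintro ⟨⟨l, j, rfl⟩ | ⟨l, j, hl, rfl⟩, h⟩
    · rcases mem_inner.1 h with ⟨e, -⟩ | ⟨rfl, -⟩
      · omega
      · exact ⟨j, rfl⟩
    · rcases mem_outer.1 h with ⟨e, -⟩ | ⟨e, -⟩ <;> omega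
  · rintro ⟨j, rfl⟩
    exact ⟨Or.inl ⟨_, _, rfl⟩, by rw [inner, vx_zero (dn 0 j)]; simp⟩

/-! ### The links of the vertices of the model -/

/-- The link of a vertex with two neighbours on the ring below. -/
def linkA (k : ℕ) (i : ℤ) : ZMod 7 → SiloVertex :=
  (![vx (k + 1) (i + 1), vx (k + 2) (up (k + 1) i + 2), vx (k + 2) (up (k + 1) i + 1),
    vx (k + 2) (up (k + 1) i), vx (k + 1) (i - 1), vx k (dn k i), vx k (dn k i + 1)] :
    Fin 7 → SiloVertex)

/-- The link of a vertex with one neighbour on the ring below. -/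
def linkB (k : ℕ) (i : ℤ) : ZMod 7 → SiloVertex :=
  (![vx (k + 1) (i + 1), vx (k + 2) (up (k + 1) i + 3), vx (k + 2) (up (k + 1) i + 2),
    vx (k + 2) (up (k + 1) i + 1), vx (k + 2) (up (k + 1) i), vx (k + 1) (i - 1), vx k (dn k i)] :
    Fin 7 → SiloVertex)

/-- The link of a Euclidean vertex. -/
def linkE (i : ℤ) : ZMod 6 → SiloVertex :=
  (![vx 2 (i + 1), vx 3 (i + 1), vx 3 i, vx 2 (i - 1), vx 1 (i - 1), vx 1 i] :
    Fin 6 → SiloVertex)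

/-- The link of a vertex of the first ring. -/
def linkFirst (i : ℤ) : ZMod 5 → SiloVertex :=
  (![vx 1 (i + 1), vx 2 (i + 1), vx 2 i, vx 1 (i - 1), vx 0 0] : Fin 5 → SiloVertex)

/-- The link of the central vertex. -/
def linkZero : ZMod 5 → SiloVertex := fun j => ⟨1, j⟩

theorem linkA_injective {k : ℕ} (hk : 1 ≤ k) (i : ℤ) : Function.Injective (linkA k i) := by
  intro a b h
  have n1 := vx_ne (k := k + 1) (by omega) (i := i + 1) (j := i - 1) (by omega) (by omega) (by omega)
  have n2 := vx_ne (k := k + 2) (by omega) (i := up (k + 1) i + 2) (j := up (k + 1) i + 1)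
    (by omega) (by omega) (by omega)
  have n3 := vx_ne (k := k + 2) (by omega) (i := up (k + 1) i + 2) (j := up (k + 1) i)
    (by omega) (by omega) (by omega)
  have n4 := vx_ne (k := k + 2) (by omega) (i := up (k + 1) i + 1) (j := up (k + 1) i)
    (by omega) (by omega) (by omega)
  have n5 := vx_ne (k := k) hk (i := dn k i) (j := dn k i + 1) (by omega) (by omega) (by omega)
  have m1 : ∀ i j, vx (k + 1) i ≠ vx (k + 2) j := fun i j => vx_ne_of_level (by omega) i j
  have m2 : ∀ i j, vx k i ≠ vx (k + 2) j := fun i j => vx_ne_of_level (by omega) i j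
  have m3 : ∀ i j, vx k i ≠ vx (k + 1) j := fun i j => vx_ne_of_level (by omega) i j
  change Fin 7 at a b
  fin_cases a <;> fin_cases b <;> first
    | rfl
    | simp [linkA, n1, n2, n3, n4, n5, n1.symm, n2.symm, n3.symm, n4.symm, n5.symm, m1, m2, m3,
        (m1 _ _).symm, (m2 _ _).symm, (m3 _ _).symm] at h

theorem linkB_injective (k : ℕ) (i : ℤ) : Function.Injective (linkB k i) := by
  intro a b h
  have n1 := vx_ne (k := k + 1) (by omega) (i := i + 1) (j := i - 1) (by omega) (by omega) (by omega)
  have n2 : ∀ a b : ℤ, a ≠ b → 0 ≤ a → a ≤ 3 → 0 ≤ b → b ≤ 3 →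
      vx (k + 2) (up (k + 1) i + a) ≠ vx (k + 2) (up (k + 1) i + b) :=
    fun a b _ _ _ _ _ => vx_ne (by omega) (by omega) (by omega) (by omega)
  have n3 : ∀ a : ℤ, a ≠ 0 → 0 ≤ a → a ≤ 3 →
      vx (k + 2) (up (k + 1) i + a) ≠ vx (k + 2) (up (k + 1) i) :=
    fun a _ _ _ => vx_ne (by omega) (by omega) (by omega) (by omega)
  have m1 : ∀ i j, vx (k + 1) i ≠ vx (k + 2) j := fun i j => vx_ne_of_level (by omega) i j
  have m2 : ∀ i j, vx k i ≠ vx (k + 2) j := fun i j => vx_ne_of_level (by omega) i j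
  have m3 : ∀ i j, vx k i ≠ vx (k + 1) j := fun i j => vx_ne_of_level (by omega) i j
  change Fin 7 at a b
  fin_cases a <;> fin_cases b <;> first
    | rfl
    | simp [linkB, n1, n2, n3, n1.symm, (n3 _ _ _ _).symm, m1, m2, m3,
        (m1 _ _).symm, (m2 _ _).symm, (m3 _ _).symm] at h

theorem linkE_injective (i : ℤ) : Function.Injective (linkE i) := by
  intro a b h
  have n1 := vx_ne (k := 2) (by omega) (i := i + 1) (j := i - 1) (by omega) (by omega) (by omega)
  have n2 := vx_ne (k := 3) (by omega) (i := i + 1) (j := i) (by omega) (by omega) (by omega)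
  have n3 := vx_ne (k := 1) (by omega) (i := i) (j := i - 1) (by omega) (by omega) (by omega)
  have m1 : ∀ i j, vx 1 i ≠ vx 2 j := fun i j => vx_ne_of_level (by omega) i j
  have m2 : ∀ i j, vx 1 i ≠ vx 3 j := fun i j => vx_ne_of_level (by omega) i j
  have m3 : ∀ i j, vx 2 i ≠ vx 3 j := fun i j => vx_ne_of_level (by omega) i j
  change Fin 6 at a b
  fin_cases a <;> fin_cases b <;> first
    | rfl
    | simp [linkE, n1, n2, n3, n1.symm, n2.symm, n3.symm, m1, m2, m3,
        (m1 _ _).symm, (m2 _ _).symm, (m3 _ _).symm] at h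

theorem linkFirst_injective (i : ℤ) : Function.Injective (linkFirst i) := by
  intro a b h
  have n1 := vx_ne (k := 1) (by omega) (i := i + 1) (j := i - 1) (by omega) (by omega) (by omega)
  have n2 := vx_ne (k := 2) (by omega) (i := i + 1) (j := i) (by omega) (by omega) (by omega)
  have m1 : ∀ i j, vx 0 i ≠ vx 1 j := fun i j => vx_ne_of_level (by omega) i j
  have m2 : ∀ i j, vx 0 i ≠ vx 2 j := fun i j => vx_ne_of_level (by omega) i j
  have m3 : ∀ i j, vx 1 i ≠ vx 2 j := fun i j => vx_ne_of_level (by omega) i j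
  change Fin 5 at a b
  fin_cases a <;> fin_cases b <;> first
    | rfl
    | simp [linkFirst, n1, n2, n1.symm, n2.symm, m1, m2, m3,
        (m1 _ _).symm, (m2 _ _).symm, (m3 _ _).symm] at h

/-- Four triangles lie along the two ring edges at the vertex. As `dn` advances by one and `up` by
two, one triangle has its base on the ring below and two have theirs on the ring above. -/
theorem isLink_linkA {k : ℕ} (hk : 2 ≤ k) {i : ℤ} (h : dn k (i + 1) = dn k i + 1) :
    IsLink siloTriangles (vx (k + 1) i) (linkA k i) := by
  have hu : up (k + 1) (i + 1) = up (k + 1) i + 2 := by rw [up_succ hk, up_succ hk, h]; ring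
  have e0 : outer (k + 1) (i + 1) = {vx (k + 1) i, linkA k i 0, linkA k i (0 + 1)} := by
    rw [outer, hu, add_sub_cancel_right]; rfl
  have hin : ∀ j, up (k + 1) i < j → j ≤ up (k + 1) (i + 1) →
      inner (k + 1) j = {vx (k + 1) i, vx (k + 2) j, vx (k + 2) (j - 1)} := fun j h1 h2 => by
    rw [inner, dn_eq_iff.2 ⟨h1, h2⟩, ← insert_rotate, insert_swap]
  have e1 : inner (k + 1) (up (k + 1) i + 2) = {vx (k + 1) i, linkA k i 1, linkA k i (1 + 1)} := by
    rw [hin _ (by omega) (by omega), show up (k + 1) i + 2 - 1 = up (k + 1) i + 1 by ring]; rfl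
  have e2 : inner (k + 1) (up (k + 1) i + 1) = {vx (k + 1) i, linkA k i 2, linkA k i (2 + 1)} := by
    rw [hin _ (by omega) (by omega), add_sub_cancel_right]; rfl
  have e3 : outer (k + 1) i = {vx (k + 1) i, linkA k i 3, linkA k i (3 + 1)} := by
    rw [outer, insert_rotate]; rfl
  have e4 : inner k i = {vx (k + 1) i, linkA k i 4, linkA k i (4 + 1)} := by
    rw [inner, insert_swap']; rfl
  have e5 : outer k (dn k i + 1) = {vx (k + 1) i, linkA k i 5, linkA k i (5 + 1)} := by
    rw [outer, (up_eq_iff (j := dn k i + 1)).2 ⟨lt_add_one _, h.ge⟩, ← insert_rotate,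
      add_sub_cancel_right]; rfl
  have e6 : inner k (i + 1) = {vx (k + 1) i, linkA k i 6, linkA k i (6 + 1)} := by
    rw [inner, h, insert_swap, add_sub_cancel_right]; rfl
  refine ⟨linkA_injective (by omega) i, fun τ => ?_⟩
  rw [mem_star_iff]
  constructor
  · rintro (rfl | rfl | rfl | rfl | ⟨j, h1, h2, rfl⟩ | ⟨-, j, h1, h2, rfl⟩)
    · exact ⟨3, e3⟩
    · exact ⟨0, e0⟩
    · exact ⟨4, e4⟩
    · exact ⟨6, e6⟩
    · rcases (by omega : j = up (k + 1) i + 2 ∨ j = up (k + 1) i + 1) with rfl | rfl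
      · exact ⟨1, e1⟩
      · exact ⟨2, e2⟩
    · obtain rfl : j = dn k i + 1 := by omega
      exact ⟨5, e5⟩
  · rintro ⟨j, rfl⟩
    change Fin 7 at j
    fin_cases j
    · exact Or.inr (Or.inl e0.symm)
    · exact Or.inr (Or.inr (Or.inr (Or.inr (Or.inl ⟨_, by omega, by omega, e1.symm⟩))))
    · exact Or.inr (Or.inr (Or.inr (Or.inr (Or.inl ⟨_, by omega, by omega, e2.symm⟩))))
    · exact Or.inl e3.symm
    · exact Or.inr (Or.inr (Or.inl e4.symm))
    · exact Or.inr (Or.inr (Or.inr (Or.inr (Or.inr ⟨by omega, _, by omega, by omega, e5.symm⟩))))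
    · exact Or.inr (Or.inr (Or.inr (Or.inl e6.symm)))

/-- As `dn` does not advance and `up` advances by three, no triangle at the vertex has its base
below and three have theirs above, besides the four along the ring. -/
theorem isLink_linkB {k : ℕ} (hk : 2 ≤ k) {i : ℤ} (h : dn k (i + 1) = dn k i) :
    IsLink siloTriangles (vx (k + 1) i) (linkB k i) := by
  have hu : up (k + 1) (i + 1) = up (k + 1) i + 3 := by rw [up_succ hk, up_succ hk, h]; ring
  have e0 : outer (k + 1) (i + 1) = {vx (k + 1) i, linkB k i 0, linkB k i (0 + 1)} := by
    rw [outer, hu, add_sub_cancel_right]; rfl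
  have hin : ∀ j, up (k + 1) i < j → j ≤ up (k + 1) (i + 1) →
      inner (k + 1) j = {vx (k + 1) i, vx (k + 2) j, vx (k + 2) (j - 1)} := fun j h1 h2 => by
    rw [inner, dn_eq_iff.2 ⟨h1, h2⟩, ← insert_rotate, insert_swap]
  have e1 : inner (k + 1) (up (k + 1) i + 3) = {vx (k + 1) i, linkB k i 1, linkB k i (1 + 1)} := by
    rw [hin _ (by omega) (by omega), show up (k + 1) i + 3 - 1 = up (k + 1) i + 2 by ring]; rfl
  have e2 : inner (k + 1) (up (k + 1) i + 2) = {vx (k + 1) i, linkB k i 2, linkB k i (2 + 1)} := by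
    rw [hin _ (by omega) (by omega), show up (k + 1) i + 2 - 1 = up (k + 1) i + 1 by ring]; rfl
  have e3 : inner (k + 1) (up (k + 1) i + 1) = {vx (k + 1) i, linkB k i 3, linkB k i (3 + 1)} := by
    rw [hin _ (by omega) (by omega), add_sub_cancel_right]; rfl
  have e4 : outer (k + 1) i = {vx (k + 1) i, linkB k i 4, linkB k i (4 + 1)} := by
    rw [outer, insert_rotate]; rfl
  have e5 : inner k i = {vx (k + 1) i, linkB k i 5, linkB k i (5 + 1)} := by
    rw [inner, insert_swap']; rfl
  have e6 : inner k (i + 1) = {vx (k + 1) i, linkB k i 6, linkB k i (6 + 1)} := by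
    rw [inner, h, insert_swap, add_sub_cancel_right]; rfl
  refine ⟨linkB_injective k i, fun τ => ?_⟩
  rw [mem_star_iff]
  constructor
  · rintro (rfl | rfl | rfl | rfl | ⟨j, h1, h2, rfl⟩ | ⟨-, j, h1, h2, rfl⟩)
    · exact ⟨4, e4⟩
    · exact ⟨0, e0⟩
    · exact ⟨5, e5⟩
    · exact ⟨6, e6⟩
    · rcases (by omega : j = up (k + 1) i + 3 ∨ j = up (k + 1) i + 2 ∨ j = up (k + 1) i + 1)
        with rfl | rfl | rfl
      · exact ⟨1, e1⟩
      · exact ⟨2, e2⟩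
      · exact ⟨3, e3⟩
    · omega
  · rintro ⟨j, rfl⟩
    change Fin 7 at j
    fin_cases j
    · exact Or.inr (Or.inl e0.symm)
    · exact Or.inr (Or.inr (Or.inr (Or.inr (Or.inl ⟨_, by omega, by omega, e1.symm⟩))))
    · exact Or.inr (Or.inr (Or.inr (Or.inr (Or.inl ⟨_, by omega, by omega, e2.symm⟩))))
    · exact Or.inr (Or.inr (Or.inr (Or.inr (Or.inl ⟨_, by omega, by omega, e3.symm⟩))))
    · exact Or.inl e4.symm
    · exact Or.inr (Or.inr (Or.inl e5.symm))
    · exact Or.inr (Or.inr (Or.inr (Or.inl e6.symm)))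

theorem up_one (i : ℤ) : up 1 i = i := up_of_eq rfl i

theorem up_two (i : ℤ) : up 2 i = i := up_of_eq rfl i

theorem dn_one (i : ℤ) : dn 1 i = i - 1 := dn_of_eq rfl i

theorem dn_two (i : ℤ) : dn 2 i = i - 1 := dn_of_eq rfl i

theorem isLink_linkE (i : ℤ) : IsLink siloTriangles (vx 2 i) (linkE i) := by
  have e0 : outer 2 (i + 1) = {vx 2 i, linkE i 0, linkE i (0 + 1)} := by
    rw [outer, up_two, add_sub_cancel_right]; rfl
  have e1 : inner 2 (i + 1) = {vx 2 i, linkE i 1, linkE i (1 + 1)} := by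
    rw [inner, dn_two, add_sub_cancel_right, ← insert_rotate, insert_swap]; rfl
  have e2 : outer 2 i = {vx 2 i, linkE i 2, linkE i (2 + 1)} := by
    rw [outer, up_two, insert_rotate]; rfl
  have e3 : inner 1 i = {vx 2 i, linkE i 3, linkE i (3 + 1)} := by
    rw [inner, dn_one, insert_swap']; rfl
  have e4 : outer 1 i = {vx 2 i, linkE i 4, linkE i (4 + 1)} := by
    rw [outer, up_one, ← insert_rotate]; rfl
  have e5 : inner 1 (i + 1) = {vx 2 i, linkE i 5, linkE i (5 + 1)} := by
    rw [inner, dn_one, add_sub_cancel_right, insert_swap]; rfl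
  refine ⟨linkE_injective i, fun τ => ?_⟩
  rw [show vx 2 i = vx (1 + 1) i from rfl, mem_star_iff]
  simp only [Nat.reduceAdd, up_two, dn_one, le_refl, true_and]
  constructor
  · rintro (rfl | rfl | rfl | rfl | ⟨j, h1, h2, rfl⟩ | ⟨j, h1, h2, rfl⟩)
    · exact ⟨2, e2⟩
    · exact ⟨0, e0⟩
    · exact ⟨3, e3⟩
    · exact ⟨5, e5⟩
    · obtain rfl : j = i + 1 := by omega
      exact ⟨1, e1⟩
    · obtain rfl : j = i := by omega
      exact ⟨4, e4⟩
  · rintro ⟨j, rfl⟩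
    change Fin 6 at j
    fin_cases j
    · exact Or.inr (Or.inl e0.symm)
    · exact Or.inr (Or.inr (Or.inr (Or.inr (Or.inl ⟨_, by omega, by omega, e1.symm⟩))))
    · exact Or.inl e2.symm
    · exact Or.inr (Or.inr (Or.inl e3.symm))
    · exact Or.inr (Or.inr (Or.inr (Or.inr (Or.inr ⟨_, by omega, by omega, e4.symm⟩))))
    · exact Or.inr (Or.inr (Or.inr (Or.inl e5.symm)))

theorem isLink_linkFirst (i : ℤ) : IsLink siloTriangles (vx 1 i) (linkFirst i) := by
  have e0 : outer 1 (i + 1) = {vx 1 i, linkFirst i 0, linkFirst i (0 + 1)} := by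
    rw [outer, up_one, add_sub_cancel_right]; rfl
  have e1 : inner 1 (i + 1) = {vx 1 i, linkFirst i 1, linkFirst i (1 + 1)} := by
    rw [inner, dn_one, add_sub_cancel_right, ← insert_rotate, insert_swap]; rfl
  have e2 : outer 1 i = {vx 1 i, linkFirst i 2, linkFirst i (2 + 1)} := by
    rw [outer, up_one, insert_rotate]; rfl
  have e3 : inner 0 i = {vx 1 i, linkFirst i 3, linkFirst i (3 + 1)} := by
    rw [inner, vx_zero, insert_swap']; rfl
  have e4 : inner 0 (i + 1) = {vx 1 i, linkFirst i 4, linkFirst i (4 + 1)} := by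
    rw [inner, vx_zero, add_sub_cancel_right, insert_swap]; rfl
  refine ⟨linkFirst_injective i, fun τ => ?_⟩
  rw [show vx 1 i = vx (0 + 1) i from rfl, mem_star_iff]
  simp only [Nat.reduceAdd, up_one, nonpos_iff_eq_zero, one_ne_zero, false_and, or_false]
  constructor
  · rintro (rfl | rfl | rfl | rfl | ⟨j, h1, h2, rfl⟩)
    · exact ⟨2, e2⟩
    · exact ⟨0, e0⟩
    · exact ⟨3, e3⟩
    · exact ⟨4, e4⟩
    · obtain rfl : j = i + 1 := by omega
      exact ⟨1, e1⟩
  · rintro ⟨j, rfl⟩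
    change Fin 5 at j
    fin_cases j
    · exact Or.inr (Or.inl e0.symm)
    · exact Or.inr (Or.inr (Or.inr (Or.inr ⟨_, by omega, by omega, e1.symm⟩)))
    · exact Or.inl e2.symm
    · exact Or.inr (Or.inr (Or.inl e3.symm))
    · exact Or.inr (Or.inr (Or.inr (Or.inl e4.symm)))

theorem linkZero_intCast (i : ℤ) : linkZero i = vx 1 i := rfl

theorem isLink_linkZero : IsLink siloTriangles (vx 0 0) linkZero := by
  refine ⟨fun a b h => ?_, fun τ => ?_⟩
  · exact eq_of_heq (Sigma.mk.inj h).2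
  · have e : ∀ j : ℤ, inner 0 (j + 1) = {vx 0 0, linkZero j, linkZero (j + 1)} := fun j => by
      have h : linkZero (j + 1) = vx 1 (j + 1) := by rw [← linkZero_intCast]; push_cast; rfl
      rw [inner, vx_zero, add_sub_cancel_right, ← insert_rotate, h]; rfl
    rw [mem_star_zero_iff]
    constructor
    · rintro ⟨j, rfl⟩
      exact ⟨((j - 1 : ℤ) : ZMod 5), by rw [← e, sub_add_cancel]⟩
    · rintro ⟨j, rfl⟩
      refine ⟨(j.val : ℤ) + 1, ?_⟩
      rw [e]; simp

/-- The model. -/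
def silo : SManifold where
  V := SiloVertex
  triangles := siloTriangles
  card_eq_three := by
    rintro τ (⟨k, i, rfl⟩ | ⟨k, i, hk, rfl⟩)
    · exact card_eq_three_of_ne (vx_ne (by omega) (by omega) (by omega) (by omega))
        (vx_ne_of_level (by omega) _ _) (vx_ne_of_level (by omega) _ _)
    · exact card_eq_three_of_ne (vx_ne hk (by omega) (by omega) (by omega))
        (vx_ne_of_level (by omega) _ _) (vx_ne_of_level (by omega) _ _)
  exists_link := by
    intro v
    obtain ⟨i, -, -, h⟩ := exists_eq_vx v
    rw [h]
    match v.1 with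
    | 0 => exact ⟨5, by omega, linkZero, by rw [vx_zero]; exact isLink_linkZero⟩
    | 1 => exact ⟨5, by omega, _, isLink_linkFirst i⟩
    | 2 => exact ⟨6, by omega, _, isLink_linkE i⟩
    | k + 3 =>
      rcases dn_succ (k + 2) i with h | h
      · exact ⟨7, by omega, _, isLink_linkB (by omega) h⟩
      · exact ⟨7, by omega, _, isLink_linkA (by omega) h⟩

/-! ### Valences and kinds of vertices. -/

theorem valence_eq {M : SManifold} {v : M.V} {n : ℕ} (hn : n = 5 ∨ n = 6 ∨ n = 7) {c : ZMod n → M.V}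
    (h : IsLink M.triangles v c) : M.valence v = n := h.ncard_star hn M.card_eq_three

theorem valence_silo (v : silo.V) :
    silo.valence v = if v.1 ≤ 1 then 5 else if v.1 = 2 then 6 else 7 := by
  obtain ⟨i, -, -, h⟩ := exists_eq_vx v
  obtain ⟨k, x⟩ := v
  dsimp only at h
  rw [h]
  match k with
  | 0 => exact valence_eq (M := silo) (n := 5) (by omega) (vx_zero i ▸ isLink_linkZero)
  | 1 => exact valence_eq (M := silo) (n := 5) (by omega) (isLink_linkFirst i)
  | 2 => exact valence_eq (M := silo) (n := 6) (by omega) (isLink_linkE i)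
  | k + 3 =>
    have e : (if k + 3 ≤ 1 then 5 else if k + 3 = 2 then 6 else 7) = 7 := by
      rw [if_neg (by omega), if_neg (by omega)]
    refine Eq.trans ?_ e.symm
    rcases dn_succ (k + 2) i with h | h
    · exact valence_eq (M := silo) (by omega) (isLink_linkB (by omega) h)
    · exact valence_eq (M := silo) (by omega) (isLink_linkA (by omega) h)

theorem isEllipticVertex_silo {v : silo.V} : silo.IsEllipticVertex v ↔ v.1 ≤ 1 := by
  rw [IsEllipticVertex, valence_silo]; split_ifs <;> simp_all

theorem isEuclideanVertex_silo {v : silo.V} : silo.IsEuclideanVertex v ↔ v.1 = 2 := by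
  rw [IsEuclideanVertex, valence_silo]; split_ifs <;> simp_all; omega

theorem isHyperbolicVertex_silo {v : silo.V} : silo.IsHyperbolicVertex v ↔ 3 ≤ v.1 := by
  rw [IsHyperbolicVertex, valence_silo]; split_ifs <;> simp_all <;> omega

theorem level_le_of_mem {τ : Finset SiloVertex} (hτ : τ ∈ siloTriangles) {u v : SiloVertex}
    (hu : u ∈ τ) (hv : v ∈ τ) : v.1 ≤ u.1 + 1 := by
  rcases hτ with ⟨k, i, rfl⟩ | ⟨k, i, -, rfl⟩ <;>
  · simp only [inner, outer, Finset.mem_insert, Finset.mem_singleton] at hu hv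
    rcases hu with rfl | rfl | rfl <;> rcases hv with rfl | rfl | rfl <;>
      (simp only [vx_fst]; omega)

theorem eq_vx_zero {v : SiloVertex} (h : v.1 = 0) : v = vx 0 0 := by
  obtain ⟨i, -, -, e⟩ := exists_eq_vx v
  rw [e, h, vx_zero]

theorem adj_zero_iff {v : silo.V} : silo.Adj (vx 0 0) v ↔ v.1 = 1 := by
  constructor
  · rintro ⟨hne, τ, hτ, h1, h2⟩
    have := level_le_of_mem hτ h1 h2
    have h0 : v.1 ≠ 0 := fun h => hne (eq_vx_zero h).symm
    have : v.1 ≤ 0 + 1 := this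
    omega
  · intro h
    obtain ⟨i, -, -, e⟩ := exists_eq_vx v
    rw [h] at e
    rw [e]
    exact ⟨vx_ne_of_level (by omega) _ _, inner 0 i, Or.inl ⟨_, _, rfl⟩,
      mem_inner.2 (Or.inr ⟨rfl, (vx_zero _).symm⟩), mem_inner.2 (Or.inl ⟨rfl, Or.inr rfl⟩)⟩

theorem ncard_ring (k : ℕ) : {v : SiloVertex | v.1 = k}.ncard = ringSize k := by
  have : NeZero (ringSize k) := ⟨(ringSize_pos k).ne'⟩
  have e : {v : SiloVertex | v.1 = k} = range (fun j : ZMod (ringSize k) => (⟨k, j⟩ : SiloVertex)) := by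
    ext ⟨l, j⟩
    constructor
    · rintro rfl; exact ⟨j, rfl⟩
    · rintro ⟨j, h⟩; exact (congrArg Sigma.fst h).symm
  rw [e, ← Nat.card_coe_set_eq, Nat.card_range_of_injective fun a b h => eq_of_heq (Sigma.mk.inj h).2,
    Nat.card_eq_fintype_card, ZMod.card]

theorem finite_ring (k : ℕ) : {v : SiloVertex | v.1 = k}.Finite :=
  finite_of_ncard_ne_zero (by rw [ncard_ring]; exact (ringSize_pos k).ne')

theorem isExtendedSilo_silo (h : Nonempty (silo.Point ≃ₜ EuclideanSpace ℝ (Fin 2))) :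
    silo.IsExtendedSilo where
  homeomorph_plane := h
  elliptic_iff := by
    refine ⟨vx 0 0, fun v => ?_⟩
    rw [isEllipticVertex_silo, adj_zero_iff]
    constructor
    · intro h
      rcases (by omega : v.1 = 0 ∨ v.1 = 1) with h | h
      · exact Or.inl (eq_vx_zero h)
      · exact Or.inr h
    · rintro (rfl | h)
      · exact Nat.zero_le _
      · omega
  ncard_elliptic := by
    simp only [isEllipticVertex_silo]
    have e : {v : SiloVertex | v.1 ≤ 1} = {v | v.1 = 0} ∪ {v | v.1 = 1} := by
      ext v; simp only [mem_ofPred_eq, mem_union]; omega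
    refine (congrArg ncard e).trans ?_
    rw [ncard_union_eq _ (finite_ring 0) (finite_ring 1), ncard_ring, ncard_ring]
    · rfl
    · rw [disjoint_left]; intro v h1 h2; simp only [mem_ofPred_eq] at h1 h2; omega
  euclidean_iff v := by
    simp only [isEllipticVertex_silo, isEuclideanVertex_silo]
    constructor
    · intro h
      obtain ⟨i, -, -, e⟩ := exists_eq_vx v
      rw [h] at e
      refine ⟨by omega, vx 1 i, le_rfl, ?_⟩
      rw [e]
      exact ⟨vx_ne_of_level (by omega) _ _, outer 1 i, Or.inr ⟨_, _, le_rfl, rfl⟩,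
        mem_outer.2 (Or.inl ⟨rfl, Or.inr rfl⟩), mem_outer.2 (Or.inr ⟨rfl, by rw [up_one]⟩)⟩
    · rintro ⟨h, u, hu, -, τ, hτ, h1, h2⟩
      have := level_le_of_mem hτ h1 h2
      omega
  ncard_euclidean := by
    simp only [isEuclideanVertex_silo]
    exact ncard_ring 2
  hyperbolic_iff v := by
    simp only [isEllipticVertex_silo, isEuclideanVertex_silo, isHyperbolicVertex_silo]
    omega

end SManifold

end


noncomputable section

namespace SManifold

open Set

/-! ### The height function -/

/-- The height of a vertex of the model: the number of its ring. -/
def lvl (v : silo.V) : ℝ := (v.1 : ℕ)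

theorem lvl_vx (k : ℕ) (i : ℤ) : lvl (vx k i) = k := rfl

/-- Within a sector the slope is a combination, with weights `polX` and `polY`, of the rises towards
two consecutive neighbours. Strictly inside the arc from `c 0` to `c m` a positive rise has a
positive weight. -/
theorem lin_pdir_pos {M : SManifold} (F : M.V → ℝ) {v : M.V} {n : ℕ} {c : ZMod n → M.V}
    (hc : IsLink M.triangles v c) {m : ℤ} (hm2 : 2 ≤ m) (h0 : F v ≤ F (c (0 : ℤ)))
    (hm : F v ≤ F (c m)) (hpos : ∀ j : ℤ, 0 < j → j < m → F v < F (c j)) {θ : ℝ} (hθ : 0 < θ)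
    (hθ' : θ < m * (Real.pi / 3)) : 0 < lin F (pdir v c θ) := by
  have hπ : 0 < Real.pi / 3 := by positivity
  obtain ⟨k, h1, h2⟩ := exists_sector θ
  have hk : 0 ≤ k := by
    by_contra h
    have : (k + 1 : ℝ) ≤ 0 := by exact_mod_cast (by omega : k + 1 ≤ 0)
    nlinarith
  have hkm : k < m := by
    by_contra h
    have : (m : ℝ) ≤ k := by exact_mod_cast (by omega : m ≤ k)
    nlinarith
  have hc1 : c ((k : ZMod n) + 1) = c ((k + 1 : ℤ) : ZMod n) := by push_cast; rfl
  rw [lin_pdir F hc h1 h2.le, hc1]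
  set φ := θ - k * (Real.pi / 3) with hφ
  have hφ0 : 0 ≤ φ := by linarith
  have hφ1 : φ < Real.pi / 3 := by linarith
  have hX := polX_pos hφ0 hφ1
  have hY := polY_nonneg hφ0 hφ1.le
  have hk1 : F v ≤ F (c ((k + 1 : ℤ) : ZMod n)) := by
    rcases (by omega : k + 1 < m ∨ k + 1 = m) with h | h
    · exact (hpos _ (by omega) h).le
    · rw [h]; exact hm
  rcases hk.lt_or_eq with hk | rfl
  · have := hpos k hk hkm
    have := mul_pos hX (sub_pos.2 this)
    have := mul_nonneg hY (sub_nonneg.2 hk1)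
    linarith
  · have hφp : 0 < φ := by rw [hφ]; simpa using hθ
    have := mul_pos (polY_pos hφp hφ1.le) (sub_pos.2 (hpos (0 + 1) (by omega) (by omega)))
    have := mul_nonneg hX.le (sub_nonneg.2 h0)
    linarith

/-- The open arc of ascending directions has angle `m π / 3`, more than half of the total angle `n π
/ 3`, so a direction outside of it is opposite to one inside. -/
theorem lin_pos_of_vOpp {M : SManifold} (F : M.V → ℝ) {v : M.V} {n : ℕ} {c : ZMod n → M.V}
    (hn : n = 5 ∨ n = 6 ∨ n = 7)
    (hc : IsLink M.triangles v c) {m : ℤ} (hm2 : 2 ≤ m) (hmn : (n : ℤ) < 2 * m)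
    (h0 : F v ≤ F (c (0 : ℤ)))
    (hm : F v ≤ F (c m)) (hpos : ∀ j : ℤ, 0 < j → j < m → F v < F (c j)) {E D : M.V → ℝ}
    (h : VOpp v E D) (hE : lin F E ≤ 0) : 0 < lin F D := by
  obtain ⟨θ, rfl, rfl⟩ := h.exists_angle hn hc
  have hπ : 0 < Real.pi / 6 := by positivity
  have hn5 : (5 : ℝ) ≤ n := by exact_mod_cast (by omega : 5 ≤ n)
  have hmn' : (n : ℝ) + 1 ≤ 2 * m := by exact_mod_cast hmn
  have hP : 0 < n * (Real.pi / 3) := by positivity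
  obtain ⟨q, q0, q1⟩ : ∃ q : ℤ, q * (n * (Real.pi / 3)) ≤ θ ∧ θ < (q + 1) * (n * (Real.pi / 3)) :=
    ⟨⌊θ / (n * (Real.pi / 3))⌋, by rw [← le_div_iff₀ hP]; exact Int.floor_le _,
      by rw [← div_lt_iff₀ hP]; exact Int.lt_floor_add_one _⟩
  obtain ⟨φ, hφ⟩ : ∃ φ, θ = φ + q * (n * (Real.pi / 3)) := ⟨θ - q * (n * (Real.pi / 3)), by ring⟩
  subst hφ
  rw [pdir_add_period] at hE
  have key : ∀ φ, 0 < φ → φ < m * (Real.pi / 3) → 0 < lin F (pdir v c φ) :=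
    fun φ => lin_pdir_pos F hc hm2 h0 hm hpos
  rcases (show 0 ≤ φ by linarith).eq_or_lt with rfl | hpos'
  · rw [zero_add, add_comm, pdir_add_period]
    exact key _ (by positivity) (by nlinarith)
  · rcases lt_or_ge φ (m * (Real.pi / 3)) with h | h
    · exact absurd (key _ hpos' h) (not_lt.2 hE)
    · have e : φ + q * (n * (Real.pi / 3)) + n * (Real.pi / 6)
          = (φ - n * (Real.pi / 6)) + ((q + 1 : ℤ) : ℝ) * (n * (Real.pi / 3)) := by
        push_cast; ring
      rw [e, pdir_add_period]
      exact key _ (by nlinarith) (by nlinarith)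

/-- The heights of the link of a vertex with two neighbours below, up to a constant. -/
def patA : ZMod 7 → ℕ := (![1, 2, 2, 2, 1, 0, 0] : Fin 7 → ℕ)

/-- The heights of the link of a vertex with one neighbour below, up to a constant. -/
def patB : ZMod 7 → ℕ := (![1, 2, 2, 2, 2, 1, 0] : Fin 7 → ℕ)

def patE : ZMod 6 → ℕ := (![2, 3, 3, 2, 1, 1] : Fin 6 → ℕ)

def patFirst : ZMod 5 → ℕ := (![1, 2, 2, 1, 0] : Fin 5 → ℕ)

theorem linkA_lvl (k : ℕ) (i : ℤ) (j : ZMod 7) :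
    lvl (linkA k i j) = (k + patA j : ℕ) := by
  change Fin 7 at j
  fin_cases j <;> rfl

theorem linkB_lvl (k : ℕ) (i : ℤ) (j : ZMod 7) :
    lvl (linkB k i j) = (k + patB j : ℕ) := by
  change Fin 7 at j
  fin_cases j <;> rfl

theorem linkE_lvl (i : ℤ) (j : ZMod 6) :
    lvl (linkE i j) = (patE j : ℕ) := by
  change Fin 6 at j
  fin_cases j <;> rfl

theorem linkFirst_lvl (i : ℤ) (j : ZMod 5) :
    lvl (linkFirst i j) = (patFirst j : ℕ) := by
  change Fin 5 at j
  fin_cases j <;> rfl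

theorem linkZero_lvl (j : ZMod 5) : lvl (linkZero j) = 1 := by simp [lvl, linkZero]

/-- Every vertex other than the central one lies on a ring. -/
theorem silo_cases {P : silo.V → Prop} (h0 : P (vx 0 0)) (h1 : ∀ i, P (vx 1 i))
    (h2 : ∀ i, P (vx 2 i)) (hA : ∀ k i, 2 ≤ k → dn k (i + 1) = dn k i + 1 → P (vx (k + 1) i))
    (hB : ∀ k i, 2 ≤ k → dn k (i + 1) = dn k i → P (vx (k + 1) i)) (v : silo.V) : P v := by
  obtain ⟨i, -, -, h⟩ := exists_eq_vx v
  rw [h]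
  match v.1 with
  | 0 => rw [vx_zero]; exact h0
  | 1 => exact h1 i
  | 2 => exact h2 i
  | k + 3 =>
    rcases dn_succ (k + 2) i with h | h
    · exact hB _ _ (by omega) h
    · exact hA _ _ (by omega) h

/-- The inequality is convexity of the height across the edge from `v` to `c j`; on ring 2 the
height is affine across these edges. Both are read off from the finite height patterns. -/
theorem lvl_link (v : silo.V) : ∃ n : ℕ, (n = 5 ∨ n = 6 ∨ n = 7) ∧ ∃ c : ZMod n → silo.V,
    IsLink silo.triangles v c ∧ (∀ j, lvl v + lvl (c j) ≤ lvl (c (j - 1)) + lvl (c (j + 1))) ∧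
      (v.1 = 2 → ∀ j, lvl v + lvl (c j) = lvl (c (j - 1)) + lvl (c (j + 1))) := by
  revert v
  refine silo_cases ?_ (fun i => ?_) (fun i => ?_) (fun k i hk h => ?_) (fun k i hk h => ?_)
  · refine ⟨5, by omega, _, isLink_linkZero, fun j => ?_, by simp⟩
    simp [linkZero_lvl, lvl_vx]
  · refine ⟨5, by omega, _, isLink_linkFirst i, fun j => ?_, by simp⟩
    simp only [linkFirst_lvl, lvl_vx]
    norm_cast
    revert j; decide
  · refine ⟨6, by omega, _, isLink_linkE i, fun j => ?_, fun _ j => ?_⟩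
    · simp only [linkE_lvl, lvl_vx]
      norm_cast
      revert j; decide
    · simp only [linkE_lvl, lvl_vx]
      norm_cast
      revert j; decide
  · refine ⟨7, by omega, _, isLink_linkA hk h, fun j => ?_, fun h => by simp at h; omega⟩
    simp only [linkA_lvl, lvl_vx]
    norm_cast
    have : ∀ j, 1 + patA j ≤ patA (j - 1) + patA (j + 1) := by decide
    have := this j
    omega
  · refine ⟨7, by omega, _, isLink_linkB hk h, fun j => ?_, fun h => by simp at h; omega⟩
    simp only [linkB_lvl, lvl_vx]
    norm_cast
    have : ∀ j, 1 + patB j ≤ patB (j - 1) + patB (j + 1) := by decide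
    have := this j
    omega

theorem lvl_rhombus {u v w w' : silo.V} (hw : {u, v, w} ∈ silo.triangles)
    (hw' : {u, v, w'} ∈ silo.triangles) (hne : w ≠ w') :
    lvl u + lvl v ≤ lvl w + lvl w' ∧ (u.1 = 2 → lvl u + lvl v = lvl w + lvl w') := by
  obtain ⟨n, hn, c, hc, h1, h2⟩ := lvl_link u
  obtain ⟨k, rfl, h3⟩ := hc.exists_index silo.card_eq_three hw
  have h4 := hc.third silo.card_eq_three hw'
  rcases h3 with rfl | rfl <;> rcases h4 with rfl | rfl
  · exact absurd rfl hne
  · exact ⟨(h1 k).trans_eq (add_comm _ _), fun h => (h2 h k).trans (add_comm _ _)⟩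
  · exact ⟨h1 k, fun h => h2 h k⟩
  · exact absurd rfl hne

/-- The slope of the height of a geodesic is positive after a vertex outside of the second ring, if
it was not negative in the opposite direction. -/
theorem slope_pos_of_vOpp {v : silo.V} (hv : v.1 ≠ 2) {E D : silo.V → ℝ} (h : VOpp v E D)
    (hE : lin lvl E ≤ 0) : 0 < lin lvl D := by
  refine silo_cases (P := fun v => v.1 ≠ 2 → VOpp v E D → 0 < lin lvl D) (fun _ h => ?_)
    (fun i _ h => ?_) (fun i hv => absurd rfl hv)
    (fun k i hk hd _ h => ?_) (fun k i hk hd _ h => ?_) v hv h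
  -- `m` counts the sectors without a descending side: 5 of 5 at the centre, 3 of 5 on ring 1, and 4
  -- or 5 of 7 at hyperbolic vertices. On ring 2 it would be 3 of 6, not more than half.
  · refine lin_pos_of_vOpp lvl (m := 5) (by omega) isLink_linkZero (by omega) (by omega) ?_ ?_
      (fun j _ _ => ?_) h hE <;> simp [linkZero_lvl, lvl_vx]
  · refine lin_pos_of_vOpp lvl (m := 3) (by omega) (isLink_linkFirst i) (by omega) (by omega) ?_ ?_
      (fun j h1 h2 => ?_) h hE
    · exact le_of_eq rfl
    · exact le_of_eq rfl
    · simp only [linkFirst_lvl, lvl_vx]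
      norm_cast
      interval_cases j <;> decide
  · refine lin_pos_of_vOpp lvl (m := 4) (by omega) (isLink_linkA hk hd) (by omega) (by omega) ?_ ?_
      (fun j h1 h2 => ?_) h hE
    · exact le_of_eq rfl
    · exact le_of_eq rfl
    · simp only [linkA_lvl, lvl_vx]
      norm_cast
      rw [add_lt_add_iff_left]
      interval_cases j <;> decide
  · refine lin_pos_of_vOpp lvl (m := 5) (by omega) (isLink_linkB hk hd) (by omega) (by omega) ?_ ?_
      (fun j h1 h2 => ?_) h hE
    · exact le_of_eq rfl
    · exact le_of_eq rfl
    · simp only [linkB_lvl, lvl_vx]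
      norm_cast
      rw [add_lt_add_iff_left]
      interval_cases j <;> decide

/-- Antipodal neighbours of a Euclidean vertex lie symmetrically above and below it, which is `patE
(j + 3) + patE j = 4`. -/
theorem lin_add_pi (i : ℤ) (θ : ℝ) :
    lin lvl (pdir (vx 2 i) (linkE i) (θ + Real.pi)) =
      -lin lvl (pdir (vx 2 i) (linkE i) θ) := by
  obtain ⟨k, h1, h2⟩ := exists_sector θ
  have e : ∀ j : ZMod 6, lvl (linkE i (j + 3)) - 2 = -(lvl (linkE i j) - 2) := by
    intro j
    have h : ∀ j, patE (j + 3) + patE j = 4 := by decide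
    have : ((patE (j + 3) : ℕ) : ℝ) + (patE j : ℕ) = 4 := by exact_mod_cast h j
    simp only [linkE_lvl]
    linarith
  have hv : lvl (vx 2 i) = 2 := by rw [lvl_vx]; norm_num
  rw [lin_pdir (M := silo) lvl (isLink_linkE i) h1 h2.le,
    lin_pdir (M := silo) lvl (isLink_linkE i) (k := k + 3) (by push_cast; linarith)
      (by push_cast; linarith), hv]
  have e1 := e k
  have e2 := e (k + 1)
  push_cast
  rw [show θ + Real.pi - (k + 3) * (Real.pi / 3) = θ - k * (Real.pi / 3) by ring, e1,
    add_right_comm, e2]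
  ring

theorem slope_neg_of_vOpp {v : silo.V} (hv : v.1 = 2) {E D : silo.V → ℝ} (h : VOpp v E D) :
    lin lvl D = -lin lvl E := by
  obtain ⟨i, -, -, e⟩ := exists_eq_vx v
  rw [hv] at e
  obtain ⟨θ, rfl, rfl⟩ := h.exists_angle (n := 6) (c := linkE i) (by omega)
    (by rw [e]; exact isLink_linkE i)
  rw [e, ← lin_add_pi, show θ + ((6 : ℕ) : ℝ) * (Real.pi / 6) = θ + Real.pi by push_cast; ring]

theorem slope_add_nonneg {p : silo.Point} {E D : silo.V → ℝ} (h : SOpp p E D) :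
    0 ≤ lin lvl E + lin lvl D := by
  rcases h.lin_add lvl with h | ⟨u, v, w, w', h1, h2, h3, -, -, h4, h5⟩
  · exact h.ge
  · rw [h5]
    have := (lvl_rhombus h1 h2 h3).1
    exact mul_nonneg h4.le (by linarith)

theorem lin_edge {M : SManifold} (F : M.V → ℝ) {p : M.Point} {u v w : M.V}
    (hT : {u, v, w} ∈ M.triangles) (hp : p.MemTriangle {u, v, w}) (hw : p w = 0) :
    lin F p = p u * F u + p v * F v ∧ p u + p v = 1 := by
  have := Point.sum_tri hT hp
  rw [lin_tri F hT hp, hw]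
  exact ⟨by ring, by linarith⟩

theorem lvl_le_of_mem {u v w : silo.V} (hT : {u, v, w} ∈ silo.triangles) :
    u.1 ≤ v.1 + 1 ∧ v.1 ≤ u.1 + 1 :=
  ⟨level_le_of_mem hT (Finset.mem_insert_of_mem (Finset.mem_insert_self _ _))
    (Finset.mem_insert_self _ _), level_le_of_mem hT (Finset.mem_insert_self _ _)
    (Finset.mem_insert_of_mem (Finset.mem_insert_self _ _))⟩

/-- An edge joins vertices of the same ring or of successive rings, so an edge through a point of
height strictly between 1 and 3 has an end on ring 2, and across such an edge the height is affine.
-/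
theorem slope_add_eq_zero {p : silo.Point} {E D : silo.V → ℝ} (h : SOpp p E D)
    (h1 : 1 < lin lvl p) (h3 : lin lvl p < 3) : lin lvl E + lin lvl D = 0 := by
  rcases h.lin_add lvl with h | ⟨u, v, w, w', hw, hw', hne, hp, hp0, -, h5⟩
  · exact h
  · rw [h5]
    have hz : lvl w + lvl w' - lvl u - lvl v = 0 := by
      by_cases hu : u.1 = 2
      · linarith [(lvl_rhombus hw hw' hne).2 hu]
      by_cases hv : v.1 = 2
      · rw [insert_swap'] at hw hw'
        linarith [(lvl_rhombus hw hw' hne).2 hv]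
      exfalso
      obtain ⟨e1, e2⟩ := lin_edge lvl hw hp hp0
      have l1 := lvl_le_of_mem hw
      have p1 := p.nonneg u
      have p2 := p.nonneg v
      rcases (by omega : (u.1 ≤ 1 ∧ v.1 ≤ 1) ∨ (3 ≤ u.1 ∧ 3 ≤ v.1)) with ⟨a1, a2⟩ | ⟨a1, a2⟩
      · have b1 : lvl u ≤ 1 := by rw [lvl]; exact_mod_cast a1
        have b2 : lvl v ≤ 1 := by rw [lvl]; exact_mod_cast a2
        nlinarith
      · have b1 : 3 ≤ lvl u := by rw [lvl]; exact_mod_cast a1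
        have b2 : 3 ≤ lvl v := by rw [lvl]; exact_mod_cast a2
        nlinarith
    rw [hz, mul_zero]

theorem Opp.cases {M : SManifold} {p : M.Point} {E D : M.V → ℝ} (h : Opp p E D) :
    (∃ v, p v = 1 ∧ VOpp v E D) ∨ ((∀ v, p v ≠ 1) ∧ SOpp p E D) := by
  by_cases hv : ∃ v, p v = 1
  · obtain ⟨v, hv⟩ := hv
    exact Or.inl ⟨v, hv, h.1 v hv⟩
  · push Not at hv
    exact Or.inr ⟨hv, h.2 hv⟩

theorem slope_nonneg_of_opp {p : silo.Point} {E D : silo.V → ℝ} (h : Opp p E D)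
    (hE : lin lvl E ≤ 0) : 0 ≤ lin lvl D := by
  rcases h.cases with ⟨v, -, h⟩ | ⟨-, h⟩
  · by_cases hv : v.1 = 2
    · rw [slope_neg_of_vOpp hv h]; linarith
    · exact (slope_pos_of_vOpp hv h hE).le
  · linarith [slope_add_nonneg h]

/-- The flatness of the cylinder: a vertex of such a height lies on ring 2, where opposite slopes
cancel as well. -/
theorem slope_neg_of_opp {p : silo.Point} {E D : silo.V → ℝ} (h : Opp p E D)
    (h1 : 1 < lin lvl p) (h3 : lin lvl p < 3) : lin lvl D = -lin lvl E := by
  rcases h.cases with ⟨v, hv, h⟩ | ⟨-, h⟩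
  · rw [lin_vertex lvl hv] at h1 h3
    refine slope_neg_of_vOpp ?_ h
    rw [lvl] at h1 h3
    have a1 : 1 < v.1 := by exact_mod_cast h1
    have a2 : v.1 < 3 := by exact_mod_cast h3
    omega
  · linarith [slope_add_eq_zero h h1 h3]

/-- A geodesic that does not descend at some time never comes below its height at that time. -/
theorem height_le {γ : ℝ → silo.Point} (hγ : IsGeodesic γ) {t₀ : ℝ} {D₀ : silo.V → ℝ}
    (hD : RGerm γ t₀ D₀) (h : 0 ≤ lin lvl D₀) {t : ℝ} (ht : t₀ ≤ t) :
    lin lvl (γ t₀) ≤ lin lvl (γ t) := by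
  have := (slope_propagate lvl hγ (T := t) (σ := 0) (P := fun s => 0 ≤ s) (fun s hs => hs) hD h
    (fun s hs E D _ _ _ _ hO _ hE => slope_nonneg_of_opp hO (by linarith)) t ⟨ht, le_rfl⟩).1
  linarith

theorem height_le_of_left {γ : ℝ → silo.Point} (hγ : IsGeodesic γ) {t₀ : ℝ} {E₀ : silo.V → ℝ}
    (hE : LGerm γ t₀ E₀) (h : 0 ≤ lin lvl E₀) {t : ℝ} (ht : t ≤ t₀) :
    lin lvl (γ t₀) ≤ lin lvl (γ t) := by
  have hr : RGerm (fun s => γ (-s)) (-t₀) E₀ := by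
    have := hE.reverse
    simpa using this
  have := height_le hγ.reverse hr h (t := -t) (by linarith)
  simpa using this

end SManifold

end


noncomputable section

namespace SManifold

open Set Topology

/-! ### Reaching the heights of the cylinder -/

theorem continuous_lin {M : SManifold} (F : M.V → ℝ) {γ : ℝ → M.Point} (hγ : IsGeodesic γ) :
    Continuous fun t => lin F (γ t) := by
  rw [continuous_iff_continuousAt]
  intro t
  obtain ⟨D, E, ⟨ε, hε, hR⟩, ⟨δ, hδ, hL⟩, hD, hE, -⟩ := (show GeodesicAt γ t from hγ t).germs
  rw [continuousAt_iff_continuous_left_right]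
  constructor
  · refine ContinuousWithinAt.congr_of_eventuallyEq (f := fun s => lin F (γ t) + (t - s) * lin F E)
      (by fun_prop) ?_ (by simp)
    filter_upwards [Icc_mem_nhdsLE (show t - δ < t by linarith)] with s hs
    exact lin_germ F hE fun x => by
      rw [← hL (t - s) ⟨by linarith [hs.2], by linarith [hs.1]⟩, sub_sub_cancel]
  · refine ContinuousWithinAt.congr_of_eventuallyEq (f := fun s => lin F (γ t) + (s - t) * lin F D)
      (by fun_prop) ?_ (by simp)
    filter_upwards [Icc_mem_nhdsGE (show t < t + ε by linarith)] with s hs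
    exact lin_germ F hD fun x => by
      rw [← hR (s - t) ⟨by linarith [hs.1], by linarith [hs.2]⟩, add_sub_cancel]

theorem exists_eq_of_le {f : ℝ → ℝ} (hf : Continuous f) {a b y : ℝ} (hab : a ≤ b) (ha : f a ≤ y)
    (hb : y ≤ f b) : ∃ t, a ≤ t ∧ f t = y := by
  obtain ⟨t, ht, h⟩ := intermediate_value_Icc hab hf.continuousOn ⟨ha, hb⟩
  exact ⟨t, ht.1, h⟩

/-- A geodesic that ascends at some time reaches all the greater heights below `3`. -/
theorem exists_height_eq_of_ascending {γ : ℝ → silo.Point} (hγ : IsGeodesic γ) {t₀ y : ℝ}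
    {D₀ : silo.V → ℝ} (hD : RGerm γ t₀ D₀) (h : 0 < lin lvl D₀) (h1 : 1 ≤ lin lvl (γ t₀))
    (hy : lin lvl (γ t₀) ≤ y) (hy3 : y < 3) : ∃ t, lin lvl (γ t) = y := by
  by_contra hne
  push Not at hne
  have hlt : ∀ t, t₀ ≤ t → lin lvl (γ t) < y := by
    intro t ht
    by_contra hc
    obtain ⟨s, -, hs⟩ := exists_eq_of_le (continuous_lin lvl hγ) ht hy (not_lt.1 hc)
    exact hne s hs
  set σ := lin lvl D₀ with hσ
  -- Starting at height at least 1 with the constant slope `σ`, the geodesic would be at height at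
  -- least 3 after the time `2 / σ`.
  have := (slope_propagate lvl hγ (T := t₀ + 2 / σ) (σ := σ) (P := fun s => s = σ)
    (fun s hs => hs.ge) hD rfl (fun s hs E D _ _ _ _ hO hval hE => ?_) (t₀ + 2 / σ)
    ⟨by have := div_pos two_pos h; linarith, le_rfl⟩).1
  · have h2 := hlt (t₀ + 2 / σ) (by have := div_pos two_pos h; linarith)
    rw [add_sub_cancel_left, mul_div_cancel₀ _ h.ne'] at this
    linarith
  · have := mul_pos h (sub_pos.2 hs.1)
    rw [slope_neg_of_opp hO (by linarith) (by linarith [hlt s hs.1.le])]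
    exact hE

/-- A geodesic that descends at some time reaches all the smaller heights above `1`. -/
theorem exists_height_eq_of_descending {γ : ℝ → silo.Point} (hγ : IsGeodesic γ) {t₀ y : ℝ}
    {D₀ : silo.V → ℝ} (hD : RGerm γ t₀ D₀) (h : lin lvl D₀ < 0) (h3 : lin lvl (γ t₀) ≤ 3)
    (hy : y ≤ lin lvl (γ t₀)) (hy1 : 1 < y) : ∃ t, lin lvl (γ t) = y := by
  by_contra hne
  push Not at hne
  have hlt : ∀ t, t₀ ≤ t → y < lin lvl (γ t) := by
    intro t ht
    by_contra hc
    obtain ⟨s, -, hs⟩ := exists_eq_of_le (f := fun t => -lin lvl (γ t)) (y := -y)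
      (continuous_lin lvl hγ).neg ht (by linarith) (by linarith [not_lt.1 hc])
    exact hne s (by linarith)
  set σ := lin (fun v => -lvl v) D₀ with hσ
  have hσ0 : 0 < σ := by rw [hσ, lin_neg_left]; linarith
  have := (slope_propagate (fun v => -lvl v) hγ (T := t₀ + 2 / σ) (σ := σ) (P := fun s => s = σ)
    (fun s hs => hs.ge) hD rfl (fun s hs E D _ _ _ _ hO hval hE => ?_) (t₀ + 2 / σ)
    ⟨by have := div_pos two_pos hσ0; linarith, le_rfl⟩).1
  · have h2 := hlt (t₀ + 2 / σ) (by have := div_pos two_pos hσ0; linarith)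
    rw [add_sub_cancel_left, mul_div_cancel₀ _ hσ0.ne', lin_neg_left, lin_neg_left] at this
    linarith
  · have := mul_pos hσ0 (sub_pos.2 hs.1)
    rw [lin_neg_left, lin_neg_left] at hval
    rw [lin_neg_left] at hE ⊢
    rw [slope_neg_of_opp hO (by linarith [hlt s hs.1.le]) (by linarith)]
    exact hE

/-- Below the cylinder the slope may change, but at edges it only grows. A vertex met on the way has
height at least 1 and is left ascending, so `exists_height_eq_of_ascending` applies from there. If
no vertex is met, the slope stays at least `σ`. -/
theorem exists_height_eq_of_ascending' {γ : ℝ → silo.Point} (hγ : IsGeodesic γ) {t₀ y : ℝ}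
    {D₀ : silo.V → ℝ} (hD : RGerm γ t₀ D₀) (h : 0 < lin lvl D₀) (h1 : 0 ≤ lin lvl (γ t₀))
    (hy : lin lvl (γ t₀) ≤ y) (hy3 : y < 3) : ∃ t, lin lvl (γ t) = y := by
  by_contra hne
  have hlt : ∀ t, t₀ ≤ t → lin lvl (γ t) < y := by
    intro t ht
    by_contra hc
    obtain ⟨s, -, hs⟩ := exists_eq_of_le (continuous_lin lvl hγ) ht hy (not_lt.1 hc)
    exact hne ⟨s, hs⟩
  have hslope : ∀ t, t₀ ≤ t → 1 ≤ lin lvl (γ t) → ∀ D, RGerm γ t D → lin lvl D ≤ 0 := by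
    intro t ht h1 D hD
    by_contra hc
    exact hne (exists_height_eq_of_ascending hγ hD (not_le.1 hc) h1 (hlt t ht).le hy3)
  set σ := lin lvl D₀ with hσ
  have := (slope_propagate lvl hγ (T := t₀ + 3 / σ) (σ := σ) (P := fun s => σ ≤ s)
    (fun s hs => hs) hD le_rfl (fun s hs E D hR _ _ _ hO hval hE => ?_) (t₀ + 3 / σ)
    ⟨by have := div_pos three_pos h; linarith, le_rfl⟩).1
  · have h2 := hlt (t₀ + 3 / σ) (by have := div_pos three_pos h; linarith)
    rw [add_sub_cancel_left, mul_div_cancel₀ _ h.ne'] at this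
    linarith
  · have hpos := mul_pos h (sub_pos.2 hs.1)
    rcases hO.cases with ⟨v, hv, hO⟩ | ⟨-, hO⟩
    · exfalso
      have hf := lin_vertex lvl hv
      have hv0 : 1 ≤ v.1 := by
        have : 0 < lvl v := by linarith
        rw [lvl] at this
        exact_mod_cast this
      have hle := hslope s hs.1.le (by rw [hf, lvl]; exact_mod_cast hv0) D hR
      by_cases h2 : v.1 = 2
      · rw [slope_neg_of_vOpp h2 hO] at hle; linarith
      · linarith [slope_pos_of_vOpp h2 hO (by linarith)]
    · linarith [slope_add_nonneg hO]

/-- Every line through the centre reaches all the heights of the cylinder. -/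
theorem exists_height_eq_of_zero {γ : ℝ → silo.Point} (hγ : IsGeodesic γ) {t₀ y : ℝ}
    (h : γ t₀ (vx 0 0) = 1) (hy : 0 ≤ y) (hy3 : y < 3) : ∃ t, lin lvl (γ t) = y := by
  obtain ⟨D, E, hR, hL, -, -, hO⟩ := (show GeodesicAt γ t₀ from hγ t₀).germs
  have h0 : lin lvl (γ t₀) = 0 := by rw [lin_vertex lvl h, lvl_vx, Nat.cast_zero]
  rcases le_or_gt (lin lvl E) 0 with hE | hE
  · have := slope_pos_of_vOpp (v := vx 0 0) (by decide) (hO.1 _ h) hE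
    exact exists_height_eq_of_ascending' hγ hR this h0.ge (by linarith) hy3
  · obtain ⟨t, ht⟩ := exists_height_eq_of_ascending' (t₀ := -t₀) (y := y) hγ.reverse hL.reverse hE
      (by simpa using h0.ge) (by simpa [h0] using hy) hy3
    exact ⟨-t, ht⟩

/-- A periodic geodesic has constant height. -/
theorem height_const_of_periodic {γ : ℝ → silo.Point} (hγ : IsGeodesic γ) {L : ℝ} (hL : 0 < L)
    (hper : ∀ t (k : ℤ), γ (t + k * L) = γ t) (t t' : ℝ) : lin lvl (γ t) = lin lvl (γ t') := by
  have key : ∀ t t', lin lvl (γ t) ≤ lin lvl (γ t') := by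
    intro t t'
    obtain ⟨D, E, hR, hE, -, -, hO⟩ := (show GeodesicAt γ t from hγ t).germs
    obtain ⟨k, hk⟩ := exists_nat_gt (|t - t'| / L)
    rw [div_lt_iff₀ hL] at hk
    have h1 := le_abs_self (t - t')
    have h2 := neg_abs_le (t - t')
    -- One of the two directions at `t` does not descend, and periodicity moves `t'` to this side of
    -- `t`.
    rcases le_or_gt 0 (lin lvl D) with h | h
    · have := height_le hγ hR h (t := t' + (k : ℤ) * L) (by push_cast; linarith)
      rwa [hper] at this
    · have hE0 : 0 ≤ lin lvl E := by
        by_contra hc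
        linarith [slope_nonneg_of_opp hO (not_le.1 hc).le]
      have := height_le_of_left hγ hE hE0 (t := t' + (-k : ℤ) * L) (by push_cast; linarith)
      rwa [hper] at this
  exact le_antisymm (key t t') (key t' t)

end SManifold

end


noncomputable section

namespace SManifold

open Set Topology

/-! ### Angles -/

/-- The shift of the ring `k`, in units of its edges. -/
def ringShift (k : ℕ) : ℝ := (min (k - 1) 2 : ℕ) / 2

/-- The angle of the `i`-th vertex of the ring `k`, as a fraction of the full circle. -/
def ang (k : ℕ) (i : ℤ) : ℝ := (i - ringShift k) / ringSize k

theorem ringSize_pos_real (k : ℕ) : (0 : ℝ) < ringSize k := by exact_mod_cast ringSize_pos k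

theorem ang_add_mul (k : ℕ) (i m : ℤ) : ang k (i + m * ringSize k) = ang k i + m := by
  have := ringSize_pos_real k
  rw [ang, ang]; push_cast; field_simp; ring

theorem ang_sub_ang (k : ℕ) (i j : ℤ) : ang k i - ang k j = (i - j) / ringSize k := by
  rw [ang, ang]; ring

theorem ang_mono (k : ℕ) {i j : ℤ} (h : i ≤ j) : ang k i ≤ ang k j := by
  have := ringSize_pos_real k
  have h' : (i : ℝ) ≤ j := by exact_mod_cast h
  rw [ang, ang]; gcongr

theorem ang_injective (k : ℕ) : Function.Injective (ang k) := by
  intro i j h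
  have := ringSize_pos_real k
  rw [ang, ang, div_left_inj' this.ne', sub_left_inj] at h
  exact_mod_cast h

theorem abs_ang_sub_le {k : ℕ} (hk : 1 ≤ k) (i : ℤ) : |ang k (i - 1) - ang k i| < 1 / 2 := by
  have h5 : (5 : ℝ) ≤ ringSize k := by exact_mod_cast five_le_ringSize hk
  rw [ang_sub_ang, abs_div, abs_of_pos (ringSize_pos_real k), div_lt_div_iff₀ (by linarith) two_pos]
  push_cast
  rw [show (i - 1 - i : ℝ) = -1 by ring, abs_neg, abs_one]
  linarith

/-- The shift is 0 up to ring 1, `1 / 2` on ring 2 and 1 from ring 3 on. It places the vertices of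
rings 2 and 3 over the midpoints of the edges below them, as in the unrolled cylinder, and it is
small enough not to spoil the closeness of the angles in a triangle. -/
theorem ringShift_div {k : ℕ} (hk : 1 ≤ k) :
    0 ≤ ringShift k / ringSize k ∧ ringShift k / ringSize k ≤ 1 / 5 := by
  have h5 : (5 : ℝ) ≤ ringSize k := by exact_mod_cast five_le_ringSize hk
  have h1 : ringShift k ≤ 1 := by
    rw [ringShift, div_le_one two_pos]
    exact_mod_cast min_le_right _ _
  have h0 : 0 ≤ ringShift k := by rw [ringShift]; positivity
  exact ⟨by positivity, by rw [div_le_div_iff₀ (by linarith) (by norm_num)]; nlinarith⟩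

theorem inv_ringSize {k : ℕ} (hk : 1 ≤ k) :
    0 < 1 / (ringSize k : ℝ) ∧ 1 / (ringSize k : ℝ) ≤ 1 / 5 := by
  have h5 : (5 : ℝ) ≤ ringSize k := by exact_mod_cast five_le_ringSize hk
  exact ⟨by positivity, one_div_le_one_div_of_le (by norm_num) h5⟩

theorem ang_eq (k : ℕ) (i : ℤ) : ang k i = i / ringSize k - ringShift k / ringSize k := by
  rw [ang]; ring

theorem dn_bounds {k : ℕ} {i j : ℤ} (h : dn k j = i) :
    (i / ringSize k : ℝ) < j / ringSize (k + 1) ∧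
      (j / ringSize (k + 1) : ℝ) ≤ i / ringSize k + 1 / ringSize k := by
  obtain ⟨h1, h2⟩ := dn_eq_iff.1 h
  rw [up, Int.ediv_lt_iff_lt_mul (ringSize_pos' k)] at h1
  rw [up, Int.le_ediv_iff_mul_le (ringSize_pos' k)] at h2
  have p1 := ringSize_pos_real k
  have p2 := ringSize_pos_real (k + 1)
  have h1' : (ringSize (k + 1) * i : ℝ) < j * ringSize k := by exact_mod_cast h1
  have h2' : (j * ringSize k : ℝ) ≤ ringSize (k + 1) * (i + 1) := by exact_mod_cast h2
  refine ⟨by rw [div_lt_div_iff₀ p1 p2]; linarith, ?_⟩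
  rw [← add_div, div_le_div_iff₀ p2 p1]; linarith

theorem up_bounds {k : ℕ} {i j : ℤ} (h : up k i = j) :
    (j / ringSize (k + 1) : ℝ) ≤ i / ringSize k ∧
      (i / ringSize k : ℝ) < j / ringSize (k + 1) + 1 / ringSize (k + 1) := by
  have h1 : j ≤ up k i := h.ge
  have h2 : up k i < j + 1 := by omega
  rw [up, Int.le_ediv_iff_mul_le (ringSize_pos' k)] at h1
  rw [up, Int.ediv_lt_iff_lt_mul (ringSize_pos' k)] at h2
  have p1 := ringSize_pos_real k
  have p2 := ringSize_pos_real (k + 1)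
  have h1' : (j * ringSize k : ℝ) ≤ ringSize (k + 1) * i := by exact_mod_cast h1
  have h2' : (ringSize (k + 1) * i : ℝ) < (j + 1) * ringSize k := by exact_mod_cast h2
  refine ⟨by rw [div_le_div_iff₀ p2 p1]; linarith, ?_⟩
  rw [← add_div, div_lt_div_iff₀ p1 p2]; linarith

theorem ang_sub_one (k : ℕ) (i : ℤ) : ang k (i - 1) = ang k i - 1 / ringSize k := by
  rw [ang, ang]; push_cast; ring

/-- `a` assigns angles to the vertices of the triangle `τ` in such a way that they come from one
lift of `τ`. -/
structure IsLift (τ : Finset silo.V) (a : silo.V → ℝ) : Prop where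
  mem : τ ∈ silo.triangles
  zero : a (vx 0 0) = 0
  lift : ∀ v ∈ τ, v.1 ≠ 0 → ∃ i, v = vx v.1 i ∧ a v = ang v.1 i
  close : ∀ v ∈ τ, ∀ w ∈ τ, v.1 ≠ 0 → w.1 ≠ 0 → |a v - a w| < 1 / 2

theorem vx_ne_zero {k : ℕ} (hk : 1 ≤ k) (i : ℤ) : vx 0 0 ≠ vx k i := vx_ne_of_level (by omega) _ _

theorem isLift_of_triple {u v w : silo.V} (hT : {u, v, w} ∈ silo.triangles) {x y z : ℝ}
    {ku kv kw : ℕ} {iu iv iw : ℤ} (hu : u = vx ku iu) (hv : v = vx kv iv) (hw : w = vx kw iw)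
    (hku : 1 ≤ ku) (hkv : 1 ≤ kv) (hkw : 1 ≤ kw) (hx : x = ang ku iu) (hy : y = ang kv iv)
    (hz : z = ang kw iw) (h1 : |x - y| < 1 / 2) (h2 : |y - z| < 1 / 2) (h3 : |x - z| < 1 / 2) :
    IsLift {u, v, w} (triVec u v w x y z) := by
  obtain ⟨e1, e2, e3⟩ := triVec_apply hT x y z
  have h0 : |x - x| < 1 / 2 ∧ |y - y| < 1 / 2 ∧ |z - z| < 1 / 2 := by simp
  refine ⟨hT, triVec_of_notMem _ _ _ ?_, ?_, ?_⟩
  · intro hm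
    rcases Finset.mem_insert.1 hm with h | h
    · exact vx_ne_zero hku iu (h.trans hu)
    rcases Finset.mem_insert.1 h with h | h
    · exact vx_ne_zero hkv iv (h.trans hv)
    · exact vx_ne_zero hkw iw ((Finset.mem_singleton.1 h).trans hw)
  · intro q hq _
    rcases Finset.mem_insert.1 hq with rfl | h
    · exact ⟨iu, by subst hu; rfl, by rw [e1, hx]; subst hu; rfl⟩
    rcases Finset.mem_insert.1 h with rfl | h
    · exact ⟨iv, by subst hv; rfl, by rw [e2, hy]; subst hv; rfl⟩
    · obtain rfl := Finset.mem_singleton.1 h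
      exact ⟨iw, by subst hw; rfl, by rw [e3, hz]; subst hw; rfl⟩
  · have key : ∀ q ∈ ({u, v, w} : Finset silo.V), triVec u v w x y z q = x ∨
        triVec u v w x y z q = y ∨ triVec u v w x y z q = z := by
      intro q hq
      rcases Finset.mem_insert.1 hq with rfl | h
      · exact Or.inl e1
      rcases Finset.mem_insert.1 h with rfl | h
      · exact Or.inr (Or.inl e2)
      · obtain rfl := Finset.mem_singleton.1 h
        exact Or.inr (Or.inr e3)
    intro p hp q hq _ _
    rcases key p hp with h | h | h <;> rcases key q hq with h' | h' | h' <;> rw [h, h'] <;>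
      first | tauto | (rw [abs_sub_comm]; assumption)

theorem inner_mem (k : ℕ) (j : ℤ) : inner k j ∈ silo.triangles := Or.inl ⟨k, j, rfl⟩

theorem outer_mem {k : ℕ} (hk : 1 ≤ k) (i : ℤ) : outer k i ∈ silo.triangles :=
  Or.inr ⟨k, i, hk, rfl⟩

theorem isLift_inner {k : ℕ} (hk : 1 ≤ k) (j : ℤ) :
    IsLift (inner k j) (triVec (M := silo) (vx (k + 1) (j - 1)) (vx (k + 1) j) (vx k (dn k j))
      (ang (k + 1) (j - 1)) (ang (k + 1) j) (ang k (dn k j))) := by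
  obtain ⟨h1, h2⟩ := dn_bounds (k := k) (j := j) rfl
  have h3 := ringShift_div hk
  have h4 := ringShift_div (k := k + 1) (by omega)
  have h5 := inv_ringSize hk
  have h6 := inv_ringSize (k := k + 1) (by omega)
  refine isLift_of_triple (inner_mem k j) rfl rfl rfl (by omega) (by omega) hk rfl rfl rfl
    (abs_ang_sub_le (by omega) j) ?_ ?_
  · rw [ang_eq, ang_eq, _root_.abs_lt]; constructor <;> linarith
  · rw [ang_sub_one, ang_eq, ang_eq, _root_.abs_lt]; constructor <;> linarith

theorem isLift_outer {k : ℕ} (hk : 1 ≤ k) (i : ℤ) :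
    IsLift (outer k i) (triVec (M := silo) (vx k (i - 1)) (vx k i) (vx (k + 1) (up k i))
      (ang k (i - 1)) (ang k i) (ang (k + 1) (up k i))) := by
  obtain ⟨h1, h2⟩ := up_bounds (k := k) (i := i) rfl
  have h3 := ringShift_div hk
  have h4 := ringShift_div (k := k + 1) (by omega)
  have h5 := inv_ringSize hk
  have h6 := inv_ringSize (k := k + 1) (by omega)
  refine isLift_of_triple (outer_mem hk i) rfl rfl rfl hk hk (by omega) rfl rfl rfl
    (abs_ang_sub_le hk i) ?_ ?_
  · rw [ang_eq, ang_eq, _root_.abs_lt]; constructor <;> linarith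
  · rw [ang_sub_one, ang_eq, ang_eq, _root_.abs_lt]; constructor <;> linarith

theorem isLift_inner_zero (j : ℤ) :
    IsLift (inner 0 j) (triVec (M := silo) (vx 1 (j - 1)) (vx 1 j) (vx 0 (dn 0 j))
      (ang 1 (j - 1)) (ang 1 j) 0) := by
  obtain ⟨e1, e2, e3⟩ := triVec_apply (M := silo) (inner_mem 0 j) (ang 1 (j - 1)) (ang 1 j) 0
  have key : ∀ q ∈ inner 0 j, q.1 ≠ 0 → q = vx 1 (j - 1) ∨ q = vx 1 j := by
    intro q hq h0
    rw [inner, Finset.mem_insert, Finset.mem_insert, Finset.mem_singleton] at hq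
    rcases hq with h | h | rfl
    · exact Or.inl h
    · exact Or.inr h
    · exact absurd rfl h0
  have hab := abs_ang_sub_le (k := 1) le_rfl j
  refine ⟨inner_mem 0 j, by rw [← vx_zero (dn 0 j)]; exact e3, fun v hv h0 => ?_,
    fun v hv w hw h0 h0' => ?_⟩
  · rcases key v hv h0 with rfl | rfl
    · exact ⟨_, rfl, e1⟩
    · exact ⟨_, rfl, e2⟩
  · rcases key v hv h0 with rfl | rfl <;> rcases key w hw h0' with rfl | rfl
    · simp
    · erw [e1, e2]; exact hab
    · erw [e1, e2]; rw [abs_sub_comm]; exact hab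
    · simp

/-- `x` is the angle of `p`, as a fraction of the full circle, for one of the lifts of `p`. -/
def HasAngle (p : silo.Point) (x : ℝ) : Prop :=
  ∃ τ a, IsLift τ a ∧ p.MemTriangle τ ∧ lin a p = x * (1 - p (vx 0 0))

theorem sum_off {M : SManifold} (o : M.V) {τ : Finset M.V} {p : M.Point} (hp : p.MemTriangle τ) :
    ∑ v ∈ τ, p v * (if v = o then 0 else 1) = 1 - p o := by
  have h1 := p.sum_eq_one hp
  have h2 : ∑ v ∈ τ, p v * (if v = o then 1 else 0) = p o := by
    simp only [mul_ite, mul_one, mul_zero]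
    rw [Finset.sum_ite_eq']
    split_ifs with h
    · rfl
    · exact (hp _ h).symm
  have h3 : ∑ v ∈ τ, p v * (if v = o then 0 else 1) + ∑ v ∈ τ, p v * (if v = o then 1 else 0) =
      1 := by
    rw [← Finset.sum_add_distrib]
    refine (Finset.sum_congr rfl fun v _ => ?_).trans h1
    split_ifs <;> ring
  linarith

/-- The angles of a vertex in two lifts differ by an integer. Since angles within a triangle differ
by less than `1 / 2`, it is the same integer for all vertices that carry weight. The centre has no
angle and is taken out by the factor `1 - p (vx 0 0)`. -/
theorem HasAngle.unique {p : silo.Point} (hp : p (vx 0 0) ≠ 1) {x x' : ℝ} (h : HasAngle p x)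
    (h' : HasAngle p x') : ∃ m : ℤ, x = x' + m := by
  obtain ⟨τ, a, ha, hτ, hx⟩ := h
  obtain ⟨τ', a', ha', hτ', hx'⟩ := h'
  have h1 : 0 < 1 - p (vx 0 0) := sub_pos.2 (lt_of_le_of_ne (p.le_one _) hp)
  have hm : ∀ v : silo.V, 0 < p v → v ≠ vx 0 0 → v ∈ τ ∧ v ∈ τ' ∧ v.1 ≠ 0 ∧
      ∃ m : ℤ, a v = a' v + m := by
    intro v hv h0
    have h0' : v.1 ≠ 0 := fun h => h0 (eq_vx_zero h)
    refine ⟨p.mem_of_pos hτ hv, p.mem_of_pos hτ' hv, h0', ?_⟩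
    obtain ⟨i, e1, e2⟩ := ha.lift v (p.mem_of_pos hτ hv) h0'
    obtain ⟨i', e1', e2'⟩ := ha'.lift v (p.mem_of_pos hτ' hv) h0'
    obtain ⟨m, hm⟩ := vx_eq_iff.1 (e1'.symm.trans e1)
    exact ⟨m, by rw [e2, e2', show i = i' + m * ringSize v.1 by linarith, ang_add_mul]⟩
  obtain ⟨v, hv, hv0⟩ : ∃ v, 0 < p v ∧ v ≠ vx 0 0 := by
    by_contra hc
    push Not at hc
    have := sum_off (M := silo) (vx 0 0) hτ
    rw [Finset.sum_eq_zero] at this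
    · linarith
    · intro v _
      split_ifs with h
      · simp
      · rcases (p.nonneg v).eq_or_lt with h' | h'
        · rw [← h', zero_mul]
        · exact absurd (hc v h') h
  obtain ⟨v1, v2, v3, m, hm0⟩ := hm v hv hv0
  refine ⟨m, ?_⟩
  have hall : ∀ w, 0 < p w → w ≠ vx 0 0 → a w = a' w + m := by
    intro w hw hw0
    obtain ⟨w1, w2, w3, m', hm'⟩ := hm w hw hw0
    have c1 := _root_.abs_lt.1 (ha.close v v1 w w1 v3 w3)
    have c2 := _root_.abs_lt.1 (ha'.close v v2 w w2 v3 w3)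
    have d1 : (m : ℝ) - m' < 1 := by linarith
    have d2 : (m' : ℝ) - m < 1 := by linarith
    have d1' : m - m' < 1 := by exact_mod_cast d1
    have d2' : m' - m < 1 := by exact_mod_cast d2
    rw [hm', show m' = m by omega]
  have key : lin a p = lin a' p + m * (1 - p (vx 0 0)) := by
    rw [← sum_off (M := silo) (vx 0 0) hτ, lin_eq_sum a hτ, lin_eq_sum a' hτ, Finset.mul_sum,
      ← Finset.sum_add_distrib]
    refine Finset.sum_congr rfl fun w _ => ?_
    rcases (p.nonneg w).eq_or_lt with h' | h'
    · rw [← h']; ring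
    · split_ifs with h
      · subst h; rw [ha.zero, ha'.zero]; ring
      · rw [hall w h' h]; ring
  rw [hx, hx', ← add_mul] at key
  exact mul_right_cancel₀ h1.ne' key

open Classical in
/-- An angle of `p`, as a fraction of the full circle. -/
def angle (p : silo.Point) : ℝ := if h : ∃ x, HasAngle p x then h.choose else 0

theorem hasAngle_angle {p : silo.Point} {x : ℝ} (h : HasAngle p x) : HasAngle p (angle p) := by
  have hex : ∃ x, HasAngle p x := ⟨x, h⟩
  rw [angle, dif_pos hex]
  exact hex.choose_spec

/-- The map of the model onto the plane. -/
def toPlane (p : silo.Point) : ℂ :=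
  lin lvl p * Complex.exp (2 * Real.pi * (angle p : ℝ) * Complex.I)

theorem exp_add_int (x : ℝ) (m : ℤ) : Complex.exp (2 * Real.pi * (x + m : ℝ) * Complex.I) =
    Complex.exp (2 * Real.pi * x * Complex.I) := by
  rw [Complex.exp_eq_exp_iff_exists_int]
  exact ⟨m, by push_cast; ring⟩

theorem lvl_nonneg (v : silo.V) : 0 ≤ lvl v := Nat.cast_nonneg _

theorem lin_nonneg {M : SManifold} {F : M.V → ℝ} (hF : ∀ v, 0 ≤ F v) (p : M.Point) :
    0 ≤ lin F p := by
  obtain ⟨τ, -, hτ⟩ := p.exists_triangle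
  rw [lin_eq_sum F hτ]
  exact Finset.sum_nonneg fun v _ => mul_nonneg (p.nonneg v) (hF v)

/-- Any angle may be used: the exponential does not see the integer ambiguity, and at the centre the
height is 0. -/
theorem toPlane_eq {p : silo.Point} {x : ℝ} (h : HasAngle p x) :
    toPlane p = lin lvl p * Complex.exp (2 * Real.pi * x * Complex.I) := by
  by_cases hp : p (vx 0 0) = 1
  · rw [toPlane, lin_vertex lvl hp, lvl_vx]; simp
  · obtain ⟨m, hm⟩ := (hasAngle_angle h).unique hp h
    rw [toPlane, hm, exp_add_int]

theorem norm_toPlane (p : silo.Point) : ‖toPlane p‖ = lin lvl p := by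
  rw [toPlane, norm_mul, Complex.norm_real, Real.norm_of_nonneg (lin_nonneg lvl_nonneg p),
    ← Complex.ofReal_ofNat, ← Complex.ofReal_mul, ← Complex.ofReal_mul,
    Complex.norm_exp_ofReal_mul_I, mul_one]

end SManifold

end


noncomputable section

namespace SManifold

open Set Topology

/-! ### The rungs between two rings -/

/-- The index on the ring `k` of the lower end of the `n`-th edge between the rings `k` and
`k + 1`; the index of the upper end is `n - rung k n`. -/
def rung (k : ℕ) (n : ℤ) : ℤ :=
  (ringSize k * (n + 1) - 1) / (ringSize k + ringSize (k + 1))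

/-- The vertices `i` and `j` of successive rings are joined when `up k i ≤ j ≤ up k (i + 1)`. Around
the annulus these edges are ordered by `n = i + j`, and each integer `n` occurs once. -/
theorem rung_eq_iff {k : ℕ} {n i : ℤ} :
    rung k n = i ↔ up k i ≤ n - i ∧ n - i ≤ up k (i + 1) := by
  have p1 := ringSize_pos' k
  have p2 := ringSize_pos' (k + 1)
  have p3 : 0 < (ringSize k + ringSize (k + 1) : ℤ) := by omega
  have e1 : up k i ≤ n - i ↔ i ≤ rung k n := by
    rw [← Int.lt_add_one_iff, up, Int.ediv_lt_iff_lt_mul p1, rung, Int.le_ediv_iff_mul_le p3]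
    constructor <;> intro h <;> nlinarith
  have e2 : n - i ≤ up k (i + 1) ↔ rung k n < i + 1 := by
    rw [up, Int.le_ediv_iff_mul_le p1, rung, Int.ediv_lt_iff_lt_mul p3]
    constructor <;> intro h <;> nlinarith
  rw [e1, e2]; omega

theorem rung_bounds (k : ℕ) (n : ℤ) :
    up k (rung k n) ≤ n - rung k n ∧ n - rung k n ≤ up k (rung k n + 1) := rung_eq_iff.1 rfl

/-- From one edge to the next exactly one end advances, according to whether the triangle in between
has its base on the outer or on the inner ring. -/
theorem rung_succ (k : ℕ) (n : ℤ) :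
    (rung k (n + 1) = rung k n ∧ dn k (n + 1 - rung k n) = rung k n) ∨
      (rung k (n + 1) = rung k n + 1 ∧ up k (rung k n + 1) = n - rung k n) := by
  obtain ⟨h1, h2⟩ := rung_bounds k n
  rcases h2.lt_or_eq with h | h
  · left
    rw [rung_eq_iff, dn_eq_iff]
    omega
  · right
    have := up_lt_up k (rung k n + 1)
    rw [rung_eq_iff]
    omega

theorem rung_add_mul (k : ℕ) (n m : ℤ) :
    rung k (n + m * (ringSize k + ringSize (k + 1))) = rung k n + m * ringSize k := by
  have p1 := ringSize_pos' k
  have p2 := ringSize_pos' (k + 1)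
  rw [rung, rung, show (ringSize k * (n + m * (ringSize k + ringSize (k + 1)) + 1) - 1 : ℤ)
    = ringSize k * (n + 1) - 1 + m * ringSize k * (ringSize k + ringSize (k + 1)) by ring,
    Int.add_mul_ediv_right _ _ (by omega)]

/-- The barycentric coordinates of the point of the segment from `a` to `b` that divides it in the
ratio `s : 1 - s`. -/
def seg {V : Type} [DecidableEq V] (s : ℝ) (a b : V) (v : V) : ℝ :=
  (1 - s) * (if v = a then 1 else 0) + s * (if v = b then 1 else 0)

/-- The point at the height `k + s` of the `n`-th edge between the rings `k` and `k + 1`. -/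
def rungPt (k : ℕ) (s : ℝ) (n : ℤ) : silo.V → ℝ :=
  seg (V := silo.V) s (vx k (rung k n)) (vx (k + 1) (n - rung k n))

/-- The points at the height `k + s` between two successive edges. -/
def cellPt (k : ℕ) (s : ℝ) (n : ℤ) (r : ℝ) (v : silo.V) : ℝ :=
  (1 - r) * rungPt k s n v + r * rungPt k s (n + 1) v

theorem exists_cell_triangle (k : ℕ) (n : ℤ) : ∃ τ ∈ silo.triangles,
    vx k (rung k n) ∈ τ ∧ vx (k + 1) (n - rung k n) ∈ τ ∧ vx k (rung k (n + 1)) ∈ τ ∧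
      vx (k + 1) (n + 1 - rung k (n + 1)) ∈ τ := by
  rcases rung_succ k n with ⟨h1, h2⟩ | ⟨h1, h2⟩
  · refine ⟨inner k (n + 1 - rung k n), inner_mem _ _, ?_, ?_, ?_, ?_⟩
    · exact mem_inner.2 (Or.inr ⟨rfl, by rw [h2]⟩)
    · exact mem_inner.2 (Or.inl ⟨rfl, Or.inl (by congr 1; ring)⟩)
    · exact mem_inner.2 (Or.inr ⟨rfl, by rw [h1, h2]⟩)
    · exact mem_inner.2 (Or.inl ⟨rfl, Or.inr (by rw [h1])⟩)
  · have e : n + 1 - rung k (n + 1) = n - rung k n := by omega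
    rw [e]
    -- For `k = 0` the lower end advances from the centre to itself: once per turn the cell
    -- degenerates to an edge.
    rcases Nat.eq_zero_or_pos k with rfl | hk
    · refine ⟨inner 0 (n - rung 0 n), inner_mem _ _, ?_, ?_, ?_, ?_⟩
      · exact mem_inner.2 (Or.inr ⟨rfl, by rw [vx_zero, ← vx_zero (dn 0 _)]⟩)
      · exact mem_inner.2 (Or.inl ⟨rfl, Or.inr rfl⟩)
      · exact mem_inner.2 (Or.inr ⟨rfl, by rw [vx_zero, ← vx_zero (dn 0 _)]⟩)
      · exact mem_inner.2 (Or.inl ⟨rfl, Or.inr rfl⟩)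
    · refine ⟨outer k (rung k n + 1), outer_mem hk _, ?_, ?_, ?_, ?_⟩
      · exact mem_outer.2 (Or.inl ⟨rfl, Or.inl (by rw [add_sub_cancel_right])⟩)
      · exact mem_outer.2 (Or.inr ⟨rfl, by rw [h2]⟩)
      · exact mem_outer.2 (Or.inl ⟨rfl, Or.inr (by rw [h1])⟩)
      · exact mem_outer.2 (Or.inr ⟨rfl, by rw [h2]⟩)

theorem seg_nonneg {V : Type} [DecidableEq V] {s : ℝ} (h0 : 0 ≤ s) (h1 : s ≤ 1) (a b v : V) :
    0 ≤ seg s a b v := by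
  have : 0 ≤ 1 - s := by linarith
  rw [seg]; positivity

theorem sum_seg {V : Type} [DecidableEq V] (s : ℝ) {a b : V} {τ : Finset V} (ha : a ∈ τ)
    (hb : b ∈ τ) (F : V → ℝ) : ∑ v ∈ τ, seg s a b v * F v = (1 - s) * F a + s * F b := by
  simp only [seg, add_mul, mul_assoc, ite_mul, one_mul, zero_mul, Finset.sum_add_distrib,
    ← Finset.mul_sum, Finset.sum_ite_eq', ha, hb, if_true]

theorem seg_of_ne {V : Type} [DecidableEq V] (s : ℝ) {a b v : V} (h1 : v ≠ a) (h2 : v ≠ b) :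
    seg s a b v = 0 := by simp [seg, h1, h2]

theorem seg_of_eq_left {V : Type} [DecidableEq V] (s : ℝ) {a b v : V} (h1 : v = a) (h2 : v ≠ b) :
    seg s a b v = 1 - s := by subst h1; simp [seg, h2]

theorem seg_of_notMem {V : Type} [DecidableEq V] (s : ℝ) {a b v : V} {τ : Finset V} (ha : a ∈ τ)
    (hb : b ∈ τ) (hv : v ∉ τ) : seg s a b v = 0 := by
  have h1 : v ≠ a := fun h => hv (h ▸ ha)
  have h2 : v ≠ b := fun h => hv (h ▸ hb)
  simp [seg, h1, h2]

theorem cellPt_of_notMem {k : ℕ} {s : ℝ} {n : ℤ} {r : ℝ} {τ : Finset silo.V}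
    (h1 : vx k (rung k n) ∈ τ) (h2 : vx (k + 1) (n - rung k n) ∈ τ)
    (h3 : vx k (rung k (n + 1)) ∈ τ) (h4 : vx (k + 1) (n + 1 - rung k (n + 1)) ∈ τ) {v : silo.V}
    (hv : v ∉ τ) : cellPt k s n r v = 0 := by
  rw [cellPt, rungPt, rungPt, seg_of_notMem (V := silo.V) s h1 h2 hv,
    seg_of_notMem (V := silo.V) s h3 h4 hv]; ring

theorem sum_cellPt {k : ℕ} {s : ℝ} {n : ℤ} {r : ℝ} {τ : Finset silo.V}
    (h1 : vx k (rung k n) ∈ τ) (h2 : vx (k + 1) (n - rung k n) ∈ τ)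
    (h3 : vx k (rung k (n + 1)) ∈ τ) (h4 : vx (k + 1) (n + 1 - rung k (n + 1)) ∈ τ)
    (F : silo.V → ℝ) : ∑ v ∈ τ, cellPt k s n r v * F v =
      (1 - r) * ((1 - s) * F (vx k (rung k n)) + s * F (vx (k + 1) (n - rung k n))) +
        r * ((1 - s) * F (vx k (rung k (n + 1))) + s * F (vx (k + 1) (n + 1 - rung k (n + 1)))) := by
  simp only [cellPt, rungPt, add_mul, mul_assoc, Finset.sum_add_distrib, ← Finset.mul_sum]
  rw [sum_seg (V := silo.V) s h1 h2, sum_seg (V := silo.V) s h3 h4]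

theorem exists_cell_point (k : ℕ) {s : ℝ} (hs0 : 0 ≤ s) (hs1 : s ≤ 1) (n : ℤ) {r : ℝ} (hr0 : 0 ≤ r)
    (hr1 : r ≤ 1) : ∃ p : silo.Point, ∀ v, p v = cellPt k s n r v := by
  obtain ⟨τ, hτ, h1, h2, h3, h4⟩ := exists_cell_triangle k n
  have : 0 ≤ 1 - r := by linarith
  refine ⟨mkPoint hτ (cellPt k s n r) (fun v => ?_) (fun v => cellPt_of_notMem h1 h2 h3 h4) ?_,
    fun _ => rfl⟩
  · exact add_nonneg (mul_nonneg this (seg_nonneg hs0 hs1 _ _ _))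
      (mul_nonneg hr0 (seg_nonneg hs0 hs1 _ _ _))
  · have := sum_cellPt (s := s) (r := r) h1 h2 h3 h4 (fun _ => 1)
    simp only [mul_one] at this
    rw [this]; ring

theorem lin_cellPt (F : silo.V → ℝ) (k : ℕ) (s : ℝ) (n : ℤ) (r : ℝ) : lin F (cellPt k s n r) =
    (1 - r) * ((1 - s) * F (vx k (rung k n)) + s * F (vx (k + 1) (n - rung k n))) +
      r * ((1 - s) * F (vx k (rung k (n + 1))) + s * F (vx (k + 1) (n + 1 - rung k (n + 1)))) := by
  obtain ⟨τ, hτ, h1, h2, h3, h4⟩ := exists_cell_triangle k n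
  rw [lin_eq_sum F fun v => cellPt_of_notMem h1 h2 h3 h4, sum_cellPt h1 h2 h3 h4]

theorem lvl_cellPt (k : ℕ) (s : ℝ) (n : ℤ) (r : ℝ) : lin lvl (cellPt k s n r) = k + s := by
  rw [lin_cellPt]; simp only [lvl_vx]; push_cast; ring

/-- The angle at the height `k + s` of the `n`-th edge between the rings `k` and `k + 1`. -/
def rungAng (k : ℕ) (s : ℝ) (n : ℤ) : ℝ :=
  if k = 0 then ang 1 (n - rung k n)
  else (1 - s) * ang k (rung k n) + s * ang (k + 1) (n - rung k n)

theorem isLift_cell (k : ℕ) (n : ℤ) : ∃ τ a, IsLift τ a ∧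
    vx k (rung k n) ∈ τ ∧ vx (k + 1) (n - rung k n) ∈ τ ∧ vx k (rung k (n + 1)) ∈ τ ∧
      vx (k + 1) (n + 1 - rung k (n + 1)) ∈ τ ∧
      (k ≠ 0 → a (vx k (rung k n)) = ang k (rung k n)) ∧
      a (vx (k + 1) (n - rung k n)) = ang (k + 1) (n - rung k n) ∧
      (k ≠ 0 → a (vx k (rung k (n + 1))) = ang k (rung k (n + 1))) ∧
      a (vx (k + 1) (n + 1 - rung k (n + 1))) = ang (k + 1) (n + 1 - rung k (n + 1)) := by
  rcases rung_succ k n with ⟨h1, h2⟩ | ⟨h1, h2⟩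
  · set j := n + 1 - rung k n with hj
    have e1 : n - rung k n = j - 1 := by omega
    have e2 : n + 1 - rung k (n + 1) = j := by omega
    have m : vx k (rung k n) ∈ inner k j ∧ vx (k + 1) (j - 1) ∈ inner k j ∧
        vx k (rung k n) ∈ inner k j ∧ vx (k + 1) j ∈ inner k j :=
      ⟨mem_inner.2 (Or.inr ⟨rfl, by rw [h2]⟩), mem_inner.2 (Or.inl ⟨rfl, Or.inl rfl⟩),
        mem_inner.2 (Or.inr ⟨rfl, by rw [h2]⟩), mem_inner.2 (Or.inl ⟨rfl, Or.inr rfl⟩)⟩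
    rw [e1, e2, h1]
    rcases Nat.eq_zero_or_pos k with rfl | hk
    · obtain ⟨a1, a2, a3⟩ := triVec_apply (M := silo) (inner_mem 0 j) (ang 1 (j - 1)) (ang 1 j) 0
      exact ⟨_, _, isLift_inner_zero j, m.1, m.2.1, m.2.2.1, m.2.2.2, fun h => absurd rfl h, a1,
        fun h => absurd rfl h, a2⟩
    · obtain ⟨a1, a2, a3⟩ := triVec_apply (M := silo) (inner_mem k j) (ang (k + 1) (j - 1))
        (ang (k + 1) j) (ang k (dn k j))
      rw [h2] at a1 a2 a3
      have hl := isLift_inner hk j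
      rw [h2] at hl
      exact ⟨_, _, hl, m.1, m.2.1, m.2.2.1, m.2.2.2, fun _ => a3, a1, fun _ => a3, a2⟩
  · have e1 : n + 1 - rung k (n + 1) = n - rung k n := by omega
    rw [e1]
    rcases Nat.eq_zero_or_pos k with rfl | hk
    · obtain ⟨a1, a2, a3⟩ := triVec_apply (M := silo) (inner_mem 0 (n - rung 0 n))
        (ang 1 (n - rung 0 n - 1)) (ang 1 (n - rung 0 n)) 0
      have m0 : ∀ i, vx 0 i ∈ inner 0 (n - rung 0 n) := fun i =>
        mem_inner.2 (Or.inr ⟨rfl, by rw [vx_zero, ← vx_zero (dn 0 _)]⟩)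
      have m1 : vx 1 (n - rung 0 n) ∈ inner 0 (n - rung 0 n) :=
        mem_inner.2 (Or.inl ⟨rfl, Or.inr rfl⟩)
      exact ⟨_, _, isLift_inner_zero (n - rung 0 n), m0 _, m1, m0 _, m1, fun h => absurd rfl h, a2,
        fun h => absurd rfl h, a2⟩
    · obtain ⟨a1, a2, a3⟩ := triVec_apply (M := silo) (outer_mem hk (rung k n + 1))
        (ang k (rung k n + 1 - 1)) (ang k (rung k n + 1)) (ang (k + 1) (up k (rung k n + 1)))
      have hl := isLift_outer hk (rung k n + 1)
      rw [h2, add_sub_cancel_right] at a1 a2 a3 hl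
      rw [h1]
      exact ⟨_, _, hl, mem_outer.2 (Or.inl ⟨rfl, Or.inl (by rw [add_sub_cancel_right])⟩),
        mem_outer.2 (Or.inr ⟨rfl, by rw [h2]⟩), mem_outer.2 (Or.inl ⟨rfl, Or.inr rfl⟩),
        mem_outer.2 (Or.inr ⟨rfl, by rw [h2]⟩), fun _ => a1, a3, fun _ => a2, a3⟩

theorem hasAngle_cellPt {k : ℕ} {s : ℝ} {n : ℤ} {r : ℝ} {p : silo.Point}
    (hp : ∀ v, p v = cellPt k s n r v) :
    HasAngle p ((1 - r) * rungAng k s n + r * rungAng k s (n + 1)) := by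
  have hp' : (p : silo.V → ℝ) = cellPt k s n r := funext hp
  obtain ⟨τ, a, ha, h1, h2, h3, h4, a1, a2, a3, a4⟩ := isLift_cell k n
  refine ⟨τ, a, ha, fun v hv => by rw [hp]; exact cellPt_of_notMem h1 h2 h3 h4 hv, ?_⟩
  have e0 : cellPt k s n r (vx 0 0) =
      (1 - r) * seg (V := silo.V) s (vx k (rung k n)) (vx (k + 1) (n - rung k n)) (vx 0 0) +
      r * seg (V := silo.V) s (vx k (rung k (n + 1))) (vx (k + 1) (n + 1 - rung k (n + 1)))
        (vx 0 0) := rfl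
  rw [hp', lin_cellPt, a2, a4, e0]
  rcases Nat.eq_zero_or_pos k with rfl | hk
  · have z : ∀ i, a (vx 0 i) = 0 := fun i => by rw [vx_zero, ha.zero]
    have z1 : ∀ i j, seg (V := silo.V) s (vx 0 i) (vx (0 + 1) j) (vx 0 0) = 1 - s := fun i j =>
      seg_of_eq_left s (vx_zero i).symm (vx_ne_zero le_rfl j)
    rw [z, z, z1, z1, rungAng, if_pos rfl, rungAng, if_pos rfl]
    ring
  · have z1 : ∀ i j, seg (V := silo.V) s (vx k i) (vx (k + 1) j) (vx 0 0) = 0 := fun i j =>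
      seg_of_ne s (vx_ne_zero hk i) (vx_ne_zero (by omega) j)
    rw [a1 hk.ne', a3 hk.ne', z1, z1, rungAng, if_neg hk.ne', rungAng, if_neg hk.ne']
    ring

theorem rungAng_le_succ (k : ℕ) {s : ℝ} (h0 : 0 ≤ s) (h1 : s ≤ 1) (n : ℤ) :
    rungAng k s n ≤ rungAng k s (n + 1) := by
  have hs : 0 ≤ 1 - s := by linarith
  have i1 : rung k n ≤ rung k (n + 1) := by rcases rung_succ k n with h | h <;> omega
  have i2 : n - rung k n ≤ n + 1 - rung k (n + 1) := by rcases rung_succ k n with h | h <;> omega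
  rw [rungAng, rungAng]
  split_ifs with h
  · exact ang_mono _ i2
  · have := ang_mono k i1
    have := ang_mono (k + 1) i2
    gcongr

theorem rungAng_mono (k : ℕ) {s : ℝ} (h0 : 0 ≤ s) (h1 : s ≤ 1) : Monotone (rungAng k s) :=
  monotone_int_of_le_succ (rungAng_le_succ k h0 h1)

theorem rungAng_add_mul (k : ℕ) (s : ℝ) (n m : ℤ) :
    rungAng k s (n + m * (ringSize k + ringSize (k + 1))) = rungAng k s n + m := by
  have e : n + m * (ringSize k + ringSize (k + 1)) - (rung k n + m * ringSize k) =
    n - rung k n + m * ringSize (k + 1) := by ring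
  rw [rungAng, rungAng, rung_add_mul, e]
  split_ifs with h
  · subst h; rw [ang_add_mul]
  · rw [ang_add_mul, ang_add_mul]; ring

theorem rungPt_add_mul (k : ℕ) (s : ℝ) (n m : ℤ) :
    rungPt k s (n + m * (ringSize k + ringSize (k + 1))) = rungPt k s n := by
  have e : n + m * (ringSize k + ringSize (k + 1)) - (rung k n + m * ringSize k) =
    n - rung k n + m * ringSize (k + 1) := by ring
  rw [rungPt, rungPt, rung_add_mul, e, vx_add_mul, vx_add_mul]

/-- Both ends advance monotonically, so equal angles leave no room for either weighted increment. As
`s < 1`, the lower end is fixed; the upper end is fixed too unless `s = 0`, when it does not matter.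
For `k = 0` the upper end alone carries the angle. -/
theorem rungPt_congr {k : ℕ} {s : ℝ} (h0 : 0 ≤ s) (h1 : s < 1) {n m : ℤ} (hnm : n ≤ m)
    (h : rungAng k s n = rungAng k s m) : rungPt k s n = rungPt k s m := by
  have hs : 0 < 1 - s := by linarith
  have hmono : Monotone (rung k) := monotone_int_of_le_succ fun n => by
    rcases rung_succ k n with h | h <;> omega
  have hmono' : Monotone (fun n => n - rung k n) := monotone_int_of_le_succ fun n => by
    rcases rung_succ k n with h | h <;> omega
  have i1 := hmono hnm
  have i2 : n - rung k n ≤ m - rung k m := hmono' hnm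
  rw [rungAng, rungAng] at h
  split_ifs at h with hk
  · subst hk
    have e := ang_injective 1 h
    rw [rungPt, rungPt, e, vx_zero, vx_zero (rung 0 m)]
  · have a1 := ang_mono k i1
    have a2 := ang_mono (k + 1) i2
    have b1 := mul_le_mul_of_nonneg_left a1 hs.le
    have b2 := mul_le_mul_of_nonneg_left a2 h0
    have c1 : ang k (rung k n) = ang k (rung k m) := mul_left_cancel₀ hs.ne' (by linarith)
    have e1 := ang_injective k c1
    rcases h0.eq_or_lt with rfl | h0
    · rw [rungPt, rungPt, e1]; funext v; simp [seg]
    · have c2 : ang (k + 1) (n - rung k n) = ang (k + 1) (m - rung k m) :=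
        mul_left_cancel₀ h0.ne' (by linarith)
      rw [rungPt, rungPt, ang_injective _ c2, e1]

/-- The points at a given height are determined by their angles. -/
theorem cellPt_eq_of_angle {k : ℕ} {s : ℝ} (h0 : 0 ≤ s) (h1 : s < 1) {n m : ℤ} (hnm : n ≤ m)
    {r r' : ℝ} (hr : r ∈ Icc (0 : ℝ) 1) (hr' : r' ∈ Icc (0 : ℝ) 1)
    (h : (1 - r) * rungAng k s n + r * rungAng k s (n + 1) =
      (1 - r') * rungAng k s m + r' * rungAng k s (m + 1)) :
    cellPt k s n r = cellPt k s m r' := by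
  have a1 := rungAng_le_succ k h0 h1.le n
  have a2 := rungAng_le_succ k h0 h1.le m
  have key : ∀ {n : ℤ} {r : ℝ}, rungAng k s n = rungAng k s (n + 1) →
      cellPt k s n r = rungPt k s n := by
    intro n r h
    funext v
    rw [cellPt, ← rungPt_congr h0 h1 (by omega) h]; ring
  rcases hnm.eq_or_lt with rfl | hlt
  · have h2 : (r - r') * (rungAng k s (n + 1) - rungAng k s n) = 0 := by linarith
    rcases mul_eq_zero.1 h2 with h | h
    · rw [sub_eq_zero.1 h]
    · have h : rungAng k s n = rungAng k s (n + 1) := by linarith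
      rw [key h, key h]
  · have a3 := rungAng_mono k h0 h1.le (show n + 1 ≤ m by omega)
    have b1 := mul_nonneg (sub_nonneg.2 hr.2) (sub_nonneg.2 a1)
    have b2 := mul_nonneg hr'.1 (sub_nonneg.2 a2)
    have e1 : rungAng k s (n + 1) = rungAng k s m := by linarith
    have e2 := rungPt_congr h0 h1 (by omega) e1
    have c1 : (1 - r) * (rungAng k s (n + 1) - rungAng k s n) = 0 := by linarith
    have c2 : r' * (rungAng k s (m + 1) - rungAng k s m) = 0 := by linarith
    have d1 : cellPt k s n r = rungPt k s (n + 1) := by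
      rcases mul_eq_zero.1 c1 with h | h
      · obtain rfl : r = 1 := by linarith
        funext v; rw [cellPt]; ring
      · have h : rungAng k s n = rungAng k s (n + 1) := by linarith
        rw [key h, rungPt_congr h0 h1 (by omega) h]
    have d2 : cellPt k s m r' = rungPt k s m := by
      rcases mul_eq_zero.1 c2 with rfl | h
      · funext v; rw [cellPt]; ring
      · exact key (by linarith)
    rw [d1, d2, e2]

/-- The angles of the edges grow by 1 per turn, so there is a last edge with angle at most `x`. The
next one has a strictly greater angle, and one can interpolate. -/
theorem rungAng_exists {k : ℕ} {s : ℝ} (h0 : 0 ≤ s) (h1 : s ≤ 1) (x : ℝ) :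
    ∃ n r, r ∈ Icc (0 : ℝ) 1 ∧ (1 - r) * rungAng k s n + r * rungAng k s (n + 1) = x := by
  have hP := ringSize_pos' k
  have hP' := ringSize_pos' (k + 1)
  set c := rungAng k s 0 with hc
  have hex : ∃ n, rungAng k s n ≤ x := ⟨0 + (⌊x - c⌋) * (ringSize k + ringSize (k + 1)), by
    rw [rungAng_add_mul, ← hc]; linarith [Int.floor_le (x - c)]⟩
  have hbd : ∃ b, ∀ n, rungAng k s n ≤ x → n ≤ b := by
    refine ⟨0 + (⌊x - c⌋ + 1) * (ringSize k + ringSize (k + 1)), fun n hn => ?_⟩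
    by_contra hlt
    have := rungAng_mono k h0 h1 (not_le.1 hlt).le
    rw [rungAng_add_mul, ← hc] at this
    push_cast at this
    linarith [Int.lt_floor_add_one (x - c)]
  obtain ⟨n, hn, hmax⟩ := Int.exists_greatest_of_bdd hbd hex
  have hlt : x < rungAng k s (n + 1) := by
    by_contra h
    have := hmax (n + 1) (not_lt.1 h)
    omega
  have hd : 0 < rungAng k s (n + 1) - rungAng k s n := by linarith
  refine ⟨n, (x - rungAng k s n) / (rungAng k s (n + 1) - rungAng k s n), ⟨?_, ?_⟩, ?_⟩
  · exact div_nonneg (by linarith) hd.le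
  · rw [div_le_one hd]; linarith
  · field_simp; ring

theorem seg_lower {V : Type} [DecidableEq V] {a b c : V} (h1 : a ≠ b) (h2 : a ≠ c) (h3 : b ≠ c)
    (s r : ℝ) : ((1 - r) * seg s c a a + r * seg s c b a = (1 - r) * s) ∧
      ((1 - r) * seg s c a b + r * seg s c b b = r * s) ∧
      ((1 - r) * seg s c a c + r * seg s c b c = 1 - s) := by
  simp only [seg, if_true, if_neg h1, if_neg h2, if_neg h3, if_neg h1.symm, if_neg h2.symm,
    if_neg h3.symm]
  refine ⟨?_, ?_, ?_⟩ <;> ring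

theorem seg_upper {V : Type} [DecidableEq V] {a b c : V} (h1 : a ≠ b) (h2 : a ≠ c) (h3 : b ≠ c)
    (s r : ℝ) : ((1 - r) * seg s a c a + r * seg s b c a = (1 - r) * (1 - s)) ∧
      ((1 - r) * seg s a c b + r * seg s b c b = r * (1 - s)) ∧
      ((1 - r) * seg s a c c + r * seg s b c c = s) := by
  simp only [seg, if_true, if_neg h1, if_neg h2, if_neg h3, if_neg h1.symm, if_neg h2.symm,
    if_neg h3.symm]
  refine ⟨?_, ?_, ?_⟩ <;> ring

theorem exists_ratio {a b : ℝ} (ha : 0 ≤ a) (hb : 0 ≤ b) :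
    ∃ r ∈ Icc (0 : ℝ) 1, (1 - r) * (a + b) = a ∧ r * (a + b) = b := by
  rcases (add_nonneg ha hb).eq_or_lt with h | h
  · exact ⟨0, by simp, by linarith, by linarith⟩
  · refine ⟨b / (a + b), ⟨by positivity, by rw [div_le_one h]; linarith⟩, ?_, ?_⟩
    · field_simp; ring
    · field_simp

theorem Point.eq_of_triple {M : SManifold} {p : M.Point} {u v w : M.V} {f : M.V → ℝ}
    (hp : p.MemTriangle {u, v, w}) (hf : ∀ x, x ∉ ({u, v, w} : Finset M.V) → f x = 0)
    (h1 : f u = p u) (h2 : f v = p v) (h3 : f w = p w) (x : M.V) : p x = f x := by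
  by_cases hx : x ∈ ({u, v, w} : Finset M.V)
  · rcases Finset.mem_insert.1 hx with rfl | hx
    · exact h1.symm
    rcases Finset.mem_insert.1 hx with rfl | hx
    · exact h2.symm
    · rw [Finset.mem_singleton.1 hx, h3]
  · rw [hp x hx, hf x hx]

theorem eq_of_mem_inner {k : ℕ} {j : ℤ} {v : SiloVertex} (h : v ∈ inner k j) :
    v = vx (k + 1) (j - 1) ∨ v = vx (k + 1) j ∨ v = vx k (dn k j) := by
  simpa [inner] using h

theorem eq_of_mem_outer {k : ℕ} {i : ℤ} {v : SiloVertex} (h : v ∈ outer k i) :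
    v = vx k (i - 1) ∨ v = vx k i ∨ v = vx (k + 1) (up k i) := by
  simpa [outer] using h

theorem exists_cellPt_of_inner {p : silo.Point} {k : ℕ} {j : ℤ} (hp : p.MemTriangle (inner k j)) :
    ∃ n, ∃ r ∈ Icc (0 : ℝ) 1, ∀ v, p v = cellPt k (lin lvl p - k) n r v := by
  have hT := inner_mem k j
  obtain ⟨n1, n2, n3⟩ := tri_ne (M := silo) hT
  have hsum := Point.sum_tri (M := silo) hT hp
  have hl : lin lvl p = p (vx (k + 1) (j - 1)) * (k + 1 : ℕ) + p (vx (k + 1) j) * (k + 1 : ℕ) +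
    p (vx k (dn k j)) * k := lin_tri lvl hT hp
  have hs : lin lvl p - k = p (vx (k + 1) (j - 1)) + p (vx (k + 1) j) := by
    have e : p (vx k (dn k j)) = 1 - p (vx (k + 1) (j - 1)) - p (vx (k + 1) j) := by linarith
    rw [hl, e]; push_cast; ring
  obtain ⟨r, hr, h1, h2⟩ := exists_ratio (p.nonneg (vx (k + 1) (j - 1))) (p.nonneg (vx (k + 1) j))
  obtain ⟨d1, d2⟩ := dn_eq_iff.1 (rfl : dn k j = dn k j)
  -- The two sides of the triangle at its apex are consecutive edges, with index sums `dn k j + (j -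
  -- 1)` and `dn k j + j`.
  have r1 : rung k (dn k j + (j - 1)) = dn k j := by rw [rung_eq_iff]; omega
  have r2 : rung k (dn k j + (j - 1) + 1) = dn k j := by rw [rung_eq_iff]; omega
  have m1 : dn k j + (j - 1) - dn k j = j - 1 := by ring
  have m2 : dn k j + (j - 1) + 1 - dn k j = j := by ring
  refine ⟨dn k j + (j - 1), r, hr, ?_⟩
  obtain ⟨s1, s2, s3⟩ := seg_lower n1 n2 n3 (lin lvl p - k) r
  have hc : ∀ v, cellPt k (lin lvl p - k) (dn k j + (j - 1)) r v =
      (1 - r) * seg (V := silo.V) (lin lvl p - k) (vx k (dn k j)) (vx (k + 1) (j - 1)) v +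
        r * seg (V := silo.V) (lin lvl p - k) (vx k (dn k j)) (vx (k + 1) j) v := fun v => by
    rw [cellPt, rungPt, rungPt, r1, r2, m1, m2]
  refine Point.eq_of_triple hp (fun x hx => ?_) ((hc _).trans (s1.trans ?_))
    ((hc _).trans (s2.trans ?_)) ((hc _).trans (s3.trans ?_))
  · refine cellPt_of_notMem (τ := inner k j) ?_ ?_ ?_ ?_ hx
    · rw [r1]; exact mem_inner.2 (Or.inr ⟨rfl, rfl⟩)
    · rw [r1, m1]; exact mem_inner.2 (Or.inl ⟨rfl, Or.inl rfl⟩)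
    · rw [r2]; exact mem_inner.2 (Or.inr ⟨rfl, rfl⟩)
    · rw [r2, m2]; exact mem_inner.2 (Or.inl ⟨rfl, Or.inr rfl⟩)
  · rw [hs]; exact h1
  · rw [hs]; exact h2
  · linarith

theorem exists_cellPt_of_outer {p : silo.Point} {k : ℕ} (hk : 1 ≤ k) {i : ℤ}
    (hp : p.MemTriangle (outer k i)) :
    ∃ n, ∃ r ∈ Icc (0 : ℝ) 1, ∀ v, p v = cellPt k (lin lvl p - k) n r v := by
  have hT := outer_mem hk i
  obtain ⟨n1, n2, n3⟩ := tri_ne (M := silo) hT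
  have hsum := Point.sum_tri (M := silo) hT hp
  have hl : lin lvl p = p (vx k (i - 1)) * k + p (vx k i) * k +
    p (vx (k + 1) (up k i)) * (k + 1 : ℕ) := lin_tri lvl hT hp
  have hs : 1 - (lin lvl p - k) = p (vx k (i - 1)) + p (vx k i) := by
    have e : p (vx (k + 1) (up k i)) = 1 - p (vx k (i - 1)) - p (vx k i) := by linarith
    rw [hl, e]; push_cast; ring
  obtain ⟨r, hr, h1, h2⟩ := exists_ratio (p.nonneg (vx k (i - 1))) (p.nonneg (vx k i))
  have u1 := up_lt_up k (i - 1)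
  have u2 := up_lt_up k i
  rw [sub_add_cancel] at u1
  have r1 : rung k (i - 1 + up k i) = i - 1 := by rw [rung_eq_iff, sub_add_cancel]; omega
  have r2 : rung k (i - 1 + up k i + 1) = i := by rw [rung_eq_iff]; omega
  have m1 : i - 1 + up k i - (i - 1) = up k i := by ring
  have m2 : i - 1 + up k i + 1 - i = up k i := by ring
  refine ⟨i - 1 + up k i, r, hr, ?_⟩
  obtain ⟨s1, s2, s3⟩ := seg_upper n1 n2 n3 (lin lvl p - k) r
  have hc : ∀ v, cellPt k (lin lvl p - k) (i - 1 + up k i) r v =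
      (1 - r) * seg (V := silo.V) (lin lvl p - k) (vx k (i - 1)) (vx (k + 1) (up k i)) v +
        r * seg (V := silo.V) (lin lvl p - k) (vx k i) (vx (k + 1) (up k i)) v := fun v => by
    rw [cellPt, rungPt, rungPt, r1, r2, m1, m2]
  refine Point.eq_of_triple hp (fun x hx => ?_) ((hc _).trans (s1.trans ?_))
    ((hc _).trans (s2.trans ?_)) ((hc _).trans (s3.trans ?_))
  · refine cellPt_of_notMem (τ := outer k i) ?_ ?_ ?_ ?_ hx
    · rw [r1]; exact mem_outer.2 (Or.inl ⟨rfl, Or.inl rfl⟩)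
    · rw [r1, m1]; exact mem_outer.2 (Or.inr ⟨rfl, rfl⟩)
    · rw [r2]; exact mem_outer.2 (Or.inl ⟨rfl, Or.inr rfl⟩)
    · rw [r2, m2]; exact mem_outer.2 (Or.inr ⟨rfl, rfl⟩)
  · rw [hs]; exact h1
  · rw [hs]; exact h2
  · linarith

/-- Every point is a point of a cell. -/
theorem exists_cellPt {p : silo.Point} {k : ℕ} (h0 : (k : ℝ) ≤ lin lvl p)
    (h1 : lin lvl p < k + 1) :
    ∃ n, ∃ r ∈ Icc (0 : ℝ) 1, ∀ v, p v = cellPt k (lin lvl p - k) n r v := by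
  obtain ⟨τ, ⟨l, j, rfl⟩ | ⟨l, i, hl, rfl⟩, hp⟩ := p.exists_triangle
  · have hT := inner_mem l j
    have hsum := Point.sum_tri (M := silo) hT hp
    have e : lin lvl p = p (vx (l + 1) (j - 1)) * (l + 1 : ℕ) + p (vx (l + 1) j) * (l + 1 : ℕ) +
      p (vx l (dn l j)) * l := lin_tri lvl hT hp
    have p1 := p.nonneg (vx (l + 1) (j - 1))
    have p2 := p.nonneg (vx (l + 1) j)
    have p3 := p.nonneg (vx l (dn l j))
    have e' : lin lvl p = l + 1 - p (vx l (dn l j)) := by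
      have : p (vx (l + 1) (j - 1)) = 1 - p (vx (l + 1) j) - p (vx l (dn l j)) := by linarith
      rw [e, this]; push_cast; ring
    rcases lt_trichotomy l k with h | rfl | h
    -- The triangle belongs to a lower layer, so the point lies on its upper side, which is also the
    -- base of an `outer` triangle of the layer `k`.
    · have hk : (l + 1 : ℝ) ≤ k := by exact_mod_cast h
      have hz : p (vx l (dn l j)) = 0 := by linarith
      obtain rfl : k = l + 1 := by
        have : (k : ℝ) ≤ l + 1 := by linarith
        have : k ≤ l + 1 := by exact_mod_cast this
        omega
      refine exists_cellPt_of_outer (by omega) (i := j) fun v hv => ?_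
      by_cases hv' : v ∈ inner l j
      · rcases eq_of_mem_inner hv' with rfl | rfl | rfl
        · exact absurd (mem_outer.2 (Or.inl ⟨rfl, Or.inl rfl⟩)) hv
        · exact absurd (mem_outer.2 (Or.inl ⟨rfl, Or.inr rfl⟩)) hv
        · exact hz
      · exact hp v hv'
    · exact exists_cellPt_of_inner hp
    · exfalso
      have : (k + 1 : ℝ) ≤ l := by exact_mod_cast h
      linarith
  · have hT := outer_mem hl i
    have hsum := Point.sum_tri (M := silo) hT hp
    have e : lin lvl p = p (vx l (i - 1)) * l + p (vx l i) * l +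
      p (vx (l + 1) (up l i)) * (l + 1 : ℕ) := lin_tri lvl hT hp
    have p1 := p.nonneg (vx l (i - 1))
    have p2 := p.nonneg (vx l i)
    have p3 := p.nonneg (vx (l + 1) (up l i))
    have e' : lin lvl p = l + p (vx (l + 1) (up l i)) := by
      have : p (vx l (i - 1)) = 1 - p (vx l i) - p (vx (l + 1) (up l i)) := by linarith
      rw [e, this]; push_cast; ring
    rcases lt_trichotomy l k with h | rfl | h
    · have hk : (l + 1 : ℝ) ≤ k := by exact_mod_cast h
      have hz1 : p (vx l (i - 1)) = 0 := by linarith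
      have hz2 : p (vx l i) = 0 := by linarith
      obtain rfl : k = l + 1 := by
        have : (k : ℝ) ≤ l + 1 := by linarith
        have : k ≤ l + 1 := by exact_mod_cast this
        omega
      refine exists_cellPt_of_outer (by omega) (i := up l i) fun v hv => ?_
      by_cases hv' : v ∈ outer l i
      · rcases eq_of_mem_outer hv' with rfl | rfl | rfl
        · exact hz1
        · exact hz2
        · exact absurd (mem_outer.2 (Or.inl ⟨rfl, Or.inr rfl⟩)) hv
      · exact hp v hv'
    · exact exists_cellPt_of_outer hl hp
    · exfalso
      have : (k + 1 : ℝ) ≤ l := by exact_mod_cast h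
      linarith

theorem floor_bounds {y : ℝ} (hy : 0 ≤ y) : 0 ≤ y - ⌊y⌋₊ ∧ y - ⌊y⌋₊ < 1 :=
  ⟨by linarith [Nat.floor_le hy], by linarith [Nat.lt_floor_add_one y]⟩

/-- Equal norms are equal heights, so both points lie in cells of the same layer at the same `s`.
Their angles agree up to an integer, which is absorbed by moving the index through as many full
turns; then `cellPt_eq_of_angle` applies. -/
theorem toPlane_injective : Function.Injective toPlane := by
  intro p q h
  have hF : lin lvl p = lin lvl q := by rw [← norm_toPlane, h, norm_toPlane]
  set y := lin lvl p with hy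
  have hy0 : 0 ≤ y := lin_nonneg lvl_nonneg p
  obtain ⟨f0, f1⟩ := floor_bounds hy0
  obtain ⟨n, r, hr, hp⟩ := exists_cellPt (p := p) (k := ⌊y⌋₊) (by linarith) (by linarith)
  obtain ⟨m, r', hr', hq⟩ := exists_cellPt (p := q) (k := ⌊y⌋₊) (by linarith) (by linarith)
  rw [← hF] at hq
  rw [← hy] at hp
  set k := ⌊y⌋₊ with hk
  set s := y - k with hs
  have ap := hasAngle_cellPt hp
  have aq := hasAngle_cellPt hq
  rcases hy0.eq_or_lt with h0 | h0
  · have hz : ∀ p : silo.Point, lin lvl p = 0 → p (vx 0 0) = 1 := by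
      intro p hp
      by_contra hne
      obtain ⟨τ, -, hτ⟩ := p.exists_triangle
      have h1 := sum_off (M := silo) (vx 0 0) hτ
      rw [lin_eq_sum lvl hτ, Finset.sum_eq_zero_iff_of_nonneg
        fun v _ => mul_nonneg (p.nonneg v) (lvl_nonneg v)] at hp
      rw [Finset.sum_eq_zero] at h1
      · exact hne (by linarith)
      · intro v hv
        split_ifs with h
        · simp
        · rcases mul_eq_zero.1 (hp v hv) with h' | h'
          · rw [h', zero_mul]
          · exact absurd (eq_vx_zero (by rw [lvl] at h'; exact_mod_cast h')) h
    have hp1 := hz p h0.symm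
    have hq1 := hz q (hF.symm.trans h0.symm)
    refine Point.ext fun x => ?_
    by_cases hx : x = (vx 0 0 : SiloVertex)
    · rw [hx, hp1, hq1]
    · rw [Point.eq_zero_of_eq_one hp1 hx, Point.eq_zero_of_eq_one hq1 hx]
  · rw [toPlane_eq ap, toPlane_eq aq, ← hF, ← hy] at h
    have h' := mul_left_cancel₀ (Complex.ofReal_ne_zero.2 h0.ne') h
    rw [Complex.exp_eq_exp_iff_exists_int] at h'
    obtain ⟨l, hl⟩ := h'
    have hI := Complex.I_ne_zero
    have hπ : (Real.pi : ℂ) ≠ 0 := Complex.ofReal_ne_zero.2 Real.pi_ne_zero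
    have hang : (1 - r) * rungAng k s n + r * rungAng k s (n + 1) =
        (1 - r') * rungAng k s m + r' * rungAng k s (m + 1) + l := by
      have : (2 * Real.pi * Complex.I) *
          (((1 - r) * rungAng k s n + r * rungAng k s (n + 1) : ℝ) : ℂ) = (2 * Real.pi * Complex.I) *
          (((1 - r') * rungAng k s m + r' * rungAng k s (m + 1) + l : ℝ) : ℂ) := by
        push_cast at hl ⊢; linear_combination hl
      exact_mod_cast mul_left_cancel₀ (by simp [hπ, hI]) this
    set m' := m + l * (ringSize k + ringSize (k + 1)) with hm'
    have e1 : rungAng k s m' = rungAng k s m + l := rungAng_add_mul k s m l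
    have e2 : rungAng k s (m' + 1) = rungAng k s (m + 1) + l := by
      rw [hm', add_right_comm, rungAng_add_mul]
    have e3 : cellPt k s m' r' = cellPt k s m r' := by
      funext v
      rw [cellPt, hm', add_right_comm, rungPt_add_mul, rungPt_add_mul, cellPt]
    have hang' : (1 - r) * rungAng k s n + r * rungAng k s (n + 1) =
        (1 - r') * rungAng k s m' + r' * rungAng k s (m' + 1) := by
      rw [hang, e1, e2]; ring
    refine Point.ext fun x => ?_
    rw [hp, hq, ← e3]
    rcases le_total n m' with hle | hle
    · rw [cellPt_eq_of_angle f0 f1 hle hr hr' hang']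
    · rw [cellPt_eq_of_angle f0 f1 hle hr' hr hang'.symm]

theorem toPlane_surjective : Function.Surjective toPlane := by
  intro z
  have hy0 : 0 ≤ ‖z‖ := norm_nonneg z
  obtain ⟨f0, f1⟩ := floor_bounds hy0
  set k := ⌊‖z‖⌋₊ with hk
  obtain ⟨n, r, hr, hx⟩ := rungAng_exists (k := k) f0 f1.le (z.arg / (2 * Real.pi))
  obtain ⟨p, hp⟩ := exists_cell_point k f0 f1.le n hr.1 hr.2
  refine ⟨p, ?_⟩
  have ha := hasAngle_cellPt hp
  rw [toPlane_eq ha, hx, show (p : silo.V → ℝ) = _ from funext hp, lvl_cellPt, add_sub_cancel]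
  have hπ : (Real.pi : ℂ) ≠ 0 := Complex.ofReal_ne_zero.2 Real.pi_ne_zero
  rw [show (2 * Real.pi * ((z.arg / (2 * Real.pi) : ℝ) : ℂ) * Complex.I) = z.arg * Complex.I by
    push_cast; field_simp]
  exact Complex.norm_mul_exp_arg_mul_I z

end SManifold

end


noncomputable section

namespace SManifold

open Set Topology Filter

/-! ### The topology of the model -/

theorem continuous_coord {M : SManifold} (v : M.V) : Continuous fun p : M.Point => p v :=
  (continuous_apply v).comp (continuous_subtype_val (p := fun p : M.V → ℝ => (∀ v, 0 ≤ p v) ∧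
    ∃ τ ∈ M.triangles, (∀ v, v ∉ τ → p v = 0) ∧ ∑ v ∈ τ, p v = 1))

/-- The points of a triangle. -/
def face {M : SManifold} (τ : Finset M.V) : Set M.Point := {p | p.MemTriangle τ}

theorem isClosed_face {M : SManifold} (τ : Finset M.V) : IsClosed (face (M := M) τ) := by
  have : face (M := M) τ = ⋂ v, ⋂ _ : v ∉ τ, {p | p v = 0} := by
    ext p; simp [face, Point.MemTriangle]
  rw [this]
  exact isClosed_iInter fun v => isClosed_iInter fun _ =>
    isClosed_eq (continuous_coord v) continuous_const

theorem isCompact_face {M : SManifold} {τ : Finset M.V} (hτ : τ ∈ M.triangles) :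
    IsCompact (face (M := M) τ) := by
  have hind : IsInducing (fun p : M.Point => (p : M.V → ℝ)) := ⟨rfl⟩
  rw [hind.isCompact_iff]
  have himg : (fun p : M.Point => (p : M.V → ℝ)) '' face τ =
      {f | ∀ v, 0 ≤ f v} ∩ {f | ∀ v, v ∉ τ → f v = 0} ∩ {f | ∑ v ∈ τ, f v = 1} := by
    ext f
    constructor
    · rintro ⟨p, hp, rfl⟩
      exact ⟨⟨p.nonneg, hp⟩, p.sum_eq_one hp⟩
    · rintro ⟨⟨h0, h⟩, h1⟩
      exact ⟨mkPoint hτ f h0 h h1, h, rfl⟩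
  rw [himg]
  have hK : IsCompact (univ.pi fun _ : M.V => Icc (0 : ℝ) 1) :=
    isCompact_univ_pi fun _ => isCompact_Icc
  refine hK.of_isClosed_subset ?_ ?_
  · refine (IsClosed.inter ?_ ?_).inter ?_
    · rw [show {f : M.V → ℝ | ∀ v, 0 ≤ f v} = ⋂ v, {f | 0 ≤ f v} by ext; simp]
      exact isClosed_iInter fun v => isClosed_le continuous_const (continuous_apply v)
    · rw [show {f : M.V → ℝ | ∀ v, v ∉ τ → f v = 0} = ⋂ v, ⋂ _ : v ∉ τ, {f | f v = 0} by ext; simp]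
      exact isClosed_iInter fun v => isClosed_iInter fun _ =>
        isClosed_eq (continuous_apply v) continuous_const
    · exact isClosed_eq (continuous_finsetSum _ fun v _ => continuous_apply v) continuous_const
  · rintro f ⟨⟨h0, h⟩, h1⟩ v -
    refine ⟨h0 v, ?_⟩
    by_cases hv : v ∈ τ
    · exact (Finset.single_le_sum (fun v _ => h0 v) hv).trans h1.le
    · rw [h v hv]; exact zero_le_one

theorem finite_star {M : SManifold} (v : M.V) : {τ | τ ∈ M.triangles ∧ v ∈ τ}.Finite := by
  obtain ⟨n, hn, c, hc⟩ := M.exists_link v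
  exact finite_of_ncard_ne_zero (by rw [hc.ncard_star hn M.card_eq_three]; omega)

theorem Point.exists_pos {M : SManifold} (p : M.Point) : ∃ v, 0 < p v := by
  obtain ⟨τ, -, hτ⟩ := p.exists_triangle
  by_contra h
  push Not at h
  have := p.sum_eq_one hτ
  rw [Finset.sum_eq_zero fun v _ => le_antisymm (h v) (p.nonneg v)] at this
  exact zero_ne_one this

theorem locallyFinite_face (M : SManifold) :
    LocallyFinite fun τ : M.triangles => face (M := M) τ := by
  intro p
  obtain ⟨v, hv⟩ := p.exists_pos
  refine ⟨{q | 0 < q v}, (isOpen_lt continuous_const (continuous_coord v)).mem_nhds hv, ?_⟩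
  refine Finite.of_finite_image ((finite_star v).subset ?_) Subtype.val_injective.injOn
  rintro _ ⟨τ, ⟨q, hq, hqv⟩, rfl⟩
  exact ⟨τ.2, q.mem_of_pos hq hqv⟩

theorem continuousOn_lin {M : SManifold} (F : M.V → ℝ) (τ : Finset M.V) :
    ContinuousOn (fun p : M.Point => lin F p) (face τ) := by
  refine ContinuousOn.congr (f := fun p : M.Point => ∑ v ∈ τ, p v * F v) ?_
    fun p hp => lin_eq_sum F hp
  exact (continuous_finsetSum _ fun v _ => (continuous_coord v).mul continuous_const).continuousOn

theorem exists_isLift {τ : Finset silo.V} (hτ : τ ∈ silo.triangles) : ∃ a, IsLift τ a := by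
  obtain ⟨k, j, rfl⟩ | ⟨k, i, hk, rfl⟩ := hτ
  · rcases Nat.eq_zero_or_pos k with rfl | hk
    · exact ⟨_, isLift_inner_zero j⟩
    · exact ⟨_, isLift_inner hk j⟩
  · exact ⟨_, isLift_outer hk i⟩

/-- On one triangle a single lift gives the angle as a quotient of continuous functions. At the
centre the quotient breaks down, but there the norm, which is the height, tends to 0. -/
theorem continuousOn_toPlane {τ : Finset silo.V} (hτ : τ ∈ silo.triangles) :
    ContinuousOn toPlane (face τ) := by
  obtain ⟨a, ha⟩ := exists_isLift hτ
  intro p hp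
  have hF := continuousOn_lin lvl τ p hp
  by_cases h : p (vx 0 0) = 1
  · have h0 : lin lvl p = 0 := by rw [lin_vertex lvl h, lvl_vx, Nat.cast_zero]
    have hz : toPlane p = 0 := by rw [← norm_eq_zero, norm_toPlane, h0]
    rw [ContinuousWithinAt, hz, tendsto_zero_iff_norm_tendsto_zero]
    simp only [norm_toPlane]
    have := hF.tendsto
    simpa only [h0] using this
  · have ho := continuous_coord (M := silo) (vx 0 0)
    have hev : ∀ᶠ q in 𝓝[face τ] p, toPlane q = lin lvl q *
        Complex.exp (2 * Real.pi * ((lin a q / (1 - q (vx 0 0)) : ℝ) : ℂ) * Complex.I) := by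
      have h1 : ∀ᶠ q : silo.Point in 𝓝[face τ] p, q (vx 0 0) ≠ 1 :=
        (ho.continuousAt.eventually_ne h).filter_mono nhdsWithin_le_nhds
      filter_upwards [h1, self_mem_nhdsWithin] with q hq hq'
      refine toPlane_eq ⟨τ, a, ha, hq', ?_⟩
      rw [div_mul_cancel₀ _ (sub_ne_zero.2 (Ne.symm hq))]
    refine ContinuousWithinAt.congr_of_eventuallyEq ?_ hev (hev.self_of_nhdsWithin hp)
    have h2 : ContinuousWithinAt (fun q : silo.Point => lin a q / (1 - q (vx 0 0))) (face τ) p :=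
      (continuousOn_lin a τ p hp).div (continuousWithinAt_const.sub ho.continuousWithinAt)
        (sub_ne_zero.2 (Ne.symm h))
    have h3 := Complex.continuous_ofReal.continuousAt.comp_continuousWithinAt h2
    have h4 := Complex.continuous_ofReal.continuousAt.comp_continuousWithinAt hF
    exact h4.mul (Complex.continuous_exp.continuousAt.comp_continuousWithinAt
      ((continuousWithinAt_const.mul h3).mul continuousWithinAt_const))

theorem continuous_toPlane : Continuous toPlane := by
  refine (locallyFinite_face silo).continuous ?_ (fun τ => isClosed_face _)
    fun τ => continuousOn_toPlane τ.2
  refine eq_univ_of_forall fun p => ?_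
  obtain ⟨τ, hτ, hp⟩ := p.exists_triangle
  exact mem_iUnion.2 ⟨⟨τ, hτ⟩, hp⟩

theorem finite_le_ring (k : ℕ) : {v : SiloVertex | v.1 ≤ k}.Finite := by
  have : {v : SiloVertex | v.1 ≤ k} = ⋃ l ∈ Finset.range (k + 1), {v : SiloVertex | v.1 = l} := by
    ext v
    simp only [mem_ofPred_eq, Finset.mem_range, mem_iUnion, exists_prop]
    constructor
    · intro h; exact ⟨v.1, by omega, rfl⟩
    · rintro ⟨l, h, e⟩; omega
  rw [this]
  exact Set.Finite.biUnion (Finset.finite_toSet _) fun l _ => finite_ring l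

/-- A bound on the norm is a bound on the height, and only finitely many triangles have a vertex on
the finitely many rings allowed. Being proper, the continuous bijection is closed and thus a
homeomorphism. -/
theorem isCompact_preimage_toPlane {K : Set ℂ} (hK : IsCompact K) :
    IsCompact (toPlane ⁻¹' K) := by
  obtain ⟨R, hR⟩ := hK.isBounded.exists_norm_le
  obtain ⟨k, hk⟩ := exists_nat_ge R
  have hfin : (⋃ v ∈ {v : SiloVertex | v.1 ≤ k},
      {τ | τ ∈ silo.triangles ∧ v ∈ τ}).Finite :=
    (finite_le_ring k).biUnion fun v _ => finite_star (M := silo) v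
  have hC : IsCompact (⋃ τ ∈ (⋃ v ∈ {v : SiloVertex | v.1 ≤ k},
      {τ | τ ∈ silo.triangles ∧ v ∈ τ}), face (M := silo) τ) := by
    refine hfin.isCompact_biUnion fun τ hτ => ?_
    simp only [mem_iUnion] at hτ
    obtain ⟨v, -, hτ, -⟩ := hτ
    exact isCompact_face hτ
  refine hC.of_isClosed_subset (hK.isClosed.preimage continuous_toPlane) fun p hp => ?_
  obtain ⟨τ, hτ, hp'⟩ := p.exists_triangle
  have hle : lin lvl p ≤ k := by rw [← norm_toPlane]; exact (hR _ hp).trans hk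
  obtain ⟨v, hv, hvk⟩ : ∃ v ∈ τ, v.1 ≤ k := by
    by_contra hc
    push Not at hc
    have h1 : ∀ v ∈ τ, p v * (k + 1 : ℝ) ≤ p v * lvl v := fun v hv =>
      mul_le_mul_of_nonneg_left (by rw [lvl]; exact_mod_cast hc v hv) (p.nonneg v)
    have := Finset.sum_le_sum h1
    rw [← lin_eq_sum lvl hp', ← Finset.sum_mul, p.sum_eq_one hp'] at this
    linarith
  simp only [mem_iUnion]
  exact ⟨τ, ⟨v, hvk, hτ, hv⟩, hp'⟩

/-- The model is homeomorphic to the plane. -/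
def planeHomeomorph : silo.Point ≃ₜ ℂ :=
  (Equiv.ofBijective toPlane ⟨toPlane_injective, toPlane_surjective⟩).toHomeomorphOfContinuousClosed
    continuous_toPlane
    (isProperMap_iff_isCompact_preimage.2
      ⟨continuous_toPlane, fun _ hK => isCompact_preimage_toPlane hK⟩).isClosedMap

theorem isExtendedSilo : silo.IsExtendedSilo :=
  isExtendedSilo_silo ⟨planeHomeomorph.trans Complex.orthonormalBasisOneI.repr.toHomeomorph⟩

end SManifold

end


noncomputable section

namespace SManifold

open Set Topology

/-! ### Circular lines -/

theorem IsGeodesic.continuous {M : SManifold} {γ : ℝ → M.Point} (hγ : IsGeodesic γ) :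
    Continuous γ := by
  have hind : IsInducing (fun p : M.Point => (p : M.V → ℝ)) := ⟨rfl⟩
  rw [hind.continuous_iff]
  refine continuous_pi fun x => ?_
  refine (continuous_lin (fun v => if v = x then 1 else 0) hγ).congr fun t => ?_
  obtain ⟨τ, -, hτ⟩ := (γ t).exists_triangle
  rw [lin_eq_sum _ hτ]
  simp only [mul_ite, mul_one, mul_zero, Finset.sum_ite_eq', Function.comp]
  split_ifs with h
  · rfl
  · exact (hτ x h).symm

/-- The mean of the values at 0 and at `L / 2` would be taken on both halves of the period. -/
theorem not_injective_on_circle {g : ℝ → ℝ} (hg : Continuous g) {L : ℝ} (hL : 0 < L)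
    (h : ∀ s t, g s = g t ↔ ∃ k : ℤ, t = s + k * L) : False := by
  have h0L : g L = g 0 := ((h 0 L).2 ⟨1, by push_cast; ring⟩).symm
  have hne : g 0 ≠ g (L / 2) := by
    intro e
    obtain ⟨k, hk⟩ := (h _ _).1 e
    have : (k : ℝ) * 2 = 1 := by
      have := mul_right_cancel₀ hL.ne' (show (k * 2 : ℝ) * L = 1 * L by linarith)
      exact this
    have : k * 2 = 1 := by exact_mod_cast this
    omega
  set c := (g 0 + g (L / 2)) / 2 with hc
  have hc1 : c ∈ uIcc (g 0) (g (L / 2)) := by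
    rw [mem_uIcc]
    rcases le_total (g 0) (g (L / 2)) with h | h
    · left; constructor <;> linarith
    · right; constructor <;> linarith
  obtain ⟨s, hs, e1⟩ := intermediate_value_uIcc hg.continuousOn hc1
  obtain ⟨t, ht, e2⟩ := intermediate_value_uIcc (a := L / 2) (b := L) (f := g) hg.continuousOn
    (by rw [h0L, uIcc_comm]; exact hc1)
  rw [uIcc_of_le (by linarith)] at hs ht
  obtain ⟨k, hk⟩ := (h s t).1 (e1.trans e2.symm)
  have hc0 : c ≠ g 0 := fun e => hne (by linarith)
  have hc2 : c ≠ g (L / 2) := fun e => hne (by linarith)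
  have s0 : 0 < s := lt_of_le_of_ne hs.1 fun e => hc0 (by rw [← e1, ← e])
  have s1 : s < L / 2 := lt_of_le_of_ne hs.2 fun e => hc2 (by rw [← e1, e])
  have k0 : (0 : ℝ) < k := by
    by_contra hk0
    have := mul_nonneg (sub_nonneg.2 (not_lt.1 hk0)) hL.le
    linarith [ht.1]
  have k1 : (k : ℝ) < 1 := by
    by_contra hk1
    have := mul_nonneg (sub_nonneg.2 (not_lt.1 hk1)) hL.le
    linarith [ht.2]
  have k0' : 0 < k := by exact_mod_cast k0
  have k1' : k < 1 := by exact_mod_cast k1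
  omega

/-- A circular line of constant height contains all points of this height. -/
theorem mem_range_of_height {γ : ℝ → silo.Point} (hγ : IsGeodesic γ) {L : ℝ} (hL : 0 < L)
    (hper : ∀ s t : ℝ, γ s = γ t ↔ ∃ k : ℤ, t = s + k * L) {y : ℝ} (hy : 0 < y)
    (h : ∀ t, lin lvl (γ t) = y) {q : silo.Point} (hq : lin lvl q = y) : q ∈ range γ := by
  by_contra hne
  have hn : ∀ t, ‖toPlane (γ t)‖ = y := fun t => by rw [norm_toPlane, h]
  have hnq : ‖toPlane q‖ = y := by rw [norm_toPlane, hq]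
  have hq0 : toPlane q ≠ 0 := by rw [← norm_pos_iff, hnq]; exact hy
  -- The normalisation moves the omitted point to `-1`, so the curve avoids the cut of the argument,
  -- which becomes a continuous function injective on the circle.
  set w : ℝ → ℂ := fun t => -(toPlane (γ t) / toPlane q) with hw
  have hw1 : ∀ t, ‖w t‖ = 1 := fun t => by rw [hw]; simp only [norm_neg, norm_div, hn, hnq, div_self hy.ne']
  have hslit : ∀ t, w t ∈ Complex.slitPlane := by
    intro t
    rw [Complex.mem_slitPlane_iff_not_le_zero]
    intro hle
    rw [Complex.le_def] at hle
    have him : (w t).im = 0 := hle.2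
    have hre : (w t).re ≤ 0 := hle.1
    have h1 : (w t) = ((w t).re : ℂ) := Complex.ext (by simp) (by simp [him])
    have h2 := hw1 t
    rw [h1, Complex.norm_real, Real.norm_of_nonpos hre] at h2
    have h3 : w t = -1 := by rw [h1, show (w t).re = -1 by linarith]; simp
    have h4 : toPlane (γ t) / toPlane q = 1 := neg_injective h3
    rw [div_eq_one_iff_eq hq0] at h4
    exact hne ⟨t, toPlane_injective h4⟩
  have hwc : Continuous w := ((continuous_toPlane.comp hγ.continuous).div_const _).neg
  refine not_injective_on_circle (g := fun t => (w t).arg) (continuous_iff_continuousAt.2 fun t =>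
    (Complex.continuousAt_arg (hslit t)).comp hwc.continuousAt) hL fun s t => ?_
  rw [← hper]
  constructor
  · intro e
    have e1 : w s = w t := Complex.ext_norm_arg (by rw [hw1, hw1]) e
    have e2 := neg_injective e1
    rw [div_left_inj' hq0] at e2
    exact toPlane_injective e2
  · intro e
    simp only [hw, e]

theorem exists_vertexPt {M : SManifold} (v : M.V) : ∃ p : M.Point, p v = 1 := by
  obtain ⟨n, hn, c, hc⟩ := M.exists_link v
  have hT := hc.mem 0
  refine ⟨mkPoint hT (fun x => if x = v then 1 else 0) (fun x => ?_) (fun x hx => ?_) ?_, ?_⟩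
  · split_ifs <;> norm_num
  · rw [if_neg]; rintro rfl; exact hx (Finset.mem_insert_self _ _)
  · rw [Finset.sum_ite_eq', if_pos (Finset.mem_insert_self _ _)]
  · exact if_pos rfl

theorem lvl_mem_of_two {τ : Finset silo.V} (hτ : τ ∈ silo.triangles) {u v : silo.V} (hu : u ∈ τ)
    (h : u.1 = 2) (hv : v ∈ τ) : 1 ≤ lvl v ∧ lvl v ≤ 3 := by
  have h1 := level_le_of_mem hτ hu hv
  have h2 := level_le_of_mem hτ hv hu
  rw [lvl]
  exact ⟨by exact_mod_cast (by omega : 1 ≤ v.1), by exact_mod_cast (by omega : v.1 ≤ 3)⟩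

theorem height_of_mem_cylinder {p : silo.Point} (h : p ∈ silo.cylinder) :
    1 ≤ lin lvl p ∧ lin lvl p ≤ 3 := by
  obtain ⟨τ, hτ, hp, u, hu, h2⟩ := h
  rw [isEuclideanVertex_silo] at h2
  have h1 := p.sum_eq_one hp
  rw [lin_eq_sum lvl hp]
  constructor
  · refine h1.ge.trans (Finset.sum_le_sum fun v hv => ?_)
    have := (lvl_mem_of_two hτ hu h2 hv).1
    have := p.nonneg v
    nlinarith
  · calc ∑ v ∈ τ, p v * lvl v ≤ ∑ v ∈ τ, p v * 3 := Finset.sum_le_sum fun v hv =>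
          mul_le_mul_of_nonneg_left (lvl_mem_of_two hτ hu h2 hv).2 (p.nonneg v)
      _ = 3 := by rw [← Finset.sum_mul, h1, one_mul]

theorem mem_cylinder_of_height {p : silo.Point} (h1 : 1 < lin lvl p) (h3 : lin lvl p < 3) :
    p ∈ silo.cylinder := by
  obtain ⟨τ, hτ, hp⟩ := p.exists_triangle
  refine ⟨τ, hτ, hp, ?_⟩
  simp only [isEuclideanVertex_silo]
  by_contra hne
  push Not at hne
  have hs := p.sum_eq_one hp
  rw [lin_eq_sum lvl hp] at h1 h3
  obtain ⟨u, hu⟩ : τ.Nonempty := Finset.card_pos.1 (by rw [silo.card_eq_three τ hτ]; norm_num)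
  rcases (by have := hne u hu; omega : u.1 ≤ 1 ∨ 3 ≤ u.1) with h | h
  · have : ∑ v ∈ τ, p v * lvl v ≤ ∑ v ∈ τ, p v * 1 := Finset.sum_le_sum fun v hv => by
      refine mul_le_mul_of_nonneg_left ?_ (p.nonneg v)
      have h1 := level_le_of_mem hτ hu hv
      have h2 := hne v hv
      rw [lvl]; exact_mod_cast (by omega : v.1 ≤ 1)
    rw [← Finset.sum_mul, hs] at this
    linarith
  · have : ∑ v ∈ τ, p v * 3 ≤ ∑ v ∈ τ, p v * lvl v := Finset.sum_le_sum fun v hv => by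
      refine mul_le_mul_of_nonneg_left ?_ (p.nonneg v)
      have h1 := level_le_of_mem hτ hv hu
      have h2 := hne v hv
      rw [lvl]; exact_mod_cast (by omega : 3 ≤ v.1)
    rw [← Finset.sum_mul, hs] at this
    linarith

theorem slope_eq_zero_of_const {γ : ℝ → silo.Point} {t y : ℝ} {D : silo.V → ℝ}
    (h : ∀ t, lin lvl (γ t) = y) (hR : RGerm γ t D) (hD : IsDir (γ t) D) : lin lvl D = 0 := by
  obtain ⟨ε, hε, hR⟩ := hR
  have := lin_germ lvl hD (hR ε ⟨hε.le, le_rfl⟩)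
  rw [h, h] at this
  have : ε * lin lvl D = 0 := by linarith
  exact (mul_eq_zero.1 this).resolve_left hε.ne'

/-- At constant height both slopes are 0, but at a vertex off ring 2 one of two opposite slopes has
to be positive. -/
theorem not_vertex_of_const {γ : ℝ → silo.Point} (hγ : IsGeodesic γ) {y : ℝ}
    (h : ∀ t, lin lvl (γ t) = y) {t : ℝ} {v : silo.V} (hv : v.1 ≠ 2) : γ t v ≠ 1 := by
  intro h1
  obtain ⟨D, E, hR, hL, hD, hE, hO⟩ := (show GeodesicAt γ t from hγ t).germs
  have e1 := slope_eq_zero_of_const h hR hD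
  have e2 : lin lvl E = 0 := by
    refine slope_eq_zero_of_const (γ := fun s => γ (-s)) (t := -t) (fun t => h _) hL.reverse ?_
    simpa using hE
  exact (slope_pos_of_vOpp hv (hO.1 v h1) e2.le).ne' e1

/-- The set of all points of height `y`. -/
def level (y : ℝ) : Set silo.Point := {p | lin lvl p = y}

/-- The circular lines of the cylinder are the sets of all points of a given height. -/
theorem circularLine_eq {l : Set silo.Point} (hl : IsCircularLine l) (hc : l ⊆ silo.cylinder) :
    ∃ y, 1 < y ∧ y < 3 ∧ l = level y := by
  obtain ⟨γ, hγ, rfl, L, hL, hper⟩ := hl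
  have hconst := height_const_of_periodic hγ hL fun t k => ((hper _ _).2 ⟨k, rfl⟩).symm
  obtain ⟨y, hy⟩ : ∃ y, ∀ t, lin lvl (γ t) = y := ⟨_, fun t => hconst t 0⟩
  obtain ⟨b1, b3⟩ := height_of_mem_cylinder (hc ⟨0, rfl⟩)
  rw [hy] at b1 b3
  have hcov : ∀ q : silo.Point, lin lvl q = y → q ∈ range γ := fun q hq =>
    mem_range_of_height hγ hL hper (by linarith) hy hq
  -- At a height `k` the circle, which contains all points of its height, would pass through the
  -- vertices of ring `k`.
  have hnv : ∀ k : ℕ, k ≠ 2 → y ≠ k := by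
    rintro k hk rfl
    obtain ⟨p, hp⟩ := exists_vertexPt (M := silo) (vx k 0)
    obtain ⟨t, rfl⟩ := hcov p (lin_vertex lvl hp)
    exact not_vertex_of_const hγ hy (v := vx k 0) hk hp
  refine ⟨y, lt_of_le_of_ne b1 ?_, lt_of_le_of_ne b3 ?_, ?_⟩
  · have := hnv 1 (by norm_num); rw [Nat.cast_one] at this; exact this.symm
  · have := hnv 3 (by norm_num); rw [Nat.cast_ofNat] at this; exact this
  · ext q
    constructor
    · rintro ⟨t, rfl⟩; exact hy t
    · exact hcov q

/-! ### A circular line -/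

theorem triangle_one_two (i : ℤ) : {vx 1 i, vx 2 i, vx 2 (i + 1)} ∈ silo.triangles := by
  have := inner_mem 1 (i + 1)
  rwa [inner, dn_one, add_sub_cancel_right, ← insert_rotate] at this

theorem triangle_two_one_two (i : ℤ) : {vx 2 i, vx 1 i, vx 2 (i + 1)} ∈ silo.triangles := by
  have := inner_mem 1 (i + 1)
  rwa [inner, dn_one, add_sub_cancel_right, insert_swap] at this

theorem triangle_one_one (i : ℤ) : {vx 1 i, vx 2 (i + 1), vx 1 (i + 1)} ∈ silo.triangles := by
  have := outer_mem (le_refl 1) (i + 1)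
  rwa [outer, up_one, add_sub_cancel_right, insert_swap] at this

/-- At height `3 / 2` the circle joins midpoints of consecutive edges between rings 1 and 2, through
triangles pointing down and up in turn; each piece has length `1 / 2`. -/
theorem walk_lower {γ : ℝ → silo.Point} (hγ : IsGeodesic γ) {t : ℝ} {i : ℤ}
    (h : At γ t (vx 1 i) (vx 2 i) (vx 2 (i + 1)) (1 / 2) (1 / 2) 0 0 (-1) 1) :
    At γ (t + 1 / 2) (vx 1 i) (vx 2 (i + 1)) (vx 1 (i + 1)) (1 / 2) (1 / 2) 0 (-1) 0 1 := by
  have := h.swap.rotate.cross hγ (S := 1 / 2) (w' := vx 1 (i + 1)) (by norm_num) (by norm_num)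
    (by norm_num) (by norm_num) (by norm_num) (triangle_one_one i) (vx_ne_of_level (by omega) _ _)
  norm_num at this
  exact this

theorem walk_upper {γ : ℝ → silo.Point} (hγ : IsGeodesic γ) {t : ℝ} {i : ℤ}
    (h : At γ t (vx 1 i) (vx 2 (i + 1)) (vx 1 (i + 1)) (1 / 2) (1 / 2) 0 (-1) 0 1) :
    At γ (t + 1 / 2) (vx 1 (i + 1)) (vx 2 (i + 1)) (vx 2 (i + 1 + 1)) (1 / 2) (1 / 2) 0 0 (-1) 1 := by
  have := h.rotate.cross hγ (S := 1 / 2) (w' := vx 2 (i + 1 + 1)) (by norm_num) (by norm_num)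
    (by norm_num) (by norm_num) (by norm_num)
    (triangle_two_one_two (i + 1))
    (vx_ne_of_level (by omega) _ _)
  norm_num at this
  exact this.swap

theorem toPlane_of_at {γ : ℝ → silo.Point} {s : ℝ} {u v w : silo.V} {x y z : ℝ}
    (hT : {u, v, w} ∈ silo.triangles) (hp : ∀ q, γ s q = triVec u v w x y z q) {a : silo.V → ℝ}
    (ha : IsLift {u, v, w} a) (h0 : γ s (vx 0 0) = 0) :
    toPlane (γ s) = ((x * lvl u + y * lvl v + z * lvl w : ℝ) : ℂ) *
      Complex.exp (2 * Real.pi * ((x * a u + y * a v + z * a w : ℝ) : ℂ) * Complex.I) := by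
  have hm : (γ s).MemTriangle {u, v, w} := fun q hq => by rw [hp]; exact triVec_of_notMem _ _ _ hq
  obtain ⟨e1, e2, e3⟩ := triVec_apply hT x y z
  have hl : ∀ F : silo.V → ℝ, lin F (γ s) = x * F u + y * F v + z * F w := fun F => by
    rw [lin_tri F hT hm, hp, hp, hp, e1, e2, e3]
  rw [toPlane_eq ⟨_, a, ha, hm, (show lin a (γ s) = (x * a u + y * a v + z * a w) *
    (1 - γ s (vx 0 0)) by rw [hl, h0]; ring)⟩, hl]

theorem ang_one (i : ℤ) : ang 1 i = i / 5 := by simp [ang, ringShift, ringSize]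

theorem ang_two (i : ℤ) : ang 2 i = (i - 1 / 2) / 5 := by simp [ang, ringShift, ringSize]

theorem toPlane_walk_lower {γ : ℝ → silo.Point} (hγ : IsGeodesic γ) {t : ℝ} {i : ℤ}
    (h : At γ t (vx 1 i) (vx 2 i) (vx 2 (i + 1)) (1 / 2) (1 / 2) 0 0 (-1) 1) {s : ℝ}
    (h0 : 0 ≤ s) (h1 : s ≤ 1 / 2) : toPlane (γ (t + s)) =
      (3 / 2 : ℝ) * Complex.exp (2 * Real.pi * ((i + s - 1 / 4) / 5 : ℝ) * Complex.I) := by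
  have hp := h.follow hγ (S := 1 / 2) (by norm_num) (by norm_num) (by norm_num) s ⟨h0, h1⟩
  have hT := triangle_one_two i
  obtain ⟨e1, e2, e3⟩ := triVec_apply hT (i / 5) ((i - 1 / 2) / 5) ((i + 1 - 1 / 2) / 5)
  have hl : IsLift {vx 1 i, vx 2 i, vx 2 (i + 1)} (triVec (M := silo) (vx 1 i) (vx 2 i)
      (vx 2 (i + 1)) (i / 5) ((i - 1 / 2) / 5) ((i + 1 - 1 / 2) / 5)) :=
    isLift_of_triple hT rfl rfl rfl le_rfl one_le_two one_le_two (ang_one i).symm (ang_two i).symm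
      (by rw [ang_two]; push_cast; ring) (by ring_nf; norm_num [abs_of_pos])
      (by ring_nf; norm_num) (by ring_nf; norm_num)
  rw [toPlane_of_at hT hp hl, e1, e2, e3]
  · simp only [lvl_vx]
    congr 3
    · push_cast; ring
    · push_cast; ring
  · refine (hp _).trans (triVec_of_notMem _ _ _ fun hm => ?_)
    have h2 : 2 ≤ 0 + 1 :=
      level_le_of_mem hT hm (Finset.mem_insert_of_mem (Finset.mem_insert_self _ _))
    omega

theorem toPlane_walk_upper {γ : ℝ → silo.Point} (hγ : IsGeodesic γ) {t : ℝ} {i : ℤ}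
    (h : At γ t (vx 1 i) (vx 2 (i + 1)) (vx 1 (i + 1)) (1 / 2) (1 / 2) 0 (-1) 0 1) {s : ℝ}
    (h0 : 0 ≤ s) (h1 : s ≤ 1 / 2) : toPlane (γ (t + s)) =
      (3 / 2 : ℝ) * Complex.exp (2 * Real.pi * ((i + (1 / 2 + s) - 1 / 4) / 5 : ℝ) *
        Complex.I) := by
  have hp := h.follow hγ (S := 1 / 2) (by norm_num) (by norm_num) (by norm_num) s ⟨h0, h1⟩
  have hT := triangle_one_one i
  obtain ⟨e1, e2, e3⟩ := triVec_apply hT (i / 5) ((i + 1 - 1 / 2) / 5) ((i + 1) / 5)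
  have hl : IsLift {vx 1 i, vx 2 (i + 1), vx 1 (i + 1)} (triVec (M := silo) (vx 1 i)
      (vx 2 (i + 1)) (vx 1 (i + 1)) (i / 5) ((i + 1 - 1 / 2) / 5) ((i + 1) / 5)) :=
    isLift_of_triple hT rfl rfl rfl le_rfl one_le_two le_rfl (ang_one i).symm
      (by rw [ang_two]; push_cast; ring)
      (by rw [ang_one]; push_cast; ring) (by ring_nf; norm_num [abs_of_pos])
      (by ring_nf; norm_num) (by ring_nf; norm_num)
  rw [toPlane_of_at hT hp hl, e1, e2, e3]
  · simp only [lvl_vx]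
    congr 3
    · push_cast; ring
    · push_cast; ring
  · refine (hp _).trans (triVec_of_notMem _ _ _ fun hm => ?_)
    have h2 : 2 ≤ 0 + 1 :=
      level_le_of_mem hT hm (Finset.mem_insert_of_mem (Finset.mem_insert_self _ _))
    omega

theorem exists_geodesic_at {M : SManifold} {u v w : M.V} {x y z a b c : ℝ}
    (hT : {u, v, w} ∈ M.triangles) (hx : 0 ≤ x) (hy : 0 ≤ y) (hz : 0 ≤ z) (h1 : x + y + z = 1)
    (h0 : a + b + c = 0) (h2 : a ^ 2 + b ^ 2 + c ^ 2 = 2) (ha : x = 0 → 0 ≤ a) (hb : y = 0 → 0 ≤ b)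
    (hc : z = 0 → 0 ≤ c) : ∃ γ : ℝ → M.Point, IsGeodesic γ ∧ At γ 0 u v w x y z a b c := by
  obtain ⟨e1, e2, e3⟩ := triVec_apply hT x y z
  have hp : ∀ q, 0 ≤ triVec u v w x y z q := by
    intro q
    simp only [triVec]
    split_ifs <;> first | assumption | exact le_rfl
  obtain ⟨p, hp'⟩ : ∃ p : M.Point, ∀ q, p q = triVec u v w x y z q :=
    ⟨mkPoint hT _ hp (fun q hq => triVec_of_notMem _ _ _ hq)
      (by rw [sum_tri hT, e1, e2, e3]; exact h1), fun q => rfl⟩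
  have hd : IsDir p (triVec u v w a b c) := by
    refine isDir_triVec hT (fun q hq => (hp' q).trans (triVec_of_notMem _ _ _ hq)) h0 h2 ?_
    intro q hq
    rw [hp'] at hq
    simp only [triVec] at hq ⊢
    split_ifs at hq ⊢
    · exact ha hq
    · exact hb hq
    · exact hc hq
    · exact le_rfl
  obtain ⟨γ, g1, g2, g3⟩ := exists_geodesic hd
  exact ⟨γ, g1, hT, fun q => by rw [g2, hp'], g3, h0, h2⟩

theorem exists_walk : ∃ γ : ℝ → silo.Point, IsGeodesic γ ∧
    At γ 0 (vx 1 0) (vx 2 0) (vx 2 (0 + 1)) (1 / 2) (1 / 2) 0 0 (-1) 1 :=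
  exists_geodesic_at (triangle_one_two 0) (by norm_num) (by norm_num) (by norm_num) (by norm_num)
    (by norm_num) (by norm_num) (by norm_num) (by norm_num) (by norm_num)

theorem walk_nat {γ : ℝ → silo.Point} (hγ : IsGeodesic γ)
    (h : At γ 0 (vx 1 0) (vx 2 0) (vx 2 (0 + 1)) (1 / 2) (1 / 2) 0 0 (-1) 1) (n : ℕ) :
    At γ n (vx 1 n) (vx 2 n) (vx 2 (n + 1)) (1 / 2) (1 / 2) 0 0 (-1) 1 := by
  induction n with
  | zero => simpa using h
  | succ n ih =>
    have := walk_upper hγ (walk_lower hγ ih)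
    rw [show (n : ℝ) + 1 / 2 + 1 / 2 = (n + 1 : ℕ) by push_cast; ring] at this
    exact_mod_cast this

theorem toPlane_walk {γ : ℝ → silo.Point} (hγ : IsGeodesic γ)
    (h : At γ 0 (vx 1 0) (vx 2 0) (vx 2 (0 + 1)) (1 / 2) (1 / 2) 0 0 (-1) 1) {t : ℝ} (ht : 0 ≤ t) :
    toPlane (γ t) = (3 / 2 : ℝ) *
      Complex.exp (2 * Real.pi * ((t - 1 / 4) / 5 : ℝ) * Complex.I) := by
  have hn := walk_nat hγ h ⌊t⌋₊
  have h0 := Nat.floor_le ht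
  have h1 := Nat.lt_floor_add_one t
  rcases le_total t (⌊t⌋₊ + 1 / 2) with h2 | h2
  · have := toPlane_walk_lower hγ hn (s := t - ⌊t⌋₊) (by linarith) (by linarith)
    rw [Int.cast_natCast] at this
    rwa [add_sub_cancel] at this
  · have := toPlane_walk_upper hγ (walk_lower hγ hn) (s := t - ⌊t⌋₊ - 1 / 2) (by linarith)
      (by linarith)
    rw [Int.cast_natCast] at this
    rw [show (⌊t⌋₊ : ℝ) + 1 / 2 + (t - ⌊t⌋₊ - 1 / 2) = t by ring] at this
    rw [this, show (⌊t⌋₊ : ℝ) + (1 / 2 + (t - ⌊t⌋₊ - 1 / 2)) = t by ring]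

/-- After five steps the indices return modulo 5, so position and velocity recur, and uniqueness of
geodesics does the rest. -/
theorem walk_periodic {γ : ℝ → silo.Point} (hγ : IsGeodesic γ)
    (h : At γ 0 (vx 1 0) (vx 2 0) (vx 2 (0 + 1)) (1 / 2) (1 / 2) 0 0 (-1) 1) :
    Function.Periodic γ 5 := by
  have h5 := walk_nat hγ h 5
  have e1 : vx 1 (5 : ℕ) = vx 1 0 := by rw [vx_eq_iff]; decide
  have e2 : vx 2 (5 : ℕ) = vx 2 0 := by rw [vx_eq_iff]; decide
  have e3 : vx 2 ((5 : ℕ) + 1) = vx 2 (0 + 1) := by rw [vx_eq_iff]; decide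
  rw [e1, e2, e3, Nat.cast_ofNat] at h5
  have hs : (fun s => γ (s + 5)) = γ := (hγ.shift 5).unique hγ (t := 0)
    (Point.ext fun x => by simp only [zero_add]; rw [h5.pos, h.pos])
    (RGerm.shift (by rw [zero_add]; exact h5.germ)) h.germ
  exact fun t => congrFun hs t

theorem exists_circularLine : ∃ l : Set silo.Point, IsCircularLine l ∧ l ⊆ silo.cylinder := by
  obtain ⟨γ, hγ, h⟩ := exists_walk
  have hper := walk_periodic hγ h
  have hplane : ∀ t, toPlane (γ t) = (3 / 2 : ℝ) *
      Complex.exp (2 * Real.pi * ((t - 1 / 4) / 5 : ℝ) * Complex.I) := by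
    intro t
    -- The formula for the walk is known only at nonnegative times; periodicity carries it to all
    -- times.
    obtain ⟨k, hk⟩ := exists_int_gt (-t / 5)
    have h1 := toPlane_walk hγ h (t := t + k * 5) (by linarith)
    rw [hper.int_mul k t] at h1
    rw [h1, ← exp_add_int ((t - 1 / 4) / 5) k]
    congr 5
    ring
  refine ⟨range γ, ⟨γ, hγ, rfl, 5, by norm_num, fun s t => ⟨fun e => ?_, ?_⟩⟩, ?_⟩
  · have e1 := congrArg toPlane e
    rw [hplane, hplane] at e1
    have e2 := mul_left_cancel₀ (by norm_num) e1
    rw [Complex.exp_eq_exp_iff_exists_int] at e2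
    obtain ⟨k, hk⟩ := e2
    have hpi : (2 * Real.pi * Complex.I : ℂ) ≠ 0 := Complex.two_pi_I_ne_zero
    have e3 : (((s - 1 / 4) / 5 : ℝ) : ℂ) = (((t - 1 / 4) / 5 + k : ℝ) : ℂ) := by
      refine mul_left_cancel₀ hpi ?_
      push_cast at hk ⊢
      linear_combination hk
    have e4 := Complex.ofReal_injective e3
    exact ⟨-k, by push_cast; linarith⟩
  · rintro ⟨k, rfl⟩
    exact (hper.int_mul k s).symm
  · rintro _ ⟨t, rfl⟩
    have hh : lin lvl (γ t) = 3 / 2 := by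
      rw [← norm_toPlane, hplane, norm_mul, Complex.norm_real]
      rw [show (2 * Real.pi * ((t - 1 / 4) / 5 : ℝ) * Complex.I : ℂ) =
        ((2 * Real.pi * ((t - 1 / 4) / 5) : ℝ) : ℂ) * Complex.I by push_cast; ring,
        Complex.norm_exp_ofReal_mul_I]
      norm_num
    exact mem_cylinder_of_height (by rw [hh]; norm_num) (by rw [hh]; norm_num)

end SManifold

end


noncomputable section

namespace SManifold

open Set

/-! ### Following geodesics through triangles and vertices -/

section Follow

variable {M : SManifold}

theorem ev_eq_triVec {u v w : M.V} (h : {u, v, w} ∈ M.triangles) (a b : ℝ) (x : M.V) :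
    a * ev u v x + b * ev u w x = triVec u v w (-(a + b)) a b x := by
  obtain ⟨n1, n2, n3⟩ := tri_ne h
  by_cases h1 : x = u
  · subst h1; simp [ev, triVec, n1, n2]; ring
  by_cases h2 : x = v
  · subst h2; simp [ev, triVec, h1, n3]
  by_cases h3 : x = w
  · subst h3; simp [ev, triVec, h1, h2]
  simp [ev, triVec, h1, h2, h3]

theorem pdir_eq_triVec {v : M.V} {n : ℕ} {c : ZMod n → M.V} (hc : IsLink M.triangles v c) {θ : ℝ}
    {k : ℤ} (h0 : k * (Real.pi / 3) ≤ θ) (h1 : θ ≤ (k + 1) * (Real.pi / 3)) :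
    pdir v c θ = triVec v (c k) (c (k + 1))
      (-(polX (θ - k * (Real.pi / 3)) + polY (θ - k * (Real.pi / 3))))
      (polX (θ - k * (Real.pi / 3))) (polY (θ - k * (Real.pi / 3))) := by
  funext x
  exact (pdir_eq v c h0 h1 x).trans (ev_eq_triVec (hc.mem _) _ _ x)

theorem at_of_pdir {γ : ℝ → M.Point} {t : ℝ} {v : M.V} {n : ℕ} {c : ZMod n → M.V}
    (hc : IsLink M.triangles v c) (hv : γ t v = 1) {θ : ℝ} {k : ℤ}
    (h0 : k * (Real.pi / 3) ≤ θ) (h1 : θ ≤ (k + 1) * (Real.pi / 3))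
    (hD : RGerm γ t (pdir v c θ)) : At γ t v (c k) (c (k + 1)) 1 0 0
      (-(polX (θ - k * (Real.pi / 3)) + polY (θ - k * (Real.pi / 3))))
      (polX (θ - k * (Real.pi / 3))) (polY (θ - k * (Real.pi / 3))) := by
  refine ⟨hc.mem _, fun q => ?_, pdir_eq_triVec hc h0 h1 ▸ hD, by ring, ?_⟩
  · by_cases hq : q = v
    · subst hq; simp [triVec, hv]
    · rw [Point.eq_zero_of_eq_one hv hq]
      simp only [triVec, if_neg hq]
      split_ifs <;> rfl
  · linear_combination 2 * polX_sq (θ - k * (Real.pi / 3))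

/-- A geodesic that arrives at a vertex from the angle `θ` leaves it at the opposite angle. -/
theorem IsGeodesic.turn {γ : ℝ → M.Point} (hγ : IsGeodesic γ) {t : ℝ} {v : M.V} {n : ℕ}
    {c : ZMod n → M.V} (hn : n = 5 ∨ n = 6 ∨ n = 7) (hc : IsLink M.triangles v c)
    (hv : γ t v = 1) {θ : ℝ} (hE : LGerm γ t (pdir v c θ)) :
    RGerm γ t (pdir v c (θ + n * (Real.pi / 6))) := by
  obtain ⟨D, E, hR, hL, -, -, hO⟩ := (show GeodesicAt γ t from hγ t).germs
  obtain ⟨φ, e1, e2⟩ := (hO.1 v hv).exists_angle hn hc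
  obtain ⟨m, rfl⟩ := pdir_injective hn hc ((hE.unique hL).trans e1)
  rw [e2, show θ + m * (n * (Real.pi / 3)) + n * (Real.pi / 6)
    = θ + n * (Real.pi / 6) + m * (n * (Real.pi / 3)) by ring, pdir_add_period] at hR
  exact hR

theorem At.arrive {γ : ℝ → M.Point} (hγ : IsGeodesic γ) {t S : ℝ} {u v w : M.V}
    {x y z a b c : ℝ} (h : At γ t u v w x y z a b c) (hS : 0 < S) (h1 : x + S * a = 0)
    (h2 : y + S * b = 0) :
    γ (t + S) w = 1 ∧ LGerm γ (t + S) (fun q => -triVec u v w a b c q) := by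
  have h3 : z + S * c = 1 := by
    linear_combination h.sum_pos + S * h.sum - h1 - h2
  have hf := h.follow hγ (S := S) h1.ge h2.ge (by rw [h3]; exact zero_le_one)
  constructor
  · rw [hf S ⟨hS.le, le_rfl⟩, (triVec_apply h.tri _ _ _).2.2, h3]
  · refine LGerm.of_affine (p := γ t) hS fun s hs q => ?_
    rw [hf s hs, h.pos]
    simp only [triVec]
    split_ifs <;> ring

/-- A geodesic that arrives at a vertex through the middle of a triangle or along an edge. -/
theorem At.arrive_pdir {γ : ℝ → M.Point} (hγ : IsGeodesic γ) {t S : ℝ} {w : M.V} {n : ℕ}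
    {c : ZMod n → M.V} (hn : n = 5 ∨ n = 6 ∨ n = 7) (hc : IsLink M.triangles w c) {k : ℤ}
    {x y z a b d : ℝ} (h : At γ t w (c k) (c (k + 1)) z x y d a b) (hS : 0 < S)
    (h1 : x + S * a = 0) (h2 : y + S * b = 0) {θ : ℝ} (h0 : k * (Real.pi / 3) ≤ θ)
    (hθ : θ ≤ (k + 1) * (Real.pi / 3)) (hX : polX (θ - k * (Real.pi / 3)) = -a)
    (hY : polY (θ - k * (Real.pi / 3)) = -b) :
    γ (t + S) w = 1 ∧ RGerm γ (t + S) (pdir w c (θ + n * (Real.pi / 6))) := by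
  obtain ⟨e1, e2⟩ := h.rotate.arrive hγ hS h1 h2
  refine ⟨e1, hγ.turn hn hc e1 ?_⟩
  convert e2 using 1
  funext q
  have hs := h.sum
  have hd : d = -a - b := by linarith
  rw [pdir_eq_triVec hc h0 hθ, hX, hY, hd]
  obtain ⟨n1, n2, n3⟩ := tri_ne h.tri
  by_cases hq1 : q = w
  · subst hq1; simp [triVec, n1, n2]
  · simp only [triVec, if_neg hq1]
    split_ifs <;> ring

theorem polX_pi_div_six : polX (Real.pi / 6) = 1 / √3 := by
  have h3 := sqrt_three_pos
  rw [polX, Real.cos_pi_div_six, Real.sin_pi_div_six]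
  field_simp
  rw [Real.sq_sqrt (by norm_num)]; norm_num

theorem polY_pi_div_six : polY (Real.pi / 6) = 1 / √3 := by
  rw [polY, Real.sin_pi_div_six]; norm_num

/-- A geodesic stays above the height `h` while it crosses a triangle above this height. -/
theorem At.le_of_follow (F : M.V → ℝ) {γ : ℝ → M.Point} (hγ : IsGeodesic γ) {t S h : ℝ}
    {u v w : M.V} {x y z a b c : ℝ} (hA : At γ t u v w x y z a b c) (h1 : 0 ≤ x + S * a)
    (h2 : 0 ≤ y + S * b) (h3 : 0 ≤ z + S * c) (hu : h ≤ F u) (hv : h ≤ F v) (hw : h ≤ F w)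
    (H : ∀ s, t + S ≤ s → h ≤ lin F (γ s)) : ∀ s, t ≤ s → h ≤ lin F (γ s) := by
  intro s hs
  rcases le_or_gt (t + S) s with h' | h'
  · exact H s h'
  · have hp := hA.follow hγ h1 h2 h3 (s - t) ⟨by linarith, by linarith⟩
    rw [add_sub_cancel] at hp
    have hm : (γ s).MemTriangle {u, v, w} := fun q hq => by rw [hp]; exact triVec_of_notMem _ _ _ hq
    have hs1 := Point.sum_tri hA.tri hm
    rw [lin_tri F hA.tri hm]
    have p1 := mul_le_mul_of_nonneg_left hu ((γ s).nonneg u)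
    have p2 := mul_le_mul_of_nonneg_left hv ((γ s).nonneg v)
    have p3 := mul_le_mul_of_nonneg_left hw ((γ s).nonneg w)
    calc h = γ s u * h + γ s v * h + γ s w * h := by rw [← add_mul, ← add_mul, hs1, one_mul]
      _ ≤ _ := by linarith

/-- The same for a geodesic that leaves the triangle through the side opposite to `w`. -/
theorem At.le_of_cross (F : M.V → ℝ) {γ : ℝ → M.Point} (hγ : IsGeodesic γ) {t S h : ℝ}
    {u v w w' : M.V} {x y z a b c X Y a' b' c' : ℝ} (hA : At γ t u v w x y z a b c) (hS : 0 < S)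
    (h1 : x + S * a = X) (h2 : y + S * b = Y) (h3 : z + S * c = 0) (hX : 0 < X) (hY : 0 < Y)
    (hc : -c = c') (hc' : 0 < c') (ha : a + c = a') (hb : b + c = b')
    (hw' : {u, v, w'} ∈ M.triangles) (hne : w' ≠ w)
    (hu : h ≤ F u) (hv : h ≤ F v) (hw : h ≤ F w)
    (H : At γ (t + S) u v w' X Y 0 a' b' c' → ∀ s, t + S ≤ s → h ≤ lin F (γ s)) :
    ∀ s, t ≤ s → h ≤ lin F (γ s) := by
  subst h1 h2 hc ha hb
  exact hA.le_of_follow F hγ hX.le hY.le h3.ge hu hv hw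
    (H (hA.cross hγ hS hX hY h3 (by linarith) hw' hne))

theorem At.lin_eq (F : M.V → ℝ) {γ : ℝ → M.Point} {t : ℝ} {u v w : M.V} {x y z a b c : ℝ}
    (h : At γ t u v w x y z a b c) : lin F (triVec u v w a b c) = a * F u + b * F v + c * F w := by
  obtain ⟨e1, e2, e3⟩ := triVec_apply h.tri a b c
  rw [lin_tri F h.tri fun x hx => triVec_of_notMem _ _ _ hx, e1, e2, e3]

theorem At.lin_pos_eq (F : M.V → ℝ) {γ : ℝ → M.Point} {t : ℝ} {u v w : M.V} {x y z a b c : ℝ}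
    (h : At γ t u v w x y z a b c) : lin F (γ t) = x * F u + y * F v + z * F w := by
  obtain ⟨e1, e2, e3⟩ := h.coords
  rw [lin_tri F h.tri h.mem, e1, e2, e3]

theorem _root_.IsLink.reflect {V : Type} [DecidableEq V] {T : Set (Finset V)} {v : V} {n : ℕ}
    {c : ZMod n → V} (h : IsLink T v c) (a : ZMod n) : IsLink T v fun j => c (a - j) := by
  refine ⟨fun i j e => sub_right_injective (h.1 e), fun τ => ?_⟩
  rw [h.2]
  constructor
  · rintro ⟨k, rfl⟩
    refine ⟨a - k - 1, ?_⟩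
    beta_reduce
    rw [show a - (a - k - 1) = k + 1 by ring, show a - (a - k - 1 + 1) = k by ring, insert_swap]
  · rintro ⟨k, rfl⟩
    refine ⟨a - k - 1, ?_⟩
    beta_reduce
    rw [show a - k - 1 + 1 = a - k by ring, show a - (k + 1) = a - k - 1 by ring, insert_swap]

end Follow

end SManifold

end


noncomputable section

namespace SManifold

open Set

/-! ### Geodesics that leave a vertex with one neighbour below -/

/-- The heights `h + patB (5 - j)` around a vertex of height `h + 1` with one neighbour below. -/
def IsLowLink (w : silo.V) (c : ZMod 7 → silo.V) (h : ℕ) : Prop :=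
  IsLink silo.triangles w c ∧ lvl w = (h + 1 : ℕ) ∧ lvl (c 0) = (h + 1 : ℕ) ∧
    lvl (c 1) = (h + 2 : ℕ) ∧ lvl (c 2) = (h + 2 : ℕ) ∧ lvl (c 3) = (h + 2 : ℕ) ∧
    lvl (c 4) = (h + 2 : ℕ) ∧ lvl (c 5) = (h + 1 : ℕ) ∧ lvl (c 6) = (h : ℕ)

theorem isLowLink_left {k : ℕ} (hk : 2 ≤ k) {i : ℤ} (h : dn k (i + 1) = dn k i) :
    IsLowLink (vx (k + 1) i) (linkB k i) k :=
  ⟨isLink_linkB hk h, rfl, rfl, rfl, rfl, rfl, rfl, rfl, rfl⟩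

theorem isLowLink_right {k : ℕ} (hk : 2 ≤ k) {i : ℤ} (h : dn k (i + 1) = dn k i) :
    IsLowLink (vx (k + 1) i) (fun j => linkB k i (5 - j)) k :=
  ⟨(isLink_linkB hk h).reflect 5, rfl, rfl, rfl, rfl, rfl, rfl, rfl, rfl⟩

theorem IsLowLink.tri {w : silo.V} {c : ZMod 7 → silo.V} {h : ℕ} (hc : IsLowLink w c h)
    (k : ZMod 7) : {w, c k, c (k + 1)} ∈ silo.triangles := hc.1.mem k

theorem IsLowLink.ne {w : silo.V} {c : ZMod 7 → silo.V} {h : ℕ} (hc : IsLowLink w c h)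
    {i j : ZMod 7} (hij : i ≠ j) : c i ≠ c j := fun e => hij (hc.1.1 e)

variable {w v : silo.V} {c : ZMod 7 → silo.V} {h : ℕ} {γ : ℝ → silo.Point} {t α β : ℝ}

theorem le_of_slope_nonneg (hγ : IsGeodesic γ) {u v w : silo.V} {x y z a b c : ℝ}
    (hA : At γ t u v w x y z a b c) {h : ℝ} (h0 : h ≤ lin lvl (γ t))
    (h1 : 0 ≤ a * lvl u + b * lvl v + c * lvl w) : ∀ s, t ≤ s → h ≤ lin lvl (γ s) := fun _ hs =>
  h0.trans (height_le hγ hA.germ (by rw [hA.lin_eq]; exact h1) hs)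

/-- The geodesic crosses `p w` when the weight of `q` vanishes and then `w r` when that of `p`
vanishes. By `H` it does not descend in the next triangle, so convexity takes care of the future. -/
theorem le_of_double_cross (hγ : IsGeodesic γ) {p q r r' : silo.V} {h : ℝ} (hβ : 0 < β)
    (hβα : β < α)
    (hA : At γ t p q w (α / (α + β)) (β / (α + β)) 0 (-β) (-α) (α + β))
    (hr : {p, w, r} ∈ silo.triangles) (hr' : {w, r, r'} ∈ silo.triangles) (hne : r ≠ q)
    (hne' : r' ≠ p) (hp : h ≤ lvl p) (hq : h ≤ lvl q) (hw : h ≤ lvl w) (hr0 : h ≤ lvl r)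
    (H : 0 ≤ -α * lvl w + -β * lvl r + (α + β) * lvl r') :
    ∀ s, t ≤ s → h ≤ lin lvl (γ s) := by
  have hα : 0 < α := by linarith
  have hs : 0 < α + β := by linarith
  have hd : 0 < α - β := by linarith
  refine hA.swap.rotate.le_of_cross lvl hγ (S := β / (α * (α + β))) (X := (α - β) / α)
    (Y := β / α) (a' := -(α + β)) (b' := β) (c' := α) (w' := r) (by positivity)
    (by field_simp; ring) (by field_simp; ring) (by field_simp; ring) (by positivity)
    (by positivity) (by ring) hα (by ring) (by ring) hr hne hp hw hq fun h1 => ?_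
  refine h1.rotate.le_of_cross lvl hγ (S := (α - β) / (α * (α + β))) (X := 2 * β / (α + β))
    (Y := (α - β) / (α + β)) (a' := -α) (b' := -β) (c' := α + β) (w' := r') (by positivity)
    (by field_simp; ring) (by field_simp; ring) (by field_simp; ring) (by positivity)
    (by positivity) (by ring) hs (by ring) (by ring) hr' hne' hw hr0 hp fun h2 => ?_
  refine le_of_slope_nonneg hγ h2 ?_ H
  rw [h2.lin_pos_eq]
  have e : 2 * β / (α + β) + (α - β) / (α + β) = 1 := by field_simp; ring
  have p1 : 0 ≤ 2 * β / (α + β) := by positivity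
  have p2 : 0 ≤ (α - β) / (α + β) := by positivity
  calc h = 2 * β / (α + β) * h + (α - β) / (α + β) * h := by rw [← add_mul, e, one_mul]
    _ ≤ _ := by
      have := mul_le_mul_of_nonneg_left hw p1
      have := mul_le_mul_of_nonneg_left hr0 p2
      linarith

/-- With equal components the geodesic runs into `w` along a bisector, at the angle `π / 6`. It
leaves at `π / 6 + 7 π / 6 = 4 π / 3`, inside the ascending arc from 0 to `5 π / 3`. -/
theorem IsLowLink.le_of_arrive (hγ : IsGeodesic γ) (hc : IsLowLink w c h)
    (hA : At γ t (c 0) (c 1) w (1 / 2) (1 / 2) 0 (-α) (-α) (α + α)) (hα : 0 < α) :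
    ∀ s, t ≤ s → (h : ℝ) ≤ lin lvl (γ s) := by
  obtain ⟨hl, lw, l0, l1, l2, l3, l4, l5, l6⟩ := id hc
  -- Unit speed determines `α`.
  have hα' : α = 1 / √3 := by
    have h3 := sqrt_three_pos
    have h3' := sqrt_three_sq
    have := hA.sq
    rw [eq_div_iff h3.ne']
    have e : (α * √3) * (α * √3) = 1 * 1 := by
      linear_combination α ^ 2 * h3' + this / 2
    exact (mul_self_eq_mul_self_iff.1 e).resolve_right (by have := mul_pos hα h3; linarith)
  have hπ := Real.pi_pos
  have h1 : At γ t w (c ((0 : ℤ) : ZMod 7)) (c (((0 : ℤ) : ZMod 7) + 1)) 0 (1 / 2) (1 / 2)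
      (α + α) (-α) (-α) := by
    simpa only [Int.cast_zero, zero_add] using hA.rotate.rotate
  obtain ⟨g1, g2⟩ := h1.arrive_pdir hγ (S := 1 / (2 * α)) (by omega) hl (by positivity)
    (by field_simp; ring) (by field_simp; ring) (θ := Real.pi / 6) (by push_cast; linarith)
    (by push_cast; linarith) (by rw [Int.cast_zero, zero_mul, sub_zero, polX_pi_div_six, hα', neg_neg])
    (by rw [Int.cast_zero, zero_mul, sub_zero, polY_pi_div_six, hα', neg_neg])
  have hle : ∀ {m : ℕ}, h ≤ m → (h : ℝ) ≤ m := fun h => by exact_mod_cast h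
  refine hA.le_of_follow lvl hγ (S := 1 / (2 * α)) ?_ ?_ ?_ (by rw [l0]; exact hle (by omega))
    (by rw [l1]; exact hle (by omega)) (by rw [lw]; exact hle (by omega)) fun s hs => ?_
  · field_simp; norm_num
  · field_simp; norm_num
  · positivity
  · have hp := lin_pdir_pos (M := silo) lvl hl (m := 5) (by norm_num) (by rw [Int.cast_zero, lw, l0])
      (by rw [lw]; exact l5.ge) (fun j h1 h2 => by
        rw [lw]
        interval_cases j
        · exact (by exact_mod_cast (by omega : h + 1 < h + 2) : ((h + 1 : ℕ) : ℝ) < (h + 2 : ℕ)).trans_eq l1.symm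
        · exact (by exact_mod_cast (by omega : h + 1 < h + 2) : ((h + 1 : ℕ) : ℝ) < (h + 2 : ℕ)).trans_eq l2.symm
        · exact (by exact_mod_cast (by omega : h + 1 < h + 2) : ((h + 1 : ℕ) : ℝ) < (h + 2 : ℕ)).trans_eq l3.symm
        · exact (by exact_mod_cast (by omega : h + 1 < h + 2) : ((h + 1 : ℕ) : ℝ) < (h + 2 : ℕ)).trans_eq l4.symm)
      (θ := Real.pi / 6 + (7 : ℕ) * (Real.pi / 6)) (by push_cast; linarith) (by push_cast; linarith)
    have := height_le hγ g2 hp.le hs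
    rw [lin_vertex lvl g1, lw] at this
    exact (hle (by omega)).trans this

/-- A geodesic that starts at a vertex `v` across the edge from `c 0` to `c 1` never comes below the
height `h`. -/
theorem IsLowLink.le_of_sector (hγ : IsGeodesic γ) (hc : IsLowLink w c h) (hα : 0 < α)
    (hβ : 0 < β) (hv : h ≤ lvl v) (hvw : w ≠ v)
    (hA : At γ t v (c 0) (c 1) 1 0 0 (-(α + β)) α β) :
    ∀ s, t ≤ s → (h : ℝ) ≤ lin lvl (γ s) := by
  obtain ⟨hl, lw, l0, l1, l2, l3, l4, l5, l6⟩ := id hc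
  have hs : 0 < α + β := by linarith
  have hle : ∀ {m : ℕ}, h ≤ m → (h : ℝ) ≤ m := fun h => by exact_mod_cast h
  have k0 : (h : ℝ) ≤ lvl (c 0) := by rw [l0]; exact hle (by omega)
  have k1 : (h : ℝ) ≤ lvl (c 1) := by rw [l1]; exact hle (by omega)
  have k2 : (h : ℝ) ≤ lvl (c 2) := by rw [l2]; exact hle (by omega)
  have kw : (h : ℝ) ≤ lvl w := by rw [lw]; exact hle (by omega)
  refine hA.rotate.le_of_cross lvl hγ (S := 1 / (α + β)) (X := α / (α + β))
    (Y := β / (α + β)) (a' := -β) (b' := -α) (c' := α + β) (w' := w) (by positivity)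
    (by field_simp; ring) (by field_simp; ring) (by field_simp; ring) (by positivity)
    (by positivity) (by ring) hs (by ring) (by ring) (insert_rotate (V := silo.V) _ _ _ ▸ hc.tri 0) hvw k0 k1 hv
    fun h1 => ?_
  -- If `β < α`, the geodesic passes `w` on the side of `c 0` and dips past the low neighbour `c 6`
  -- before it enters a triangle where it ascends. If `α < β`, it passes on the other side, among
  -- higher vertices. Equality leads into `w` itself.
  rcases lt_trichotomy β α with hlt | rfl | hlt
  · refine le_of_double_cross hγ hβ hlt h1 (r := c 6) (r' := c 5) ?_ ?_ (hc.ne (by decide))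
      (hc.ne (by decide)) k0 k1 kw l6.ge ?_
    · have h6 : {w, c 6, c 0} ∈ silo.triangles := hc.tri 6
      exact (insert_rotate (V := silo.V) (c 0) w (c 6)) ▸ h6
    · exact insert_swap (V := silo.V) _ _ _ ▸ hc.tri 5
    · rw [lw, l6, l5]; push_cast; linarith
  · refine hc.le_of_arrive hγ ?_ hβ
    have e : β / (β + β) = 1 / 2 := by field_simp; ring
    rwa [e] at h1
  · rw [add_comm α β] at h1 ⊢
    refine le_of_double_cross hγ hα hlt h1.swap (r := c 2) (r' := c 3) ?_ ?_ (hc.ne (by decide))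
      (hc.ne (by decide)) k1 k0 kw k2 ?_
    · exact insert_swap' (V := silo.V) _ _ _ ▸ hc.tri 1
    · exact hc.tri 2
    · rw [lw, l2, l3]; push_cast; linarith

end SManifold

end


noncomputable section

namespace SManifold

open Set

/-! ### Lines through a point -/

/-- All geodesics from `p` in the direction `D` stay above the height `h`. -/
def StaysAbove (h : ℝ) (p : silo.Point) (D : silo.V → ℝ) : Prop :=
  ∀ γ : ℝ → silo.Point, IsGeodesic γ → ∀ t, γ t = p → RGerm γ t D → ∀ s, t ≤ s → h ≤ lin lvl (γ s)

theorem staysAbove_of_slope {p : silo.Point} {D : silo.V → ℝ} (h : 0 ≤ lin lvl D) :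
    StaysAbove (lin lvl p) p D := by
  rintro γ hγ t rfl hD s hs
  exact height_le hγ hD h hs

theorem StaysAbove.mono {h h' : ℝ} {p : silo.Point} {D : silo.V → ℝ} (H : StaysAbove h p D)
    (hh : h' ≤ h) : StaysAbove h' p D := fun γ hγ t hp hD s hs => hh.trans (H γ hγ t hp hD s hs)

theorem StaysAbove.le {γ : ℝ → silo.Point} (hγ : IsGeodesic γ) {h : ℝ} {t : ℝ}
    {D E : silo.V → ℝ} (hD : RGerm γ t D) (hE : LGerm γ t E) (HD : StaysAbove h (γ t) D)
    (HE : StaysAbove h (γ t) E) (s : ℝ) : h ≤ lin lvl (γ s) := by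
  rcases le_total t s with hs | hs
  · exact HD γ hγ t rfl hD s hs
  · have := HE _ hγ.reverse (-t) (by rw [neg_neg]) hE.reverse (-s) (by linarith)
    rwa [neg_neg] at this

/-- A geodesic through a vertex, with its two directions. -/
theorem IsGeodesic.exists_angle {M : SManifold} {γ : ℝ → M.Point} (hγ : IsGeodesic γ) {t : ℝ}
    {v : M.V} (hv : γ t v = 1) {n : ℕ} {c : ZMod n → M.V} (hn : n = 5 ∨ n = 6 ∨ n = 7)
    (hc : IsLink M.triangles v c) : ∃ θ : ℝ, LGerm γ t (pdir v c θ) ∧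
      RGerm γ t (pdir v c (θ + n * (Real.pi / 6))) := by
  obtain ⟨D, E, hR, hL, -, -, hO⟩ := (show GeodesicAt γ t from hγ t).germs
  obtain ⟨φ, rfl, rfl⟩ := (hO.1 v hv).exists_angle hn hc
  exact ⟨φ, hL, hR⟩

/-- The direction opposite to the angle `θ`. -/
theorem IsGeodesic.left_of_right {M : SManifold} {γ : ℝ → M.Point} (hγ : IsGeodesic γ) {t : ℝ}
    {v : M.V} (hv : γ t v = 1) {n : ℕ} {c : ZMod n → M.V} (hn : n = 5 ∨ n = 6 ∨ n = 7)
    (hc : IsLink M.triangles v c) {θ : ℝ} (hD : RGerm γ t (pdir v c θ)) :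
    LGerm γ t (pdir v c (θ + n * (Real.pi / 6))) := by
  obtain ⟨φ, hL, hR⟩ := hγ.exists_angle hv hn hc
  obtain ⟨m, hm⟩ := pdir_injective hn hc (hD.unique hR)
  have e : θ + n * (Real.pi / 6) = φ + ((1 - m : ℤ) : ℝ) * (n * (Real.pi / 3)) := by
    push_cast; linarith
  rwa [e, pdir_add_period]

theorem disjoint_level {γ : ℝ → silo.Point} {y : ℝ} (h : ∀ t, y < lin lvl (γ t)) :
    Disjoint (range γ) (level y) := by
  rw [Set.disjoint_left]
  rintro _ ⟨t, rfl⟩ e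
  exact (h t).ne' e

theorem not_disjoint_level {γ : ℝ → silo.Point} {y t : ℝ} (h : lin lvl (γ t) = y) :
    ¬ Disjoint (range γ) (level y) := fun hd => Set.disjoint_left.1 hd ⟨t, rfl⟩ h

theorem notMem_level {p : silo.Point} {v : silo.V} (hv : p v = 1) {y : ℝ} (h : y ≠ lvl v) :
    p ∉ level y := fun e => h (by rw [← lin_vertex lvl hv]; exact Eq.symm e)

/-! ### An elliptic and a regularly hyperbolic point -/

theorem exists_ellipticPoint {y : ℝ} (h1 : 1 < y) (h3 : y < 3) :
    ∃ P, IsEllipticPoint (level y) P := by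
  obtain ⟨p, hp⟩ := exists_vertexPt (M := silo) (vx 0 0)
  refine ⟨p, notMem_level hp (by rw [lvl_vx, Nat.cast_zero]; linarith), ?_⟩
  rw [Set.eq_empty_iff_forall_notMem]
  rintro m ⟨⟨γ, hγ, rfl⟩, ⟨t, rfl⟩, hd⟩
  obtain ⟨s, hs⟩ := exists_height_eq_of_zero hγ hp (by linarith) h3
  exact not_disjoint_level hs hd

theorem slope_pos_linkA {k : ℕ} (hk : 2 ≤ k) {i : ℤ} (h : dn k (i + 1) = dn k i + 1) {θ : ℝ}
    (h0 : 0 < θ) (h1 : θ < 4 * (Real.pi / 3)) :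
    0 < lin lvl (pdir (V := silo.V) (vx (k + 1) i) (linkA k i) θ) := by
  refine lin_pdir_pos (M := silo) lvl (isLink_linkA hk h) (m := 4) (by omega) le_rfl le_rfl
    (fun j h1 h2 => ?_) h0 (by push_cast; exact h1)
  simp only [linkA_lvl, lvl_vx]
  norm_cast
  rw [add_lt_add_iff_left]
  interval_cases j <;> decide

theorem slope_pos_linkB {k : ℕ} (hk : 2 ≤ k) {i : ℤ} (h : dn k (i + 1) = dn k i) {θ : ℝ}
    (h0 : 0 < θ) (h1 : θ < 5 * (Real.pi / 3)) :
    0 < lin lvl (pdir (V := silo.V) (vx (k + 1) i) (linkB k i) θ) := by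
  refine lin_pdir_pos (M := silo) lvl (isLink_linkB hk h) (m := 5) (by omega) le_rfl le_rfl
    (fun j h1 h2 => ?_) h0 (by push_cast; exact h1)
  simp only [linkB_lvl, lvl_vx]
  norm_cast
  rw [add_lt_add_iff_left]
  interval_cases j <;> decide

/-- At a vertex of ring 3 with two lower neighbours the ascending arc is `(0, 4 π / 3)`. For `θ` in
`(0, π / 6)` both `θ` and its opposite `θ + 7 π / 6` lie in it, so these lines are parallel. Angles
between `4 π / 3` and `5 π / 3` lead down through the cylinder. -/
theorem exists_regularlyHyperbolicPoint {y : ℝ} (h1 : 1 < y) (h3 : y < 3) :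
    ∃ P, IsRegularlyHyperbolicPoint (level y) P := by
  obtain ⟨p, hp⟩ := exists_vertexPt (M := silo) (vx 3 0)
  have hπ := Real.pi_pos
  have hd : dn 2 (0 + 1) = dn 2 0 + 1 := by decide
  have hc := isLink_linkA le_rfl hd
  have hh : lin lvl p = 3 := (lin_vertex lvl hp).trans (by rw [lvl_vx]; norm_num)
  have hpar : (parallels (level y) p).Infinite := by
    refine infinite_of_angles (M := silo) (a := 0) (b := Real.pi / 6) (by omega) hc hp (by positivity)
      (by linarith) ?_
    rintro θ ⟨a1, a2⟩ γ hγ rfl hD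
    refine ⟨⟨γ, hγ, rfl⟩, ⟨0, rfl⟩, disjoint_level fun t => h3.trans_le ?_⟩
    have hE := hγ.left_of_right hp (by omega) hc hD
    rw [← hh]
    exact StaysAbove.le hγ hD hE
      (staysAbove_of_slope (slope_pos_linkA le_rfl hd a1 (by linarith)).le)
      (staysAbove_of_slope (slope_pos_linkA le_rfl hd (by push_cast; linarith)
        (by push_cast; linarith)).le) t
  refine ⟨p, ⟨notMem_level hp ?_, hpar.nontrivial⟩, hpar, ?_⟩
  · rw [lvl_vx]; push_cast; linarith
  · refine infinite_of_angles (M := silo) (a := 4 * (Real.pi / 3)) (b := 5 * (Real.pi / 3)) (by omega)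
      hc hp (by linarith) (by linarith) ?_
    rintro θ ⟨a1, a2⟩ γ hγ rfl hD
    have hs : lin lvl (pdir (V := silo.V) (vx 3 0) (linkA 2 0) θ) < 0 := by
      rw [lin_pdir (M := silo) lvl hc (k := 4) (by push_cast; linarith) (by push_cast; linarith)]
      have e4 : lvl (linkA 2 0 ((4 : ℤ) : ZMod 7)) = 3 := by
        rw [linkA_lvl]; exact_mod_cast (by decide : 2 + patA ((4 : ℤ) : ZMod 7) = 3)
      have e5 : lvl (linkA 2 0 (((4 : ℤ) : ZMod 7) + 1)) = 2 := by
        rw [linkA_lvl]; exact_mod_cast (by decide : 2 + patA (((4 : ℤ) : ZMod 7) + 1) = 2)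
      have e : lvl (vx 3 0) = 3 := by rw [lvl_vx]; norm_num
      have := polY_pos (φ := θ - ((4 : ℤ) : ℝ) * (Real.pi / 3)) (by push_cast; linarith)
        (by push_cast; linarith)
      rw [e4, e5, e]
      linarith
    obtain ⟨t, ht⟩ := exists_height_eq_of_descending hγ hD hs (by rw [hh]) (by rw [hh]; exact h3.le) h1
    exact ⟨⟨γ, hγ, rfl⟩, ⟨0, rfl⟩, not_disjoint_level ht⟩

/-! ### A Euclidean point -/

theorem sum_opposite {M : SManifold} (F : M.V → ℝ) {u v a b w w' : M.V}
    (ha : {u, v, a} ∈ M.triangles) (hb : {u, v, b} ∈ M.triangles) (hab : a ≠ b)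
    (hw : {u, v, w} ∈ M.triangles) (hw' : {u, v, w'} ∈ M.triangles) (hww : w ≠ w') :
    F w + F w' = F a + F b := by
  by_cases e : w = a
  · subst e
    rw [third_eq ha hw' hb hww.symm hab.symm]
  · have e1 : w = b := third_eq ha hw hb e hab.symm
    subst e1
    rw [third_eq hb hw' ha hww.symm hab]
    ring

theorem exists_third {M : SManifold} {τ : Finset M.V} (hτ : τ ∈ M.triangles) {u v : M.V}
    (huv : u ≠ v) (hu : u ∈ τ) (hv : v ∈ τ) : ∃ w, τ = {u, v, w} := by
  obtain ⟨x, y, rfl⟩ := exists_triple_of_mem hτ hu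
  rw [Finset.mem_insert, Finset.mem_insert, Finset.mem_singleton] at hv
  rcases hv with rfl | rfl | rfl
  · exact absurd rfl huv
  · exact ⟨y, rfl⟩
  · exact ⟨x, insert_swap _ _ _⟩

/-- By `hF` the function is affine across the edge that contains `p`, so slopes of opposite
directions cancel. -/
theorem SOpp.lin_add_edge {M : SManifold} (F : M.V → ℝ) {p : M.Point} {E D : M.V → ℝ}
    (h : SOpp p E D) {u v a b : M.V} (hu : 0 < p u) (hv : 0 < p v)
    (ha : {u, v, a} ∈ M.triangles) (hb : {u, v, b} ∈ M.triangles) (hab : a ≠ b)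
    (hF : F a + F b = F u + F v) : lin F E + lin F D = 0 := by
  rcases h.lin_add F with h | ⟨x, y, w, w', h1, h2, h3, h4, h5, -, h6⟩
  · exact h
  have hmem : ∀ q, 0 < p q → q = x ∨ q = y := by
    intro q hq
    have := Point.mem_of_pos h4 hq
    rw [Finset.mem_insert, Finset.mem_insert, Finset.mem_singleton] at this
    rcases this with h | h | h
    · exact Or.inl h
    · exact Or.inr h
    · rw [h, h5] at hq; exact absurd hq (lt_irrefl _)
  have huv := (tri_ne ha).1
  have key : F w + F w' - F x - F y = 0 := by
    rcases hmem u hu with rfl | rfl <;> rcases hmem v hv with rfl | rfl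
    · exact absurd rfl huv
    · linarith [sum_opposite F ha hb hab h1 h2 h3]
    · rw [insert_swap'] at h1 h2
      linarith [sum_opposite F ha hb hab h1 h2 h3]
    · exact absurd rfl huv
  rw [h6, key, mul_zero]

/-- A direction without slope at a point inside of an edge of constant height. -/
theorem IsDir.eq_edge {M : SManifold} (F : M.V → ℝ) {p : M.Point} {D : M.V → ℝ} (h : IsDir p D)
    {u v : M.V} (huv : u ≠ v) (hu : 0 < p u) (hv : 0 < p v) (hF : F u = F v)
    (hne : ∀ w, {u, v, w} ∈ M.triangles → F w ≠ F u) (h0 : lin F D = 0) :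
    D = ev u v ∨ D = ev v u := by
  obtain ⟨x, y, z, h1, h2, h3, -, -⟩ := h.triple
  obtain ⟨w, hw⟩ := exists_third h1 huv (Point.mem_of_pos h2 hu) (Point.mem_of_pos h2 hv)
  rw [hw] at h1 h3
  obtain ⟨s1, s2⟩ := h.sums h1 h3
  obtain ⟨n1, n2, n3⟩ := tri_ne h1
  rw [lin_tri F h1 h3, ← hF] at h0
  have hDw : D w = 0 := by
    have : D w * (F w - F u) = 0 := by linear_combination h0 - F u * s1
    exact (mul_eq_zero.1 this).resolve_right (sub_ne_zero.2 (hne w h1))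
  rw [hDw] at s1 s2
  have hDv : D v = -D u := by linarith
  rw [hDv] at s2
  have : (D u - 1) * (D u + 1) = 0 := by linear_combination s2 / 2
  have hext : ∀ E : M.V → ℝ, (∀ q, q ≠ u → q ≠ v → E q = 0) → D u = E u → D v = E v → D = E := by
    intro E hE e1 e2
    funext q
    by_cases hq1 : q = u
    · rw [hq1, e1]
    by_cases hq2 : q = v
    · rw [hq2, e2]
    rw [hE q hq1 hq2]
    by_cases hq3 : q = w
    · rw [hq3, hDw]
    · exact h3 q (by simp [hq1, hq2, hq3])
  rcases mul_eq_zero.1 this with e | e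
  · right
    refine hext _ (fun q h1 h2 => ev_of_ne h1 h2) ?_ ?_
    · rw [ev_self huv]; linarith
    · rw [ev_base huv, hDv]; linarith
  · left
    refine hext _ (fun q h1 h2 => ev_of_ne h2 h1) ?_ ?_
    · rw [ev_base huv.symm]; linarith
    · rw [ev_self huv.symm, hDv]; linarith

theorem SOpp.eq_neg {M : SManifold} {p : M.Point} {E D : M.V → ℝ} (h : SOpp p E D)
    (hE : ∀ x, p x = 0 → E x = 0) (x : M.V) : D x = -E x := by
  rcases h with h | ⟨u, v, w, w', -, -, -, -, h1, -, h2, -⟩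
  · exact h x
  · rw [hE w h1] at h2
    exact absurd h2 (lt_irrefl _)

theorem exists_geodesic_zero {M : SManifold} {m : Set M.Point} (hm : IsLine m) {p : M.Point}
    (hp : p ∈ m) : ∃ γ : ℝ → M.Point, IsGeodesic γ ∧ range γ = m ∧ γ 0 = p := by
  obtain ⟨γ, hγ, rfl⟩ := hm
  obtain ⟨t, rfl⟩ := hp
  exact ⟨_, hγ.shift t, (Equiv.addRight t).surjective.range_comp γ, congrArg γ (zero_add t)⟩

theorem range_reverse {M : SManifold} (γ : ℝ → M.Point) : range (fun s => γ (-s)) = range γ :=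
  (Equiv.neg ℝ).surjective.range_comp γ

theorem edge_three : {vx 3 0, vx 3 1, vx 2 0} ∈ silo.triangles ∧
    {vx 3 0, vx 3 1, vx 4 (up 3 1)} ∈ silo.triangles :=
  ⟨inner_mem 2 1, outer_mem (by norm_num) 1⟩

/-- The point is the midpoint of an edge of ring 3 with apexes on rings 2 and 4. Since `2 + 4 = 3 +
3`, opposite slopes cancel at this point, so a line with nonzero slope descends on one side and
crosses the cylinder. Only the line along the edge remains, and by convexity it stays at height at
least 3. -/
theorem exists_euclideanPoint {y : ℝ} (h1 : 1 < y) (h3 : y < 3) :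
    ∃ P, IsEuclideanPoint (level y) P := by
  obtain ⟨hT, hT'⟩ := edge_three
  obtain ⟨γ₀, g1, g2⟩ := exists_geodesic_at (x := 1 / 2) (y := 1 / 2) (z := 0) (a := -1) (b := 1)
    (c := 0) hT (by norm_num) (by norm_num) (by norm_num) (by norm_num) (by norm_num) (by norm_num)
    (by norm_num) (by norm_num) (by norm_num)
  obtain ⟨n1, n2, n3⟩ := tri_ne hT
  obtain ⟨c1, c2, c3⟩ := g2.coords
  have hne : (vx 2 0 : silo.V) ≠ vx 4 (up 3 1) := vx_ne_of_level (by norm_num) _ _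
  have hl : lvl (vx 3 0) = 3 := by rw [lvl_vx]; norm_num
  have hl' : lvl (vx 3 1) = 3 := by rw [lvl_vx]; norm_num
  have hl2 : lvl (vx 2 0) = 2 := by rw [lvl_vx]; norm_num
  have hl4 : lvl (vx 4 (up 3 1)) = 4 := by rw [lvl_vx]; norm_num
  have hu : 0 < γ₀ 0 (vx 3 0) := by rw [c1]; norm_num
  have hv : 0 < γ₀ 0 (vx 3 1) := by rw [c2]; norm_num
  have hh : lin lvl (γ₀ 0) = 3 := by rw [g2.lin_pos_eq, hl, hl', hl2]; norm_num
  have hnv : ∀ v, γ₀ 0 v ≠ 1 := by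
    intro v hv1
    by_cases h : v = vx 3 0
    · rw [h] at hv1; rw [hv1] at c1; norm_num at c1
    · exact hu.ne' (Point.eq_zero_of_eq_one hv1 (Ne.symm h))
  have hD₀ : triVec (M := silo) (vx 3 0) (vx 3 1) (vx 2 0) (-1) 1 0 = ev (vx 3 0) (vx 3 1) := by
    funext x
    have := ev_eq_triVec hT 1 0 x
    rw [one_mul, zero_mul, add_zero, add_zero] at this
    exact this.symm
  have g3 : RGerm γ₀ 0 (ev (V := silo.V) (vx 3 0) (vx 3 1)) :=
    hD₀.subst (motive := fun D => RGerm γ₀ 0 D) g2.germ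
  have hedge : ∀ D, IsDir (γ₀ 0) D → lin lvl D = 0 →
      D = ev (V := silo.V) (vx 3 0) (vx 3 1) ∨ D = ev (V := silo.V) (vx 3 1) (vx 3 0) := by
    intro D hD h0
    refine hD.eq_edge lvl n1 hu hv (hl.trans hl'.symm) (fun w hw => ?_) h0
    by_cases e : w = vx 2 0
    · rw [e, hl, hl2]; norm_num
    · rw [third_eq hT hw hT' e hne.symm, hl, hl4]; norm_num
  have hneg : ∀ E D, SOpp (γ₀ 0) E D → lin lvl E + lin lvl D = 0 := fun E D h =>
    h.lin_add_edge lvl hu hv hT hT' hne (by rw [hl, hl', hl2, hl4]; norm_num)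
  have hs₀ : lin lvl (triVec (M := silo) (vx 3 0) (vx 3 1) (vx 2 0) (-1) 1 0) = 0 := by
    rw [g2.lin_eq, hl, hl', hl2]; norm_num
  have hdesc : ∀ γ : ℝ → silo.Point, IsGeodesic γ → γ 0 = γ₀ 0 → ∀ D, RGerm γ 0 D →
      Disjoint (range γ) (level y) → 0 ≤ lin lvl D := by
    intro γ hγ e D hD hdis
    by_contra hlt
    obtain ⟨t, ht⟩ := exists_height_eq_of_descending hγ hD (not_le.1 hlt) (by rw [e, hh])
      (by rw [e, hh]; exact h3.le) h1
    exact not_disjoint_level ht hdis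
  refine ⟨γ₀ 0, fun e => h3.ne ?_, range γ₀, ⟨⟨γ₀, g1, rfl⟩, ⟨0, rfl⟩, ?_⟩, ?_⟩
  · exact (Eq.symm e).trans hh
  · refine disjoint_level fun t => h3.trans_le ?_
    obtain ⟨D, E, hR, hL, -, -, hO⟩ := (show GeodesicAt γ₀ 0 from g1 0).germs
    have e := hneg E D (hO.2 hnv)
    rw [← g2.germ.unique hR, hs₀, add_zero] at e
    rw [← hh]
    exact StaysAbove.le g1 g2.germ hL (staysAbove_of_slope hs₀.ge) (staysAbove_of_slope e.ge) t
  · rintro m ⟨hm, hp, hdis⟩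
    obtain ⟨γ, hγ, rfl, e0⟩ := exists_geodesic_zero hm hp
    obtain ⟨D, E, hR, hL, hD, hE, hO⟩ := (show GeodesicAt γ 0 from hγ 0).germs
    rw [e0] at hD hE hO
    have hS := hO.2 hnv
    have hsum := hneg E D hS
    have hL' : RGerm (fun s => γ (-s)) 0 E := by simpa only [neg_zero] using hL.reverse
    have d1 := hdesc γ hγ e0 D hR hdis
    have d2 := hdesc _ hγ.reverse (by rw [neg_zero]; exact e0) E hL' (by rwa [range_reverse])
    -- The edge can be run along in two senses; reversal reduces the second one to the first.
    rcases hedge D hD (by linarith) with e | e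
    · rw [hγ.unique g1 (t := 0) e0 hR (e.symm.subst (motive := fun D => RGerm γ₀ 0 D) g3)]
    · have hE' : E = ev (V := silo.V) (vx 3 0) (vx 3 1) := by
        rcases hedge E hE (by linarith) with e' | e'
        · exact e'
        · have h := hS.eq_neg (fun x hx => by
            rw [e']
            exact ev_of_ne (fun h => by rw [h] at hx; exact hu.ne' hx)
              (fun h => by rw [h] at hx; exact hv.ne' hx)) (vx 3 0)
          rw [e, e', ev_self n1] at h
          norm_num at h
      rw [← range_reverse γ, hγ.reverse.unique g1 (t := 0) (by rw [neg_zero]; exact e0) hL'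
        (hE'.symm.subst (motive := fun D => RGerm γ₀ 0 D) g3)]

end SManifold

end


noncomputable section

namespace SManifold

open Set

/-! ### An extremely and a completely hyperbolic point -/

theorem exists_reduced_angle {V : Type} [DecidableEq V] (v : V) {n : ℕ} (hn : 0 < n)
    (c : ZMod n → V) (θ : ℝ) :
    ∃ φ, 0 ≤ φ ∧ φ < n * (Real.pi / 3) ∧ pdir v c θ = pdir v c φ := by
  have hP : 0 < n * (Real.pi / 3) := by positivity
  have h0 := Int.floor_le (θ / (n * (Real.pi / 3)))
  have h1 := Int.lt_floor_add_one (θ / (n * (Real.pi / 3)))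
  rw [le_div_iff₀ hP] at h0
  rw [div_lt_iff₀ hP] at h1
  refine ⟨θ - ⌊θ / (n * (Real.pi / 3))⌋ * (n * (Real.pi / 3)), by linarith, by linarith, ?_⟩
  rw [← pdir_add_period v c ⌊θ / (n * (Real.pi / 3))⌋ (θ - _), sub_add_cancel]

/-! ### Geodesics along edges and along bisectors of triangles. -/

section Middle

variable {M : SManifold} {γ : ℝ → M.Point} {t : ℝ} {v a b : M.V} {n : ℕ} {c : ZMod n → M.V}

theorem At.of_edge (hc : IsLink M.triangles v c) (hv : γ t v = 1) {θ : ℝ} {k : ℤ}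
    (hθ : θ = k * (Real.pi / 3)) (ha : c k = a) (hb : c (k + 1) = b)
    (hD : RGerm γ t (pdir v c θ)) : At γ t v a b 1 0 0 (-1) 1 0 := by
  have hπ := Real.pi_pos
  subst hθ ha hb
  have := at_of_pdir hc hv le_rfl (by linarith) hD
  rwa [sub_self, polX_zero, polY_zero, add_zero] at this

theorem At.of_middle (hc : IsLink M.triangles v c) (hv : γ t v = 1) {θ : ℝ} {k : ℤ}
    (hθ : θ = k * (Real.pi / 3) + Real.pi / 6) (ha : c k = a) (hb : c (k + 1) = b)
    (hD : RGerm γ t (pdir v c θ)) :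
    At γ t v a b 1 0 0 (-(1 / √3 + 1 / √3)) (1 / √3) (1 / √3) := by
  have hπ := Real.pi_pos
  subst hθ ha hb
  have := at_of_pdir hc hv (k := k) (by linarith) (by linarith) hD
  rwa [add_sub_cancel_left, polX_pi_div_six, polY_pi_div_six] at this

theorem sqrt_three_half : √3 / 2 * (1 / √3) = 1 / 2 := by
  have := sqrt_three_pos
  field_simp

theorem At.cross_middle (hγ : IsGeodesic γ)
    (h : At γ t v a b 1 0 0 (-(1 / √3 + 1 / √3)) (1 / √3) (1 / √3)) {w : M.V}
    (hw : {a, b, w} ∈ M.triangles) (hne : w ≠ v) :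
    At γ (t + √3 / 2) a b w (1 / 2) (1 / 2) 0 (-(1 / √3)) (-(1 / √3)) (1 / √3 + 1 / √3) := by
  have h3 := sqrt_three_pos
  have e := sqrt_three_half
  have := h.rotate.cross hγ (S := √3 / 2) (by positivity) (by rw [e]; norm_num)
    (by rw [e]; norm_num) (by rw [mul_neg, mul_add, e]; norm_num)
    (neg_neg_of_pos (by positivity)) hw hne
  rwa [e, zero_add, neg_neg, ← sub_eq_add_neg, sub_add_cancel_left] at this

theorem At.arrive_edge (hγ : IsGeodesic γ) (hn : n = 5 ∨ n = 6 ∨ n = 7)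
    (hc : IsLink M.triangles v c) {k : ℤ} (ha : c k = a) (hb : c (k + 1) = b)
    (h : At γ t v a b 0 0 1 1 0 (-1)) : γ (t + 1) v = 1 ∧
      RGerm γ (t + 1) (pdir v c ((k + 1) * (Real.pi / 3) + n * (Real.pi / 6))) := by
  have hπ := Real.pi_pos
  subst ha hb
  have e : (k + 1) * (Real.pi / 3) - k * (Real.pi / 3) = Real.pi / 3 := by ring
  exact h.arrive_pdir hγ hn hc (S := 1) (by norm_num) (by norm_num) (by norm_num) (by linarith) le_rfl
    (by rw [e, polX_pi_div_three, neg_zero]) (by rw [e, polY_pi_div_three, neg_neg])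

theorem At.arrive_middle (hγ : IsGeodesic γ) (hn : n = 5 ∨ n = 6 ∨ n = 7)
    (hc : IsLink M.triangles v c) {k : ℤ} (ha : c k = a) (hb : c (k + 1) = b)
    (h : At γ t v a b 0 (1 / 2) (1 / 2) (1 / √3 + 1 / √3) (-(1 / √3)) (-(1 / √3))) :
    γ (t + √3 / 2) v = 1 ∧ RGerm γ (t + √3 / 2)
      (pdir v c (k * (Real.pi / 3) + Real.pi / 6 + n * (Real.pi / 6))) := by
  have hπ := Real.pi_pos
  have h3 := sqrt_three_pos
  have e := sqrt_three_half
  subst ha hb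
  exact h.arrive_pdir hγ hn hc (S := √3 / 2) (by positivity) (by rw [mul_neg, e, add_neg_cancel])
    (by rw [mul_neg, e, add_neg_cancel]) (by linarith) (by linarith)
    (by rw [add_sub_cancel_left, polX_pi_div_six, neg_neg])
    (by rw [add_sub_cancel_left, polY_pi_div_six, neg_neg])

end Middle

/-- A vertex with two neighbours below whose neighbours on its ring have only one, and the only
vertex above it that is adjacent to no other vertex of the ring. -/
structure IsChild (k : ℕ) (d j : ℤ) : Prop where
  two_le : 2 ≤ k
  mid : dn k (d + 1) = dn k d + 1
  right : dn k (d + 1 + 1) = dn k (d + 1)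
  left : dn k (d - 1 + 1) = dn k (d - 1)
  child : j = up (k + 1) d + 1

namespace IsChild

variable {k : ℕ} {d j : ℤ}

theorem up_right (h : IsChild k d j) : up (k + 1) (d + 1) = j + 1 := by
  have h1 := up_succ h.two_le d
  have h2 := up_succ h.two_le (d + 1)
  have := h.mid
  have := h.child
  omega

/-- The neighbour `d - 1` has one vertex below, so `up` advances by three there, and its last outer
neighbour is the first one of `d`, namely `j - 1`. -/
theorem up_left (h : IsChild k d j) : up (k + 1) (d - 1) + 3 = j - 1 := by
  have h1 := up_succ h.two_le d
  have h2 := up_succ h.two_le (d - 1)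
  have h3 := h.left
  rw [sub_add_cancel] at h3
  have := h.child
  omega

theorem dn_eq (h : IsChild k d j) : dn (k + 1) j = d := by
  have := h.child
  have := h.up_right
  rw [dn_eq_iff]; omega

theorem dn_succ_eq (h : IsChild k d j) : dn (k + 1) (j + 1) = dn (k + 1) j := by
  have := h.child
  have := h.up_right
  rw [h.dn_eq, dn_eq_iff]; omega

theorem isLink (h : IsChild k d j) :
    IsLink silo.triangles (vx (k + 2) j) (linkB (k + 1) j) :=
  isLink_linkB (by have := h.two_le; omega) h.dn_succ_eq

theorem link_six (h : IsChild k d j) : linkB (k + 1) j 6 = vx (k + 1) d := by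
  conv_rhs => rw [← h.dn_eq]
  rfl

theorem staysAbove_of_mem (h : IsChild k d j) {p : silo.Point} (hp : p (vx (k + 2) j) = 1) {θ : ℝ}
    (h0 : 0 ≤ θ) (h5 : θ ≤ 5 * (Real.pi / 3)) :
    StaysAbove ((k : ℝ) + 2) p (pdir (V := silo.V) (vx (k + 2) j) (linkB (k + 1) j) θ) := by
  have hh : lin lvl p = (k : ℝ) + 2 := (lin_vertex lvl hp).trans (by rw [lvl_vx]; push_cast; ring)
  rw [← hh]
  refine staysAbove_of_slope ?_
  have h2 := h.two_le
  have hπ := Real.pi_pos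
  -- The two ends of the arc point along the ring and have slope 0; they are not covered by the
  -- strict inequality of `slope_pos_linkB`.
  rcases h0.eq_or_lt with rfl | h0
  · rw [lin_pdir (M := silo) lvl h.isLink (k := 0) (by simp) (by push_cast; linarith)]
    rw [Int.cast_zero, zero_mul, sub_zero, polX_zero, polY_zero, one_mul, zero_mul, add_zero,
      sub_nonneg]
    exact le_rfl
  rcases h5.eq_or_lt with rfl | h5
  · rw [lin_pdir (M := silo) lvl h.isLink (k := 5) (by push_cast; linarith) (by push_cast; linarith)]
    push_cast
    rw [sub_self, polX_zero, polY_zero, one_mul, zero_mul, add_zero, sub_nonneg]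
    exact le_rfl
  exact (slope_pos_linkB (by omega) h.dn_succ_eq h0 h5).le

/-- The geodesic leaves over the edge from `vx (k + 1) d` to `vx (k + 2) (j + 1)`. On the other side
waits `vx (k + 1) (d + 1)`, which has only one lower neighbour, so `IsLowLink.le_of_sector` applies
with its reflected link. -/
theorem staysAbove_of_right (h : IsChild k d j) {p : silo.Point} (hp : p (vx (k + 2) j) = 1) {θ : ℝ}
    (h6 : 6 * (Real.pi / 3) < θ) (h7 : θ < 7 * (Real.pi / 3)) :
    StaysAbove k p (pdir (V := silo.V) (vx (k + 2) j) (linkB (k + 1) j) θ) := by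
  rintro γ hγ t rfl hD
  have hA := at_of_pdir h.isLink hp (k := 6) (by push_cast; linarith) (by push_cast; linarith) hD
  have hlow := isLowLink_right h.two_le h.right
  have e0 : linkB k (d + 1) (5 - 0) = linkB (k + 1) j ((6 : ℤ) : ZMod 7) := by
    refine Eq.trans ?_ h.link_six.symm
    change vx (k + 1) (d + 1 - 1) = _
    rw [add_sub_cancel_right]
  have e1 : linkB k (d + 1) (5 - 1) = linkB (k + 1) j (((6 : ℤ) : ZMod 7) + 1) := by
    change vx (k + 2) (up (k + 1) (d + 1)) = vx (k + 2) (j + 1)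
    rw [h.up_right]
  refine hlow.le_of_sector hγ (polX_pos (φ := θ - ((6 : ℤ) : ℝ) * (Real.pi / 3)) ?_ ?_)
    (polY_pos (φ := θ - ((6 : ℤ) : ℝ) * (Real.pi / 3)) ?_ ?_) (v := vx (k + 2) j) ?_
    (vx_ne_of_level (by omega) _ _) ?_
  · push_cast; linarith
  · push_cast; linarith
  · push_cast; linarith
  · push_cast; linarith
  · rw [lvl_vx]; push_cast; linarith
  · simp only [e0, e1]; exact hA

theorem staysAbove_of_left (h : IsChild k d j) {p : silo.Point} (hp : p (vx (k + 2) j) = 1) {θ : ℝ}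
    (h5 : 5 * (Real.pi / 3) < θ) (h6 : θ < 6 * (Real.pi / 3)) :
    StaysAbove k p (pdir (V := silo.V) (vx (k + 2) j) (linkB (k + 1) j) θ) := by
  rintro γ hγ t rfl hD
  have hA := at_of_pdir h.isLink hp (k := 5) (by push_cast; linarith) (by push_cast; linarith) hD
  have hlow := isLowLink_left h.two_le h.left
  have e0 : linkB k (d - 1) 0 = linkB (k + 1) j (((5 : ℤ) : ZMod 7) + 1) := by
    refine Eq.trans ?_ h.link_six.symm
    change vx (k + 1) (d - 1 + 1) = _
    rw [sub_add_cancel]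
  have e1 : linkB k (d - 1) 1 = linkB (k + 1) j ((5 : ℤ) : ZMod 7) := by
    change vx (k + 2) (up (k + 1) (d - 1) + 3) = vx (k + 2) (j - 1)
    rw [h.up_left]
  refine hlow.le_of_sector hγ (polY_pos (φ := θ - ((5 : ℤ) : ℝ) * (Real.pi / 3)) ?_ ?_)
    (polX_pos (φ := θ - ((5 : ℤ) : ℝ) * (Real.pi / 3)) ?_ ?_) (v := vx (k + 2) j) ?_
    (vx_ne_of_level (by omega) _ _) ?_
  · push_cast; linarith
  · push_cast; linarith
  · push_cast; linarith
  · push_cast; linarith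
  · rw [lvl_vx]; push_cast; linarith
  · simp only [e0, e1]
    rw [add_comm (polY _)]
    exact hA.swap.rotate

/-- Only the direction of the edge to the vertex below may lead down. -/
theorem staysAbove_or (h : IsChild k d j) {p : silo.Point} (hp : p (vx (k + 2) j) = 1) (θ : ℝ) :
    StaysAbove k p (pdir (V := silo.V) (vx (k + 2) j) (linkB (k + 1) j) θ) ∨
      pdir (V := silo.V) (vx (k + 2) j) (linkB (k + 1) j) θ =
        pdir (V := silo.V) (vx (k + 2) j) (linkB (k + 1) j) (6 * (Real.pi / 3)) := by
  obtain ⟨φ, h0, h7, e⟩ := exists_reduced_angle (V := silo.V) (vx (k + 2) j) (by norm_num)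
    (linkB (k + 1) j) θ
  rw [e]
  rcases le_or_gt φ (5 * (Real.pi / 3)) with h5 | h5
  · exact Or.inl ((h.staysAbove_of_mem hp h0 h5).mono (by linarith))
  rcases lt_trichotomy φ (6 * (Real.pi / 3)) with h6 | rfl | h6
  · exact Or.inl (h.staysAbove_of_left hp h5 h6)
  · exact Or.inr rfl
  · exact Or.inl (h.staysAbove_of_right hp h6 (by exact_mod_cast h7))

/-- The line along the edge down from the child leaves the next vertex in the middle of the triangle
below and leaves this triangle through the midpoint of its side. -/
theorem center_line {k : ℕ} (h : IsChild (k + 1) d j) {γ : ℝ → silo.Point} (hγ : IsGeodesic γ)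
    {t : ℝ} (hv : γ t (vx (k + 3) j) = 1)
    (hD : RGerm γ t (pdir (V := silo.V) (vx (k + 3) j) (linkB (k + 2) j) (6 * (Real.pi / 3)))) :
    ∃ T, At γ T (vx (k + 1) (dn (k + 1) d)) (vx (k + 1) (dn (k + 1) d + 1))
      (vx k (dn k (dn (k + 1) d + 1))) (1 / 2) (1 / 2) 0 (-(1 / √3)) (-(1 / √3)) (1 / √3 + 1 / √3) ∧
      ∀ y : ℝ, y ≤ k + 1 → (∀ s, T ≤ s → y ≤ lin lvl (γ s)) → ∀ s, t ≤ s → y ≤ lin lvl (γ s) := by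
  have hπ := Real.pi_pos
  have e := sqrt_three_half
  have hlink := isLink_linkA h.two_le h.mid
  have hA : At γ t (vx (k + 3) j) (vx (k + 2) d) (vx (k + 3) (j + 1)) 1 0 0 (-1) 1 0 :=
    At.of_edge h.isLink hv (k := 6) (by push_cast; ring) h.link_six rfl hD
  have a1 : linkA (k + 1) d ((1 : ℤ) : ZMod 7) = vx (k + 3) (j + 1) := by
    change vx (k + 3) (up (k + 2) d + 2) = _
    rw [h.child, add_assoc]; rfl
  have a2 : linkA (k + 1) d (((1 : ℤ) : ZMod 7) + 1) = vx (k + 3) j := by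
    change vx (k + 3) (up (k + 2) d + 1) = _
    rw [h.child]
  -- The edge arrives at the angle `2 π / 3`. The opposite angle `2 π / 3 + 7 π / 6 = 5 π / 3 + π /
  -- 6` bisects the sector between the two lower neighbours.
  obtain ⟨g1, g2⟩ := hA.rotate.arrive_edge hγ (by omega) hlink a1 a2
  have hB : At γ (t + 1) (vx (k + 2) d) (vx (k + 1) (dn (k + 1) d)) (vx (k + 1) (dn (k + 1) d + 1))
      1 0 0 (-(1 / √3 + 1 / √3)) (1 / √3) (1 / √3) :=
    At.of_middle hlink g1 (k := 5) (by push_cast; ring) rfl rfl g2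
  have hT := inner_mem k (dn (k + 1) d + 1)
  rw [inner, add_sub_cancel_right] at hT
  have hC := hB.cross_middle hγ hT (vx_ne_of_level (by omega) _ _)
  refine ⟨_, hC, fun y hy H => ?_⟩
  have l0 : lvl (vx (k + 1) (dn (k + 1) d)) = k + 1 := by rw [lvl_vx]; push_cast; ring
  have l1 : lvl (vx (k + 1) (dn (k + 1) d + 1)) = k + 1 := by rw [lvl_vx]; push_cast; ring
  have l2 : lvl (vx (k + 2) d) = k + 2 := by rw [lvl_vx]; push_cast; ring
  have l3 : ∀ i, lvl (vx (k + 3) i) = k + 3 := fun i => by rw [lvl_vx]; push_cast; ring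
  refine hA.le_of_follow lvl hγ (S := 1) (by norm_num) (by norm_num) (by norm_num)
    (by rw [l3]; linarith) (by rw [l2]; linarith) (by rw [l3]; linarith) ?_
  exact hB.le_of_follow lvl hγ (S := √3 / 2) (by rw [mul_neg, mul_add, e]; norm_num)
    (by rw [e]; norm_num) (by rw [e]; norm_num) (by rw [l2]; linarith) (by rw [l0]; linarith)
    (by rw [l1]; linarith) H

end IsChild

theorem isChild_three : IsChild 3 0 1 := by
  constructor <;> decide

/-- Chosen such that the central line descends towards `vx 4 1`, a vertex with a single lower
neighbour. -/
theorem isChild_five : IsChild 5 7 19 := by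
  constructor <;> decide

/-- At `vx 5 1` all directions but that of the edge to `vx 4 0` keep the geodesic at height at least
3. So a non-parallel must be the line along this edge, and that one passes through the midpoint of
an edge of ring 3 into the cylinder. -/
theorem exists_extremelyHyperbolicPoint {y : ℝ} (h1 : 1 < y) (h3 : y < 3) :
    ∃ P, IsExtremelyHyperbolicPoint (level y) P := by
  have hπ := Real.pi_pos
  obtain ⟨p, hp⟩ := exists_vertexPt (M := silo) (vx 5 1)
  have hch := isChild_three
  have hc := hch.isLink
  obtain ⟨γ₀, g1, g2, g3⟩ := exists_geodesic (isDir_pdir hc hp (6 * (Real.pi / 3)))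
  have hpar : (parallels (level y) p).Infinite := by
    refine infinite_of_angles (M := silo) (a := 0) (b := Real.pi / 6) (by omega) hc hp (by positivity)
      (by linarith) ?_
    rintro θ ⟨a1, a2⟩ γ hγ rfl hD
    refine ⟨⟨γ, hγ, rfl⟩, ⟨0, rfl⟩, disjoint_level fun t => ?_⟩
    have := StaysAbove.le hγ hD (hγ.left_of_right hp (by omega) hc hD)
      (hch.staysAbove_of_mem hp a1.le (by linarith))
      (hch.staysAbove_of_mem hp (by push_cast; linarith) (by push_cast; linarith)) t
    norm_num at this
    linarith
  have hnon : nonparallels (level y) p ⊆ {range γ₀} := by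
    rintro m ⟨hm, hpm, hnd⟩
    obtain ⟨γ, hγ, rfl, rfl⟩ := exists_geodesic_zero hm hpm
    obtain ⟨θ, hL, hR⟩ := hγ.exists_angle hp (by omega) hc
    rcases hch.staysAbove_or hp θ with HE | HE
    · rcases hch.staysAbove_or hp (θ + (7 : ℕ) * (Real.pi / 6)) with HD | HD
      · refine absurd (disjoint_level fun t => h3.trans_le ?_) hnd
        have := StaysAbove.le hγ hR hL HD HE t
        exact_mod_cast this
      · rw [HD] at hR
        rw [mem_singleton_iff, hγ.unique g1 g2.symm hR g3]
    · rw [HE] at hL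
      have hL' := hL.reverse
      rw [neg_zero] at hL'
      rw [mem_singleton_iff, ← range_reverse γ,
        hγ.reverse.unique g1 (t := 0) (by rw [neg_zero]; exact g2.symm) hL' g3]
  refine ⟨p, ⟨notMem_level hp ?_, hpar.nontrivial⟩, hpar, (finite_singleton _).subset hnon,
    range γ₀, ⟨γ₀, g1, rfl⟩, ⟨0, g2⟩, ?_⟩
  · rw [lvl_vx]; push_cast; linarith
  · obtain ⟨T, hT, -⟩ := IsChild.center_line (k := 2) hch g1 (t := 0) (by rw [g2]; exact hp) g3
    have e3 : ∀ i, lvl (vx (2 + 1) i) = 3 := fun i => by rw [lvl_vx]; norm_num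
    have e2 : ∀ i, lvl (vx 2 i) = 2 := fun i => by rw [lvl_vx]; norm_num
    have hh : lin lvl (γ₀ T) = 3 := by rw [hT.lin_pos_eq, e3, e3, e2]; norm_num
    have hr : 0 < 1 / √3 := div_pos one_pos sqrt_three_pos
    obtain ⟨t, ht⟩ := exists_height_eq_of_descending g1 hT.germ
      (by rw [hT.lin_eq, e3, e3, e2]; linarith) hh.le (by rw [hh]; exact h3.le) h1
    exact not_disjoint_level ht

/-- The exceptional line reaches `vx 4 1` along a bisector, at the angle `7 π / 6`, and leaves at `7
π / 3`, which is a full turn: along the edge of ring 4 to `vx 4 2`, with slope 0. From then on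
convexity keeps it up. -/
theorem staysAbove_five {p : silo.Point} (hp : p (vx 7 19) = 1) (θ : ℝ) :
    StaysAbove 4 p (pdir (V := silo.V) (vx 7 19) (linkB 6 19) θ) := by
  have hch := isChild_five
  rcases hch.staysAbove_or hp θ with H | H
  · exact H.mono (by norm_num)
  rw [H]
  rintro γ hγ t rfl hD
  obtain ⟨T, hT, hle⟩ := IsChild.center_line (k := 4) hch hγ hp hD
  refine hle 4 (by norm_num) ?_
  have hd : dn 3 (1 + 1) = dn 3 1 := by decide
  have hlink := isLink_linkB (by norm_num) hd
  have e4 : ∀ i, lvl (vx 4 i) = 4 := fun i => by rw [lvl_vx]; norm_num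
  have e5 : ∀ i, lvl (vx (4 + 1) i) = 5 := fun i => by rw [lvl_vx]; norm_num
  have a1 : dn (4 + 1) 7 = 2 := by decide
  have a2 : dn 4 (2 + 1) = 1 := by decide
  rw [a1, a2] at hT
  have b3 : linkB 3 1 ((3 : ℤ) : ZMod 7) = vx (4 + 1) (2 + 1) := by decide
  have b4 : linkB 3 1 (((3 : ℤ) : ZMod 7) + 1) = vx (4 + 1) 2 := by decide
  obtain ⟨g1, g2⟩ := hT.swap.rotate.rotate.arrive_middle hγ (by omega) hlink b3 b4
  have hr := sqrt_three_half
  refine hT.le_of_follow lvl hγ (S := √3 / 2) (by rw [mul_neg, hr]; norm_num)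
    (by rw [mul_neg, hr]; norm_num) (by rw [mul_add, hr]; norm_num) (by rw [e5]; norm_num)
    (by rw [e5]; norm_num) (by rw [e4]) ?_
  intro s hs
  have e0 : ((3 : ℤ) : ℝ) * (Real.pi / 3) + Real.pi / 6 + (7 : ℕ) * (Real.pi / 6) =
      0 + (1 : ℤ) * ((7 : ℕ) * (Real.pi / 3)) := by push_cast; ring
  rw [e0] at g2
  have g3 := (pdir_add_period (V := silo.V) (vx 4 1) (linkB 3 1) 1 0).subst
    (motive := fun D => RGerm γ (T + √3 / 2) D) g2
  have hA := At.of_edge hlink g1 (k := 0) (by simp) rfl rfl g3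
  refine le_of_slope_nonneg hγ hA ?_ ?_ s hs
  · exact ((lin_vertex lvl g1).trans (e4 1)).ge
  · have : lvl (linkB 3 1 ((0 : ℤ) : ZMod 7)) = 4 := e4 2
    rw [this, e4]; norm_num

theorem four_le_height {γ : ℝ → silo.Point} (hγ : IsGeodesic γ) {t : ℝ}
    (hp : γ t (vx 7 19) = 1) (s : ℝ) : 4 ≤ lin lvl (γ s) := by
  obtain ⟨θ, hL, hR⟩ := hγ.exists_angle hp (by omega) isChild_five.isLink
  exact StaysAbove.le hγ hR hL (staysAbove_five hp _) (staysAbove_five hp _) s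

theorem exists_completelyHyperbolicPoint {y : ℝ} (h3 : y < 3) :
    ∃ P, IsCompletelyHyperbolicPoint (level y) P := by
  have hπ := Real.pi_pos
  obtain ⟨p, hp⟩ := exists_vertexPt (M := silo) (vx 7 19)
  have hdis : ∀ γ : ℝ → silo.Point, IsGeodesic γ → p ∈ range γ →
      Disjoint (range γ) (level y) := by
    rintro γ hγ ⟨t, rfl⟩
    exact disjoint_level fun s => by linarith [four_le_height hγ hp s]
  refine ⟨p, ⟨notMem_level hp ?_, Set.Infinite.nontrivial ?_⟩, ?_⟩
  · rw [lvl_vx]; push_cast; linarith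
  · refine infinite_of_angles (M := silo) (a := 0) (b := Real.pi / 6) (by omega)
      isChild_five.isLink hp (by positivity) (by linarith) ?_
    rintro θ - γ hγ h0 -
    exact ⟨⟨γ, hγ, rfl⟩, ⟨0, h0⟩, hdis γ hγ ⟨0, h0⟩⟩
  · rw [Set.eq_empty_iff_forall_notMem]
    rintro _ ⟨⟨γ, hγ, rfl⟩, hpm, hnd⟩
    exact hnd (hdis γ hγ hpm)

/-- Lines through `vx 7 19` stay at height at least 4, while the centre has height 0. -/
theorem exists_noncollinear :
    ∃ P Q : silo.Point, ¬ ∃ m : Set silo.Point, IsLine m ∧ P ∈ m ∧ Q ∈ m := by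
  obtain ⟨p, hp⟩ := exists_vertexPt (M := silo) (vx 7 19)
  obtain ⟨q, hq⟩ := exists_vertexPt (M := silo) (vx 0 0)
  refine ⟨p, q, ?_⟩
  rintro ⟨_, ⟨γ, hγ, rfl⟩, ⟨t, rfl⟩, ⟨s, rfl⟩⟩
  have h := four_le_height hγ hp s
  rw [lin_vertex lvl hq, lvl_vx, Nat.cast_zero] at h
  linarith

theorem IsCircularLine.isLine {M : SManifold} {l : Set M.Point} (h : IsCircularLine l) :
    IsLine l := by
  obtain ⟨γ, h1, h2, -⟩ := h
  exact ⟨γ, h1, h2⟩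

end SManifold

end


/-! ### Assembly of the theorem. -/

namespace SManifold

theorem exists_points {l : Set silo.Point} (hl : IsCircularLine l) (hc : l ⊆ silo.cylinder) :
    (∃ P, IsEllipticPoint l P) ∧ (∃ P, IsEuclideanPoint l P) ∧
      (∃ P, IsRegularlyHyperbolicPoint l P) ∧ (∃ P, IsExtremelyHyperbolicPoint l P) ∧
      (∃ P, IsCompletelyHyperbolicPoint l P) := by
  obtain ⟨y, h1, h3, rfl⟩ := circularLine_eq hl hc
  exact ⟨exists_ellipticPoint h1 h3, exists_euclideanPoint h1 h3,
    exists_regularlyHyperbolicPoint h1 h3, exists_extremelyHyperbolicPoint h1 h3,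
    exists_completelyHyperbolicPoint h3⟩

theorem isAlmostParadoxist_silo : silo.IsAlmostParadoxist := by
  obtain ⟨l, hl, hc⟩ := exists_circularLine
  obtain ⟨⟨P₁, h₁⟩, ⟨P₂, h₂⟩, ⟨P₃, h₃⟩, ⟨P₄, h₄⟩, P₅, h₅⟩ := exists_points hl hc
  exact ⟨⟨l, P₁, hl.isLine, h₁⟩, ⟨l, P₂, hl.isLine, h₂⟩, ⟨l, P₃, hl.isLine, h₃⟩,
    ⟨l, P₄, hl.isLine, h₄⟩, ⟨l, P₅, hl.isLine, h₅⟩⟩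

end SManifold

theorem mainTheorem2 :
    ∃ M : SManifold, M.IsExtendedSilo ∧
      (∃ l : Set M.Point, SManifold.IsCircularLine l ∧ l ⊆ M.cylinder) ∧
      (∀ l : Set M.Point, SManifold.IsCircularLine l → l ⊆ M.cylinder →
        (∃ P, SManifold.IsEllipticPoint l P) ∧
        (∃ P, SManifold.IsEuclideanPoint l P) ∧
        (∃ P, SManifold.IsRegularlyHyperbolicPoint l P) ∧
        (∃ P, SManifold.IsExtremelyHyperbolicPoint l P) ∧
        (∃ P, SManifold.IsCompletelyHyperbolicPoint l P)) ∧
      M.IsAlmostParadoxist ∧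
      ∃ P Q : M.Point, ¬ ∃ m : Set M.Point, SManifold.IsLine m ∧ P ∈ m ∧ Q ∈ m := by
  exact ⟨SManifold.silo, SManifold.isExtendedSilo, SManifold.exists_circularLine,
    fun _ => SManifold.exists_points, SManifold.isAlmostParadoxist_silo,
    SManifold.exists_noncollinear⟩
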